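/- **Setting.** Let $n$ be even and $d\ge 1$. An architecture on $n$ qubits with depth $d$ prescribes, for each of the $d$ layers, $n/2$ pairwise disjoint ordered pairs of qubits covering all qubits (no geometric locality is required). A circuit $C=U_d\cdots U_1$ on it places a gate from $\mathbb U(4)$ on every pair of every layer. Its ideal output distribution is $p(C,x)=|\langle x|C|0^n\rangle|^2$, $x\in\{0,1\}^n$. For a depolarizing rate $\gamma$ let $\mathcal E(\rho)=(1-\gamma)\rho+\gamma\frac I2\operatorname{Tr}(\rho)$ on one qubit and $\mathcal U_i(\rho)=U_i\rho U_i^\dagger$; the noisy output distribution is $$\tilde p(C,x)=\langle x|\,\big(\mathcal E^{\otimes n}\,\mathcal U_d\,\mathcal E^{\otimes n}\cdots\mathcal U_1\,\mathcal E^{\otimes n}\big)\big(|0^n\rangle\langle 0^n|\big)\,|x\rangle .$$ A Pauli-invariant ensemble on an architecture is the law $\mathcal D$ of a circuit whose gates are independent, where each gate has a law $\mu$ on $\mathbb U(4)$ (possibly different for different gates) that is invariant under right multiplication by a random Pauli, i.e. $\mathbb E_{U\sim\mu}F(U)=\frac1{16}\sum_{V\in\{I,X,Y,Z\}^{\otimes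 2}}\mathbb E_{U\sim\mu}F(UV)$ for all measurable $F\ge 0$ that do not depend on the global phase of $U$, and where the laws of the gates in the final layer are also invariant, in the same sense, under left multiplication by a random Pauli. A classical algorithm is a randomized random access machine over the integers with fair coins and logarithmic (bit) cost. It is given $n$, can query which qubits a gate acts on (and is told if a layer or gate does not exist), and can query, for any $k$, an integer within $1$ of $2^k r$ where $r$ is the real or imaginary part of an entry of a gate of $C$, or one of the numbers $\gamma,\varepsilon,\delta$, at a cost of at least $k$. **Theorem.** Fix $\gamma\in(0,1]$ and constants $A\in\mathbb R$ and $c>0$. There are a classical algorithm and a polynomial $T$ (both depending only on $\gamma,A,c$) such that the following holds for every even $n$, every $d\ge1$, every architecture on $n$ qubits with depth $d$, and every Pauli-invariant ensemble $\mathcal D$ on it which satisfies anti-concentration $$\mathbb E_{C\sim\mathcal D}\;2^n\sum_{x\in\{0,1\}^n}p(C,x)^2\le A$$ and for which either $d\ge c\log n$ or all gates are Haar random in $\mathbb U(4)$. For all $\varepsilon,\delta\in(0,1]$: 1. for every circuit $C$ on the architecture, every choice of correct answers to the queries, and all outcomes of the coins, the algorithm halts in time at most $T(n,1/\varepsilon,1/\delta)$;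 2. with probability at least $1-\delta$ over $C\sim\mathcal D$, for every choice of correct answers to the queries, the output of the algorithm is a sample from a distribution on $\{0,1\}^n$ within total variation distance $\varepsilon$ of $\tilde p(C,\cdot)$. -/

import Mathlib

open MeasureTheory
open scoped Kronecker ENNReal

noncomputable section

namespace NoisyRCS

/-! ### Two-qubit gates, architectures, circuits -/

/-- Basis labels of two qubits. -/
abbrev TwoBits : Type := Fin 2 × Fin 2

/-- Two-qubit gates: the unitary group `U(4)`, in the basis `|00⟩, |01⟩, |10⟩, |11⟩`. -/
abbrev Gate : Type := Matrix.unitaryGroup TwoBits ℂ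

/-- The Borel σ-algebra of `U(4)`: the one generated by the matrix entries. -/
instance : MeasurableSpace Gate :=
  MeasurableSpace.comap (fun (U : Gate) (r s : TwoBits) => (U : Matrix TwoBits TwoBits ℂ) r s)
    inferInstance

/-- An architecture on `n = 2 * m` qubits with `d` layers. In layer `t`, the gate with number `g`
acts on the ordered pair of qubits `(arch t (g, 0), arch t (g, 1))`; as `arch t` is a bijection,
every qubit is acted on by exactly one of the `m` gates of the layer. -/
abbrev Architecture (m d : ℕ) : Type := Fin d → (Fin m × Fin 2 ≃ Fin (2 * m))

/-- The gates of a circuit: `C t g` is the gate with number `g` in layer `t`. The layer `t = 0` is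
applied first. -/
abbrev Circuit (m d : ℕ) : Type := Fin d → Fin m → Gate

/-- Bit strings, labelling the computational basis of `n` qubits. -/
abbrev Bits (n : ℕ) : Type := Fin n → Fin 2

/-- Operators on `n` qubits. -/
abbrev Op (n : ℕ) : Type := Matrix (Bits n) (Bits n) ℂ

variable {m d n : ℕ}

/-- The unitary of layer `t`: the tensor product of its gates. -/
def layer (arch : Architecture m d) (C : Circuit m d) (t : Fin d) : Op (2 * m) :=
  Matrix.of fun x y => ∏ g : Fin m,
    (C t g : Matrix TwoBits TwoBits ℂ)
      (x (arch t (g, 0)), x (arch t (g, 1))) (y (arch t (g, 0)), y (arch t (g, 1)))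

/-- The unitary `U_d ⋯ U_1` of the whole circuit. -/
def circuitUnitary (arch : Architecture m d) (C : Circuit m d) : Op (2 * m) :=
  (List.finRange d).foldl (fun V t => layer arch C t * V) 1

/-- The ideal output probability `p(C, x) = |⟨x| C |0ⁿ⟩|²`. -/
def idealProb (arch : Architecture m d) (C : Circuit m d) (x : Bits (2 * m)) : ℝ :=
  ‖circuitUnitary arch C x 0‖ ^ 2

/-- Depolarizing noise `ρ ↦ (1 - γ) ρ + γ (I / 2) ⊗ Tr_j ρ` on qubit `j`. -/
def depolarize (γ : ℝ) (j : Fin n) (ρ : Op n) : Op n :=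
  Matrix.of fun x y => (1 - γ : ℂ) * ρ x y +
    if x j = y j then
      (γ / 2 : ℂ) * ∑ b : Fin 2, ρ (Function.update x j b) (Function.update y j b)
    else 0

/-- Depolarizing noise on every qubit. -/
def depolarizeAll (γ : ℝ) (ρ : Op n) : Op n :=
  (List.finRange n).foldl (fun σ j => depolarize γ j σ) ρ

/-- The final state of the noisy circuit: noise on every qubit of `|0ⁿ⟩⟨0ⁿ|`, and again after each
layer. -/
def noisyState (γ : ℝ) (arch : Architecture m d) (C : Circuit m d) : Op (2 * m) :=
  (List.finRange d).foldl
    (fun ρ t => depolarizeAll γ (layer arch C t * ρ * (layer arch C t).conjTranspose))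
    (depolarizeAll γ (Matrix.single 0 0 1))

/-- The output probability of the noisy circuit. -/
def noisyProb (γ : ℝ) (arch : Architecture m d) (C : Circuit m d) (x : Bits (2 * m)) : ℝ :=
  (noisyState γ arch C x x).re

/-! ### Random circuits -/

/-- The Pauli matrices `I, X, Y, Z`. -/
def pauliMatrix : Fin 4 → Matrix (Fin 2) (Fin 2) ℂ :=
  ![1, !![0, 1; 1, 0], !![0, -Complex.I; Complex.I, 0], !![1, 0; 0, -1]]

theorem pauliMatrix_mem (a : Fin 4) : pauliMatrix a ∈ unitary (Matrix (Fin 2) (Fin 2) ℂ) := by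
  rw [Unitary.mem_iff]
  fin_cases a <;> constructor <;> ext i j <;> fin_cases i <;> fin_cases j <;>
    simp [pauliMatrix, Matrix.mul_apply, Fin.sum_univ_two, Matrix.star_apply, Matrix.one_apply]

/-- The sixteen two-qubit Pauli operators. -/
def pauliGate (a : Fin 4 × Fin 4) : Gate :=
  ⟨pauliMatrix a.1 ⊗ₖ pauliMatrix a.2,
    Matrix.kronecker_mem_unitary (pauliMatrix_mem a.1) (pauliMatrix_mem a.2)⟩

/-- A function of a gate that depends only on the channel `ρ ↦ U ρ U†`: it ignores the physically
meaningless global phase. -/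
def PhaseInvariant (F : Gate → ℝ≥0∞) : Prop :=
  ∀ (z : ℂ) (U V : Gate),
    (V : Matrix TwoBits TwoBits ℂ) = z • (U : Matrix TwoBits TwoBits ℂ) → F V = F U

/-- Invariance of the law of a gate under right multiplication by a uniformly random Pauli. -/
def RightPauliInvariant (μ : Measure Gate) : Prop :=
  ∀ F : Gate → ℝ≥0∞, Measurable F → PhaseInvariant F →
    ∫⁻ U, F U ∂μ = (∑ a : Fin 4 × Fin 4, ∫⁻ U, F (U * pauliGate a) ∂μ) / 16

/-- Invariance of the law of a gate under left multiplication by a uniformly random Pauli. -/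
def LeftPauliInvariant (μ : Measure Gate) : Prop :=
  ∀ F : Gate → ℝ≥0∞, Measurable F → PhaseInvariant F →
    ∫⁻ U, F U ∂μ = (∑ a : Fin 4 × Fin 4, ∫⁻ U, F (pauliGate a * U) ∂μ) / 16

/-- A choice of a law for every gate of the circuit: each law is a probability measure that is
invariant under right multiplication by a random Pauli, and those of the final layer also under
left multiplication. -/
structure IsPauliInvariantEnsemble (μ : Fin d → Fin m → Measure Gate) : Prop where
  prob : ∀ t g, IsProbabilityMeasure (μ t g)
  right : ∀ t g, RightPauliInvariant (μ t g)
  left_last : ∀ (t : Fin d) (g : Fin m), (t : ℕ) + 1 = d → LeftPauliInvariant (μ t g)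

/-- All gates are Haar random: each law is a left translation invariant probability measure on
`U(4)`. -/
def IsHaarEnsemble (μ : Fin d → Fin m → Measure Gate) : Prop :=
  ∀ t g, IsProbabilityMeasure (μ t g) ∧ (μ t g).IsMulLeftInvariant

/-- The law of the random circuit: all gates are independent. -/
def circuitLaw (μ : Fin d → Fin m → Measure Gate) : Measure (Circuit m d) :=
  Measure.pi fun t => Measure.pi fun g => μ t g

/-- Anti-concentration with constant `A`: `E_C 2ⁿ ∑ₓ p(C, x)² ≤ A`. -/
def AntiConcentrated (arch : Architecture m d) (μ : Fin d → Fin m → Measure Gate) (A : ℝ) : Prop :=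
  ∫ C, (2 : ℝ) ^ (2 * m) * ∑ x : Bits (2 * m), idealProb arch C x ^ 2 ∂circuitLaw μ ≤ A

/-! ### Randomized algorithms

A random access machine over the integers, with structured programs, fair coins and logarithmic
(bit) cost. Real numbers of the input are accessed by asking for approximations. -/

/-- The length of an integer in binary. -/
def size (z : ℤ) : ℕ := 1 + Nat.size z.natAbs

/-- Arithmetic operations. -/
inductive Arith
  | add | sub | mul | div | lt

/-- The value of an arithmetic operation. -/
def Arith.eval : Arith → ℤ → ℤ → ℤ
  | add, a, b => a + b
  | sub, a, b => a - b
  | mul, a, b => a * b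
  | div, a, b => a / b
  | lt, a, b => if a < b then 1 else 0

/-- Expressions: literals, the content of the memory cell with a computed address, arithmetic. -/
inductive Expr
  | lit (z : ℤ)
  | load (a : Expr)
  | arith (o : Arith) (a b : Expr)

/-- The value of an expression in a given memory (negative addresses are read as `0`). -/
def Expr.eval (mem : ℕ → ℤ) : Expr → ℤ
  | lit z => z
  | load a => mem (a.eval mem).toNat
  | arith o a b => o.eval (a.eval mem) (b.eval mem)

/-- The bit cost of evaluating an expression; an arithmetic operation costs the product of the
lengths of its operands. -/
def Expr.cost (mem : ℕ → ℤ) : Expr → ℕ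
  | lit z => size z
  | load a => a.cost mem + size (a.eval mem) + size (mem (a.eval mem).toNat)
  | arith _ a b => a.cost mem + b.cost mem + size (a.eval mem) * size (b.eval mem)

/-- Programs. Each of `store`, `flip`, `wire`, `entry`, `param` writes to the cell whose address is
its argument `dst`: the value of an expression, a fair coin flip, the number of a qubit that a gate
acts on, an approximation to the real or imaginary part of an entry of a gate, or an approximation
to one of the three real parameters. -/
inductive Program
  | skip
  | store (dst e : Expr)
  | seq (P Q : Program)
  | cond (e : Expr) (P Q : Program)
  | loop (e : Expr) (P : Program)
  | flip (dst : Expr)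
  | wire (b : Fin 2) (dst t g : Expr)
  | entry (r s : TwoBits) (im : Bool) (dst t g prec : Expr)
  | param (k : Fin 3) (dst prec : Expr)

/-- The input that a program can query. -/
structure Input where
  wire : ℕ → ℕ → Fin 2 → ℕ
  entry : ℕ → ℕ → TwoBits → TwoBits → Bool → ℕ → ℤ
  param : Fin 3 → ℕ → ℤ

/-- The integers `a k` approximate the real number `x`: `a k / 2 ^ k` is within `2 ^ (-k)` of it. -/
def Approximates (a : ℕ → ℤ) (x : ℝ) : Prop := ∀ k : ℕ, |(a k : ℝ) - 2 ^ k * x| ≤ 1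

/-- `I` describes the circuit `(arch, C)` and the parameters `γ, ε, δ`. Qubits are numbered from
`1` in the answers to queries, and the answer `0` says that there is no such gate. -/
structure Input.Describes (I : Input) (arch : Architecture m d) (C : Circuit m d) (γ ε δ : ℝ) :
    Prop where
  wire : ∀ t g b, I.wire t g b =
    if h : t < d ∧ g < m then (arch ⟨t, h.1⟩ (⟨g, h.2⟩, b) : ℕ) + 1 else 0
  re : ∀ (t : Fin d) (g : Fin m) (r s : TwoBits), Approximates (I.entry t g r s false)
    ((C t g : Matrix TwoBits TwoBits ℂ) r s).re
  im : ∀ (t : Fin d) (g : Fin m) (r s : TwoBits), Approximates (I.entry t g r s true)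
    ((C t g : Matrix TwoBits TwoBits ℂ) r s).im
  gamma : Approximates (I.param 0) γ
  eps : Approximates (I.param 1) ε
  delta : Approximates (I.param 2) δ

/-- The state of the machine: the memory and the coins that have not been used yet. -/
structure State where
  mem : ℕ → ℤ
  coins : ℕ → Bool

/-- The initial state: the number of qubits in cell `0`, and zeros. -/
def initial (n : ℕ) (ω : ℕ → Bool) : State := ⟨Function.update 0 0 (n : ℤ), ω⟩

/-- Writing to memory. -/
def State.write (σ : State) (a z : ℤ) : State := ⟨Function.update σ.mem a.toNat z, σ.coins⟩

/-- The value of an expression in a state. -/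
abbrev State.val (σ : State) (e : Expr) : ℤ := e.eval σ.mem

/-- The cost of a list of arguments: the cost of evaluating them, and their lengths. -/
def State.costs (σ : State) (l : List Expr) : ℕ :=
  (l.map fun e => e.cost σ.mem + size (σ.val e)).sum

/-- The answer to a coin flip. -/
def State.coin (σ : State) : ℤ := if σ.coins 0 then 1 else 0

/-- `Exec I P σ σ' T`: on input `I`, the program `P` started in state `σ` halts in state `σ'`, at
cost `T`. A query with precision `k` costs at least `k`. -/
inductive Exec (I : Input) : Program → State → State → ℕ → Prop
  | skip (σ : State) : Exec I .skip σ σ 1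
  | store (σ : State) (dst e : Expr) :
      Exec I (.store dst e) σ (σ.write (σ.val dst) (σ.val e)) (1 + σ.costs [dst, e])
  | seq {P Q : Program} {σ σ' σ'' : State} {T T' : ℕ} :
      Exec I P σ σ' T → Exec I Q σ' σ'' T' → Exec I (.seq P Q) σ σ'' (1 + T + T')
  | cond_true {e : Expr} {P Q : Program} {σ σ' : State} {T : ℕ} :
      σ.val e ≠ 0 → Exec I P σ σ' T → Exec I (.cond e P Q) σ σ' (1 + σ.costs [e] + T)
  | cond_false {e : Expr} {P Q : Program} {σ σ' : State} {T : ℕ} :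
      σ.val e = 0 → Exec I Q σ σ' T → Exec I (.cond e P Q) σ σ' (1 + σ.costs [e] + T)
  | loop_true {e : Expr} {P : Program} {σ σ' σ'' : State} {T T' : ℕ} :
      σ.val e ≠ 0 → Exec I P σ σ' T → Exec I (.loop e P) σ' σ'' T' →
      Exec I (.loop e P) σ σ'' (1 + σ.costs [e] + T + T')
  | loop_false {e : Expr} {P : Program} {σ : State} :
      σ.val e = 0 → Exec I (.loop e P) σ σ (1 + σ.costs [e])
  | flip (σ : State) (dst : Expr) :
      Exec I (.flip dst) σ
        ⟨Function.update σ.mem (σ.val dst).toNat σ.coin, fun i => σ.coins (i + 1)⟩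
        (1 + σ.costs [dst])
  | wire (σ : State) (b : Fin 2) (dst t g : Expr) (z : ℤ) :
      z = I.wire (σ.val t).toNat (σ.val g).toNat b →
      Exec I (.wire b dst t g) σ (σ.write (σ.val dst) z) (1 + σ.costs [dst, t, g] + size z)
  | entry (σ : State) (r s : TwoBits) (im : Bool) (dst t g prec : Expr) (z : ℤ) :
      z = I.entry (σ.val t).toNat (σ.val g).toNat r s im (σ.val prec).toNat →
      Exec I (.entry r s im dst t g prec) σ (σ.write (σ.val dst) z)
        (1 + σ.costs [dst, t, g, prec] + (σ.val prec).toNat + size z)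
  | param (σ : State) (k : Fin 3) (dst prec : Expr) (z : ℤ) :
      z = I.param k (σ.val prec).toNat →
      Exec I (.param k dst prec) σ (σ.write (σ.val dst) z)
        (1 + σ.costs [dst, prec] + (σ.val prec).toNat + size z)

/-- The bit string in the first `n` memory cells (any non-zero content is read as `1`). -/
def State.output (n : ℕ) (σ : State) : Bits n := fun i => if σ.mem i = 0 then 0 else 1

/-- Infinitely many independent fair coins. -/
def coinLaw : Measure (ℕ → Bool) :=
  Measure.infinitePi fun _ => (PMF.uniformOfFintype Bool).toMeasure

/-- On input `I` and `n`, the program halts within cost `B`, whatever the coins show. -/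
def RunsWithin (P : Program) (I : Input) (n : ℕ) (B : ℝ) : Prop :=
  ∀ ω, ∃ σ T, Exec I P (initial n ω) σ T ∧ (T : ℝ) ≤ B

/-- The probability, over the coins, that the program outputs `x` on input `I` and `n`. -/
def outputProb (P : Program) (I : Input) (n : ℕ) (x : Bits n) : ℝ :=
  coinLaw.real {ω | ∃ σ T, Exec I P (initial n ω) σ T ∧ σ.output n = x}

/-- The total variation distance of two distributions on bit strings. -/
def tvDist (p q : Bits n → ℝ) : ℝ := (∑ x, |p x - q x|) / 2

end NoisyRCS

end

open MeasureTheory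
open scoped Kronecker ENNReal

noncomputable section

namespace NoisyRCS

variable {m d n : ℕ}

/-! ### Two-qubit Pauli operators and transfer coefficients -/

/-! Depolarizing noise is diagonal in the Pauli basis, and conjugation by a gate maps a two-qubit
Pauli operator to a real combination of such operators. Expanding the initial state in Pauli strings
and pushing it through the layers writes the noisy output probability as a sum over Pauli paths,
with one string before the first layer and one after every layer. A path of total weight `ℓ` carries
the factor `(1 - γ) ^ ℓ`, an amplitude that depends on the circuit, and a factor in `{-1, 0, 1}`
that depends on the output string (`noisyProb_eq`).

Averaging over random Paulis makes different paths orthogonal: two paths that enter some layer with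
different strings have uncorrelated amplitudes, and paths that differ only in the last string are
separated by summing over outputs. Hence a Parseval identity holds (`integral_sum_pathSum_sq`), and
anti-concentration says that the second moments of all paths add up to at most `A`. By
Cauchy-Schwarz and Markov, discarding paths of weight above `L` costs little in total variation once
`(1 - γ) ^ L` is small. It suffices to take `L = c₁ * k`, where `2 ^ k` is of the order of `n + 1/ε
+ 1/δ`.

The light paths can be enumerated in polynomial time. A path of weight at most `L` through `d`
layers has a string of weight at most `L / d` (`exists_retained`). There are at most `(4 * n) ^ (L /
d)` candidates for it, which is polynomial when `d ≥ c * log n`. From this pivot the path is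
continued forwards and backwards. Only gates that see a non-trivial label branch, in at most 16
ways, and at most `L` of them occur on either side, so the continuations are numbered by integers
below `16 ^ L`. Choosing the first light string as the pivot counts every path once
(`sum_retained`). If `L < d`, only the trivial path matters, so deep circuits need no enumeration at
all.

A path sum is affine in the sign of each qubit, and setting a sign to zero averages over the bit.
The same enumeration therefore yields marginals, and bits are sampled one after the other. The
approximate marginals may be negative, but a hybrid argument shows that the sampling errors only add
up over the bits (`MultiAffine.sum_abs_prod_bitProb_sub_le`).

For Haar random gates the logarithmic depth is automatic. The `n` paths that carry a single `Z` on a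
fixed qubit have moments at least `κ ^ d`, so `n * κ ^ d ≤ A` (`exists_log_le_depth`).

The remaining work is numerical. Sweeps use fixed-point numbers whose error at most doubles, up to a
constant, with every operation, so polynomially many bits suffice. A program logic with costs then
verifies an explicit program. The bounds on values and running time hold for every circuit; only the
truncation error is controlled merely with high probability. -/

/-- Labels of two-qubit Pauli operators. -/
abbrev Pauli2 : Type := Fin 4 × Fin 4

theorem pauliMatrix_zero : pauliMatrix 0 = 1 := rfl

/-- Two-qubit Pauli operators as matrices. -/
def pauli2 (P : Pauli2) : Matrix TwoBits TwoBits ℂ := pauliMatrix P.1 ⊗ₖ pauliMatrix P.2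

theorem coe_pauliGate (P : Pauli2) : (pauliGate P : Matrix TwoBits TwoBits ℂ) = pauli2 P := rfl

theorem pauli2_zero : pauli2 0 = 1 := by
  simp [pauli2, pauliMatrix_zero]

/-- The sum of `P ⊗ P` over the Pauli matrices is twice the swap operator; this encodes that they
form an orthogonal basis. -/
theorem pauliMatrix_complete (i j k l : Fin 2) :
    ∑ a, pauliMatrix a i j * pauliMatrix a k l = if i = l ∧ j = k then 2 else 0 := by
  fin_cases i <;> fin_cases j <;> fin_cases k <;> fin_cases l <;>
    simp [Fin.sum_univ_four, pauliMatrix, one_add_one_eq_two]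

theorem pauliMatrix_star (a : Fin 4) : (pauliMatrix a).conjTranspose = pauliMatrix a := by
  fin_cases a <;> ext i j <;> fin_cases i <;> fin_cases j <;> simp [pauliMatrix]

theorem pauliMatrix_trace (a : Fin 4) : (pauliMatrix a).trace = if a = 0 then 2 else 0 := by
  fin_cases a <;> simp [pauliMatrix, Matrix.trace, Fin.sum_univ_two]

theorem pauli2_complete (i j k l : TwoBits) :
    ∑ P, pauli2 P i j * pauli2 P k l = if i = l ∧ j = k then 4 else 0 := by
  have h : ∑ P, pauli2 P i j * pauli2 P k l =
      (∑ a, pauliMatrix a i.1 j.1 * pauliMatrix a k.1 l.1) *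
        ∑ b, pauliMatrix b i.2 j.2 * pauliMatrix b k.2 l.2 := by
    rw [Finset.sum_mul_sum, Fintype.sum_prod_type]
    refine Finset.sum_congr rfl fun a _ => Finset.sum_congr rfl fun b _ => ?_
    simp only [pauli2, Matrix.kroneckerMap_apply]; ring
  rw [h, pauliMatrix_complete, pauliMatrix_complete]
  simp only [Prod.ext_iff]
  split_ifs <;> first | (exfalso; tauto) | norm_num

theorem pauli2_star (P : Pauli2) : (pauli2 P).conjTranspose = pauli2 P := by
  simp [pauli2, Matrix.conjTranspose_kronecker, pauliMatrix_star]

theorem pauli2_trace (P : Pauli2) : (pauli2 P).trace = if P = 0 then 4 else 0 := by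
  rw [pauli2, Matrix.trace_kronecker, pauliMatrix_trace, pauliMatrix_trace]
  simp only [Prod.ext_iff, Prod.fst_zero, Prod.snd_zero]
  split_ifs <;> first | (exfalso; tauto) | norm_num

/-- Contracting the completeness relation with the entries of `M` leaves only the entry that is
wanted. -/
theorem pauli2_expand (M : Matrix TwoBits TwoBits ℂ) :
    M = ∑ Q, ((1 / 4 : ℂ) * (pauli2 Q * M).trace) • pauli2 Q := by
  ext i j
  simp only [Matrix.sum_apply, Matrix.smul_apply, Matrix.trace, Matrix.diag_apply,
    Matrix.mul_apply, smul_eq_mul, Finset.mul_sum, Finset.sum_mul]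
  rw [Finset.sum_comm]
  have : ∀ k l : TwoBits, ∑ Q, 1 / 4 * (pauli2 Q k l * M l k) * pauli2 Q i j =
      if k = j ∧ l = i then M l k else 0 := by
    intro k l
    have h := pauli2_complete k l i j
    calc _ = 1 / 4 * M l k * ∑ Q, pauli2 Q k l * pauli2 Q i j := by
          rw [Finset.mul_sum]; exact Finset.sum_congr rfl fun _ _ => by ring
      _ = _ := by rw [h]; split_ifs <;> ring
  rw [Finset.sum_congr rfl fun k _ => Finset.sum_comm]
  simp only [this]
  rw [Finset.sum_eq_single j]
  · rw [Finset.sum_eq_single i] <;> simp +contextual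
  · intro b _ hb; simp [hb]
  · simp

/-- The transfer coefficient `tr(Q U P U†) / 4` of a gate between two Pauli operators. -/
def rc (U : Gate) (P Q : Pauli2) : ℝ :=
  ((1 / 4 : ℂ) * (pauli2 Q * ((U : Matrix TwoBits TwoBits ℂ) * pauli2 P *
    (U : Matrix TwoBits TwoBits ℂ).conjTranspose)).trace).re

/-- The trace of a product of two Hermitian matrices is real, because conjugation reverses the
product and the trace is cyclic. So taking the real part in the definition loses nothing. -/
theorem coe_rc (U : Gate) (P Q : Pauli2) : (rc U P Q : ℂ) =
    (1 / 4 : ℂ) * (pauli2 Q * ((U : Matrix TwoBits TwoBits ℂ) * pauli2 P *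
    (U : Matrix TwoBits TwoBits ℂ).conjTranspose)).trace := by
  rw [rc]
  refine (Complex.conj_eq_iff_re.1 ?_)
  set M := (U : Matrix TwoBits TwoBits ℂ) * pauli2 P * (U : Matrix TwoBits TwoBits ℂ).conjTranspose
    with hM
  have hMs : M.conjTranspose = M := by
    simp [hM, Matrix.conjTranspose_mul, pauli2_star, Matrix.mul_assoc]
  have h : (starRingEnd ℂ) (pauli2 Q * M).trace = (pauli2 Q * M).trace := by
    have := Matrix.trace_conjTranspose (pauli2 Q * M)
    rw [starRingEnd_apply, ← this, Matrix.conjTranspose_mul, hMs, pauli2_star, Matrix.trace_mul_comm]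
  rw [map_mul, h]; simp [show (starRingEnd ℂ) 4 = 4 from Complex.conj_ofNat 4]

theorem conj_pauli2 (U : Gate) (P : Pauli2) :
    (U : Matrix TwoBits TwoBits ℂ) * pauli2 P * (U : Matrix TwoBits TwoBits ℂ).conjTranspose =
      ∑ Q, (rc U P Q : ℂ) • pauli2 Q := by
  simp only [coe_rc]
  exact pauli2_expand _

theorem gate_mul_star (U : Gate) :
    (U : Matrix TwoBits TwoBits ℂ) * (U : Matrix TwoBits TwoBits ℂ).conjTranspose = 1 := by
  rw [← Matrix.star_eq_conjTranspose]; exact Unitary.mul_star_self_of_mem U.2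

theorem gate_star_mul (U : Gate) :
    (U : Matrix TwoBits TwoBits ℂ).conjTranspose * (U : Matrix TwoBits TwoBits ℂ) = 1 := by
  rw [← Matrix.star_eq_conjTranspose]; exact Unitary.star_mul_self_of_mem U.2

/-- Conjugation by a unitary is unital and, in the companion statement, trace preserving. A gate
therefore neither creates nor destroys the trivial label, which is what makes gates without
non-trivial input free in the enumeration. -/
theorem rc_zero_left (U : Gate) (Q : Pauli2) : rc U 0 Q = if Q = 0 then 1 else 0 := by
  rw [rc, pauli2_zero, Matrix.mul_one, gate_mul_star, Matrix.mul_one, pauli2_trace]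
  split_ifs <;> simp

theorem rc_zero_right (U : Gate) (P : Pauli2) : rc U P 0 = if P = 0 then 1 else 0 := by
  rw [rc, pauli2_zero, Matrix.one_mul, Matrix.trace_mul_comm, ← Matrix.mul_assoc, gate_star_mul,
    Matrix.one_mul, pauli2_trace]
  split_ifs <;> simp

theorem pauli2_mem (P : Pauli2) : pauli2 P ∈ Matrix.unitaryGroup TwoBits ℂ := (pauliGate P).2

/-- The matrix under the trace is a product of unitaries, so each of its four diagonal entries has
modulus at most one. -/
theorem abs_rc_le_one (U : Gate) (P Q : Pauli2) : |rc U P Q| ≤ 1 := by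
  have hm : pauli2 Q * ((U : Matrix TwoBits TwoBits ℂ) * pauli2 P *
      (U : Matrix TwoBits TwoBits ℂ).conjTranspose) ∈ Matrix.unitaryGroup TwoBits ℂ := by
    refine mul_mem (pauli2_mem Q) (mul_mem (mul_mem U.2 (pauli2_mem P)) ?_)
    rw [← Matrix.star_eq_conjTranspose]; exact Unitary.star_mem U.2
  refine (Complex.abs_re_le_norm _).trans ?_
  rw [norm_mul]
  have h4 : ‖(pauli2 Q * ((U : Matrix TwoBits TwoBits ℂ) * pauli2 P *
      (U : Matrix TwoBits TwoBits ℂ).conjTranspose)).trace‖ ≤ 4 := by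
    rw [Matrix.trace]
    refine (norm_sum_le _ _).trans ?_
    refine (Finset.sum_le_sum fun i _ => entry_norm_bound_of_unitary hm i i).trans ?_
    simp
  norm_num
  linarith

/-- Commutation sign of two one-qubit Pauli operators. -/
def pauliSign (a b : Fin 4) : ℝ := if a = 0 ∨ b = 0 ∨ a = b then 1 else -1

theorem pauliMatrix_conj (a b : Fin 4) :
    pauliMatrix a * pauliMatrix b * pauliMatrix a = (pauliSign a b : ℂ) • pauliMatrix b := by
  fin_cases a <;> fin_cases b <;> ext i j <;> fin_cases i <;> fin_cases j <;>
    simp [pauliMatrix, pauliSign, Matrix.mul_apply, Fin.sum_univ_two]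

/-- Commutation signs are the characters of the Pauli group modulo phases, and this is their
orthogonality. -/
theorem sum_pauliSign (b c : Fin 4) :
    ∑ a, pauliSign a b * pauliSign a c = if b = c then 4 else 0 := by
  fin_cases b <;> fin_cases c <;> simp [Fin.sum_univ_four, pauliSign] <;> norm_num

/-- Conjugating a Pauli operator by another one only changes its sign. Right multiplication by a
random Pauli thus acts on transfer coefficients through characters of the input label. -/
theorem rc_mul_pauliGate (U : Gate) (V P Q : Pauli2) :
    rc (U * pauliGate V) P Q = pauliSign V.1 P.1 * pauliSign V.2 P.2 * rc U P Q := by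
  have h : pauli2 V * pauli2 P * pauli2 V =
      ((pauliSign V.1 P.1 * pauliSign V.2 P.2 : ℝ) : ℂ) • pauli2 P := by
    simp only [pauli2, ← Matrix.mul_kronecker_mul, pauliMatrix_conj, Matrix.smul_kronecker,
      Matrix.kronecker_smul, smul_smul, Complex.ofReal_mul]
    rw [mul_comm]
  have h2 : (((U * pauliGate V : Gate) : Matrix TwoBits TwoBits ℂ)) * pauli2 P *
      ((U * pauliGate V : Gate) : Matrix TwoBits TwoBits ℂ).conjTranspose =
      ((pauliSign V.1 P.1 * pauliSign V.2 P.2 : ℝ) : ℂ) •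
        ((U : Matrix TwoBits TwoBits ℂ) * pauli2 P *
          (U : Matrix TwoBits TwoBits ℂ).conjTranspose) := by
    have : ((U * pauliGate V : Gate) : Matrix TwoBits TwoBits ℂ) =
      (U : Matrix TwoBits TwoBits ℂ) * pauli2 V := rfl
    rw [this, Matrix.conjTranspose_mul, pauli2_star, ← Matrix.smul_mul, ← Matrix.mul_smul, ← h]
    simp only [Matrix.mul_assoc]
  rw [rc, h2, Matrix.mul_smul, Matrix.trace_smul, rc, smul_eq_mul, mul_left_comm, Complex.re_ofReal_mul]

/-- Needed because invariance of the gate laws may be tested only on functions that ignore the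
global phase. Unitarity of both gates forces `|z| = 1`. -/
theorem rc_phase {z : ℂ} {U V : Gate}
    (h : (V : Matrix TwoBits TwoBits ℂ) = z • (U : Matrix TwoBits TwoBits ℂ)) (P Q : Pauli2) :
    rc V P Q = rc U P Q := by
  have hz : z * star z = 1 := by
    have h1 := gate_mul_star V
    rw [h, Matrix.conjTranspose_smul, Matrix.smul_mul, Matrix.mul_smul, gate_mul_star, smul_smul] at h1
    have := congrFun (congrFun h1 0) 0
    simpa using this
  rw [rc, rc, h, Matrix.conjTranspose_smul, Matrix.smul_mul, Matrix.smul_mul,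
    Matrix.mul_smul ((U : Matrix TwoBits TwoBits ℂ) * pauli2 P), smul_smul, hz, one_smul]

theorem measurable_entry (r s : TwoBits) :
    Measurable fun U : Gate => (U : Matrix TwoBits TwoBits ℂ) r s := by
  have h : Measurable fun (U : Gate) (r s : TwoBits) => (U : Matrix TwoBits TwoBits ℂ) r s :=
    comap_measurable _
  exact (measurable_pi_apply s).comp ((measurable_pi_apply r).comp h)

theorem measurable_rc (P Q : Pauli2) : Measurable fun U : Gate => rc U P Q := by
  unfold rc
  simp only [Matrix.trace, Matrix.diag_apply, Matrix.mul_apply, Matrix.conjTranspose_apply]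
  refine Complex.measurable_re.comp (Measurable.const_mul ?_ _)
  refine Finset.measurable_sum _ fun i _ => Finset.measurable_sum _ fun j _ =>
    Measurable.const_mul (Finset.measurable_sum _ fun k _ => Measurable.mul
      (Finset.measurable_sum _ fun l _ => Measurable.mul_const (measurable_entry _ _) _) ?_) _
  exact (continuous_star.measurable).comp (measurable_entry _ _)

/-! ### Pauli strings and the Pauli path expansion -/

/-- Labels of Pauli operators on `n` qubits. -/
abbrev PStr (n : ℕ) : Type := Fin n → Fin 4

/-- The tensor product of Pauli matrices. -/
def pauliStr (s : PStr n) : Op n := Matrix.of fun x y => ∏ j, pauliMatrix (s j) (x j) (y j)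

/-- The number of tensor factors that are not the identity. -/
def wt (s : PStr n) : ℕ := (Finset.univ.filter fun j => s j ≠ 0).card

/-- The contribution of one tensor factor to a diagonal matrix element, given a sign. -/
def zfac {α : Type*} [Zero α] [One α] (a : Fin 4) (z : α) : α :=
  if a = 0 then 1 else if a = 3 then z else 0

/-- Diagonal matrix elements of Pauli strings, given the sign of every qubit. -/
def zprod (s : PStr n) (z : Fin n → ℝ) : ℝ := ∏ j, zfac (s j) (z j)

/-- The signs `(-1) ^ x_j`. -/
def bitSign (x : Bits n) (j : Fin n) : ℝ := if x j = 0 then 1 else -1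

theorem pauliMatrix_diag (a : Fin 4) (b : Fin 2) :
    pauliMatrix a b b = ((zfac a (if b = 0 then 1 else -1) : ℝ) : ℂ) := by
  fin_cases a <;> fin_cases b <;> simp [pauliMatrix, zfac]

theorem pauliStr_diag (s : PStr n) (x : Bits n) :
    pauliStr s x x = ((zprod s (bitSign x) : ℝ) : ℂ) := by
  simp [pauliStr, zprod, bitSign, pauliMatrix_diag]

/-- Each tensor factor of the initial projector is `(I + Z) / 2`; multiply out. -/
theorem single_eq_sum_pauliStr :
    (Matrix.single 0 0 1 : Op n) =
      ((2 : ℂ) ^ n)⁻¹ • ∑ s : PStr n, ((zprod s 1 : ℝ) : ℂ) • pauliStr s := by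
  ext x y
  have h1 : ∀ i j : Fin 2, ∑ a, ((zfac a (1 : ℝ) : ℝ) : ℂ) * pauliMatrix a i j =
      if i = 0 ∧ j = 0 then 2 else 0 := by
    intro i j
    fin_cases i <;> fin_cases j <;>
      simp [Fin.sum_univ_four, zfac, pauliMatrix, one_add_one_eq_two]
  have h2 : ∑ s : PStr n, ((zprod s 1 : ℝ) : ℂ) * pauliStr s x y =
      ∏ j, ∑ a, ((zfac a (1 : ℝ) : ℝ) : ℂ) * pauliMatrix a (x j) (y j) := by
    rw [Fintype.prod_sum]
    refine Finset.sum_congr rfl fun s _ => ?_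
    simp [zprod, pauliStr, Finset.prod_mul_distrib]
  simp only [Matrix.smul_apply, Matrix.sum_apply, smul_eq_mul]
  rw [h2]
  simp only [h1]
  by_cases h : x = 0 ∧ y = 0
  · obtain ⟨rfl, rfl⟩ := h
    simp
  · rw [Matrix.single_apply_of_ne _ _ _ _ _ (by tauto)]
    have : ∃ j, ¬ (x j = 0 ∧ y j = 0) := by
      by_contra! hc
      exact h ⟨funext fun j => (hc j).1, funext fun j => (hc j).2⟩
    obtain ⟨j, hj⟩ := this
    rw [Finset.prod_eq_zero (Finset.mem_univ j) (if_neg hj), mul_zero]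

/-- Pauli strings are eigenvectors of the noise: the partial trace kills a non-trivial factor on the
noisy qubit, and the identity is preserved. -/
theorem depolarize_pauliStr (γ : ℝ) (j : Fin n) (s : PStr n) :
    depolarize γ j (pauliStr s) = ((if s j = 0 then 1 else 1 - γ : ℝ) : ℂ) • pauliStr s := by
  ext x y
  have hsplit : ∀ x y : Bits n, pauliStr s x y = pauliMatrix (s j) (x j) (y j) *
      ∏ i ∈ Finset.univ.erase j, pauliMatrix (s i) (x i) (y i) := by
    intro x y
    rw [Finset.mul_prod_erase _ (fun i => pauliMatrix (s i) (x i) (y i)) (Finset.mem_univ j)]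
    rfl
  have hupd : ∀ b, pauliStr s (Function.update x j b) (Function.update y j b) =
      pauliMatrix (s j) b b *
        ∏ i ∈ Finset.univ.erase j, pauliMatrix (s i) (x i) (y i) := by
    intro b
    rw [hsplit]
    congr 1
    · simp
    · refine Finset.prod_congr rfl fun i hi => ?_
      rw [Function.update_of_ne (Finset.ne_of_mem_erase hi),
        Function.update_of_ne (Finset.ne_of_mem_erase hi)]
  simp only [depolarize, Matrix.of_apply, Matrix.smul_apply, smul_eq_mul, hupd]
  rw [← Finset.sum_mul, show ∑ b, pauliMatrix (s j) b b = (pauliMatrix (s j)).trace from rfl,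
    pauliMatrix_trace, hsplit x y]
  by_cases h0 : s j = 0
  · simp only [h0, if_true, pauliMatrix_zero]
    by_cases hxy : x j = y j
    · have h1 : (1 : Matrix (Fin 2) (Fin 2) ℂ) (x j) (y j) = 1 := by rw [hxy, Matrix.one_apply_eq]
      rw [h1, if_pos hxy]; push_cast; ring
    · have h1 : (1 : Matrix (Fin 2) (Fin 2) ℂ) (x j) (y j) = 0 := Matrix.one_apply_ne hxy
      rw [h1, if_neg hxy]; simp
  · simp [h0]

theorem depolarize_sum {ι : Type*} (γ : ℝ) (j : Fin n) (S : Finset ι) (f : ι → Op n) :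
    depolarize γ j (∑ s ∈ S, f s) = ∑ s ∈ S, depolarize γ j (f s) := by
  ext x y
  simp only [depolarize, Matrix.of_apply, Matrix.sum_apply, Finset.mul_sum, Finset.sum_add_distrib]
  congr 1
  split_ifs
  · rw [Finset.sum_comm]
  · simp

theorem depolarize_smul (γ : ℝ) (j : Fin n) (c : ℂ) (ρ : Op n) :
    depolarize γ j (c • ρ) = c • depolarize γ j ρ := by
  ext x y
  simp only [depolarize, Matrix.of_apply, Matrix.smul_apply, smul_eq_mul, mul_add, mul_ite,
    mul_zero, Finset.mul_sum]
  congr 1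
  · ring
  · split_ifs
    · exact Finset.sum_congr rfl fun _ _ => by ring
    · rfl

theorem depolarizeAll_sum {ι : Type*} (γ : ℝ) (S : Finset ι) (f : ι → Op n) :
    depolarizeAll γ (∑ s ∈ S, f s) = ∑ s ∈ S, depolarizeAll γ (f s) := by
  unfold depolarizeAll
  induction List.finRange n generalizing f with
  | nil => rfl
  | cons j l ih => simp only [List.foldl_cons, depolarize_sum, ih]

theorem depolarizeAll_smul (γ : ℝ) (c : ℂ) (ρ : Op n) :
    depolarizeAll γ (c • ρ) = c • depolarizeAll γ ρ := by
  unfold depolarizeAll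
  induction List.finRange n generalizing ρ with
  | nil => rfl
  | cons j l ih => simp only [List.foldl_cons, depolarize_smul, ih]

theorem depolarizeAll_pauliStr (γ : ℝ) (s : PStr n) :
    depolarizeAll γ (pauliStr s) = (((1 - γ) ^ wt s : ℝ) : ℂ) • pauliStr s := by
  have key : ∀ l : List (Fin n), ∀ c : ℂ, l.foldl (fun σ j => depolarize γ j σ) (c • pauliStr s) =
      (c * (((l.map fun j => if s j = 0 then (1 : ℝ) else 1 - γ).prod : ℝ) : ℂ)) • pauliStr s := by
    intro l
    induction l with
    | nil => intro c; simp
    | cons j l ih =>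
      intro c
      rw [List.foldl_cons, depolarize_smul, depolarize_pauliStr, smul_smul, ih, List.map_cons,
        List.prod_cons, Complex.ofReal_mul, mul_assoc]
  have := key (List.finRange n) 1
  rw [one_smul, one_mul] at this
  rw [depolarizeAll, this, ← List.ofFn_eq_map, List.prod_ofFn, wt, Finset.prod_ite]
  simp

/-- The labels of the qubits, grouped by the gates of a layer. -/
def pairEquiv (e : Fin m × Fin 2 ≃ Fin (2 * m)) (α : Type*) :
    (Fin (2 * m) → α) ≃ (Fin m → α × α) where
  toFun x g := (x (e (g, 0)), x (e (g, 1)))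
  invFun y j := if (e.symm j).2 = 0 then (y (e.symm j).1).1 else (y (e.symm j).1).2
  left_inv x := by
    funext j
    obtain ⟨⟨g, b⟩, rfl⟩ := e.surjective j
    fin_cases b <;> simp
  right_inv y := by
    funext g
    simp

/-- Tensor products of two-qubit operators. -/
def tens (M : Fin m → Matrix TwoBits TwoBits ℂ) : Matrix (Fin m → TwoBits) (Fin m → TwoBits) ℂ :=
  Matrix.of fun x y => ∏ g, M g (x g) (y g)

theorem tens_mul (M N : Fin m → Matrix TwoBits TwoBits ℂ) :
    tens M * tens N = tens fun g => M g * N g := by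
  ext x y
  simp only [tens, Matrix.mul_apply, Matrix.of_apply, Fintype.prod_sum, Finset.prod_mul_distrib]

theorem tens_conjTranspose (M : Fin m → Matrix TwoBits TwoBits ℂ) :
    (tens M).conjTranspose = tens fun g => (M g).conjTranspose := by
  ext x y
  simp [tens, Matrix.conjTranspose_apply]

theorem tens_sum (c : Fin m → Pauli2 → ℝ) :
    (tens fun g => ∑ Q, (c g Q : ℂ) • pauli2 Q) =
      ∑ s : Fin m → Pauli2, ((∏ g, c g (s g) : ℝ) : ℂ) • tens fun g => pauli2 (s g) := by
  ext x y
  simp only [tens, Matrix.of_apply, Matrix.sum_apply, Matrix.smul_apply, smul_eq_mul,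
    Fintype.prod_sum, Finset.prod_mul_distrib, Complex.ofReal_prod]

theorem layer_eq (arch : Architecture m d) (C : Circuit m d) (t : Fin d) :
    layer arch C t = (tens fun g => (C t g : Matrix TwoBits TwoBits ℂ)).submatrix
      (pairEquiv (arch t) (Fin 2)) (pairEquiv (arch t) (Fin 2)) := rfl

theorem pauliStr_eq (e : Fin m × Fin 2 ≃ Fin (2 * m)) (s : PStr (2 * m)) :
    pauliStr s = (tens fun g => pauli2 (pairEquiv e (Fin 4) s g)).submatrix
      (pairEquiv e (Fin 2)) (pairEquiv e (Fin 2)) := by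
  ext x y
  simp only [pauliStr, tens, Matrix.of_apply, Matrix.submatrix_apply, pauli2,
    Matrix.kroneckerMap_apply, pairEquiv, Equiv.coe_fn_mk]
  rw [← e.prod_comp, Fintype.prod_prod_type]
  simp

/-- The transfer coefficient of a layer. -/
def trans (arch : Architecture m d) (C : Circuit m d) (t : Fin d) (s s' : PStr (2 * m)) : ℝ :=
  ∏ g, rc (C t g) (pairEquiv (arch t) (Fin 4) s g) (pairEquiv (arch t) (Fin 4) s' g)

/-- Regrouping the qubits by gates turns both the layer and the string into tensor products of
two-qubit matrices. The coefficients of the layer are then products of those of its gates. -/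
theorem layer_conj (arch : Architecture m d) (C : Circuit m d) (t : Fin d) (s : PStr (2 * m)) :
    layer arch C t * pauliStr s * (layer arch C t).conjTranspose =
      ∑ s', (trans arch C t s s' : ℂ) • pauliStr s' := by
  rw [pauliStr_eq (arch t), layer_eq, Matrix.conjTranspose_submatrix, Matrix.submatrix_mul_equiv,
    Matrix.submatrix_mul_equiv, tens_conjTranspose, tens_mul, tens_mul]
  simp only [conj_pauli2]
  rw [tens_sum, ← (pairEquiv (arch t) (Fin 4)).sum_comp]
  ext x y
  simp only [Matrix.submatrix_apply, Matrix.sum_apply, Matrix.smul_apply, trans,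
    pauliStr_eq (arch t)]

/-- A Pauli path: a Pauli string before the first and after every layer. -/
abbrev Path (m d : ℕ) : Type := Fin (d + 1) → PStr (2 * m)

/-- The total weight of a path. -/
def pathWt (s : Path m d) : ℕ := ∑ t, wt (s t)

/-- The amplitude of a path, without noise and without the final measurement. -/
def pathAmp (arch : Architecture m d) (C : Circuit m d) (s : Path m d) : ℝ :=
  zprod (s 0) 1 * ∏ t : Fin d, trans arch C t (s t.castSucc) (s t.succ)

theorem sum_path_succ {M : Type*} [AddCommMonoid M] (f : Path m (d + 1) → M) :
    ∑ s, f s = ∑ s : Path m d, ∑ q : PStr (2 * m), f (Fin.snoc s q) := by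
  have h := (Fin.snocEquiv fun _ : Fin (d + 1 + 1) => PStr (2 * m)).sum_comp f
  rw [← h, Fintype.sum_prod_type, Finset.sum_comm]
  rfl

theorem pathWt_snoc (s : Path m d) (q : PStr (2 * m)) :
    pathWt (Fin.snoc s q : Path m (d + 1)) = pathWt s + wt q := by
  simp [pathWt, Fin.sum_univ_castSucc (n := d + 1)]

theorem pathAmp_snoc (arch : Architecture m (d + 1)) (C : Circuit m (d + 1)) (s : Path m d)
    (q : PStr (2 * m)) :
    pathAmp arch C (Fin.snoc s q : Path m (d + 1)) =
      pathAmp (fun t => arch t.castSucc) (fun t => C t.castSucc) s *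
        trans arch C (Fin.last d) (s (Fin.last d)) q := by
  have hc : ∀ t : Fin (d + 1), (Fin.snoc s q : Path m (d + 1)) t.castSucc = s t :=
    fun t => Fin.snoc_castSucc (α := fun _ => PStr (2 * m)) q s t
  have hl : (Fin.snoc s q : Path m (d + 1)) (Fin.last (d + 1)) = q :=
    Fin.snoc_last (α := fun _ => PStr (2 * m)) q s
  have h0 : (Fin.snoc s q : Path m (d + 1)) 0 = s 0 := hc 0
  generalize (Fin.snoc s q : Path m (d + 1)) = u at hc hl h0
  rw [pathAmp, Fin.prod_univ_castSucc, ← mul_assoc, h0, hc, Fin.succ_last, hl, pathAmp]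
  congr 2
  refine Finset.prod_congr rfl fun t _ => ?_
  rw [hc, Fin.succ_castSucc, hc]
  rfl

theorem noisyState_succ (γ : ℝ) (arch : Architecture m (d + 1)) (C : Circuit m (d + 1)) :
    noisyState γ arch C = depolarizeAll γ (layer arch C (Fin.last d) *
      noisyState γ (fun t => arch t.castSucc) (fun t => C t.castSucc) *
        (layer arch C (Fin.last d)).conjTranspose) := by
  rw [noisyState, List.finRange_succ_last, List.foldl_append, List.foldl_map]
  rfl

/-- Peeling off the last layer extends every path by one string, whose weight is added to the
exponent by the noise that follows. -/
theorem noisyState_eq (γ : ℝ) (arch : Architecture m d) (C : Circuit m d) :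
    noisyState γ arch C = ((2 : ℂ) ^ (2 * m))⁻¹ • ∑ s : Path m d,
      (((1 - γ) ^ pathWt s * pathAmp arch C s : ℝ) : ℂ) • pauliStr (s (Fin.last d)) := by
  induction d with
  | zero =>
    rw [noisyState, List.finRange_zero, List.foldl_nil, single_eq_sum_pauliStr, depolarizeAll_smul,
      depolarizeAll_sum, ← (Equiv.funUnique (Fin 1) (PStr (2 * m))).sum_comp]
    congr 1
    refine Finset.sum_congr rfl fun s _ => ?_
    rw [depolarizeAll_smul, depolarizeAll_pauliStr, smul_smul, ← Complex.ofReal_mul]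
    simp [pathWt, pathAmp, mul_comm]
  | succ d ih =>
    rw [noisyState_succ, ih, sum_path_succ (d := d), Matrix.mul_smul, Matrix.smul_mul, depolarizeAll_smul,
      Matrix.mul_sum, Matrix.sum_mul, depolarizeAll_sum]
    congr 1
    refine Finset.sum_congr rfl fun s _ => ?_
    rw [Matrix.mul_smul, Matrix.smul_mul, depolarizeAll_smul, layer_conj, depolarizeAll_sum,
      Finset.smul_sum]
    refine Finset.sum_congr rfl fun q _ => ?_
    rw [depolarizeAll_smul, depolarizeAll_pauliStr, smul_smul, smul_smul, pathWt_snoc,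
      pathAmp_snoc, Fin.snoc_last]
    congr 1
    push_cast
    ring

theorem noisyProb_eq (γ : ℝ) (arch : Architecture m d) (C : Circuit m d) (x : Bits (2 * m)) :
    noisyProb γ arch C x = ((2 : ℝ) ^ (2 * m))⁻¹ * ∑ s : Path m d,
      (1 - γ) ^ pathWt s * pathAmp arch C s * zprod (s (Fin.last d)) (bitSign x) := by
  have h : noisyState γ arch C x x = ((((2 : ℝ) ^ (2 * m))⁻¹ * ∑ s : Path m d,
      (1 - γ) ^ pathWt s * pathAmp arch C s * zprod (s (Fin.last d)) (bitSign x) : ℝ) : ℂ) := by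
    rw [noisyState_eq, Matrix.smul_apply, Matrix.sum_apply]
    simp only [Matrix.smul_apply, pauliStr_diag, smul_eq_mul]
    push_cast
    rfl
  rw [noisyProb, h, Complex.ofReal_re]

/-! ### The noiseless circuit -/

theorem depolarizeAll_zero (ρ : Op n) : depolarizeAll 0 ρ = ρ := by
  have h : ∀ j (ρ : Op n), depolarize 0 j ρ = ρ := by
    intro j ρ; ext x y; simp [depolarize]
  unfold depolarizeAll
  induction List.finRange n with
  | nil => rfl
  | cons j l ih => rw [List.foldl_cons, h, ih]

/-- This translates anti-concentration, which concerns the unitary, into a statement about paths: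
the ideal circuit is the case where all paths have coefficient one. -/
theorem noisyProb_zero (arch : Architecture m d) (C : Circuit m d) (x : Bits (2 * m)) :
    noisyProb 0 arch C x = idealProb arch C x := by
  have h : ∀ (l : List (Fin d)) (V : Op (2 * m)),
      l.foldl (fun ρ t => depolarizeAll 0 (layer arch C t * ρ * (layer arch C t).conjTranspose))
        (V * Matrix.single 0 0 1 * V.conjTranspose) =
      (l.foldl (fun V t => layer arch C t * V) V) * Matrix.single 0 0 1 *
        (l.foldl (fun V t => layer arch C t * V) V).conjTranspose := by
    intro l
    induction l with
    | nil => intro V; rfl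
    | cons t l ih =>
      intro V
      rw [List.foldl_cons, List.foldl_cons, ← ih, depolarizeAll_zero, Matrix.conjTranspose_mul]
      simp only [Matrix.mul_assoc]
  have h1 := h (List.finRange d) 1
  rw [Matrix.one_mul, Matrix.conjTranspose_one, Matrix.mul_one] at h1
  rw [noisyProb, noisyState, depolarizeAll_zero, h1, idealProb, circuitUnitary]
  generalize ((List.finRange d).foldl (fun V t => layer arch C t * V) 1 : Op (2 * m)) = V
  have h2 : (V * (Matrix.single 0 0 1 : Op (2 * m)) * V.conjTranspose : Op (2 * m)) x x = V x 0 * star (V x 0) := by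
    rw [Matrix.mul_apply, Finset.sum_eq_single 0]
    · simp [Matrix.conjTranspose_apply]
    · intro b _ hb
      rw [Matrix.mul_single_apply_of_ne _ _ _ _ _ hb, zero_mul]
    · simp
  rw [h2, Complex.star_def, Complex.mul_conj, Complex.ofReal_re, Complex.normSq_eq_norm_sq]

/-! ### Positivity -/

open scoped ComplexOrder in
theorem depolarize_posSemidef {γ : ℝ} (h0 : 0 ≤ γ) (h1 : γ ≤ 1) (j : Fin n) {ρ : Op n}
    (h : ρ.PosSemidef) : (depolarize γ j ρ).PosSemidef := by
  -- Kraus operators `|a⟩⟨b|` on qubit `j`; the sum of `B ρ B†` over all pairs is the identity on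
  -- qubit `j` tensored with the partial trace.
  let B : Fin 2 × Fin 2 → Op n := fun p => Matrix.of fun x x' =>
    if x j = p.1 ∧ x' = Function.update x j p.2 then 1 else 0
  have hB : ∀ p x y, (B p * ρ * (B p).conjTranspose) x y = if x j = p.1 ∧ y j = p.1 then
      ρ (Function.update x j p.2) (Function.update y j p.2) else 0 := by
    intro p x y
    rw [Matrix.mul_apply, Finset.sum_eq_single (Function.update y j p.2)]
    · rw [Matrix.mul_apply, Finset.sum_eq_single (Function.update x j p.2)]
      · by_cases hx : x j = p.1 <;> by_cases hy : y j = p.1 <;>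
          simp [B, Matrix.conjTranspose_apply, hx, hy]
      · intro b _ hb; simp [B, hb]
      · simp
    · intro b _ hb; simp [B, Matrix.conjTranspose_apply, hb]
    · simp
  have hd : depolarize γ j ρ = ((1 - γ : ℝ) : ℂ) • ρ +
      ((γ / 2 : ℝ) : ℂ) • ∑ p, B p * ρ * (B p).conjTranspose := by
    ext x y
    simp only [depolarize, Matrix.of_apply, Matrix.add_apply, Matrix.smul_apply, smul_eq_mul,
      Matrix.sum_apply, hB, Fintype.sum_prod_type]
    push_cast
    congr 1
    by_cases hxy : x j = y j
    · rw [if_pos hxy, Finset.sum_comm]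
      congr 1
      refine Finset.sum_congr rfl fun b _ => ?_
      simp [← hxy]
    · rw [if_neg hxy, eq_comm]
      refine mul_eq_zero_of_right _ (Finset.sum_eq_zero fun a _ => Finset.sum_eq_zero fun b _ => ?_)
      rw [if_neg]
      rintro ⟨h1, h2⟩
      exact hxy (h1.trans h2.symm)
  rw [hd]
  refine (h.smul ?_).add ((Matrix.posSemidef_sum _ fun p _ =>
    h.mul_mul_conjTranspose_same (B p)).smul ?_)
  · rw [Complex.zero_le_real]; linarith
  · rw [Complex.zero_le_real]; linarith

open scoped ComplexOrder in
theorem depolarizeAll_posSemidef {γ : ℝ} (h0 : 0 ≤ γ) (h1 : γ ≤ 1) {ρ : Op n}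
    (h : ρ.PosSemidef) : (depolarizeAll γ ρ).PosSemidef := by
  unfold depolarizeAll
  induction List.finRange n generalizing ρ with
  | nil => exact h
  | cons j l ih => exact ih (depolarize_posSemidef h0 h1 j h)

open scoped ComplexOrder in
theorem noisyState_posSemidef {γ : ℝ} (h0 : 0 ≤ γ) (h1 : γ ≤ 1) (arch : Architecture m d)
    (C : Circuit m d) : (noisyState γ arch C).PosSemidef := by
  have h : (Matrix.single 0 0 1 : Op (2 * m)).PosSemidef := by
    rw [← Matrix.diagonal_single]
    refine Matrix.PosSemidef.diagonal ?_
    exact Pi.single_nonneg.2 zero_le_one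
  unfold noisyState
  have h' := depolarizeAll_posSemidef h0 h1 h
  generalize depolarizeAll γ (Matrix.single 0 0 1 : Op (2 * m)) = ρ at h'
  induction List.finRange d generalizing ρ with
  | nil => exact h'
  | cons t l ih =>
    exact ih _ (depolarizeAll_posSemidef h0 h1 (h'.mul_mul_conjTranspose_same _))

-- Positivity of the target is invisible in the path expansion, but the comparison of sampled bits
-- with the exact marginals relies on it.
open scoped ComplexOrder in
theorem noisyProb_nonneg {γ : ℝ} (h0 : 0 ≤ γ) (h1 : γ ≤ 1) (arch : Architecture m d)
    (C : Circuit m d) (x : Bits (2 * m)) : 0 ≤ noisyProb γ arch C x :=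
  (Complex.nonneg_iff.1 ((noisyState_posSemidef h0 h1 arch C).diag_nonneg)).1

/-! ### Orthogonality of Pauli paths -/

theorem integrable_of_abs_le {Ω : Type*} [MeasurableSpace Ω] {μ : Measure Ω} [IsFiniteMeasure μ]
    {f : Ω → ℝ} (hf : Measurable f) (B : ℝ) (hB : ∀ x, |f x| ≤ B) : Integrable f μ :=
  Integrable.of_bound hf.aestronglyMeasurable B (Filter.Eventually.of_forall hB)

theorem abs_rc_mul_rc_le (U : Gate) (P Q P' Q' : Pauli2) : |rc U P Q * rc U P' Q'| ≤ 1 := by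
  rw [abs_mul]
  exact mul_le_one₀ (abs_rc_le_one _ _ _) (abs_nonneg _) (abs_rc_le_one _ _ _)

/-- A random Pauli to the right multiplies the integrand by a character, which is non-trivial
because the input labels differ; hence the average vanishes. -/
theorem integral_rc_mul_rc {μ : Measure Gate} [IsProbabilityMeasure μ]
    (hμ : RightPauliInvariant μ) {P P' : Pauli2} (h : P ≠ P') (Q Q' : Pauli2) :
    ∫ U, rc U P Q * rc U P' Q' ∂μ = 0 := by
  set f : Gate → ℝ := fun U => rc U P Q * rc U P' Q' with hf
  have hfm : Measurable f := (measurable_rc P Q).mul (measurable_rc P' Q')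
  have hfb : ∀ U, |f U| ≤ 1 := fun U => abs_rc_mul_rc_le _ _ _ _ _
  have hfi : Integrable f μ := integrable_of_abs_le hfm 1 hfb
  set J := ∫ U, f U ∂μ
  let χ : Pauli2 → ℝ := fun V => pauliSign V.1 P.1 * pauliSign V.1 P'.1 *
    (pauliSign V.2 P.2 * pauliSign V.2 P'.2)
  have hχ : ∀ V, |χ V| ≤ 1 := by
    intro V
    have : ∀ a b, |pauliSign a b| = 1 := by
      intro a b; unfold pauliSign; split_ifs <;> simp
    simp [χ, abs_mul, this]
  have hχs : ∑ V, χ V = 0 := by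
    have : ∑ V, χ V = (∑ a, pauliSign a P.1 * pauliSign a P'.1) *
        ∑ a, pauliSign a P.2 * pauliSign a P'.2 := by
      rw [Finset.sum_mul_sum, Fintype.sum_prod_type]
    rw [this, sum_pauliSign, sum_pauliSign]
    by_cases h1 : P.1 = P'.1
    · have : P.2 ≠ P'.2 := fun h2 => h (Prod.ext h1 h2)
      simp [this]
    · simp [h1]
  have hfχ : ∀ V U, f (U * pauliGate V) = χ V * f U := by
    intro V U
    simp only [hf, rc_mul_pauliGate, χ]; ring
  -- Invariance is given for non-negative functions only, so it is applied to `1 + f`, which is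
  -- non-negative as `|f| ≤ 1`.
  have hlin : ∀ c : ℝ, |c| ≤ 1 → ∫⁻ U, ENNReal.ofReal (1 + c * f U) ∂μ = ENNReal.ofReal (1 + c * J) := by
    intro c hc
    rw [← ofReal_integral_eq_lintegral_ofReal]
    · rw [integral_add (integrable_const _) (hfi.const_mul c), integral_const_mul]
      simp [J]
    · exact (integrable_const _).add (hfi.const_mul c)
    · refine Filter.Eventually.of_forall fun U => ?_
      have : |c * f U| ≤ 1 := by
        rw [abs_mul]; exact mul_le_one₀ hc (abs_nonneg _) (hfb U)
      have := (abs_le.1 this).1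
      simp only [Pi.zero_apply]; linarith
  have hJ : |J| ≤ 1 := by
    have := norm_integral_le_of_norm_le_const (μ := μ) (f := f) (C := 1) (Filter.Eventually.of_forall hfb)
    simpa using this
  have key := hμ (fun U => ENNReal.ofReal (1 + 1 * f U))
    (ENNReal.measurable_ofReal.comp ((hfm.const_mul 1).const_add 1)) (by
      intro z U V hz
      simp only [hf, rc_phase hz])
  simp only [hfχ, one_mul] at key
  have h1 := hlin 1 (by simp)
  simp only [one_mul] at h1
  rw [h1] at key
  simp only [fun V => hlin (χ V) (hχ V)] at key
  -- The right side averages `1 + χ V * J` over `V`. The characters cancel, so that `1 + J = 1`.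
  rw [← ENNReal.ofReal_sum_of_nonneg, Finset.sum_add_distrib, ← Finset.sum_mul, hχs] at key
  · simp only [Finset.sum_const, Finset.card_univ, Fintype.card_prod, Fintype.card_fin, zero_mul,
      add_zero] at key
    norm_num at key
    rw [ENNReal.div_self (by norm_num) (by norm_num)] at key
    have h2 := (ENNReal.ofReal_eq_one).1 key
    change J = 0
    linarith
  · intro V _
    have : |χ V * J| ≤ 1 := by
      rw [abs_mul]; exact mul_le_one₀ (hχ V) (abs_nonneg _) hJ
    have := (abs_le.1 this).1
    linarith

theorem integral_circuit_prod (μ : Fin d → Fin m → Measure Gate)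
    (hμ : ∀ t g, IsProbabilityMeasure (μ t g)) (h : Fin d → Fin m → Gate → ℝ) :
    ∫ C, ∏ t, ∏ g, h t g (C t g) ∂circuitLaw μ = ∏ t, ∏ g, ∫ U, h t g U ∂μ t g := by
  have := hμ
  unfold circuitLaw
  rw [integral_fintype_prod_eq_prod (fun t (Ct : Fin m → Gate) => ∏ g, h t g (Ct g))]
  refine Finset.prod_congr rfl fun t _ => ?_
  rw [integral_fintype_prod_eq_prod (fun g U => h t g U)]

theorem isProbabilityMeasure_circuitLaw {μ : Fin d → Fin m → Measure Gate}
    (hμ : ∀ t g, IsProbabilityMeasure (μ t g)) : IsProbabilityMeasure (circuitLaw μ) := by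
  have := hμ
  unfold circuitLaw
  infer_instance

theorem abs_zprod_le_one (s : PStr n) {z : Fin n → ℝ} (hz : ∀ j, |z j| ≤ 1) : |zprod s z| ≤ 1 := by
  rw [zprod, Finset.abs_prod]
  refine Finset.prod_le_one (fun _ _ => abs_nonneg _) fun j _ => ?_
  unfold zfac
  split_ifs
  · simp
  · exact hz j
  · simp

theorem abs_trans_le_one (arch : Architecture m d) (C : Circuit m d) (t : Fin d)
    (s s' : PStr (2 * m)) : |trans arch C t s s'| ≤ 1 := by
  rw [trans, Finset.abs_prod]
  exact Finset.prod_le_one (fun _ _ => abs_nonneg _) fun g _ => abs_rc_le_one _ _ _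

theorem abs_pathAmp_le_one (arch : Architecture m d) (C : Circuit m d) (s : Path m d) :
    |pathAmp arch C s| ≤ 1 := by
  rw [pathAmp, abs_mul, Finset.abs_prod]
  exact mul_le_one₀ (abs_zprod_le_one _ (by simp)) (Finset.prod_nonneg fun _ _ => abs_nonneg _)
    (Finset.prod_le_one (fun _ _ => abs_nonneg _) fun g _ => abs_trans_le_one _ _ _ _ _)

theorem measurable_pathAmp (arch : Architecture m d) (s : Path m d) :
    Measurable fun C : Circuit m d => pathAmp arch C s := by
  unfold pathAmp trans
  refine Measurable.const_mul (Finset.measurable_prod _ fun t _ =>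
    Finset.measurable_prod _ fun g _ => ?_) _
  exact (measurable_rc _ _).comp ((measurable_pi_apply g).comp (measurable_pi_apply t))

/-- By independence the expectation factorises over gates, and a single gate with different input
labels makes the product vanish. Only strings that enter some layer are compared here; the final
string is handled by `sum_zprod_mul`. -/
theorem integral_pathAmp_mul {μ : Fin d → Fin m → Measure Gate} (hμ : IsPauliInvariantEnsemble μ)
    (arch : Architecture m d) {s s' : Path m d} (h : ∃ t : Fin d, s t.castSucc ≠ s' t.castSucc) :
    ∫ C, pathAmp arch C s * pathAmp arch C s' ∂circuitLaw μ = 0 := by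
  have hp := hμ.prob
  simp only [pathAmp, trans, mul_mul_mul_comm _ _ (zprod (s' 0) 1), ← Finset.prod_mul_distrib]
  rw [integral_const_mul, integral_circuit_prod μ hμ.prob (fun t g U =>
    rc U (pairEquiv (arch t) (Fin 4) (s t.castSucc) g) (pairEquiv (arch t) (Fin 4) (s t.succ) g) *
    rc U (pairEquiv (arch t) (Fin 4) (s' t.castSucc) g) (pairEquiv (arch t) (Fin 4) (s' t.succ) g))]
  obtain ⟨t, ht⟩ := h
  have : ∃ g, pairEquiv (arch t) (Fin 4) (s t.castSucc) g ≠
      pairEquiv (arch t) (Fin 4) (s' t.castSucc) g := by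
    by_contra! hc
    exact ht ((pairEquiv (arch t) (Fin 4)).injective (funext hc))
  obtain ⟨g, hg⟩ := this
  rw [Finset.prod_eq_zero (Finset.mem_univ t), mul_zero]
  exact Finset.prod_eq_zero (Finset.mem_univ g) (integral_rc_mul_rc (hμ.right t g) hg _ _)

/-- At a position where the strings differ, either one of the labels is `X` or `Y` and has zero
diagonal, or the labels are `I` and `Z`, whose diagonals are orthogonal. -/
theorem sum_zprod_mul {a b : PStr n} (h : a ≠ b) :
    ∑ x, zprod a (bitSign x) * zprod b (bitSign x) = 0 := by
  obtain ⟨j, hj⟩ := Function.ne_iff.1 h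
  have : ∑ x, zprod a (bitSign x) * zprod b (bitSign x) =
      ∏ j, ∑ c : Fin 2, zfac (a j) (if c = 0 then (1 : ℝ) else -1) *
        zfac (b j) (if c = 0 then (1 : ℝ) else -1) := by
    simp only [Fintype.prod_sum, zprod, bitSign, Finset.prod_mul_distrib]
  rw [this]
  refine Finset.prod_eq_zero (Finset.mem_univ j) ?_
  generalize a j = p at hj
  generalize b j = q at hj
  rw [Fin.sum_univ_two]
  unfold zfac
  split_ifs <;> simp_all

/-- The function on bit strings given by a linear combination of Pauli paths. -/
def pathSum (arch : Architecture m d) (c : Path m d → ℝ) (C : Circuit m d) (x : Bits (2 * m)) : ℝ :=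
  ((2 : ℝ) ^ (2 * m))⁻¹ * ∑ s, c s * pathAmp arch C s * zprod (s (Fin.last d)) (bitSign x)

/-- The second moment of a Pauli path. -/
def pathMoment (arch : Architecture m d) (μ : Fin d → Fin m → Measure Gate) (s : Path m d) : ℝ :=
  (∫ C, pathAmp arch C s ^ 2 ∂circuitLaw μ) *
    (((2 : ℝ) ^ (2 * m))⁻¹ * ∑ x, zprod (s (Fin.last d)) (bitSign x) ^ 2)

theorem pathMoment_nonneg (arch : Architecture m d) (μ : Fin d → Fin m → Measure Gate)
    (s : Path m d) : 0 ≤ pathMoment arch μ s :=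
  mul_nonneg (integral_nonneg fun _ => sq_nonneg _)
    (mul_nonneg (by positivity) (Finset.sum_nonneg fun _ _ => sq_nonneg _))

theorem sum_pathSum_sq (arch : Architecture m d) (c : Path m d → ℝ) (C : Circuit m d) :
    (2 : ℝ) ^ (2 * m) * ∑ x, pathSum arch c C x ^ 2 = ∑ s, ∑ s',
      (c s * c s' * (((2 : ℝ) ^ (2 * m))⁻¹ * ∑ x, zprod (s (Fin.last d)) (bitSign x) *
        zprod (s' (Fin.last d)) (bitSign x))) * (pathAmp arch C s * pathAmp arch C s') := by
  have h2 : ((2 : ℝ) ^ (2 * m)) ≠ 0 := by positivity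
  set D := (2 : ℝ) ^ (2 * m)
  have : ∀ x, pathSum arch c C x ^ 2 = D⁻¹ * D⁻¹ * ∑ s, ∑ s',
      (c s * pathAmp arch C s * zprod (s (Fin.last d)) (bitSign x)) *
      (c s' * pathAmp arch C s' * zprod (s' (Fin.last d)) (bitSign x)) := by
    intro x
    rw [pathSum, mul_pow, pow_two (∑ s, _), Finset.sum_mul_sum, pow_two]
  simp only [this]
  rw [← Finset.mul_sum, ← mul_assoc, mul_inv_cancel_left₀ h2, Finset.sum_comm, Finset.mul_sum]
  refine Finset.sum_congr rfl fun s _ => ?_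
  rw [Finset.sum_comm, Finset.mul_sum]
  refine Finset.sum_congr rfl fun s' _ => ?_
  simp only [Finset.mul_sum, Finset.sum_mul]
  refine Finset.sum_congr rfl fun x _ => ?_
  ring

theorem integrable_pathAmp_mul {μ : Fin d → Fin m → Measure Gate} (hμ : IsPauliInvariantEnsemble μ)
    (arch : Architecture m d) (s s' : Path m d) (a : ℝ) :
    Integrable (fun C => a * (pathAmp arch C s * pathAmp arch C s')) (circuitLaw μ) := by
  have := isProbabilityMeasure_circuitLaw hμ.prob
  refine (integrable_of_abs_le ((measurable_pathAmp arch s).mul (measurable_pathAmp arch s')) 1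
    fun C => ?_).const_mul a
  simp only [Pi.mul_apply]
  rw [abs_mul]
  exact mul_le_one₀ (abs_pathAmp_le_one _ _ _) (abs_nonneg _) (abs_pathAmp_le_one _ _ _)

theorem integrable_sum_pathSum_sq {μ : Fin d → Fin m → Measure Gate}
    (hμ : IsPauliInvariantEnsemble μ) (arch : Architecture m d) (c : Path m d → ℝ) :
    Integrable (fun C => (2 : ℝ) ^ (2 * m) * ∑ x, pathSum arch c C x ^ 2) (circuitLaw μ) := by
  simp only [sum_pathSum_sq]
  exact integrable_finsetSum _ fun s _ => integrable_finsetSum _ fun s' _ =>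
    integrable_pathAmp_mul hμ arch s s' _

/-- Parseval's identity for paths: all off-diagonal terms vanish, by the randomness of the gates or
by the sum over outputs. -/
theorem integral_sum_pathSum_sq {μ : Fin d → Fin m → Measure Gate}
    (hμ : IsPauliInvariantEnsemble μ) (arch : Architecture m d) (c : Path m d → ℝ) :
    ∫ C, (2 : ℝ) ^ (2 * m) * ∑ x, pathSum arch c C x ^ 2 ∂circuitLaw μ =
      ∑ s, c s ^ 2 * pathMoment arch μ s := by
  simp only [sum_pathSum_sq]
  rw [integral_finsetSum _ fun s _ => integrable_finsetSum _ fun s' _ =>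
    integrable_pathAmp_mul hμ arch s s' _]
  refine Finset.sum_congr rfl fun s _ => ?_
  rw [integral_finsetSum _ fun s' _ => integrable_pathAmp_mul hμ arch s s' _]
  simp only [integral_const_mul]
  rw [Finset.sum_eq_single s]
  · simp only [pathMoment, pow_two]; ring
  · intro s' _ hs
    by_cases h : ∃ t : Fin d, s t.castSucc ≠ s' t.castSucc
    · rw [integral_pathAmp_mul hμ arch h, mul_zero]
    · push Not at h
      rw [sum_zprod_mul]
      · simp
      · intro hl
        apply hs
        funext t
        induction t using Fin.lastCases with
        | last => exact hl.symm
        | cast t => exact (h t).symm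
  · simp

theorem pathSum_one (arch : Architecture m d) (C : Circuit m d) (x : Bits (2 * m)) :
    pathSum arch 1 C x = idealProb arch C x := by
  rw [← noisyProb_zero, noisyProb_eq, pathSum]
  simp

/-- With all coefficients equal to one, Parseval's identity expresses precisely the quantity that
anti-concentration bounds. -/
theorem sum_pathMoment_le {μ : Fin d → Fin m → Measure Gate} (hμ : IsPauliInvariantEnsemble μ)
    {arch : Architecture m d} {A : ℝ} (hA : AntiConcentrated arch μ A) :
    ∑ s, pathMoment arch μ s ≤ A := by
  have h := integral_sum_pathSum_sq hμ arch 1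
  simp only [pathSum_one, Pi.one_apply, one_pow, one_mul] at h
  rw [← h]
  exact hA

theorem pathMoment_eq_zero {μ : Fin d → Fin m → Measure Gate} {arch : Architecture m d}
    {s : Path m d} (h : ∀ C, pathAmp arch C s = 0) : pathMoment arch μ s = 0 := by
  simp [pathMoment, h]

/-- Markov's inequality for the total variation norm of a combination of paths. -/
theorem measure_le_sum_abs_pathSum {μ : Fin d → Fin m → Measure Gate}
    (hμ : IsPauliInvariantEnsemble μ) {arch : Architecture m d} {A : ℝ}
    (hA : AntiConcentrated arch μ A) (c : Path m d → ℝ) {r η : ℝ}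
    (hc : ∀ s, |c s| ≤ r ∨ ∀ C, pathAmp arch C s = 0) (hη : 0 < η) :
    circuitLaw μ {C | η ≤ ∑ x, |pathSum arch c C x|} ≤ ENNReal.ofReal (r ^ 2 * A / η ^ 2) := by
  have := isProbabilityMeasure_circuitLaw hμ.prob
  have h1 := mul_meas_ge_le_integral_of_nonneg (μ := circuitLaw μ)
    (f := fun C => (2 : ℝ) ^ (2 * m) * ∑ x, pathSum arch c C x ^ 2)
    (Filter.Eventually.of_forall fun C =>
      mul_nonneg (by positivity) (Finset.sum_nonneg fun _ _ => sq_nonneg _))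
    (integrable_sum_pathSum_sq hμ arch c) (η ^ 2)
  rw [integral_sum_pathSum_sq hμ] at h1
  have h2 : ∑ s, c s ^ 2 * pathMoment arch μ s ≤ r ^ 2 * A := by
    refine le_trans ?_ (mul_le_mul_of_nonneg_left (sum_pathMoment_le hμ hA) (sq_nonneg r))
    rw [Finset.mul_sum]
    refine Finset.sum_le_sum fun s _ => ?_
    rcases hc s with h | h
    · refine mul_le_mul_of_nonneg_right ?_ (pathMoment_nonneg _ _ _)
      exact sq_le_sq' (by linarith [(abs_le.1 h).1]) (abs_le.1 h).2
    · rw [pathMoment_eq_zero h]; simp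
  -- Cauchy-Schwarz over the `2 ^ n` outputs, which supplies the normalisation of the second moment.
  have h3 : {C | η ≤ ∑ x, |pathSum arch c C x|} ⊆
      {C | η ^ 2 ≤ (2 : ℝ) ^ (2 * m) * ∑ x, pathSum arch c C x ^ 2} := by
    intro C hC
    simp only [Set.mem_ofPred_eq] at hC ⊢
    have := sq_sum_le_card_mul_sum_sq (s := Finset.univ) (f := fun x => |pathSum arch c C x|)
    simp only [sq_abs, Finset.card_univ, Fintype.card_pi, Fintype.card_fin, Finset.prod_const] at this
    push_cast at this
    exact (pow_le_pow_left₀ hη.le hC 2).trans this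
  refine (measure_mono h3).trans ?_
  rw [← ofReal_measureReal]
  refine ENNReal.ofReal_le_ofReal ?_
  rw [le_div_iff₀ (by positivity), mul_comm]
  exact h1.trans h2

/-! ### Haar random circuits -/

theorem isCompact_unitaryGroup :
    IsCompact (Matrix.unitaryGroup TwoBits ℂ : Set (Matrix TwoBits TwoBits ℂ)) := by
  have h : IsCompact (Set.univ.pi fun _ : TwoBits => Set.univ.pi fun _ : TwoBits =>
      Metric.closedBall (0 : ℂ) 1) :=
    isCompact_univ_pi fun _ => isCompact_univ_pi fun _ => isCompact_closedBall 0 1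
  refine h.of_isClosed_subset (isClosed_unitary (R := Matrix TwoBits TwoBits ℂ)) ?_
  intro U hU i _ j _
  simpa using entry_norm_bound_of_unitary hU i j

theorem continuous_rc (P Q : Pauli2) : Continuous fun U : Gate => rc U P Q := by
  unfold rc
  refine Complex.continuous_re.comp (continuous_const.mul (Continuous.matrix_trace ?_))
  exact continuous_const.mul ((continuous_subtype_val.mul continuous_const).mul
    continuous_subtype_val.matrix_conjTranspose)

theorem rc_one_self (P : Pauli2) : rc 1 P P = 1 := by
  have h : pauli2 P * pauli2 P = 1 := by
    have := gate_mul_star (pauliGate P)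
    rwa [coe_pauliGate, pauli2_star] at this
  rw [rc]
  simp [h, Matrix.trace_one]

theorem measurable_mul_left_gate (V : Gate) : Measurable fun U : Gate => V * U := by
  refine measurable_comap_iff.2 (measurable_pi_lambda _ fun r => measurable_pi_lambda _ fun s => ?_)
  have : (fun U : Gate => ((V * U : Gate) : Matrix TwoBits TwoBits ℂ) r s) = fun U : Gate =>
      ∑ k, (V : Matrix TwoBits TwoBits ℂ) r k * (U : Matrix TwoBits TwoBits ℂ) k s := by
    funext U
    rw [← Matrix.mul_apply]; rfl
  change Measurable (fun U : Gate => ((V * U : Gate) : Matrix TwoBits TwoBits ℂ) r s)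
  rw [this]
  exact Finset.measurable_sum _ fun k _ => (measurable_entry k s).const_mul _

/-- Under the Haar measure, diagonal transfer coefficients have second moments bounded below. -/
theorem exists_le_integral_rc_sq : ∃ κ : ℝ, 0 < κ ∧ κ ≤ 1 ∧ ∀ μ : Measure Gate,
    IsProbabilityMeasure μ → μ.IsMulLeftInvariant → ∀ P, κ ≤ ∫ U, rc U P P ^ 2 ∂μ := by
  have key : ∀ P : Pauli2, ∃ N : ℕ, 0 < N ∧ ∀ μ : Measure Gate,
      IsProbabilityMeasure μ → μ.IsMulLeftInvariant → 1 / (4 * N : ℝ) ≤ ∫ U, rc U P P ^ 2 ∂μ := by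
    intro P
    have : CompactSpace Gate := isCompact_iff_compactSpace.1 isCompact_unitaryGroup
    -- An open neighbourhood of the identity. Finitely many translates cover the compact group, so
    -- every left invariant probability measure gives it a mass bounded below by a constant
    -- independent of the measure.
    let O : Set Gate := {U | 1 / 2 < rc U P P}
    have hO : IsOpen O := isOpen_lt continuous_const (continuous_rc P P)
    have hOm : MeasurableSet O := measurableSet_lt measurable_const (measurable_rc P P)
    obtain ⟨S, hS⟩ := isCompact_univ.elim_finite_subcover
      (fun V : Gate => (fun U : Gate => V * U) ⁻¹' O)
      (fun V => hO.preimage (continuous_const.mul continuous_id))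
      (fun U _ => Set.mem_iUnion.2 ⟨U⁻¹, by
        simp only [Set.mem_preimage, inv_mul_cancel, O, Set.mem_ofPred_eq, rc_one_self]; norm_num⟩)
    refine ⟨S.card + 1, Nat.succ_pos _, fun μ hp hl => ?_⟩
    have h1 : (1 : ENNReal) ≤ S.card * μ O := by
      calc (1 : ENNReal) = μ Set.univ := measure_univ.symm
        _ ≤ μ (⋃ V ∈ S, (fun U : Gate => V * U) ⁻¹' O) := measure_mono hS
        _ ≤ ∑ V ∈ S, μ ((fun U : Gate => V * U) ⁻¹' O) := measure_biUnion_finset_le _ _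
        _ = ∑ V ∈ S, μ O := by
          refine Finset.sum_congr rfl fun V _ => ?_
          rw [← Measure.map_apply (measurable_mul_left_gate V) hOm, hl.map_mul_left_eq_self V]
        _ = _ := by simp
    have h2 : 1 ≤ (S.card : ℝ) * μ.real O := by
      have := ENNReal.toReal_mono (ENNReal.mul_ne_top (ENNReal.natCast_ne_top _)
        (measure_ne_top μ O)) h1
      simpa [Measure.real] using this
    have h3 := mul_meas_ge_le_integral_of_nonneg (μ := μ) (f := fun U => rc U P P ^ 2)
      (Filter.Eventually.of_forall fun U => sq_nonneg _)
      (integrable_of_abs_le ((measurable_rc P P).pow_const 2) 1 fun U => by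
        rw [abs_pow]; exact pow_le_one₀ (abs_nonneg _) (abs_rc_le_one _ _ _)) (1 / 4)
    have h4 : μ.real O ≤ μ.real {U | 1 / 4 ≤ rc U P P ^ 2} := by
      refine measureReal_mono ?_
      intro U hU
      simp only [O, Set.mem_ofPred_eq] at hU ⊢
      nlinarith
    refine le_trans ?_ h3
    rw [div_le_iff₀ (by positivity)]
    push_cast
    have h5 : (0 : ℝ) ≤ μ.real O := measureReal_nonneg
    nlinarith
  choose N hN hμ using key
  obtain ⟨M, hM⟩ : ∃ M, ∀ P, N P ≤ M := ⟨∑ P, N P, fun P =>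
    Finset.single_le_sum (f := N) (fun _ _ => Nat.zero_le _) (Finset.mem_univ P)⟩
  have hM0 : 0 < M := (hN 0).trans_le (hM 0)
  refine ⟨1 / (4 * M), by positivity, ?_, fun μ hp hl P => le_trans ?_ (hμ P μ hp hl)⟩
  · rw [div_le_one (by positivity)]
    have : (1 : ℝ) ≤ M := by exact_mod_cast hM0
    linarith
  · refine one_div_le_one_div_of_le ?_ ?_
    · have := hN P; positivity
    · have : (N P : ℝ) ≤ M := by exact_mod_cast hM P
      linarith

/-- In each layer only the gate on qubit `q` sees a non-trivial label, and it contributes at least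
`κ`. The other gates map the trivial label to itself with coefficient one. -/
theorem pathMoment_const_single {κ : ℝ} (hκ : 0 < κ) {μ : Fin d → Fin m → Measure Gate}
    (hp : ∀ t g, IsProbabilityMeasure (μ t g))
    (h : ∀ t g P, κ ≤ ∫ U, rc U P P ^ 2 ∂μ t g) (arch : Architecture m d) (q : Fin (2 * m)) :
    κ ^ d ≤ pathMoment arch μ fun _ => Pi.single q 3 := by
  have hz : ∀ z : Fin (2 * m) → ℝ, zprod (Pi.single q 3) z = z q := by
    intro z
    rw [zprod, Finset.prod_eq_single q]
    · simp [zfac]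
    · intro j _ hj; simp [zfac, hj]
    · simp
  have h1 : ((2 : ℝ) ^ (2 * m))⁻¹ *
      ∑ x, zprod (Pi.single q 3 : PStr (2 * m)) (bitSign x) ^ 2 = 1 := by
    have : ∀ x : Bits (2 * m), zprod (Pi.single q 3 : PStr (2 * m)) (bitSign x) ^ 2 = 1 := by
      intro x; rw [hz, bitSign]; split_ifs <;> norm_num
    simp [this]
  rw [pathMoment, h1, mul_one]
  let f : Fin d → Fin m → Gate → ℝ := fun t g U =>
    rc U (pairEquiv (arch t) (Fin 4) (Pi.single q 3) g)
      (pairEquiv (arch t) (Fin 4) (Pi.single q 3) g) ^ 2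
  have h2 : ∀ C, pathAmp arch C (fun _ => Pi.single q 3) ^ 2 = ∏ t, ∏ g, f t g (C t g) := by
    intro C
    simp only [pathAmp, hz, trans, Pi.one_apply, one_mul, Finset.prod_pow, f]
  simp only [h2]
  rw [integral_circuit_prod μ hp f]
  dsimp only [f]
  calc κ ^ d = ∏ t : Fin d, κ := by simp
    _ ≤ _ := Finset.prod_le_prod (fun _ _ => hκ.le) fun t _ => ?_
  obtain ⟨⟨g, b⟩, hg⟩ := (arch t).surjective q
  calc κ = ∏ g' : Fin m, if g' = g then κ else 1 := by simp
    _ ≤ _ := Finset.prod_le_prod (fun g' _ => by split_ifs <;> linarith) fun g' _ => ?_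
  have := hp t g'
  split_ifs with hgg
  · exact h t g' _
  · have : pairEquiv (arch t) (Fin 4) (Pi.single q 3 : PStr (2 * m)) g' = 0 := by
      have hne : ∀ b', arch t (g', b') ≠ q := by
        intro b' hb
        rw [← hg] at hb
        have := (arch t).injective hb
        exact hgg (congrArg Prod.fst this)
      simp only [pairEquiv, Equiv.coe_fn_mk, Pi.single_eq_of_ne (hne _)]
      rfl
    simp [this, rc_zero_left]

/-- Anti-concentrated Haar random circuits have at least logarithmic depth. -/
theorem exists_log_le_depth (A : ℝ) : ∃ c : ℝ, 0 < c ∧ ∀ (m d : ℕ), 0 < d →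
    ∀ (arch : Architecture m d) (μ : Fin d → Fin m → Measure Gate), IsPauliInvariantEnsemble μ →
      AntiConcentrated arch μ A → IsHaarEnsemble μ → c * Real.log ((2 * m : ℕ) : ℝ) ≤ d := by
  obtain ⟨κ, hκ, hκ1, hint⟩ := exists_le_integral_rc_sq
  -- From `n * κ ^ d ≤ A` one gets `log n ≤ log (max A 1) - d * log κ`, which is at most `d * D`
  -- because `d ≥ 1`; the summand `1` makes `D` positive.
  set D := Real.log (max A 1) - Real.log κ + 1 with hD
  have hl1 : 0 ≤ Real.log (max A 1) := Real.log_nonneg (le_max_right _ _)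
  have hl2 : Real.log κ ≤ 0 := Real.log_nonpos hκ.le hκ1
  have hD0 : 0 < D := by linarith
  refine ⟨1 / D, by positivity, fun m d hd arch μ hμ hA hH => ?_⟩
  rcases Nat.eq_zero_or_pos m with rfl | hm
  · simp
  have h1 : ((2 * m : ℕ) : ℝ) * κ ^ d ≤ A := by
    refine le_trans ?_ (sum_pathMoment_le hμ hA)
    have hinj : Function.Injective fun q : Fin (2 * m) =>
        (fun _ => Pi.single q 3 : Path m d) := by
      intro q q' hqq
      have := congrFun hqq 0
      by_contra hne
      have h2 := congrFun this q
      simp [Pi.single_eq_of_ne hne] at h2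
    calc ((2 * m : ℕ) : ℝ) * κ ^ d = ∑ q : Fin (2 * m), κ ^ d := by simp
      _ ≤ ∑ q : Fin (2 * m), pathMoment arch μ (fun _ => Pi.single q 3) :=
        Finset.sum_le_sum fun q _ => pathMoment_const_single hκ hμ.prob
          (fun t g P => hint _ (hμ.prob t g) (hH t g).2 P) arch q
      _ = ∑ s ∈ Finset.univ.map ⟨_, hinj⟩, pathMoment arch μ s := by
        rw [Finset.sum_map]; rfl
      _ ≤ _ := Finset.sum_le_sum_of_subset_of_nonneg (Finset.subset_univ _)
        fun s _ _ => pathMoment_nonneg _ _ _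
  have hn : (0 : ℝ) < ((2 * m : ℕ) : ℝ) := by exact_mod_cast (by omega : 0 < 2 * m)
  have h2 := Real.log_le_log (by positivity) (h1.trans (le_max_left A 1))
  rw [Real.log_mul hn.ne' (by positivity), Real.log_pow] at h2
  rw [one_div_mul_eq_div, div_le_iff₀ hD0]
  have hd1 : (1 : ℝ) ≤ d := by exact_mod_cast hd
  have : Real.log (max A 1) ≤ d * Real.log (max A 1) := le_mul_of_one_le_left hl1 hd1
  rw [hD]
  nlinarith

/-! ### Sweeps along Pauli paths -/

/-- The two-qubit Pauli label encoded by the last digit of a number in base 16. -/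
def pauliDigit (z : ℕ) : Pauli2 := (⟨z / 4 % 4, Nat.mod_lt _ (by norm_num)⟩,
  ⟨z % 4, Nat.mod_lt _ (by norm_num)⟩)

/-- Replacing the labels of the two qubits of a gate. -/
def setPair (e : Fin m × Fin 2 ≃ Fin (2 * m)) (g : Fin m) (Q : Pauli2) (A : PStr (2 * m)) :
    PStr (2 * m) :=
  Function.update (Function.update A (e (g, 0)) Q.1) (e (g, 1)) Q.2

theorem pairEquiv_setPair (e : Fin m × Fin 2 ≃ Fin (2 * m)) (g : Fin m) (Q : Pauli2)
    (A : PStr (2 * m)) :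
    pairEquiv e (Fin 4) (setPair e g Q A) = Function.update (pairEquiv e (Fin 4) A) g Q := by
  funext g'
  by_cases h : g' = g
  · subst h
    simp [pairEquiv, setPair]
  · have h1 : ∀ b b', e (g', b) ≠ e (g, b') := by
      intro b b' hb
      exact h (congrArg Prod.fst (e.injective hb))
    simp [pairEquiv, setPair, Function.update_of_ne (h1 _ _), Function.update_of_ne h]

/-- How the value carried along a sweep is updated at a gate, given the label that is read and the
label that is chosen, and at a noisy qubit. -/
structure SweepOps (m : ℕ) (α : Type*) where
  gate : ℕ → Fin m → Pauli2 → Pauli2 → α → α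
  damp : α → α

/-- The state of a sweep: the current Pauli string, the code of the remaining choices, the value. -/
abbrev SweepState (m : ℕ) (α : Type*) : Type _ := PStr (2 * m) × ℕ × α

section Sweep

variable {α : Type*} (W : ℕ → (Fin m × Fin 2 ≃ Fin (2 * m))) (o : SweepOps m α)

/-- Passing a gate. -/
def gateStep (t : ℕ) (x : SweepState m α) (g : Fin m) : SweepState m α :=
  if pairEquiv (W t) (Fin 4) x.1 g = 0 then x
  else (setPair (W t) g (pauliDigit x.2.1) x.1, x.2.1 / 16,
    o.gate t g (pairEquiv (W t) (Fin 4) x.1 g) (pauliDigit x.2.1) x.2.2)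

/-- Passing a layer. -/
def layerStep (t : ℕ) (x : SweepState m α) : SweepState m α :=
  (List.finRange m).foldl (gateStep W o t) x

/-- The noise on a Pauli string. -/
def dampAll (A : PStr n) (damp : α → α) (v : α) : α :=
  (List.finRange n).foldl (fun v j => if A j = 0 then v else damp v) v

/-- Passing the noise after a layer. In a backward sweep, strings of weight at most `w` are
discarded. -/
def nodeStep [Zero α] (fwd : Bool) (w : ℕ) (x : SweepState m α) : SweepState m α :=
  (x.1, x.2.1, if fwd = false ∧ wt x.1 ≤ w then 0 else dampAll x.1 o.damp x.2.2)

/-- Passing the layers of a list. -/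
def sweep [Zero α] (fwd : Bool) (w : ℕ) (ts : List ℕ) (x : SweepState m α) : SweepState m α :=
  ts.foldl (fun x t => nodeStep o fwd w (layerStep W o t x)) x

/-- The value at the end of a sweep. -/
def finish [AddGroup α] (z : Fin (2 * m) → ℤ) (x : SweepState m α) : α :=
  if x.2.1 = 0 then (List.finRange (2 * m)).foldl
    (fun v j => if x.1 j = 0 then v else if x.1 j = 3 then z j • v else 0) x.2.2 else 0

end Sweep

/-! ### Sums over codes -/

theorem sum_range_mul_digit {M : Type*} [AddCommMonoid M] (b N : ℕ) (f : ℕ → ℕ → M) :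
    ∑ z ∈ Finset.range (b * N), f (z % b) (z / b) =
      ∑ e ∈ Finset.range b, ∑ z ∈ Finset.range N, f e z := by
  rcases Nat.eq_zero_or_pos b with rfl | hb
  · simp
  induction N with
  | zero => simp
  | succ N ih =>
    rw [Nat.mul_succ, Finset.sum_range_add, ih, ← Finset.sum_add_distrib]
    refine Finset.sum_congr rfl fun e he => ?_
    have he' := Finset.mem_range.1 he
    rw [Finset.sum_range_succ, Nat.mul_add_mod, Nat.mod_eq_of_lt he', Nat.mul_add_div hb,
      Nat.div_eq_of_lt he', add_zero]

theorem pauliDigit_mod (z : ℕ) : pauliDigit (z % 16) = pauliDigit z := by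
  simp only [pauliDigit, Prod.mk.injEq, Fin.mk.injEq]
  omega

theorem sum_pauliDigit {M : Type*} [AddCommMonoid M] (f : Pauli2 → M) :
    ∑ e ∈ Finset.range 16, f (pauliDigit e) = ∑ Q, f Q := by
  refine Finset.sum_bij' (fun e _ => pauliDigit e) (fun Q _ => 4 * (Q.1 : ℕ) + Q.2) ?_ ?_ ?_ ?_ ?_
  · simp
  · intro Q _
    have := Q.1.2; have := Q.2.2
    simp only [Finset.mem_range]; omega
  · intro e he
    have := Finset.mem_range.1 he
    simp only [pauliDigit]; omega
  · intro Q _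
    have := Q.1.2; have := Q.2.2
    refine Prod.ext (Fin.ext ?_) (Fin.ext ?_) <;> simp only [pauliDigit] <;> omega
  · simp

/-- The multiplicative updates of a sweep with real values. -/
def realOps (ρ : ℕ → Fin m → Pauli2 → Pauli2 → ℝ) (lam : ℝ) : SweepOps m ℝ where
  gate t g P Q v := v * ρ t g P Q
  damp v := v * lam

/-- A functional of sweep states that is linear in the value. -/
def LinearInValue (Φ : SweepState m ℝ → ℝ) : Prop := ∀ A z v, Φ (A, z, v) = v * Φ (A, z, 1)

/-- The sum of a functional over all codes with at most `L` digits. -/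
def codeSum (Φ : SweepState m ℝ → ℝ) (A : PStr (2 * m)) (L : ℕ) : ℝ :=
  ∑ z ∈ Finset.range (16 ^ L), Φ (A, z, 1)

/-! ### Exact sums over all codes -/

section RealSweep

variable {W : ℕ → (Fin m × Fin 2 ≃ Fin (2 * m))} {ρ : ℕ → Fin m → Pauli2 → Pauli2 → ℝ} {lam : ℝ}
  {Φ : SweepState m ℝ → ℝ}

theorem LinearInValue.gateStep (h : LinearInValue Φ) (t : ℕ) (g : Fin m) :
    LinearInValue fun x => Φ (gateStep W (realOps ρ lam) t x g) := by
  intro A z v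
  simp only [NoisyRCS.gateStep]
  split_ifs with h0
  · exact h A z v
  · simp only [realOps]
    rw [h, h _ _ (1 * _)]; ring

theorem LinearInValue.gates (h : LinearInValue Φ) (t : ℕ) (l : List (Fin m)) :
    LinearInValue fun x => Φ (l.foldl (NoisyRCS.gateStep W (realOps ρ lam) t) x) := by
  induction l with
  | nil => exact h
  | cons g l ih => exact ih.gateStep t g

/-- The number of active gates of a layer. -/
def active (e : Fin m × Fin 2 ≃ Fin (2 * m)) (A : PStr (2 * m)) : ℕ :=
  ∑ g, if pairEquiv e (Fin 4) A g = 0 then 0 else 1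

/-- The gates of a layer act on disjoint pairs, and each active one contains a qubit with a
non-trivial label. So a budget of `L` active gates covers all paths of weight at most `L`. -/
theorem active_le_wt (e : Fin m × Fin 2 ≃ Fin (2 * m)) (A : PStr (2 * m)) : active e A ≤ wt A := by
  rw [wt, Finset.card_filter, ← e.sum_comp, Fintype.sum_prod_type, active]
  refine Finset.sum_le_sum fun g _ => ?_
  rw [Fin.sum_univ_two]
  by_cases h0 : A (e (g, 0)) = 0 <;> by_cases h1 : A (e (g, 1)) = 0 <;>
    simp [pairEquiv, h0, h1]

/-- An active gate consumes one hexadecimal digit, whose 16 values are the possible output labels.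
An inactive gate consumes nothing and its only possible output is trivial. -/
theorem codeSum_gateStep (hΦ : LinearInValue Φ) (h0 : ∀ t g Q, ρ t g 0 Q = if Q = 0 then 1 else 0)
    (h0' : ∀ t g P, ρ t g P 0 = if P = 0 then 1 else 0) (t : ℕ) (g : Fin m) (A : PStr (2 * m))
    (L : ℕ) :
    codeSum (fun x => Φ (gateStep W (realOps ρ lam) t x g)) A L =
      ∑ Q, ρ t g (pairEquiv (W t) (Fin 4) A g) Q *
        if (if pairEquiv (W t) (Fin 4) A g = 0 then 0 else 1) ≤ L then
          codeSum Φ (setPair (W t) g Q A) (L - if pairEquiv (W t) (Fin 4) A g = 0 then 0 else 1)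
        else 0 := by
  by_cases hP : pairEquiv (W t) (Fin 4) A g = 0
  · have hA : setPair (W t) g 0 A = A := by
      apply (pairEquiv (W t) (Fin 4)).injective
      rw [pairEquiv_setPair, ← hP, Function.update_eq_self]
    simp only [codeSum, NoisyRCS.gateStep, hP, if_true, h0, ite_mul, one_mul, zero_mul,
      Finset.sum_ite_eq', Finset.mem_univ, hA, Nat.zero_le, Nat.sub_zero]
  · simp only [codeSum, NoisyRCS.gateStep, hP, if_false]
    cases L with
    -- With an exhausted budget the only code is zero, which selects the trivial output of a
    -- non-trivial input, and this has coefficient zero.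
    | zero =>
      have hd : pauliDigit 0 = 0 := rfl
      simp [hd, realOps, h0', hP, hΦ _ _ 0]
    | succ L =>
      have h1 : ∀ z, Φ (setPair (W t) g (pauliDigit z) A, z / 16,
          (realOps ρ lam).gate t g (pairEquiv (W t) (Fin 4) A g) (pauliDigit z) 1) =
          (fun e z' => ρ t g (pairEquiv (W t) (Fin 4) A g) (pauliDigit e) *
            Φ (setPair (W t) g (pauliDigit e) A, z', 1)) (z % 16) (z / 16) := by
        intro z
        simp only [pauliDigit_mod]
        rw [hΦ]
        simp [realOps]
      rw [Finset.sum_congr rfl fun z _ => h1 z, pow_succ', sum_range_mul_digit 16 (16 ^ L) fun e z' =>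
        ρ t g (pairEquiv (W t) (Fin 4) A g) (pauliDigit e) *
            Φ (setPair (W t) g (pauliDigit e) A, z', 1), sum_pauliDigit (fun Q => ∑ z ∈ Finset.range (16 ^ L),
        ρ t g (pairEquiv (W t) (Fin 4) A g) Q * Φ (setPair (W t) g Q A, z, 1))]
      refine Finset.sum_congr rfl fun Q _ => ?_
      simp [Finset.mul_sum]

/-- Relabelling the qubits of one gate does not change what the later gates of the layer read, so
all of them see the labels of `A`. Hence the number of digits that a layer consumes is determined
before any choice is made. -/
theorem codeSum_gates (hΦ : LinearInValue Φ) (h0 : ∀ t g Q, ρ t g 0 Q = if Q = 0 then 1 else 0)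
    (h0' : ∀ t g P, ρ t g P 0 = if P = 0 then 1 else 0) (t : ℕ) (l : List (Fin m)) (hl : l.Nodup)
    (A : PStr (2 * m)) (L : ℕ) :
    codeSum (fun x => Φ (l.foldl (gateStep W (realOps ρ lam) t) x)) A L =
      ∑ B : Fin m → Pauli2, if ∀ g, g ∉ l → B g = pairEquiv (W t) (Fin 4) A g then
        (l.map fun g => ρ t g (pairEquiv (W t) (Fin 4) A g) (B g)).prod *
          if (l.map fun g => if pairEquiv (W t) (Fin 4) A g = 0 then 0 else 1).sum ≤ L then
            codeSum Φ ((pairEquiv (W t) (Fin 4)).symm B)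
              (L - (l.map fun g => if pairEquiv (W t) (Fin 4) A g = 0 then 0 else 1).sum)
          else 0
        else 0 := by
  induction l generalizing A L with
  | nil =>
    have : ∀ B : Fin m → Pauli2, (∀ g, g ∉ ([] : List (Fin m)) →
        B g = pairEquiv (W t) (Fin 4) A g) ↔ B = pairEquiv (W t) (Fin 4) A := by
      intro B
      simp [funext_iff]
    simp only [this]
    simp
  | cons g l ih =>
    obtain ⟨hg, hl⟩ := List.nodup_cons.1 hl
    simp only [List.foldl_cons]
    rw [codeSum_gateStep (hΦ.gates t l) h0 h0']
    simp only [ih hl, pairEquiv_setPair]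
    have hupd : ∀ Q g', g' ∈ l → Function.update (pairEquiv (W t) (Fin 4) A) g Q g' =
        pairEquiv (W t) (Fin 4) A g' := by
      intro Q g' hg'
      rw [Function.update_of_ne]
      rintro rfl; exact hg hg'
    have hmap1 : ∀ Q (B : Fin m → Pauli2),
        (l.map fun g' => ρ t g' (Function.update (pairEquiv (W t) (Fin 4) A) g Q g') (B g')) =
        l.map fun g' => ρ t g' (pairEquiv (W t) (Fin 4) A g') (B g') := fun Q B =>
      List.map_congr_left fun g' hg' => by rw [hupd Q g' hg']
    have hmap2 : ∀ Q, (l.map fun g' =>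
        if Function.update (pairEquiv (W t) (Fin 4) A) g Q g' = 0 then 0 else 1) =
        l.map fun g' => if pairEquiv (W t) (Fin 4) A g' = 0 then 0 else 1 := fun Q =>
      List.map_congr_left fun g' hg' => by rw [hupd Q g' hg']
    have hind : ∀ Q (B : Fin m → Pauli2),
        (∀ g', g' ∉ l → B g' = Function.update (pairEquiv (W t) (Fin 4) A) g Q g') ↔
        (Q = B g ∧ ∀ g', g' ∉ g :: l → B g' = pairEquiv (W t) (Fin 4) A g') := by
      intro Q B
      constructor
      · intro h
        refine ⟨by simpa using (h g hg).symm, fun g' hg' => ?_⟩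
        rw [List.mem_cons, not_or] at hg'
        rw [h g' hg'.2, Function.update_of_ne hg'.1]
      · rintro ⟨rfl, h⟩ g' hg'
        by_cases hgg : g' = g
        · subst hgg; simp
        · rw [Function.update_of_ne hgg]
          exact h g' (by simp [hgg, hg'])
    simp only [hmap1, hmap2, hind, List.map_cons, List.prod_cons, List.sum_cons]
    set a := if pairEquiv (W t) (Fin 4) A g = 0 then 0 else 1
    set b := (l.map fun g' => if pairEquiv (W t) (Fin 4) A g' = 0 then 0 else 1).sum
    have hpush : ∀ Q, (ρ t g (pairEquiv (W t) (Fin 4) A g) Q * if a ≤ L then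
        ∑ B : Fin m → Pauli2, (if Q = B g ∧ ∀ g', g' ∉ g :: l → B g' = pairEquiv (W t) (Fin 4) A g'
          then (l.map fun g' => ρ t g' (pairEquiv (W t) (Fin 4) A g') (B g')).prod *
            (if b ≤ L - a then codeSum Φ ((pairEquiv (W t) (Fin 4)).symm B) (L - a - b) else 0)
          else 0) else 0) =
        ∑ B : Fin m → Pauli2, if Q = B g then
          (if ∀ g', g' ∉ g :: l → B g' = pairEquiv (W t) (Fin 4) A g' then
            ρ t g (pairEquiv (W t) (Fin 4) A g) (B g) *
            (l.map fun g' => ρ t g' (pairEquiv (W t) (Fin 4) A g') (B g')).prod *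
            (if a + b ≤ L then codeSum Φ ((pairEquiv (W t) (Fin 4)).symm B) (L - (a + b)) else 0)
          else 0) else 0 := by
      intro Q
      by_cases haL : a ≤ L
      · rw [if_pos haL, Finset.mul_sum]
        refine Finset.sum_congr rfl fun B _ => ?_
        have hab : b ≤ L - a ↔ a + b ≤ L := by omega
        simp only [hab, Nat.sub_sub]
        by_cases hQ : Q = B g
        · subst hQ
          simp only [true_and, if_true]
          split_ifs <;> ring
        · simp [hQ]
      · have hab : ¬ a + b ≤ L := by omega
        simp [haL, hab]
    simp only [hpush]
    rw [Finset.sum_comm]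
    simp

theorem codeSum_layerStep (hΦ : LinearInValue Φ)
    (h0 : ∀ t g Q, ρ t g 0 Q = if Q = 0 then 1 else 0)
    (h0' : ∀ t g P, ρ t g P 0 = if P = 0 then 1 else 0) (t : ℕ) (A : PStr (2 * m)) (L : ℕ) :
    codeSum (fun x => Φ (layerStep W (realOps ρ lam) t x)) A L =
      ∑ A', (∏ g, ρ t g (pairEquiv (W t) (Fin 4) A g) (pairEquiv (W t) (Fin 4) A' g)) *
        if active (W t) A ≤ L then codeSum Φ A' (L - active (W t) A) else 0 := by
  unfold layerStep
  rw [codeSum_gates hΦ h0 h0' t _ (List.nodup_finRange m), ← (pairEquiv (W t) (Fin 4)).sum_comp]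
  refine Finset.sum_congr rfl fun A' _ => ?_
  simp only [List.mem_finRange, not_true_eq_false, false_imp_iff, implies_true, if_true,
    Equiv.symm_apply_apply, ← Fin.prod_univ_def, ← Fin.sum_univ_def, active]
  rfl

theorem LinearInValue.layerStep (h : LinearInValue Φ) (t : ℕ) :
    LinearInValue fun x => Φ (NoisyRCS.layerStep W (realOps ρ lam) t x) := h.gates t _

theorem dampAll_real (A : PStr n) (lam v : ℝ) : dampAll A (fun v => v * lam) v = v * lam ^ wt A := by
  have key : ∀ l : List (Fin n), ∀ v : ℝ, l.foldl (fun v j => if A j = 0 then v else v * lam) v =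
      v * (l.map fun j => if A j = 0 then 1 else lam).prod := by
    intro l
    induction l with
    | nil => simp
    | cons j l ih =>
      intro v
      rw [List.foldl_cons, ih, List.map_cons, List.prod_cons, ← mul_assoc]
      split_ifs <;> ring
  rw [dampAll, key, ← List.ofFn_eq_map, List.prod_ofFn, wt, Finset.prod_ite]
  simp

/-- The factor that a sweep picks up after a layer. -/
def nodeFactor (lam : ℝ) (fwd : Bool) (w : ℕ) (A : PStr n) : ℝ :=
  if fwd = false ∧ wt A ≤ w then 0 else lam ^ wt A

theorem nodeStep_real (fwd : Bool) (w : ℕ) (x : SweepState m ℝ) :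
    nodeStep (realOps ρ lam) fwd w x = (x.1, x.2.1, x.2.2 * nodeFactor lam fwd w x.1) := by
  rw [nodeStep, realOps, dampAll_real, nodeFactor]
  split_ifs <;> simp

theorem LinearInValue.nodeStep (h : LinearInValue Φ) (fwd : Bool) (w : ℕ) :
    LinearInValue fun x => Φ (NoisyRCS.nodeStep (realOps ρ lam) fwd w x) := by
  intro A z v
  simp only [nodeStep_real]
  rw [h, h _ _ (1 * _)]; ring

theorem codeSum_nodeStep (hΦ : LinearInValue Φ) (fwd : Bool) (w : ℕ) (A : PStr (2 * m)) (L : ℕ) :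
    codeSum (fun x => Φ (nodeStep (realOps ρ lam) fwd w x)) A L =
      nodeFactor lam fwd w A * codeSum Φ A L := by
  simp only [codeSum, nodeStep_real, Finset.mul_sum]
  refine Finset.sum_congr rfl fun z _ => ?_
  rw [hΦ]; ring

theorem finish_real (z : Fin (2 * m) → ℤ) (x : SweepState m ℝ) :
    finish z x = if x.2.1 = 0 then x.2.2 * zprod x.1 (fun j => (z j : ℝ)) else 0 := by
  have key : ∀ l : List (Fin (2 * m)), ∀ v : ℝ, l.foldl
      (fun v j => if x.1 j = 0 then v else if x.1 j = 3 then z j • v else 0) v =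
      v * (l.map fun j => zfac (x.1 j) (z j : ℝ)).prod := by
    intro l
    induction l with
    | nil => simp
    | cons j l ih =>
      intro v
      rw [List.foldl_cons, ih, List.map_cons, List.prod_cons, ← mul_assoc]
      congr 1
      unfold zfac
      split_ifs <;> simp [mul_comm]
  rw [finish, key, zprod, Fin.prod_univ_def]

theorem linearInValue_finish (z : Fin (2 * m) → ℤ) :
    LinearInValue (finish z : SweepState m ℝ → ℝ) := by
  intro A y v
  simp only [finish_real]
  split_ifs <;> ring

theorem linearInValue_sweep (fwd : Bool) (w : ℕ) (ts : List ℕ) (z : Fin (2 * m) → ℤ) :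
    LinearInValue fun x => finish z (sweep W (realOps ρ lam) fwd w ts x) := by
  unfold sweep
  induction ts with
  | nil => exact linearInValue_finish z
  | cons t ts ih => exact (ih.nodeStep fwd w).layerStep t

/-- Codes with unread non-zero digits are discarded at the end of a sweep, so a path that needs
fewer than `L` digits is still counted exactly once. -/
theorem codeSum_finish (z : Fin (2 * m) → ℤ) (A : PStr (2 * m)) (L : ℕ) :
    codeSum (finish z) A L = zprod A fun j => (z j : ℝ) := by
  simp only [codeSum, finish_real, one_mul]
  rw [Finset.sum_ite_eq' (Finset.range (16 ^ L)) 0 fun _ => zprod A fun j => (z j : ℝ)]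
  simp

theorem codeSum_sweep_nil (fwd : Bool) (w : ℕ) (z : Fin (2 * m) → ℤ) (A : PStr (2 * m)) (L : ℕ) :
    codeSum (fun x => finish z (sweep W (realOps ρ lam) fwd w [] x)) A L =
      zprod A fun j => (z j : ℝ) :=
  codeSum_finish z A L

theorem codeSum_sweep_cons (h0 : ∀ t g Q, ρ t g 0 Q = if Q = 0 then 1 else 0)
    (h0' : ∀ t g P, ρ t g P 0 = if P = 0 then 1 else 0) (fwd : Bool) (w t : ℕ) (ts : List ℕ)
    (z : Fin (2 * m) → ℤ) (A : PStr (2 * m)) (L : ℕ) :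
    codeSum (fun x => finish z (sweep W (realOps ρ lam) fwd w (t :: ts) x)) A L =
      ∑ A', (∏ g, ρ t g (pairEquiv (W t) (Fin 4) A g) (pairEquiv (W t) (Fin 4) A' g)) *
        if active (W t) A ≤ L then nodeFactor lam fwd w A' *
          codeSum (fun x => finish z (sweep W (realOps ρ lam) fwd w ts x)) A'
            (L - active (W t) A) else 0 := by
  have h := codeSum_layerStep (lam := lam)
    ((linearInValue_sweep (W := W) (ρ := ρ) (lam := lam) fwd w ts z).nodeStep
      (ρ := ρ) (lam := lam) fwd w) h0 h0' (W := W) t A L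
  simp only [codeSum_nodeStep (linearInValue_sweep fwd w ts z)] at h
  exact h

end RealSweep

/-! ### Sums over chains with a budget -/

section Chain

variable {S : Type*} [Fintype S] (T : ℕ → S → S → ℝ) (act : ℕ → S → ℕ)

/-- Unrolling the recursion over layers turns the successive subtractions from the budget into one
inequality. The budget is charged for the string before each layer, the factor `ν` for the string
after it. -/
theorem chain_forward (ν fin : S → ℝ) (Z : ℕ → ℕ → S → ℕ → ℝ) (h0 : ∀ i A L, Z 0 i A L = fin A)
    (hs : ∀ k i A L, Z (k + 1) i A L = ∑ A', T i A A' *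
      if act i A ≤ L then ν A' * Z k (i + 1) A' (L - act i A) else 0) (k i : ℕ) (A : S) (L : ℕ) :
    Z k i A L = ∑ u : Fin k → S,
      if ∑ j : Fin k, act (i + j) ((Fin.cons A u : Fin (k + 1) → S) j.castSucc) ≤ L then
        (∏ j : Fin k, T (i + j) ((Fin.cons A u : Fin (k + 1) → S) j.castSucc) (u j)) *
          (∏ j, ν (u j)) * fin ((Fin.cons A u : Fin (k + 1) → S) (Fin.last k))
      else 0 := by
  induction k generalizing i A L with
  | zero => simp [h0]
  | succ k ih =>
    rw [hs, ← (Fin.consEquiv fun _ => S).sum_comp, Fintype.sum_prod_type]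
    refine Finset.sum_congr rfl fun A' _ => ?_
    by_cases hL : act i A ≤ L
    · rw [if_pos hL, ih, ← mul_assoc, Finset.mul_sum]
      refine Finset.sum_congr rfl fun u _ => ?_
      simp only [Fin.consEquiv_apply, Fin.sum_univ_succ, Fin.prod_univ_succ, Fin.castSucc_zero,
        Fin.cons_zero, Fin.cons_succ, Fin.val_zero, add_zero, Fin.val_succ, ← Fin.succ_castSucc,
        ← Fin.succ_last, mul_ite, mul_zero]
      have e : ∀ j : Fin k, i + 1 + (j : ℕ) = i + (j + 1) := fun j => by omega
      simp only [e]
      have hiff : ∀ x, x ≤ L - act i A ↔ act i A + x ≤ L := fun x => by omega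
      simp only [hiff]
      split_ifs
      · ring
      · rfl
    · rw [if_neg hL, mul_zero, eq_comm]
      refine Finset.sum_eq_zero fun u _ => ?_
      rw [if_neg]
      simp only [Fin.sum_univ_succ, Fin.castSucc_zero, Fin.cons_zero,
        Fin.val_zero, add_zero]
      omega

/-- The mirror image: the known string is the last one, the budget is charged for the string after
each layer, and `ν` for the string before it. -/
theorem chain_backward (ν start : S → ℝ) (Z : ℕ → S → ℕ → ℝ) (h0 : ∀ A L, Z 0 A L = start A)
    (hs : ∀ i A L, Z (i + 1) A L = ∑ A', T i A' A *
      if act i A ≤ L then ν A' * Z i A' (L - act i A) else 0) (i : ℕ) (A : S) (L : ℕ) :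
    Z i A L = ∑ u : Fin i → S,
      if ∑ j : Fin i, act j ((Fin.snoc u A : Fin (i + 1) → S) j.succ) ≤ L then
        (∏ j : Fin i, T j (u j) ((Fin.snoc u A : Fin (i + 1) → S) j.succ)) *
          (∏ j, ν (u j)) * start ((Fin.snoc u A : Fin (i + 1) → S) 0)
      else 0 := by
  induction i generalizing A L with
  | zero =>
    simp [h0]
    rfl
  | succ i ih =>
    have hsnoc : ∀ (u : Fin i → S) (A' : S) (j : Fin (i + 1)),
        (Fin.snoc (Fin.snoc u A' : Fin (i + 1) → S) A : Fin (i + 1 + 1) → S) j.castSucc =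
          (Fin.snoc u A' : Fin (i + 1) → S) j := fun u A' j =>
      Fin.snoc_castSucc (α := fun _ => S) A (Fin.snoc u A' : Fin (i + 1) → S) j
    have hlast : ∀ (u : Fin (i + 1) → S),
        (Fin.snoc u A : Fin (i + 1 + 1) → S) (Fin.last (i + 1)) = A := fun u =>
      Fin.snoc_last (α := fun _ => S) A u
    have hsnoc' : ∀ (u : Fin i → S) (A' : S) (j : Fin i),
        (Fin.snoc u A' : Fin (i + 1) → S) j.castSucc = u j := fun u A' j =>
      Fin.snoc_castSucc (α := fun _ => S) A' u j
    have hlast' : ∀ (u : Fin i → S) (A' : S),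
        (Fin.snoc u A' : Fin (i + 1) → S) (Fin.last i) = A' := fun u A' =>
      Fin.snoc_last (α := fun _ => S) A' u
    have hz : ∀ (u : Fin i → S) (A' : S),
        (Fin.snoc (Fin.snoc u A' : Fin (i + 1) → S) A : Fin (i + 1 + 1) → S) 0 =
          (Fin.snoc u A' : Fin (i + 1) → S) 0 := fun u A' => hsnoc u A' 0
    rw [hs, ← (Fin.snocEquiv fun _ : Fin (i + 1) => S).sum_comp, Fintype.sum_prod_type]
    refine Finset.sum_congr rfl fun A' _ => ?_
    have hE : ∀ u : Fin i → S, (Fin.snocEquiv fun _ : Fin (i + 1) => S) (A', u) =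
      (Fin.snoc u A' : Fin (i + 1) → S) := fun u => rfl
    by_cases hL : act i A ≤ L
    · rw [if_pos hL, ih, ← mul_assoc, Finset.mul_sum]
      refine Finset.sum_congr rfl fun u _ => ?_
      rw [hE]
      simp only [Fin.sum_univ_castSucc (n := i), Fin.prod_univ_castSucc (n := i), Fin.succ_last, hlast, hlast',
        Fin.succ_castSucc, hsnoc, hsnoc', hz, Fin.val_castSucc, Fin.val_last, mul_ite, mul_zero]
      have hiff : ∀ x, x ≤ L - act i A ↔ x + act i A ≤ L := fun x => by omega
      simp only [hiff]
      split_ifs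
      · ring
      · rfl
    · rw [if_neg hL, mul_zero, eq_comm]
      refine Finset.sum_eq_zero fun u _ => ?_
      rw [if_neg]
      rw [Fin.sum_univ_castSucc, Fin.succ_last, hlast, Fin.val_last]
      omega

/-- Splitting a chain at an intermediate point. -/
theorem sum_chain_split {M : Type*} [AddCommMonoid M] (i k : ℕ) (f : (Fin (i + (k + 1)) → S) → M) :
    ∑ s, f s = ∑ A : S, ∑ u : Fin k → S, ∑ v : Fin i → S,
      f (Fin.append v (Fin.cons A u : Fin (k + 1) → S)) := by
  have h1 : ∑ s, f s = ∑ v : Fin i → S, ∑ r : Fin (k + 1) → S, f (Fin.append v r) := by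
    rw [← Fintype.sum_prod_type (f := fun p : (Fin i → S) × (Fin (k + 1) → S) =>
      f (Fin.append p.1 p.2))]
    exact ((Fin.appendEquiv i (k + 1) (α := S)).sum_comp f).symm
  rw [h1, Finset.sum_comm, ← (Fin.consEquiv fun _ => S).sum_comp, Fintype.sum_prod_type]
  rfl

/-- The pivot `A` at position `i` belongs to both halves: it ends the backward chain and begins the
forward one. -/
theorem append_cons_left {S : Type*} (i k : ℕ) (A : S) (u : Fin k → S) (v : Fin i → S) (j : Fin (i + 1))
    (h : (j : ℕ) < i + (k + 1)) :
    (Fin.append v (Fin.cons A u : Fin (k + 1) → S)) ⟨j, h⟩ = (Fin.snoc v A : Fin (i + 1) → S) j := by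
  induction j using Fin.lastCases with
  | last =>
    rw [Fin.snoc_last]
    have := Fin.append_right v (Fin.cons A u : Fin (k + 1) → S) 0
    rw [Fin.cons_zero] at this
    exact Eq.trans rfl this
  | cast j =>
    rw [Fin.snoc_castSucc, ← Fin.append_left v (Fin.cons A u : Fin (k + 1) → S) j]
    rfl

theorem append_cons_right {S : Type*} (i k : ℕ) (A : S) (u : Fin k → S) (v : Fin i → S) (j : Fin (k + 1))
    (h : i + (j : ℕ) < i + (k + 1)) :
    (Fin.append v (Fin.cons A u : Fin (k + 1) → S)) ⟨i + j, h⟩ =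
      (Fin.cons A u : Fin (k + 1) → S) j :=
  Fin.append_right v (Fin.cons A u : Fin (k + 1) → S) j

end Chain

/-! ### The retained paths -/

/-- The paths that are found by sweeps from position `i`: this is the first position where the
weight is at most `w`, and few gates are active on both sides. -/
def Retained (W : ℕ → (Fin m × Fin 2 ≃ Fin (2 * m))) (L w : ℕ) (s : Path m d) (i : ℕ) : Prop :=
  (∀ t : Fin (d + 1), (t : ℕ) = i → wt (s t) ≤ w) ∧ (∀ t : Fin (d + 1), (t : ℕ) < i → w < wt (s t)) ∧
    (∑ t : Fin d, if (t : ℕ) < i then active (W t) (s t.succ) else 0) ≤ L ∧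
    (∑ t : Fin d, if i ≤ (t : ℕ) then active (W t) (s t.castSucc) else 0) ≤ L

/-- The sum over forward sweeps from position `i`. -/
def forwardSum (W : ℕ → (Fin m × Fin 2 ≃ Fin (2 * m))) (ρ : ℕ → Fin m → Pauli2 → Pauli2 → ℝ)
    (lam : ℝ) (w : ℕ) (z : Fin (2 * m) → ℤ) (i k : ℕ) : PStr (2 * m) → ℕ → ℝ :=
  codeSum fun x => finish z (sweep W (realOps ρ lam) true w (List.range' i k) x)

/-- The sum over backward sweeps from position `i`. -/
def backwardSum (W : ℕ → (Fin m × Fin 2 ≃ Fin (2 * m))) (ρ : ℕ → Fin m → Pauli2 → Pauli2 → ℝ)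
    (lam : ℝ) (w : ℕ) (i : ℕ) : PStr (2 * m) → ℕ → ℝ :=
  codeSum fun x => finish 1 (sweep W (realOps (fun t g P Q => ρ t g Q P) lam) false w
    (List.range i).reverse x)

/-- A path through a pivot `A` at position `i` is a pair of independent continuations, so the sum
factorises. The damping of the pivot enters once, through `lam ^ wt A`. Backward sweeps discard
light strings, which makes `i` the first position where the path is light. -/
theorem sum_retained (arch : Architecture m d) (C : Circuit m d)
    (W : ℕ → (Fin m × Fin 2 ≃ Fin (2 * m))) (ρ : ℕ → Fin m → Pauli2 → Pauli2 → ℝ)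
    (hW : ∀ t : Fin d, W t = arch t) (hρ : ∀ (t : Fin d) g, ρ t g = rc (C t g))
    (h0 : ∀ t g Q, ρ t g 0 Q = if Q = 0 then 1 else 0)
    (h0' : ∀ t g P, ρ t g P 0 = if P = 0 then 1 else 0) (lam : ℝ) (L w : ℕ)
    (z : Fin (2 * m) → ℤ) {i : ℕ} (hi : i < d) :
    (∑ A : PStr (2 * m), if wt A ≤ w then lam ^ wt A *
      forwardSum W ρ lam w z i (d - i) A L * backwardSum W ρ lam w i A L else 0) =
    ∑ s : Path m d, open Classical in if Retained W L w s i then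
      lam ^ pathWt s * pathAmp arch C s * zprod (s (Fin.last d)) (fun j => (z j : ℝ)) else 0 := by
  classical
  obtain ⟨k, rfl⟩ := Nat.exists_eq_add_of_lt hi
  obtain ⟨k, rfl⟩ : ∃ k', k' = k + 1 := ⟨_, rfl⟩
  rw [show i + k + 1 - i = k + 1 by omega]
  revert arch C hW hρ hi
  rw [show i + k + 1 = i + (k + 1) by omega]
  generalize k + 1 = k
  intro arch C hW hρ _
  let T : ℕ → PStr (2 * m) → PStr (2 * m) → ℝ := fun t A A' =>
    ∏ g, ρ t g (pairEquiv (W t) (Fin 4) A g) (pairEquiv (W t) (Fin 4) A' g)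
  have hT : ∀ t : Fin (i + k), trans arch C t = T t := by
    intro t
    funext A A'
    simp only [trans, T, hW, hρ]
  have hF := chain_forward T (fun t => active (W t)) (nodeFactor lam true w)
    (fun A => zprod A fun j => (z j : ℝ)) (fun k i A L => forwardSum W ρ lam w z i k A L)
    (fun i A L => codeSum_sweep_nil _ _ _ _ _) (fun k i A L => by
      simp only [forwardSum, List.range'_succ]
      exact codeSum_sweep_cons h0 h0' _ _ _ _ _ _ _) k i
  have hB := chain_backward T (fun t => active (W t)) (nodeFactor lam false w)
    (fun A => zprod A 1) (fun i A L => backwardSum W ρ lam w i A L)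
    (fun A L => by
      simp only [backwardSum, List.range_zero, List.reverse_nil]
      rw [codeSum_sweep_nil]
      congr 1
      funext j; simp) (fun i A L => by
      simp only [backwardSum, List.range_succ, List.reverse_append, List.reverse_singleton,
        List.singleton_append]
      exact codeSum_sweep_cons (fun t g Q => h0' t g Q) (fun t g P => h0 t g P) _ _ _ _ _ _ _) i
  have hνf : ∀ A : PStr (2 * m), nodeFactor lam true w A = lam ^ wt A := by
    intro A; simp [nodeFactor]
  have hνb : ∀ v : Fin i → PStr (2 * m), ∏ j, nodeFactor lam false w (v j) =
      if ∀ j, w < wt (v j) then lam ^ ∑ j, wt (v j) else 0 := by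
    intro v
    split_ifs with h
    · rw [← Finset.prod_pow_eq_pow_sum]
      refine Finset.prod_congr rfl fun j _ => ?_
      rw [nodeFactor, if_neg]
      rintro ⟨_, h2⟩
      exact absurd (h j) (by omega)
    · push Not at h
      obtain ⟨j, hj⟩ := h
      exact Finset.prod_eq_zero (Finset.mem_univ j) (by simp [nodeFactor, hj])
  have hsplit := sum_chain_split (S := PStr (2 * m)) i k fun s : Path m (i + k) =>
    if Retained W L w s i then lam ^ pathWt s * pathAmp arch C s *
      zprod (s (Fin.last (i + k))) (fun j => (z j : ℝ)) else 0
  refine Eq.trans ?_ hsplit.symm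
  refine Finset.sum_congr rfl fun A _ => ?_
  simp only [hF, hB, hνf, hνb]
  rw [mul_assoc, Finset.sum_mul_sum]
  by_cases hA : wt A ≤ w
  swap
  · rw [if_neg hA, eq_comm]
    refine Finset.sum_eq_zero fun u _ => Finset.sum_eq_zero fun v _ => if_neg fun hr => hA ?_
    have h1 := hr.1 ⟨i, by omega⟩ rfl
    have h2 := append_cons_right i k A u v 0 (by simp)
    rw [Fin.cons_zero] at h2
    have h3 : (Fin.append v (Fin.cons A u : Fin (k + 1) → PStr (2 * m))) ⟨i, by omega⟩ = A := h2
    exact h3 ▸ h1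
  rw [if_pos hA, Finset.mul_sum]
  refine Finset.sum_congr rfl fun u _ => ?_
  rw [Finset.mul_sum]
  refine Finset.sum_congr rfl fun v _ => ?_
  have hl := append_cons_left i k A u v
  have hr := append_cons_right i k A u v
  -- The index types `Fin (i + (k + 1))` and `Fin (i + k + 1)` agree by computation; a name `s` for
  -- the path allows both readings.
  suffices H : ∀ s : Path m (i + k), ((Fin.append v (Fin.cons A u : Fin (k + 1) → PStr (2 * m)) :
      Fin (i + (k + 1)) → PStr (2 * m)) = s) → _ = if Retained W L w s i then
        lam ^ pathWt s * pathAmp arch C s * zprod (s (Fin.last (i + k))) (fun j => (z j : ℝ))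
        else 0 from H _ rfl
  intro s hs
  have hl' : ∀ j : Fin (i + 1), s ⟨j, by omega⟩ = (Fin.snoc v A : Fin (i + 1) → PStr (2 * m)) j :=
    fun j => by rw [← hs]; exact hl j _
  have hr' : ∀ j : Fin (k + 1), s ⟨i + j, by omega⟩ =
      (Fin.cons A u : Fin (k + 1) → PStr (2 * m)) j :=
    fun j => by rw [← hs]; exact hr j _
  have l1 : ∀ j : Fin i, s (Fin.castAdd k j).castSucc = v j := fun j => by
    have := hl' j.castSucc
    rw [Fin.snoc_castSucc (α := fun _ => PStr (2 * m))] at this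
    exact this
  have l2 : ∀ j : Fin i, s (Fin.castAdd k j).succ =
      (Fin.snoc v A : Fin (i + 1) → PStr (2 * m)) j.succ := fun j => hl' j.succ
  have r1 : ∀ j : Fin k, s (Fin.natAdd i j).castSucc =
      (Fin.cons A u : Fin (k + 1) → PStr (2 * m)) j.castSucc := fun j => hr' j.castSucc
  have r2 : ∀ j : Fin k, s (Fin.natAdd i j).succ = u j := fun j => hr' j.succ
  have z1 : s 0 = (Fin.snoc v A : Fin (i + 1) → PStr (2 * m)) 0 := hl' 0
  have z2 : s (Fin.last (i + k)) = (Fin.cons A u : Fin (k + 1) → PStr (2 * m)) (Fin.last k) :=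
    hr' (Fin.last k)
  have z3 : s ⟨i, by omega⟩ = A := hr' 0
  have hpw : pathWt s = ∑ j, wt (v j) + (wt A + ∑ j, wt (u j)) := by
    rw [pathWt]
    have := Fin.sum_univ_add (a := i) (b := k + 1) fun t => wt (s t)
    refine Eq.trans this ?_
    congr 1
    · exact Finset.sum_congr rfl fun j _ => congrArg wt (l1 j)
    · rw [Fin.sum_univ_succ]
      congr 1
      · exact congrArg wt z3
      · exact Finset.sum_congr rfl fun j _ => congrArg wt (r2 j)
  have hamp : pathAmp arch C s = zprod ((Fin.snoc v A : Fin (i + 1) → PStr (2 * m)) 0) 1 *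
      ((∏ j : Fin i, T j (v j) ((Fin.snoc v A : Fin (i + 1) → PStr (2 * m)) j.succ)) *
        ∏ j : Fin k, T (i + j) ((Fin.cons A u : Fin (k + 1) → PStr (2 * m)) j.castSucc) (u j)) := by
    simp only [pathAmp, hT]
    rw [Fin.prod_univ_add, z1]
    simp only [l1, l2, r1, r2, Fin.val_castAdd, Fin.val_natAdd]
  have hret : Retained W L w s i ↔ (∀ j, w < wt (v j)) ∧
      ∑ j : Fin i, active (W j) ((Fin.snoc v A : Fin (i + 1) → PStr (2 * m)) j.succ) ≤ L ∧
      ∑ j : Fin k, active (W (i + j))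
        ((Fin.cons A u : Fin (k + 1) → PStr (2 * m)) j.castSucc) ≤ L := by
    rw [Retained, Fin.sum_univ_add, Fin.sum_univ_add]
    simp only [l2, r1, Fin.val_castAdd, Fin.val_natAdd, Fin.is_lt, if_true,
      show ∀ j : Fin k, ¬ i + (j : ℕ) < i from fun j => by omega, if_false,
      show ∀ j : Fin i, ¬ i ≤ (j : ℕ) from fun j => by omega, Nat.le_add_right,
      Finset.sum_const_zero, add_zero, zero_add]
    have e1 : (∀ t : Fin (i + k + 1), (t : ℕ) = i → wt (s t) ≤ w) ↔ True := by
      simp only [iff_true]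
      rintro ⟨t, ht⟩ h
      simp only at h
      subst h
      rw [z3]; exact hA
    have e2 : (∀ t : Fin (i + k + 1), (t : ℕ) < i → w < wt (s t)) ↔ ∀ j, w < wt (v j) := by
      constructor
      · intro h j
        have := h (Fin.castAdd k j).castSucc j.2
        rwa [l1] at this
      · intro h t ht
        have := h ⟨t, ht⟩
        rw [← l1] at this
        exact this
    rw [e1, e2, true_and]
  rw [hpw, hamp, z2]
  simp only [hret, ite_and]
  rw [Finset.prod_pow_eq_pow_sum, pow_add, pow_add]
  split_ifs <;> ring

/-- A first position is unique, so that summing over pivot positions counts no path twice. -/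
theorem Retained.unique {W : ℕ → (Fin m × Fin 2 ≃ Fin (2 * m))} {L w : ℕ} {s : Path m d} {i j : ℕ}
    (hi : Retained W L w s i) (hj : Retained W L w s j) (hid : i < d) (hjd : j < d) : i = j := by
  rcases lt_trichotomy i j with h | h | h
  · have h1 := hj.2.1 ⟨i, by omega⟩ h
    have h2 := hi.1 ⟨i, by omega⟩ rfl
    omega
  · exact h
  · have h1 := hi.2.1 ⟨j, by omega⟩ h
    have h2 := hj.1 ⟨j, by omega⟩ rfl
    omega

/-- Pigeonhole: if all `d` strings before the layers had weight above `L / d`, the total weight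
would exceed `L`. The first light one is a pivot, and the bounds on active gates follow from the
weight. -/
theorem exists_retained (W : ℕ → (Fin m × Fin 2 ≃ Fin (2 * m))) {L : ℕ} (hd : 0 < d) {s : Path m d}
    (hs : pathWt s ≤ L) : ∃ i < d, Retained W L (L / d) s i := by
  have hsum : ∑ t : Fin d, wt (s t.castSucc) ≤ L := by
    rw [pathWt, Fin.sum_univ_castSucc] at hs; omega
  have hsum' : ∑ t : Fin d, wt (s t.succ) ≤ L := by
    rw [pathWt, Fin.sum_univ_succ] at hs; omega
  have hex : ∃ i, ∃ h : i < d, wt (s ⟨i, by omega⟩) ≤ L / d := by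
    by_contra! hc
    have : ∑ t : Fin d, (L / d + 1) ≤ ∑ t : Fin d, wt (s t.castSucc) :=
      Finset.sum_le_sum fun t _ => hc t t.2
    rw [Finset.sum_const, Finset.card_univ, Fintype.card_fin, smul_eq_mul] at this
    have := Nat.lt_mul_div_succ L hd
    omega
  classical
  obtain ⟨hi, hiw⟩ := Nat.find_spec hex
  refine ⟨Nat.find hex, hi, ?_, ?_, ?_, ?_⟩
  · rintro ⟨t, ht⟩ h
    simp only at h
    subst h
    exact hiw
  · intro t ht
    by_contra hc
    exact Nat.find_min hex ht ⟨by omega, not_lt.1 hc⟩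
  · refine le_trans (Finset.sum_le_sum fun t _ => ?_) hsum'
    split_ifs
    · exact active_le_wt _ _
    · exact Nat.zero_le _
  · refine le_trans (Finset.sum_le_sum fun t _ => ?_) hsum
    split_ifs
    · exact active_le_wt _ _
    · exact Nat.zero_le _

open Classical in
/-- The indicator of the retained paths. -/
def retainedIndicator (W : ℕ → (Fin m × Fin 2 ≃ Fin (2 * m))) (L w : ℕ) (s : Path m d) : ℝ :=
  ∑ i ∈ Finset.range d, if Retained W L w s i then 1 else 0

/-- Some paths of weight above `L` are retained too. That is harmless: the error estimate only needs
a factor between zero and one on them. -/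
theorem retainedIndicator_mem (W : ℕ → (Fin m × Fin 2 ≃ Fin (2 * m))) (L w : ℕ) (s : Path m d) :
    0 ≤ retainedIndicator W L w s ∧ retainedIndicator W L w s ≤ 1 := by
  classical
  refine ⟨Finset.sum_nonneg fun i _ => by split_ifs <;> simp, ?_⟩
  rw [retainedIndicator, Finset.sum_boole]
  have : (Finset.filter (fun i => Retained W L w s i) (Finset.range d)).card ≤ 1 := by
    rw [Finset.card_le_one]
    intro i hi j hj
    rw [Finset.mem_filter, Finset.mem_range] at hi hj
    exact hi.2.unique hj.2 hi.1 hj.1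
  exact_mod_cast this

theorem retainedIndicator_eq_one (W : ℕ → (Fin m × Fin 2 ≃ Fin (2 * m))) {L : ℕ} (hd : 0 < d)
    {s : Path m d} (hs : pathWt s ≤ L) : retainedIndicator W L (L / d) s = 1 := by
  classical
  refine le_antisymm (retainedIndicator_mem _ _ _ _).2 ?_
  obtain ⟨i, hi, hr⟩ := exists_retained W hd hs
  have h := Finset.single_le_sum (f := fun i => if Retained W L (L / d) s i then (1 : ℝ) else 0)
    (fun i _ => by split_ifs <;> simp) (Finset.mem_range.2 hi)
  simp only [hr, if_true] at h
  exact h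

/-- The sum over all retained paths, as computed by sweeps. -/
def marginalReal (W : ℕ → (Fin m × Fin 2 ≃ Fin (2 * m))) (ρ : ℕ → Fin m → Pauli2 → Pauli2 → ℝ)
    (lam : ℝ) (L w d : ℕ) (z : Fin (2 * m) → ℤ) : ℝ :=
  ∑ i ∈ Finset.range d, ∑ A : PStr (2 * m), if wt A ≤ w then lam ^ wt A *
      forwardSum W ρ lam w z i (d - i) A L * backwardSum W ρ lam w i A L else 0

theorem marginalReal_eq (arch : Architecture m d) (C : Circuit m d)
    (W : ℕ → (Fin m × Fin 2 ≃ Fin (2 * m))) (ρ : ℕ → Fin m → Pauli2 → Pauli2 → ℝ)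
    (hW : ∀ t : Fin d, W t = arch t) (hρ : ∀ (t : Fin d) g, ρ t g = rc (C t g))
    (h0 : ∀ t g Q, ρ t g 0 Q = if Q = 0 then 1 else 0)
    (h0' : ∀ t g P, ρ t g P 0 = if P = 0 then 1 else 0) (lam : ℝ) (L w : ℕ)
    (z : Fin (2 * m) → ℤ) :
    marginalReal W ρ lam L w d z = ∑ s : Path m d, lam ^ pathWt s * retainedIndicator W L w s *
      pathAmp arch C s * zprod (s (Fin.last d)) (fun j => (z j : ℝ)) := by
  classical
  rw [marginalReal, Finset.sum_congr rfl fun i hi =>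
    sum_retained arch C W ρ hW hρ h0 h0' lam L w z (Finset.mem_range.1 hi), Finset.sum_comm]
  refine Finset.sum_congr rfl fun s _ => ?_
  rw [retainedIndicator, Finset.mul_sum, Finset.sum_mul, Finset.sum_mul]
  refine Finset.sum_congr rfl fun i _ => ?_
  split_ifs <;> ring

theorem trans_eq_zero {arch : Architecture m d} {t : Fin d} {A A' : PStr (2 * m)}
    (h : ¬ (A = 0 ↔ A' = 0)) (C : Circuit m d) : trans arch C t A A' = 0 := by
  have hpe : ∀ A : PStr (2 * m), A ≠ 0 → ∃ g, pairEquiv (arch t) (Fin 4) A g ≠ 0 := by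
    intro A hA
    by_contra! hc
    apply hA
    apply (pairEquiv (arch t) (Fin 4)).injective
    funext g
    rw [hc g]; rfl
  have hz : ∀ g, pairEquiv (arch t) (Fin 4) 0 g = 0 := fun g => rfl
  by_cases hA : A = 0
  · have hA' : A' ≠ 0 := by tauto
    obtain ⟨g, hg⟩ := hpe A' hA'
    subst hA
    exact Finset.prod_eq_zero (Finset.mem_univ g) (by rw [hz, rc_zero_left, if_neg hg])
  · have hA' : A' = 0 := by tauto
    obtain ⟨g, hg⟩ := hpe A hA
    subst hA'
    exact Finset.prod_eq_zero (Finset.mem_univ g) (by rw [hz, rc_zero_right, if_neg hg])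

theorem wt_pos {A : PStr n} (h : A ≠ 0) : 0 < wt A := by
  obtain ⟨j, hj⟩ := Function.ne_iff.1 h
  exact Finset.card_pos.2 ⟨j, by simpa using hj⟩

/-- Only the trivial path has a weight below the depth of the circuit. -/
theorem lt_pathWt_or_pathAmp_eq_zero (arch : Architecture m d) {s : Path m d} (hs : s ≠ 0) :
    d < pathWt s ∨ ∀ C, pathAmp arch C s = 0 := by
  by_cases h : ∃ t : Fin d, ¬ (s t.castSucc = 0 ↔ s t.succ = 0)
  · obtain ⟨t, ht⟩ := h
    refine Or.inr fun C => ?_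
    rw [pathAmp, Finset.prod_eq_zero (Finset.mem_univ t) (trans_eq_zero ht C), mul_zero]
  · push Not at h
    left
    -- Non-triviality propagates through all layers, so each of the `d + 1` strings has weight at
    -- least one.
    have h0 : ∀ t, s t = 0 ↔ s 0 = 0 := by
      intro t
      induction t using Fin.induction with
      | zero => rfl
      | succ t ih => exact (h t).symm.trans ih
    have h1 : ∀ t, s t ≠ 0 := by
      intro t ht
      exact hs (funext fun t' => (h0 t').2 ((h0 t).1 ht))
    have : ∑ t : Fin (d + 1), 1 ≤ ∑ t, wt (s t) :=
      Finset.sum_le_sum fun t _ => wt_pos (h1 t)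
    simp at this
    exact this

/-! ### Codes of Pauli strings of small weight -/

/-- Reading one digit of a code. -/
def decodeStep (n : ℕ) (x : PStr n × ℕ) : PStr n × ℕ :=
  (if h : x.2 % (4 * n) / 4 < n ∧ x.2 % (4 * n) % 4 ≠ 0 then
    Function.update x.1 ⟨x.2 % (4 * n) / 4, h.1⟩ ⟨x.2 % (4 * n) % 4, Nat.mod_lt _ (by norm_num)⟩
    else x.1, x.2 / (4 * n))

/-- The Pauli string with a given code. -/
def decode (n w z : ℕ) : PStr n := ((decodeStep n)^[w] (0, z)).1

/-- The code of a Pauli string. -/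
def encode (A : PStr n) : ℕ :=
  (List.finRange n).foldl (fun c j => if A j = 0 then c else c * (4 * n) + 4 * j + A j) 0

/-- The code of the first `J` entries of a Pauli string. -/
def encodePrefix (A : PStr n) (J : ℕ) : ℕ :=
  ((List.finRange n).take J).foldl
    (fun c j => if A j = 0 then c else c * (4 * n) + 4 * j + A j) 0

theorem foldl_take_finRange_succ {β : Type*} (f : β → Fin n → β) (b : β) {J : ℕ} (hJ : J < n) :
    ((List.finRange n).take (J + 1)).foldl f b =
      f (((List.finRange n).take J).foldl f b) ⟨J, hJ⟩ := by
  rw [List.take_add_one, List.getElem?_eq_getElem (by simpa using hJ)]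
  simp

theorem foldl_take_finRange {β : Type*} (f : β → Fin n → β) (b : β) :
    ((List.finRange n).take n).foldl f b = (List.finRange n).foldl f b := by
  rw [List.take_of_length_le (by simp)]

theorem encodePrefix_succ (A : PStr n) {J : ℕ} (hJ : J < n) : encodePrefix A (J + 1) =
    if A ⟨J, hJ⟩ = 0 then encodePrefix A J else encodePrefix A J * (4 * n) + 4 * J + A ⟨J, hJ⟩ := by
  rw [encodePrefix, foldl_take_finRange_succ _ _ hJ]
  rfl

theorem encodePrefix_self (A : PStr n) : encodePrefix A n = encode A :=
  foldl_take_finRange _ _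

/-- The weight of the first `J` entries. -/
def wtPrefix (A : PStr n) (J : ℕ) : ℕ := (Finset.univ.filter fun j : Fin n => (j : ℕ) < J ∧ A j ≠ 0).card

theorem wtPrefix_succ (A : PStr n) {J : ℕ} (hJ : J < n) :
    wtPrefix A (J + 1) = wtPrefix A J + if A ⟨J, hJ⟩ = 0 then 0 else 1 := by
  by_cases h : A ⟨J, hJ⟩ = 0
  · rw [if_pos h, add_zero, wtPrefix, wtPrefix]
    congr 1
    ext j
    simp only [Finset.mem_filter, Finset.mem_univ, true_and]
    constructor
    · rintro ⟨h1, h2⟩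
      refine ⟨?_, h2⟩
      by_contra h3
      have : j = ⟨J, hJ⟩ := Fin.ext (by simp; omega)
      exact h2 (this ▸ h)
    · rintro ⟨h1, h2⟩
      exact ⟨by omega, h2⟩
  · rw [if_neg h, wtPrefix, wtPrefix, ← Finset.card_insert_of_notMem (a := (⟨J, hJ⟩ : Fin n))]
    · congr 1
      ext j
      simp only [Finset.mem_filter, Finset.mem_univ, true_and, Finset.mem_insert]
      constructor
      · rintro ⟨h1, h2⟩
        by_cases h3 : (j : ℕ) = J
        · exact Or.inl (Fin.ext h3)
        · exact Or.inr ⟨by omega, h2⟩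
      · rintro (rfl | ⟨h1, h2⟩)
        · exact ⟨Nat.lt_succ_self _, h⟩
        · exact ⟨by omega, h2⟩
    · simp

theorem wtPrefix_self (A : PStr n) : wtPrefix A n = wt A := by
  simp [wtPrefix, wt]

theorem encodePrefix_lt (A : PStr n) {J : ℕ} (hJ : J ≤ n) :
    encodePrefix A J < (4 * n) ^ wtPrefix A J := by
  induction J with
  | zero => simp [encodePrefix, wtPrefix]
  | succ J ih =>
    rw [encodePrefix_succ A hJ, wtPrefix_succ A hJ]
    have ih := ih (by omega)
    split_ifs with h
    · exact ih
    · rw [pow_succ]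
      have h1 := (A ⟨J, hJ⟩).2
      have h2 : (encodePrefix A J + 1) * (4 * n) ≤ (4 * n) ^ wtPrefix A J * (4 * n) :=
        Nat.mul_le_mul_right _ ih
      nlinarith

theorem decodeStep_iterate_zero (w : ℕ) (A : PStr n) : (decodeStep n)^[w] (A, 0) = (A, 0) := by
  induction w with
  | zero => rfl
  | succ w ih =>
    rw [Function.iterate_succ_apply, show decodeStep n (A, 0) = (A, 0) by simp [decodeStep], ih]

/-- A code lists the non-trivial labels as digits `4 * j + A j` in base `4 * n`. The last digit
written is the first one read, and surplus reading steps see the digit zero and change nothing. -/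
theorem decodeStep_iterate (A : PStr n) {J : ℕ} (hJ : J ≤ n) (w : ℕ) (hw : wtPrefix A J ≤ w)
    (A₀ : PStr n) : (decodeStep n)^[w] (A₀, encodePrefix A J) =
      (fun j : Fin n => if (j : ℕ) < J ∧ A j ≠ 0 then A j else A₀ j, 0) := by
  induction J generalizing w A₀ with
  | zero => simp [encodePrefix, decodeStep_iterate_zero]
  | succ J ih =>
    rw [encodePrefix_succ A hJ]
    rw [wtPrefix_succ A hJ] at hw
    split_ifs at hw ⊢ with h
    · rw [ih (by omega) w hw]
      refine Prod.ext (funext fun j => ?_) rfl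
      by_cases hj : (j : ℕ) = J
      · have : A j = 0 := by rw [← h]; congr 1; exact Fin.ext hj
        simp [this]
      · have : (j : ℕ) < J ↔ (j : ℕ) < J + 1 := by omega
        simp only [this]
    · obtain ⟨w, rfl⟩ : ∃ w', w = w' + 1 := ⟨w - 1, by omega⟩
      have h1 := (A ⟨J, hJ⟩).2
      have hpos : 0 < 4 * n := by omega
      have hA0 : (A ⟨J, hJ⟩ : ℕ) ≠ 0 := fun h0 => h (Fin.ext h0)
      have hmod : (encodePrefix A J * (4 * n) + 4 * J + A ⟨J, hJ⟩) % (4 * n) =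
          4 * J + A ⟨J, hJ⟩ := by
        rw [add_assoc, mul_comm, Nat.mul_add_mod, Nat.mod_eq_of_lt (by omega)]
      have hdiv : (encodePrefix A J * (4 * n) + 4 * J + A ⟨J, hJ⟩) / (4 * n) =
          encodePrefix A J := by
        rw [add_assoc, mul_comm, Nat.mul_add_div hpos, Nat.div_eq_of_lt (by omega), add_zero]
      have hstep : decodeStep n (A₀, encodePrefix A J * (4 * n) + 4 * J + A ⟨J, hJ⟩) =
          (Function.update A₀ ⟨J, hJ⟩ (A ⟨J, hJ⟩), encodePrefix A J) := by
        have e1 : (4 * J + (A ⟨J, hJ⟩ : ℕ)) / 4 = J := by omega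
        have e2 : (4 * J + (A ⟨J, hJ⟩ : ℕ)) % 4 = A ⟨J, hJ⟩ := by omega
        simp only [decodeStep, hmod, hdiv, e1, e2]
        rw [dif_pos ⟨by omega, hA0⟩]
      rw [Function.iterate_succ_apply, hstep, ih (by omega) w (by omega)]
      refine Prod.ext (funext fun j => ?_) rfl
      by_cases hj : j = ⟨J, hJ⟩
      · subst hj; simp [h]
      · have h3 : (j : ℕ) ≠ J := fun h3 => hj (Fin.ext h3)
        have : (j : ℕ) < J ↔ (j : ℕ) < J + 1 := by omega
        simp only [this, Function.update_of_ne hj]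

theorem decode_encode {A : PStr n} {w : ℕ} (hA : wt A ≤ w) : decode n w (encode A) = A := by
  rw [decode, ← encodePrefix_self, decodeStep_iterate A le_rfl w (by rwa [wtPrefix_self])]
  funext j
  simp only [Fin.is_lt, true_and, Pi.zero_apply, ne_eq, ite_not]
  split_ifs with h
  · exact h.symm
  · rfl

theorem wt_update_le (A : PStr n) (j : Fin n) (a : Fin 4) : wt (Function.update A j a) ≤ wt A + 1 := by
  refine le_trans (Finset.card_le_card ?_) (Finset.card_insert_le j _)
  intro i hi
  simp only [Finset.mem_filter, Finset.mem_univ, true_and, Finset.mem_insert] at hi ⊢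
  by_cases h : i = j
  · exact Or.inl h
  · rw [Function.update_of_ne h] at hi
    exact Or.inr hi

theorem wt_decodeStep_iterate (w : ℕ) (x : PStr n × ℕ) :
    wt ((decodeStep n)^[w] x).1 ≤ wt x.1 + w := by
  induction w with
  | zero => rfl
  | succ w ih =>
    rw [Function.iterate_succ_apply', decodeStep]
    dsimp only
    split_ifs
    · have := wt_update_le ((decodeStep n)^[w] x).1
      exact (this _ _).trans (by omega)
    · omega

theorem wt_decode_le (w z : ℕ) : wt (decode n w z) ≤ w := by
  have h := wt_decodeStep_iterate w ((0, z) : PStr n × ℕ)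
  have h0 : wt (0 : PStr n) = 0 := by simp [wt]
  rw [h0, zero_add] at h
  exact h

/-- Many integers decode to the same string; the test on `encode` keeps exactly one of them for each
string of weight at most `w`. -/
theorem sum_decode {M : Type*} [AddCommMonoid M] (n w : ℕ) (hn : 0 < n) (f : PStr n → M) :
    (∑ z ∈ Finset.range ((4 * n) ^ w), if encode (decode n w z) = z then f (decode n w z) else 0) =
      ∑ A, if wt A ≤ w then f A else 0 := by
  rw [← Finset.sum_filter, ← Finset.sum_filter]
  refine Finset.sum_bij' (fun z _ => decode n w z) (fun A _ => encode A) ?_ ?_ ?_ ?_ ?_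
  · intro z _
    simp [wt_decode_le]
  · intro A hA
    have hA := (Finset.mem_filter.1 hA).2
    simp only [Finset.mem_filter, Finset.mem_range, decode_encode hA, and_true]
    have h := encodePrefix_lt A le_rfl
    rw [encodePrefix_self, wtPrefix_self] at h
    exact h.trans_le (Nat.pow_le_pow_right (by omega) hA)
  · intro z hz
    exact (Finset.mem_filter.1 hz).2
  · intro A hA
    exact decode_encode (Finset.mem_filter.1 hA).2
  · intro z _; rfl

/-! ### Transfer coefficients from approximate gates -/

/-- The Pauli matrices over the Gaussian integers. -/
def pauliGauss : Fin 4 → Fin 2 → Fin 2 → GaussianInt :=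
  ![fun i j => if i = j then 1 else 0, fun i j => if i = j then 0 else 1,
    fun i j => if i = j then 0 else if i = 0 then ⟨0, -1⟩ else ⟨0, 1⟩,
    fun i j => if i = j then if i = 0 then 1 else -1 else 0]

theorem toComplex_pauliGauss (a : Fin 4) (i j : Fin 2) :
    GaussianInt.toComplex (pauliGauss a i j) = pauliMatrix a i j := by
  fin_cases a <;> fin_cases i <;> fin_cases j <;>
    simp [pauliGauss, pauliMatrix, GaussianInt.toComplex_def]

/-- The terms of `tr(Q V P V†)`. -/
def gateTerm (V : TwoBits → TwoBits → GaussianInt) (P Q : Pauli2) (a b c e : TwoBits) :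
    GaussianInt :=
  pauliGauss Q.1 a.1 b.1 * pauliGauss Q.2 a.2 b.2 *
    (V b c * (pauliGauss P.1 c.1 e.1 * pauliGauss P.2 c.2 e.2) * star (V a e))

/-- The real part of `tr(Q V P V†)`. -/
def gateNum (V : TwoBits → TwoBits → GaussianInt) (P Q : Pauli2) : ℤ :=
  (∑ a, ∑ b, ∑ c, ∑ e, gateTerm V P Q a b c e).re

theorem norm_pauli2_le_one (P : Pauli2) (a b : TwoBits) : ‖pauli2 P a b‖ ≤ 1 :=
  entry_norm_bound_of_unitary (pauli2_mem P) a b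

/-- The trace is a sum of `4 ^ 4 = 256` terms that are quadratic in the gate, each off by at most `8
* p`. -/
theorem gateNum_approx (U : Gate) (V : TwoBits → TwoBits → GaussianInt) {p : ℝ} (hp : 1 ≤ p)
    (hre : ∀ r s, |((V r s).re : ℝ) - p * ((U : Matrix TwoBits TwoBits ℂ) r s).re| ≤ 1)
    (him : ∀ r s, |((V r s).im : ℝ) - p * ((U : Matrix TwoBits TwoBits ℂ) r s).im| ≤ 1)
    (P Q : Pauli2) : |(gateNum V P Q : ℝ) - 4 * p ^ 2 * rc U P Q| ≤ 2048 * p := by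
  set M := (U : Matrix TwoBits TwoBits ℂ) with hM
  have hV : ∀ r s, ‖GaussianInt.toComplex (V r s) - p * M r s‖ ≤ 2 := by
    intro r s
    refine (Complex.norm_le_abs_re_add_abs_im _).trans ?_
    have h1 := hre r s
    have h2 := him r s
    have e1 : (GaussianInt.toComplex (V r s) - p * M r s).re = (V r s).re - p * (M r s).re := by
      rw [Complex.sub_re, Complex.re_ofReal_mul, ← GaussianInt.intCast_re]
    have e2 : (GaussianInt.toComplex (V r s) - p * M r s).im = (V r s).im - p * (M r s).im := by
      rw [Complex.sub_im, Complex.im_ofReal_mul, ← GaussianInt.intCast_im]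
    rw [e1, e2]
    linarith
  have hU : ∀ r s, ‖(p : ℂ) * M r s‖ ≤ p := by
    intro r s
    rw [norm_mul, Complex.norm_real, Real.norm_of_nonneg (by linarith)]
    exact mul_le_of_le_one_right (by linarith) (entry_norm_bound_of_unitary U.2 r s)
  let term : TwoBits → TwoBits → TwoBits → TwoBits → ℂ := fun a b c e =>
    pauli2 Q a b * (p * M b c * pauli2 P c e * star (p * M a e))
  -- Replacing the two gate entries one at a time costs `2 * (p + 2) + 2 * p`, which is at most `8 *
  -- p` for `p ≥ 1`.
  have hterm : ∀ a b c e, ‖GaussianInt.toComplex (gateTerm V P Q a b c e) - term a b c e‖ ≤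
      8 * p := by
    intro a b c e
    have e1 : GaussianInt.toComplex (gateTerm V P Q a b c e) - term a b c e =
        pauli2 Q a b * pauli2 P c e * (
          (GaussianInt.toComplex (V b c) - p * M b c) * star (GaussianInt.toComplex (V a e)) +
          p * M b c * star (GaussianInt.toComplex (V a e) - p * M a e)) := by
      simp only [gateTerm, map_mul, toComplex_pauliGauss, GaussianInt.toComplex_star, term, pauli2,
        Matrix.kroneckerMap_apply, star_sub, star_mul', RCLike.star_def]
      ring
    rw [e1, norm_mul, norm_mul]
    have h1 := norm_pauli2_le_one Q a b
    have h2 := norm_pauli2_le_one P c e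
    have h3 : ‖GaussianInt.toComplex (V a e)‖ ≤ p + 2 := by
      have := norm_add_le (GaussianInt.toComplex (V a e) - p * M a e) (p * M a e)
      rw [sub_add_cancel] at this
      linarith [hV a e, hU a e]
    have h4 : ‖(GaussianInt.toComplex (V b c) - p * M b c) * star (GaussianInt.toComplex (V a e)) +
          p * M b c * star (GaussianInt.toComplex (V a e) - p * M a e)‖ ≤ 8 * p := by
      refine (norm_add_le _ _).trans ?_
      rw [norm_mul, norm_mul, norm_star, norm_star]
      have h5 := mul_le_mul (hV b c) h3 (norm_nonneg _) (by norm_num)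
      have h6 := mul_le_mul (hU b c) (hV a e) (norm_nonneg _) (by linarith)
      linarith
    calc _ ≤ 1 * 1 * (8 * p) := by
          refine mul_le_mul (mul_le_mul h1 h2 (norm_nonneg _) zero_le_one) h4 (norm_nonneg _)
            (by norm_num)
      _ = 8 * p := by ring
  have hsum : (gateNum V P Q : ℝ) - 4 * p ^ 2 * rc U P Q =
      (∑ a, ∑ b, ∑ c, ∑ e, (GaussianInt.toComplex (gateTerm V P Q a b c e) - term a b c e)).re := by
    have h1 : (gateNum V P Q : ℝ) =
        (∑ a, ∑ b, ∑ c, ∑ e, GaussianInt.toComplex (gateTerm V P Q a b c e)).re := by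
      simp only [← map_sum]
      rw [gateNum, GaussianInt.toComplex_def]
      simp
    have h2 : 4 * p ^ 2 * rc U P Q = (∑ a, ∑ b, ∑ c, ∑ e, term a b c e).re := by
      have h3 : ∑ a, ∑ b, ∑ c, ∑ e, term a b c e = ((4 * p ^ 2 : ℝ) : ℂ) * ((1 / 4 : ℂ) *
          (pauli2 Q * (M * pauli2 P * M.conjTranspose)).trace) := by
        simp only [Matrix.trace, Matrix.diag_apply, Matrix.mul_apply, Matrix.conjTranspose_apply,
          Finset.mul_sum, Finset.sum_mul]
        refine Finset.sum_congr rfl fun a _ => Finset.sum_congr rfl fun b _ => ?_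
        rw [Finset.sum_comm]
        refine Finset.sum_congr rfl fun e _ => Finset.sum_congr rfl fun c _ => ?_
        simp only [term, star_mul', Complex.star_def, Complex.conj_ofReal]
        push_cast
        ring
      rw [h3, Complex.re_ofReal_mul, rc]
    rw [h1, h2, ← Complex.sub_re]
    simp only [Finset.sum_sub_distrib]
  rw [hsum]
  refine (Complex.abs_re_le_norm _).trans ?_
  have h16 : ∀ f : TwoBits → TwoBits → TwoBits → TwoBits → ℂ, (∀ a b c e, ‖f a b c e‖ ≤ 8 * p) →
      ‖∑ a, ∑ b, ∑ c, ∑ e, f a b c e‖ ≤ 2048 * p := by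
    intro f hf
    refine (norm_sum_le_of_le _ fun a _ => norm_sum_le_of_le _ fun b _ =>
      norm_sum_le_of_le _ fun c _ => norm_sum_le_of_le _ fun e _ => hf a b c e).trans ?_
    simp
    linarith
  exact h16 _ hterm

/-! ### Fixed-point sweeps -/

/-- The error after `j` operations. -/
def sweepErr (j : ℕ) : ℝ := 1000 * (2 ^ j - 1)

theorem sweepErr_mono {i j : ℕ} (h : i ≤ j) : sweepErr i ≤ sweepErr j := by
  unfold sweepErr
  have : (2 : ℝ) ^ i ≤ 2 ^ j := pow_le_pow_right₀ (by norm_num) h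
  linarith

theorem sweepErr_nonneg (j : ℕ) : 0 ≤ sweepErr j := by
  have := sweepErr_mono (Nat.zero_le j)
  simpa [sweepErr] using this

/-- A fixed-point number with scale `p` approximates a real number in `[-1, 1]`. -/
def Close (p : ℝ) (j : ℕ) (v : ℤ) (V : ℝ) : Prop := |(v : ℝ) - p * V| ≤ sweepErr j ∧ |V| ≤ 1

theorem Close.mono {p : ℝ} {i j : ℕ} {v : ℤ} {V : ℝ} (h : Close p i v V) (hij : i ≤ j) :
    Close p j v V := ⟨h.1.trans (sweepErr_mono hij), h.2⟩

theorem close_zero (p : ℝ) (j : ℕ) : Close p j 0 0 := ⟨by simpa using sweepErr_nonneg j, by simp⟩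

/-- One multiplication of a fixed-point number. -/
theorem Close.mul_div {p : ℝ} (hp : 512 ≤ p) {j : ℕ} {v num den : ℤ} {V r : ℝ}
    (h : Close p j v V) (hden : 0 < den) (hr : |r| ≤ 1)
    (hnum : |(num : ℝ) / den - r| ≤ 512 / p) :
    Close p (j + 1) (v * num / den) (V * r) := by
  have hden' : (0 : ℝ) < den := by exact_mod_cast hden
  have hp0 : 0 < p := by linarith
  set q := (num : ℝ) / den with hq
  refine ⟨?_, by rw [abs_mul]; exact mul_le_one₀ h.2 (abs_nonneg _) hr⟩
  have hfloor : |((v * num / den : ℤ) : ℝ) - v * q| ≤ 1 := by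
    have h1 : ((v * num / den : ℤ) : ℝ) ≤ v * q := by
      rw [hq, ← mul_div_assoc, le_div_iff₀ hden']
      exact_mod_cast Int.ediv_mul_le _ hden.ne'
    have h2 : v * q < ((v * num / den : ℤ) : ℝ) + 1 := by
      rw [hq, ← mul_div_assoc, div_lt_iff₀ hden']
      exact_mod_cast Int.lt_ediv_add_one_mul_self _ hden
    rw [abs_le]; constructor <;> linarith
  have h512 : 512 / p ≤ 1 := (div_le_one hp0).2 hp
  have hqb : |q| ≤ 2 := by
    have := abs_add_le (q - r) r
    rw [sub_add_cancel] at this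
    linarith
  have e : ((v * num / den : ℤ) : ℝ) - p * (V * r) =
      (((v * num / den : ℤ) : ℝ) - v * q) + ((v - p * V) * q + p * V * (q - r)) := by ring
  rw [e]
  have h3 : |(v - p * V) * q| ≤ sweepErr j * 2 := by
    rw [abs_mul]
    exact mul_le_mul h.1 hqb (abs_nonneg _) (sweepErr_nonneg j)
  have h4 : |p * V * (q - r)| ≤ 512 := by
    rw [abs_mul, abs_mul, abs_of_pos hp0]
    calc p * |V| * |q - r| ≤ p * 1 * (512 / p) :=
          mul_le_mul (mul_le_mul_of_nonneg_left h.2 hp0.le) hnum (abs_nonneg _) (by linarith)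
      _ = 512 := by field_simp
  refine (abs_add_le _ _).trans ((add_le_add hfloor (abs_add_le _ _)).trans ?_)
  -- The old error is multiplied by at most `2`; rounding adds `1` and the inexact factor adds
  -- `512`.
  have : sweepErr (j + 1) = sweepErr j * 2 + 1000 := by
    unfold sweepErr; rw [pow_succ]; ring
  rw [this]
  linarith

/-- The operations on fixed-point numbers approximate those on real numbers. -/
structure OpsClose (p : ℝ) (o : SweepOps m ℤ) (o' : SweepOps m ℝ) (D : ℕ) : Prop where
  gate : ∀ t < D, ∀ g P Q j v V, Close p j v V → Close p (j + 1) (o.gate t g P Q v) (o'.gate t g P Q V)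
  damp : ∀ j v V, Close p j v V → Close p (j + 1) (o.damp v) (o'.damp V)

/-- Closeness of states of sweeps. -/
def StateClose (p : ℝ) (j : ℕ) (x : SweepState m ℤ) (y : SweepState m ℝ) : Prop :=
  x.1 = y.1 ∧ x.2.1 = y.2.1 ∧ Close p j x.2.2 y.2.2

/-! ### Error propagation through a sweep -/

section

variable {p : ℝ} {o : SweepOps m ℤ} {o' : SweepOps m ℝ} {D : ℕ}
  {W : ℕ → (Fin m × Fin 2 ≃ Fin (2 * m))}

theorem StateClose.gateStep (ho : OpsClose p o o' D) {t : ℕ} (ht : t < D) (g : Fin m) {j : ℕ}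
    {x : SweepState m ℤ} {y : SweepState m ℝ} (h : StateClose p j x y) :
    StateClose p (j + 1) (gateStep W o t x g) (gateStep W o' t y g) := by
  obtain ⟨h1, h2, h3⟩ := h
  simp only [NoisyRCS.gateStep, h1, h2]
  split_ifs
  · exact ⟨h1, h2, h3.mono (Nat.le_succ j)⟩
  · exact ⟨rfl, rfl, ho.gate t ht g _ _ j _ _ h3⟩

theorem StateClose.gates (ho : OpsClose p o o' D) {t : ℕ} (ht : t < D) (l : List (Fin m)) {j : ℕ}
    {x : SweepState m ℤ} {y : SweepState m ℝ} (h : StateClose p j x y) :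
    StateClose p (j + l.length) (l.foldl (NoisyRCS.gateStep W o t) x)
      (l.foldl (NoisyRCS.gateStep W o' t) y) := by
  induction l generalizing j x y with
  | nil => exact h
  | cons g l ih =>
    rw [List.length_cons, ← add_assoc, add_right_comm]
    exact ih (h.gateStep ho ht g)

theorem Close.dampList (ho : OpsClose p o o' D) (A : PStr n) (l : List (Fin n)) {j : ℕ} {v : ℤ}
    {V : ℝ} (h : Close p j v V) :
    Close p (j + l.length) (l.foldl (fun v i => if A i = 0 then v else o.damp v) v)
      (l.foldl (fun v i => if A i = 0 then v else o'.damp v) V) := by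
  induction l generalizing j v V with
  | nil => exact h
  | cons i l ih =>
    rw [List.length_cons, ← add_assoc, add_right_comm]
    refine ih ?_
    dsimp only
    split_ifs
    · exact h.mono (Nat.le_succ j)
    · exact ho.damp _ _ _ h

theorem Close.dampAll (ho : OpsClose p o o' D) (A : PStr n) {j : ℕ} {v : ℤ} {V : ℝ}
    (h : Close p j v V) : Close p (j + n) (dampAll A o.damp v) (dampAll A o'.damp V) := by
  have := h.dampList ho A (List.finRange n)
  rwa [List.length_finRange] at this

theorem StateClose.layerStep (ho : OpsClose p o o' D) {t : ℕ} (ht : t < D) {j : ℕ}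
    {x : SweepState m ℤ} {y : SweepState m ℝ} (h : StateClose p j x y) :
    StateClose p (j + m) (layerStep W o t x) (layerStep W o' t y) := by
  have := h.gates (W := W) ho ht (List.finRange m)
  rwa [List.length_finRange] at this

theorem StateClose.nodeStep (ho : OpsClose p o o' D) (fwd : Bool) (w : ℕ) {j : ℕ}
    {x : SweepState m ℤ} {y : SweepState m ℝ} (h : StateClose p j x y) :
    StateClose p (j + 2 * m) (nodeStep o fwd w x) (nodeStep o' fwd w y) := by
  obtain ⟨h1, h2, h3⟩ := h
  refine ⟨h1, h2, ?_⟩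
  simp only [NoisyRCS.nodeStep, h1]
  split_ifs
  · exact close_zero _ _
  · exact h3.dampAll ho _

/-- A layer costs `m` operations for its gates and `2 * m` for the noise after it. Control flow
depends only on labels and codes, which are exact, so both sweeps take the same branches. -/
theorem StateClose.sweep (ho : OpsClose p o o' D) (fwd : Bool) (w : ℕ) (ts : List ℕ)
    (hts : ∀ t ∈ ts, t < D) {j : ℕ} {x : SweepState m ℤ} {y : SweepState m ℝ}
    (h : StateClose p j x y) :
    StateClose p (j + ts.length * (3 * m)) (sweep W o fwd w ts x) (sweep W o' fwd w ts y) := by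
  induction ts generalizing j x y with
  | nil => simpa [NoisyRCS.sweep] using h
  | cons t ts ih =>
    have h1 := (h.layerStep (W := W) ho (hts t (by simp))).nodeStep ho fwd w
    have h2 := ih (fun t ht => hts t (by simp [ht])) h1
    rw [List.length_cons]
    have e : j + (ts.length + 1) * (3 * m) = j + m + 2 * m + ts.length * (3 * m) := by ring
    rw [e]
    exact h2

theorem StateClose.finish {z : Fin (2 * m) → ℤ} (hz : ∀ i, |z i| ≤ 1) {j : ℕ}
    {x : SweepState m ℤ} {y : SweepState m ℝ} (h : StateClose p j x y) :
    Close p j (finish z x) (finish z y) := by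
  obtain ⟨h1, h2, h3⟩ := h
  simp only [NoisyRCS.finish, h1, h2]
  split_ifs
  · generalize x.2.2 = v at h3
    generalize y.2.2 = V at h3
    induction List.finRange (2 * m) generalizing v V with
    | nil => exact h3
    | cons i l ih =>
      refine ih _ _ ?_
      dsimp only
      split_ifs
      · exact h3
      · have hz' : |(z i : ℝ)| ≤ 1 := by exact_mod_cast hz i
        simp only [zsmul_eq_mul, Int.cast_id]
        refine ⟨?_, ?_⟩
        · have e : ((z i * v : ℤ) : ℝ) - p * (z i * V) = z i * (v - p * V) := by push_cast; ring
          rw [e, abs_mul]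
          exact (mul_le_of_le_one_left (abs_nonneg _) hz').trans h3.1
        · rw [abs_mul]
          exact mul_le_one₀ hz' (abs_nonneg _) h3.2
      · exact close_zero _ _
  · exact close_zero _ _

end

/-- The sum over forward sweeps, in fixed-point arithmetic. -/
def forwardInt (W : ℕ → (Fin m × Fin 2 ≃ Fin (2 * m))) (o : SweepOps m ℤ) (PK : ℤ) (w : ℕ)
    (z : Fin (2 * m) → ℤ) (i k : ℕ) (A : PStr (2 * m)) (N : ℕ) : ℤ :=
  ∑ c ∈ Finset.range N, finish z (sweep W o true w (List.range' i k) (A, c, dampAll A o.damp PK))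

/-- The sum over backward sweeps, in fixed-point arithmetic. -/
def backwardInt (W : ℕ → (Fin m × Fin 2 ≃ Fin (2 * m))) (o : SweepOps m ℤ) (PK : ℤ) (w : ℕ)
    (i : ℕ) (A : PStr (2 * m)) (N : ℕ) : ℤ :=
  ∑ c ∈ Finset.range N, finish 1 (sweep W o false w (List.range i).reverse (A, c, PK))

/-- The sum over all retained paths, in fixed-point arithmetic. -/
def marginalInt (W : ℕ → (Fin m × Fin 2 ≃ Fin (2 * m))) (of ob : SweepOps m ℤ) (PK : ℤ)
    (L w d : ℕ) (z : Fin (2 * m) → ℤ) : ℤ :=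
  ∑ i ∈ Finset.range d, ∑ z₁ ∈ Finset.range ((4 * (2 * m)) ^ w),
    if encode (decode (2 * m) w z₁) = z₁ then
      forwardInt W of PK w z i (d - i) (decode (2 * m) w z₁) (16 ^ L) *
        backwardInt W ob PK w i (decode (2 * m) w z₁) (16 ^ L) else 0

/-- The number of operations of a sweep. -/
def sweepLen (m d : ℕ) : ℕ := 3 * m * (d + 1)

/-! ### Accuracy of the fixed-point sums -/

section

variable {W : ℕ → (Fin m × Fin 2 ≃ Fin (2 * m))} {ρ : ℕ → Fin m → Pauli2 → Pauli2 → ℝ} {lam : ℝ}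
  {PK : ℤ} {of ob : SweepOps m ℤ}

/-- Damping the pivot takes `2 * m` operations before the layers, which explains `d + 1` in
`sweepLen`. -/
theorem close_forward (ho : OpsClose PK of (realOps ρ lam) d) (w : ℕ) {z : Fin (2 * m) → ℤ}
    (hz : ∀ i, |z i| ≤ 1) {i k : ℕ} (hik : i + k ≤ d) (A : PStr (2 * m)) (c : ℕ) :
    Close PK (sweepLen m d)
      (finish z (sweep W of true w (List.range' i k) (A, c, dampAll A of.damp PK)))
      (finish z (sweep W (realOps ρ lam) true w (List.range' i k) (A, c, lam ^ wt A))) := by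
  have h0 : Close PK 0 PK 1 := ⟨by simp [sweepErr], by simp⟩
  have h1 := h0.dampAll ho A
  simp only [realOps, dampAll_real, one_mul] at h1
  have h2 : StateClose PK (0 + 2 * m) (A, c, dampAll A of.damp PK) (A, c, lam ^ wt A) :=
    ⟨rfl, rfl, h1⟩
  have h3 := (h2.sweep (W := W) ho true w (List.range' i k) (fun t ht => by
    have := List.mem_range'_1.1 ht; omega)).finish hz
  refine h3.mono ?_
  rw [List.length_range', sweepLen]
  nlinarith

theorem close_backward (ho : OpsClose PK ob (realOps (fun t g P Q => ρ t g Q P) lam) d) (w : ℕ)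
    {i : ℕ} (hi : i ≤ d) (A : PStr (2 * m)) (c : ℕ) :
    Close PK (sweepLen m d)
      (finish 1 (sweep W ob false w (List.range i).reverse (A, c, PK)))
      (finish 1 (sweep W (realOps (fun t g P Q => ρ t g Q P) lam) false w (List.range i).reverse
        (A, c, 1))) := by
  have h0 : Close PK 0 PK 1 := ⟨by simp [sweepErr], by simp⟩
  have h2 : StateClose PK 0 ((A, c, PK) : SweepState m ℤ) (A, c, 1) := ⟨rfl, rfl, h0⟩
  have h3 := (h2.sweep (W := W) ho false w (List.range i).reverse (fun t ht => by
    have := List.mem_range.1 (List.mem_reverse.1 ht); omega)).finish (z := 1) (by simp)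
  refine h3.mono ?_
  rw [List.length_reverse, List.length_range, sweepLen]
  nlinarith

theorem abs_sum_close {N : ℕ} {p e : ℝ} {f : ℕ → ℤ} {F : ℕ → ℝ}
    (h : ∀ c, |(f c : ℝ) - p * F c| ≤ e ∧ |F c| ≤ 1) :
    |((∑ c ∈ Finset.range N, f c : ℤ) : ℝ) - p * ∑ c ∈ Finset.range N, F c| ≤ N * e ∧
      |∑ c ∈ Finset.range N, F c| ≤ N := by
  constructor
  · rw [Int.cast_sum, Finset.mul_sum, ← Finset.sum_sub_distrib]
    refine (Finset.abs_sum_le_sum_abs _ _).trans ((Finset.sum_le_sum fun c _ => (h c).1).trans ?_)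
    simp
  · refine (Finset.abs_sum_le_sum_abs _ _).trans ((Finset.sum_le_sum fun c _ => (h c).2).trans ?_)
    simp

theorem abs_forwardInt_sub (ho : OpsClose PK of (realOps ρ lam) d) (w L : ℕ)
    {z : Fin (2 * m) → ℤ} (hz : ∀ i, |z i| ≤ 1) {i k : ℕ} (hik : i + k ≤ d) (A : PStr (2 * m)) :
    |(forwardInt W of PK w z i k A (16 ^ L) : ℝ) -
      PK * (lam ^ wt A * forwardSum W ρ lam w z i k A L)| ≤ (16 ^ L : ℕ) * sweepErr (sweepLen m d) ∧
    |lam ^ wt A * forwardSum W ρ lam w z i k A L| ≤ (16 ^ L : ℕ) := by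
  have h := abs_sum_close (N := 16 ^ L) (p := PK) fun c => close_forward (W := W) ho w hz hik A c
  have e : ∑ c ∈ Finset.range (16 ^ L),
      finish z (sweep W (realOps ρ lam) true w (List.range' i k) (A, c, lam ^ wt A)) =
      lam ^ wt A * forwardSum W ρ lam w z i k A L := by
    rw [forwardSum, codeSum, Finset.mul_sum]
    exact Finset.sum_congr rfl fun c _ => linearInValue_sweep _ _ _ _ _ _ _
  rw [e] at h
  exact h

theorem abs_backwardInt_sub (ho : OpsClose PK ob (realOps (fun t g P Q => ρ t g Q P) lam) d)
    (w L : ℕ) {i : ℕ} (hi : i ≤ d) (A : PStr (2 * m)) :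
    |(backwardInt W ob PK w i A (16 ^ L) : ℝ) - PK * backwardSum W ρ lam w i A L| ≤
      (16 ^ L : ℕ) * sweepErr (sweepLen m d) ∧ |backwardSum W ρ lam w i A L| ≤ (16 ^ L : ℕ) :=
  abs_sum_close (N := 16 ^ L) (p := PK) fun c => close_backward (W := W) ho w hi A c

/-- Each pivot contributes a product of two fixed-point sums, so the natural scale of the result is
`PK ^ 2`; the errors are then added over positions and pivots. -/
theorem abs_marginalInt_sub (hof : OpsClose PK of (realOps ρ lam) d)
    (hob : OpsClose PK ob (realOps (fun t g P Q => ρ t g Q P) lam) d) (hm : 0 < m) (L w : ℕ)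
    {z : Fin (2 * m) → ℤ} (hz : ∀ i, |z i| ≤ 1) (hPK : sweepErr (sweepLen m d) ≤ PK) :
    |(marginalInt W of ob PK L w d z : ℝ) - (PK : ℝ) ^ 2 * marginalReal W ρ lam L w d z| ≤
      d * ((4 * (2 * m)) ^ w : ℕ) * (3 * (16 ^ L : ℕ) ^ 2 * sweepErr (sweepLen m d) * PK) := by
  set e := sweepErr (sweepLen m d)
  have he : 0 ≤ e := sweepErr_nonneg _
  have hPK0 : (0 : ℝ) ≤ PK := he.trans hPK
  have hreal : marginalReal W ρ lam L w d z = ∑ i ∈ Finset.range d,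
      ∑ z₁ ∈ Finset.range ((4 * (2 * m)) ^ w),
        if encode (decode (2 * m) w z₁) = z₁ then
          lam ^ wt (decode (2 * m) w z₁) *
            forwardSum W ρ lam w z i (d - i) (decode (2 * m) w z₁) L *
            backwardSum W ρ lam w i (decode (2 * m) w z₁) L else 0 :=
    Finset.sum_congr rfl fun i _ => (sum_decode (2 * m) w (by omega) _).symm
  rw [hreal, marginalInt]
  push_cast
  rw [Finset.mul_sum, ← Finset.sum_sub_distrib]
  refine (Finset.abs_sum_le_sum_abs _ _).trans ?_
  rw [mul_assoc]
  refine (Finset.sum_le_card_nsmul _ _ _ fun i hi => ?_).trans (by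
    rw [Finset.card_range, nsmul_eq_mul])
  have hid := Finset.mem_range.1 hi
  rw [Finset.mul_sum, ← Finset.sum_sub_distrib]
  refine (Finset.abs_sum_le_sum_abs _ _).trans ?_
  refine (Finset.sum_le_card_nsmul _ _ (3 * (16 ^ L) ^ 2 * e * PK) fun z₁ _ => ?_).trans (by
    rw [Finset.card_range, nsmul_eq_mul]; push_cast; rfl)
  generalize decode (2 * m) w z₁ = A
  split_ifs
  · obtain ⟨f1, f2⟩ := abs_forwardInt_sub (W := W) hof w L hz (show i + (d - i) ≤ d by omega) A
    obtain ⟨b1, b2⟩ := abs_backwardInt_sub (W := W) hob w L (show i ≤ d by omega) A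
    set N : ℝ := ((16 ^ L : ℕ) : ℝ) with hN
    have hN' : (16 : ℝ) ^ L = N := by rw [hN]; push_cast; rfl
    have hN0 : 0 ≤ N := Nat.cast_nonneg _
    rw [hN']
    set f : ℝ := (forwardInt W of PK w z i (d - i) A (16 ^ L) : ℝ)
    set b : ℝ := (backwardInt W ob PK w i A (16 ^ L) : ℝ)
    set F := lam ^ wt A * forwardSum W ρ lam w z i (d - i) A L
    set B := backwardSum W ρ lam w i A L
    -- The two summands give the shares `2` and `1` of the constant `3`; the first uses that the
    -- error is at most `PK`, so that `b` is at most twice its nominal size.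
    have e1 : f * b - PK ^ 2 * (F * B) = (f - PK * F) * b + PK * F * (b - PK * B) := by ring
    have hb : |b| ≤ N * (2 * PK) := by
      have h1 := abs_add_le (b - PK * B) (PK * B)
      rw [sub_add_cancel, abs_mul (PK : ℝ), abs_of_nonneg hPK0] at h1
      have h2 := mul_le_mul_of_nonneg_left b2 hPK0
      have h3 := mul_le_mul_of_nonneg_left hPK hN0
      linarith
    rw [e1]
    refine (abs_add_le _ _).trans ?_
    rw [abs_mul, abs_mul, abs_mul (PK : ℝ), abs_of_nonneg hPK0]
    have h1 := mul_le_mul f1 hb (abs_nonneg _) (mul_nonneg hN0 he)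
    have h2 := mul_le_mul (mul_le_mul_of_nonneg_left f2 hPK0) b1 (abs_nonneg _)
      (mul_nonneg hPK0 hN0)
    calc _ ≤ N * e * (N * (2 * PK)) + PK * N * (N * e) := add_le_add h1 h2
      _ = _ := by ring
  · simp
    positivity

end

/-! ### Lengths of integers -/

theorem size_le_of_abs_lt {z : ℤ} {B : ℕ} (h : |z| < 2 ^ B) : size z ≤ B + 1 := by
  have : z.natAbs < 2 ^ B := by
    zify; exact_mod_cast h
  have := Nat.size_le.2 this
  unfold size; omega

theorem natAbs_lt_two_pow_size (z : ℤ) : z.natAbs < 2 ^ (size z - 1) := by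
  have := Nat.lt_size_self z.natAbs
  simpa [size] using this

theorem size_le_of_natAbs_lt {z : ℤ} {b : ℕ} (hb : 0 < b) (h : z.natAbs < 2 ^ (b - 1)) :
    size z ≤ b := by
  have := Nat.size_le.2 h
  unfold size; omega

theorem one_le_size (z : ℤ) : 1 ≤ size z := by unfold size; omega

/-- A single bound for all operations suffices, because expressions have fixed size: the length of a
value is then linear in the word length. -/
theorem size_arith_le (o : Arith) (a b : ℤ) : size (o.eval a b) ≤ size a + size b := by
  have ha := one_le_size a
  have hb := one_le_size b
  have ha' := natAbs_lt_two_pow_size a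
  have hb' := natAbs_lt_two_pow_size b
  have h1 : 2 ^ (size a - 1) ≤ 2 ^ (size a + size b - 1 - 1) :=
    Nat.pow_le_pow_right (by norm_num) (by omega)
  have h2 : 2 ^ (size b - 1) ≤ 2 ^ (size a + size b - 1 - 1) :=
    Nat.pow_le_pow_right (by norm_num) (by omega)
  have h3 : 2 ^ (size a + size b - 1) = 2 * 2 ^ (size a + size b - 1 - 1) := by
    rw [← pow_succ']; congr 1; omega
  refine size_le_of_natAbs_lt (by omega) ?_
  cases o with
  | add => have := Int.natAbs_add_le a b; simp only [Arith.eval]; omega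
  | sub => have := Int.natAbs_sub_le a b; simp only [Arith.eval]; omega
  | mul =>
    simp only [Arith.eval, Int.natAbs_mul]
    calc a.natAbs * b.natAbs < 2 ^ (size a - 1) * 2 ^ (size b - 1) :=
          Nat.mul_lt_mul'' ha' hb'
      _ = 2 ^ (size a - 1 + (size b - 1)) := (pow_add _ _ _).symm
      _ ≤ _ := Nat.pow_le_pow_right (by norm_num) (by omega)
  | div => have := Int.natAbs_ediv_le_natAbs a b; simp only [Arith.eval]; omega
  | lt =>
    have : 1 ≤ 2 ^ (size a + size b - 1 - 1) := Nat.one_le_two_pow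
    simp only [Arith.eval]
    split_ifs <;> simp
    all_goals omega

/-! ### Costs of expressions and programs -/

/-- The length of the value of an expression, relative to that of the memory cells. -/
def Expr.width : Expr → ℕ
  | .lit z => size z
  | .load _ => 1
  | .arith _ a b => a.width + b.width

/-- The cost of an expression, relative to the square of the length of the memory cells. -/
def Expr.weight : Expr → ℕ
  | .lit z => size z
  | .load a => a.weight + a.width + 1
  | .arith _ a b => a.weight + b.weight + a.width * b.width

/-- All memory cells hold numbers of at most `B` bits. -/
def Bdd (B : ℕ) (mem : ℕ → ℤ) : Prop := ∀ a, |mem a| < 2 ^ B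

theorem Bdd.size_eval_le {B : ℕ} {mem : ℕ → ℤ} (h : Bdd B mem) (e : Expr) :
    size (e.eval mem) ≤ e.width * (B + 1) := by
  induction e with
  | lit z => exact Nat.le_mul_of_pos_right _ (by omega)
  | load a => simpa [Expr.width, Expr.eval] using size_le_of_abs_lt (h _)
  | arith o a b iha ihb =>
    refine (size_arith_le o _ _).trans ?_
    rw [Expr.width, add_mul]
    exact add_le_add iha ihb

/-- Lengths are linear in `B + 1` and an operation costs a product of two lengths; hence the square.
-/
theorem Bdd.cost_le {B : ℕ} {mem : ℕ → ℤ} (h : Bdd B mem) (e : Expr) :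
    e.cost mem ≤ e.weight * (B + 1) ^ 2 := by
  have h1 : B + 1 ≤ (B + 1) ^ 2 := Nat.le_self_pow (by norm_num) _
  induction e with
  | lit z => exact Nat.le_mul_of_pos_right _ (by positivity)
  | load a iha =>
    have h2 := h.size_eval_le a
    have h3 := size_le_of_abs_lt (h (a.eval mem).toNat)
    rw [Expr.cost, Expr.weight]
    nlinarith [Nat.mul_le_mul_left a.width h1]
  | arith o a b iha ihb =>
    have h2 := Nat.mul_le_mul (h.size_eval_le a) (h.size_eval_le b)
    rw [Expr.cost, Expr.weight]
    nlinarith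

theorem Bdd.arg_le {B : ℕ} {σ : State} (h : Bdd B σ.mem) (e : Expr) :
    e.cost σ.mem + size (σ.val e) ≤ (e.weight + e.width) * (B + 1) ^ 2 := by
  have h1 : B + 1 ≤ (B + 1) ^ 2 := Nat.le_self_pow (by norm_num) _
  have h2 := h.cost_le e
  have h3 := (h.size_eval_le e).trans (Nat.mul_le_mul_left _ h1)
  rw [add_mul]; exact add_le_add h2 h3

/-- The weight of an argument of a statement. -/
def Expr.arg (e : Expr) : ℕ := e.weight + e.width

/-- The cost of a single pass through the text of a program. -/
def Program.weight : Program → ℕ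
  | .skip => 1
  | .store dst e => 1 + dst.arg + e.arg
  | .seq P Q => 1 + P.weight + Q.weight
  | .cond e P Q => 1 + e.arg + P.weight + Q.weight
  | .loop e P => 1 + e.arg + P.weight
  | .flip dst => 1 + dst.arg
  | .wire _ dst t g => 2 + dst.arg + t.arg + g.arg
  | .entry _ _ _ dst t g prec => 3 + dst.arg + t.arg + g.arg + prec.arg
  | .param _ dst prec => 3 + dst.arg + prec.arg

/-- The nesting depth of the loops of a program. -/
def Program.depth : Program → ℕ
  | .seq P Q => max P.depth Q.depth
  | .cond _ P Q => max P.depth Q.depth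
  | .loop _ P => P.depth + 1
  | _ => 0

/-- If the memory cells have at most `B` bits, the program halts in a state that satisfies `Q`, the
memory cells still have at most `B` bits, and the cost is at most that of executing every loop of
the program at most `G` times. -/
def Runs (I : Input) (B G : ℕ) (P : Program) (σ : State) (Q : State → Prop) : Prop :=
  Bdd B σ.mem → ∃ σ' T, Exec I P σ σ' T ∧
    T ≤ P.weight * (G + 1) ^ P.depth * (B + 1) ^ 2 ∧ Bdd B σ'.mem ∧ Q σ'

/-! ### Rules of a program logic with costs -/

section

variable {I : Input} {B G : ℕ} {σ : State} {Q : State → Prop}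

/-- The bound on the memory may be used while verifying a program: anything already stored fits,
hence so does any smaller number. -/
theorem Runs.of_bdd {P : Program} (h : Bdd B σ.mem → Runs I B G P σ Q) : Runs I B G P σ Q :=
  fun hB => h hB hB

theorem Runs.mono {P : Program} {Q' : State → Prop} (h : Runs I B G P σ Q)
    (hQ : ∀ σ', Bdd B σ'.mem → Q σ' → Q' σ') : Runs I B G P σ Q' := fun hB => by
  obtain ⟨σ', T, h1, h2, h3, h4⟩ := h hB
  exact ⟨σ', T, h1, h2, h3, hQ _ h3 h4⟩

theorem Runs.skip (h : Q σ) : Runs I B G .skip σ Q := fun hB =>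
  ⟨σ, 1, .skip σ, by
    simp only [Program.weight, Program.depth, pow_zero, mul_one, one_mul]
    exact Nat.one_le_pow _ _ (by omega), hB, h⟩

theorem Bdd.write {z : ℤ} (h : Bdd B σ.mem) (a : ℕ) (hz : |z| < 2 ^ B) :
    Bdd B (Function.update σ.mem a z) := by
  intro a'
  by_cases h1 : a' = a
  · subst h1; simpa using hz
  · rw [Function.update_of_ne h1]; exact h a'

theorem Runs.store {dst e : Expr} (hz : |σ.val e| < 2 ^ B)
    (h : Q (σ.write (σ.val dst) (σ.val e))) : Runs I B G (.store dst e) σ Q := fun hB => by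
  refine ⟨_, _, .store σ dst e, ?_, hB.write _ hz, h⟩
  have h1 := hB.arg_le dst
  have h2 := hB.arg_le e
  have h3 : 1 ≤ (B + 1) ^ 2 := Nat.one_le_pow _ _ (by omega)
  simp only [State.costs, List.map_cons, List.map_nil, List.sum_cons, List.sum_nil, Program.weight,
    Program.depth, pow_zero, mul_one, Expr.arg, add_mul] at *
  omega

/-- The specification of the second program serves as postcondition of the first, so a verification
follows the program text statement by statement. -/
theorem Runs.seq {P P' : Program} (h : Runs I B G P σ fun σ' => Runs I B G P' σ' Q) :
    Runs I B G (.seq P P') σ Q := fun hB => by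
  obtain ⟨σ', T, h1, h2, h3, h4⟩ := h hB
  obtain ⟨σ'', T', h1', h2', h3', h4'⟩ := h4 h3
  refine ⟨σ'', _, .seq h1 h1', ?_, h3', h4'⟩
  have e1 : (G + 1) ^ P.depth ≤ (G + 1) ^ max P.depth P'.depth :=
    Nat.pow_le_pow_right (by omega) (le_max_left _ _)
  have e2 : (G + 1) ^ P'.depth ≤ (G + 1) ^ max P.depth P'.depth :=
    Nat.pow_le_pow_right (by omega) (le_max_right _ _)
  have e3 : 1 ≤ (G + 1) ^ max P.depth P'.depth := Nat.one_le_pow _ _ (by omega)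
  have e4 : 1 ≤ (B + 1) ^ 2 := Nat.one_le_pow _ _ (by omega)
  simp only [Program.weight, Program.depth, add_mul]
  exact add_le_add (add_le_add (by nlinarith) (h2.trans (by gcongr))) (h2'.trans (by gcongr))

theorem Runs.cond {e : Expr} {P P' : Program} (h : σ.val e ≠ 0 → Runs I B G P σ Q)
    (h' : σ.val e = 0 → Runs I B G P' σ Q) : Runs I B G (.cond e P P') σ Q := fun hB => by
  have e1 : (G + 1) ^ P.depth ≤ (G + 1) ^ max P.depth P'.depth :=
    Nat.pow_le_pow_right (by omega) (le_max_left _ _)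
  have e2 : (G + 1) ^ P'.depth ≤ (G + 1) ^ max P.depth P'.depth :=
    Nat.pow_le_pow_right (by omega) (le_max_right _ _)
  have e3 : 1 ≤ (G + 1) ^ max P.depth P'.depth := Nat.one_le_pow _ _ (by omega)
  have e4 : 1 ≤ (B + 1) ^ 2 := Nat.one_le_pow _ _ (by omega)
  have ha : e.cost σ.mem + size (σ.val e) ≤
      e.arg * (G + 1) ^ max P.depth P'.depth * (B + 1) ^ 2 :=
    (hB.arg_le e).trans (Nat.mul_le_mul_right _ (Nat.le_mul_of_pos_right _ (by omega)))
  have e5 : 1 ≤ (G + 1) ^ max P.depth P'.depth * (B + 1) ^ 2 := Nat.mul_pos e3 e4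
  by_cases h0 : σ.val e = 0
  · obtain ⟨σ', T, h1, h2, h3, h4⟩ := h' h0 hB
    refine ⟨σ', _, .cond_false h0 h1, ?_, h3, h4⟩
    have h2' := h2.trans (Nat.mul_le_mul_right ((B + 1) ^ 2) (Nat.mul_le_mul_left P'.weight e2))
    simp only [State.costs, List.map_cons, List.map_nil, List.sum_cons, List.sum_nil,
      Program.weight, Program.depth, add_mul, one_mul] at *
    omega
  · obtain ⟨σ', T, h1, h2, h3, h4⟩ := h h0 hB
    refine ⟨σ', _, .cond_true h0 h1, ?_, h3, h4⟩
    have h2' := h2.trans (Nat.mul_le_mul_right ((B + 1) ^ 2) (Nat.mul_le_mul_left P.weight e1))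
    simp only [State.costs, List.map_cons, List.map_nil, List.sum_cons, List.sum_nil,
      Program.weight, Program.depth, add_mul, one_mul] at *
    omega

/-- The invariant is indexed by the number of passes made, of which there are exactly `k ≤ G`. There
are `k + 1` tests, so one extra factor `G + 1` pays for the loop. -/
theorem Runs.loop {e : Expr} {P : Program} (Inv : ℕ → State → Prop) {k : ℕ} (hk : k ≤ G)
    (hbody : ∀ j < k, ∀ σ, Inv j σ → σ.val e ≠ 0 ∧ Runs I B G P σ (Inv (j + 1)))
    (hend : ∀ σ, Inv k σ → σ.val e = 0) (h0 : Inv 0 σ) : Runs I B G (.loop e P) σ (Inv k) := by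
  have key : ∀ i j σ, i + j = k → Inv i σ → Bdd B σ.mem → ∃ σ' T, Exec I (.loop e P) σ σ' T ∧
      T ≤ (1 + e.arg) * (B + 1) ^ 2 * (j + 1) + P.weight * (G + 1) ^ P.depth * (B + 1) ^ 2 * j ∧
      Bdd B σ'.mem ∧ Inv k σ' := by
    have e4 : 1 ≤ (B + 1) ^ 2 := Nat.one_le_pow _ _ (by omega)
    intro i j
    induction j generalizing i with
    | zero =>
      intro σ hi h hB
      obtain rfl : i = k := hi
      refine ⟨σ, _, .loop_false (hend σ h), ?_, hB, h⟩
      have := hB.arg_le e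
      simp only [State.costs, List.map_cons, List.map_nil, List.sum_cons, List.sum_nil, Expr.arg,
        add_mul, one_mul] at *
      omega
    | succ j ih =>
      intro σ hi h hB
      obtain ⟨h1, h2⟩ := hbody i (by omega) σ h
      obtain ⟨σ', T, h3, h4, h5, h6⟩ := h2 hB
      obtain ⟨σ'', T', h3', h4', h5', h6'⟩ := ih (i + 1) σ' (by omega) h6 h5
      refine ⟨σ'', _, .loop_true h1 h3 h3', ?_, h5', h6'⟩
      have := hB.arg_le e
      simp only [State.costs, List.map_cons, List.map_nil, List.sum_cons, List.sum_nil, Expr.arg,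
        add_mul, one_mul, mul_add, mul_one] at *
      omega
  intro hB
  obtain ⟨σ', T, h1, h2, h3, h4⟩ := key 0 k σ (by omega) h0 hB
  refine ⟨σ', T, h1, h2.trans ?_, h3, h4⟩
  have e3 : 1 ≤ (G + 1) ^ P.depth := Nat.one_le_pow _ _ (by omega)
  simp only [Program.weight, Program.depth]
  have a1 : (1 + e.arg) * (B + 1) ^ 2 * (k + 1) ≤
      (1 + e.arg) * (B + 1) ^ 2 * ((G + 1) ^ P.depth * (G + 1)) :=
    Nat.mul_le_mul_left _ ((Nat.succ_le_succ hk).trans (Nat.le_mul_of_pos_left _ e3))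
  have a2 : P.weight * (G + 1) ^ P.depth * (B + 1) ^ 2 * k ≤
      P.weight * (G + 1) ^ P.depth * (B + 1) ^ 2 * (G + 1) :=
    Nat.mul_le_mul_left _ (by omega)
  refine (add_le_add a1 a2).trans (le_of_eq ?_)
  ring

theorem Runs.flip {dst : Expr}
    (h : Q ⟨Function.update σ.mem (σ.val dst).toNat σ.coin, fun i => σ.coins (i + 1)⟩)
    (hB0 : 1 ≤ B) : Runs I B G (.flip dst) σ Q := fun hB => by
  refine ⟨_, _, .flip σ dst, ?_, hB.write _ ?_, h⟩
  · have h1 := hB.arg_le dst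
    have h3 : 1 ≤ (B + 1) ^ 2 := Nat.one_le_pow _ _ (by omega)
    simp only [State.costs, List.map_cons, List.map_nil, List.sum_cons, List.sum_nil,
      Program.weight, Program.depth, pow_zero, mul_one, Expr.arg, add_mul] at *
    omega
  · have : (2 : ℤ) ^ 1 ≤ 2 ^ B := pow_le_pow_right₀ (by norm_num) hB0
    rw [State.coin]
    split_ifs <;> simp
    all_goals linarith

theorem Runs.wire {b : Fin 2} {dst t g : Expr}
    (hz : |(I.wire (σ.val t).toNat (σ.val g).toNat b : ℤ)| < 2 ^ B)
    (h : Q (σ.write (σ.val dst) (I.wire (σ.val t).toNat (σ.val g).toNat b))) :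
    Runs I B G (.wire b dst t g) σ Q := fun hB => by
  refine ⟨_, _, .wire σ b dst t g _ rfl, ?_, hB.write _ hz, h⟩
  have h1 := hB.arg_le dst
  have h2 := hB.arg_le t
  have h4 := hB.arg_le g
  have h5 := size_le_of_abs_lt hz
  have h3 : B + 1 ≤ (B + 1) ^ 2 := Nat.le_self_pow (by norm_num) _
  simp only [State.costs, List.map_cons, List.map_nil, List.sum_cons, List.sum_nil, Program.weight,
    Program.depth, pow_zero, mul_one, Expr.arg, add_mul] at *
  omega

theorem Runs.entry {r s : TwoBits} {im : Bool} {dst t g prec : Expr}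
    (hp : (σ.val prec).toNat ≤ B)
    (hz : |I.entry (σ.val t).toNat (σ.val g).toNat r s im (σ.val prec).toNat| < 2 ^ B)
    (h : Q (σ.write (σ.val dst)
      (I.entry (σ.val t).toNat (σ.val g).toNat r s im (σ.val prec).toNat))) :
    Runs I B G (.entry r s im dst t g prec) σ Q := fun hB => by
  refine ⟨_, _, .entry σ r s im dst t g prec _ rfl, ?_, hB.write _ hz, h⟩
  have h1 := hB.arg_le dst
  have h2 := hB.arg_le t
  have h4 := hB.arg_le g
  have h6 := hB.arg_le prec
  have h5 := size_le_of_abs_lt hz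
  have h3 : B + 1 ≤ (B + 1) ^ 2 := Nat.le_self_pow (by norm_num) _
  simp only [State.costs, List.map_cons, List.map_nil, List.sum_cons, List.sum_nil, Program.weight,
    Program.depth, pow_zero, mul_one, Expr.arg, add_mul] at *
  omega

theorem Runs.param {k : Fin 3} {dst prec : Expr} (hp : (σ.val prec).toNat ≤ B)
    (hz : |I.param k (σ.val prec).toNat| < 2 ^ B)
    (h : Q (σ.write (σ.val dst) (I.param k (σ.val prec).toNat))) :
    Runs I B G (.param k dst prec) σ Q := fun hB => by
  refine ⟨_, _, .param σ k dst prec _ rfl, ?_, hB.write _ hz, h⟩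
  have h1 := hB.arg_le dst
  have h6 := hB.arg_le prec
  have h5 := size_le_of_abs_lt hz
  have h3 : B + 1 ≤ (B + 1) ^ 2 := Nat.le_self_pow (by norm_num) _
  simp only [State.costs, List.map_cons, List.map_nil, List.sum_cons, List.sum_nil, Program.weight,
    Program.depth, pow_zero, mul_one, Expr.arg, add_mul] at *
  omega

/-- A list of programs, one after the other. -/
def Program.block (l : List Program) : Program := l.foldr .seq .skip

theorem Runs.block_nil (h : Q σ) : Runs I B G (.block []) σ Q := .skip h

theorem Runs.block_cons {P : Program} {l : List Program}
    (h : Runs I B G P σ fun σ' => Runs I B G (.block l) σ' Q) :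
    Runs I B G (.block (P :: l)) σ Q := .seq h

end

/-- The machine is deterministic. -/
theorem Exec.det {I : Input} {P : Program} {σ σ₁ σ₂ : State} {T₁ T₂ : ℕ}
    (h₁ : Exec I P σ σ₁ T₁) (h₂ : Exec I P σ σ₂ T₂) : σ₁ = σ₂ := by
  induction h₁ generalizing σ₂ T₂ with
  | skip | store | flip => cases h₂; rfl
  | seq _ _ ih ih' =>
    cases h₂ with
    | seq h h' => obtain rfl := ih h; exact ih' h'
  | cond_true h0 _ ih =>
    cases h₂ with
    | cond_true _ h => exact ih h
    | cond_false h0' _ => exact absurd h0' h0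
  | cond_false h0 _ ih =>
    cases h₂ with
    | cond_true h0' _ => exact absurd h0 h0'
    | cond_false _ h => exact ih h
  | loop_true h0 _ _ ih ih' =>
    cases h₂ with
    | loop_true _ h h' => obtain rfl := ih h; exact ih' h'
    | loop_false h0' => exact absurd h0' h0
  | loop_false h0 =>
    cases h₂ with
    | loop_true h0' _ _ => exact absurd h0 h0'
    | loop_false _ => rfl
  | wire _ _ _ _ _ _ hz | entry _ _ _ _ _ _ _ _ _ hz | param _ _ _ _ _ hz =>
    cases h₂
    subst_vars
    rfl

/-! ### Expressions -/

instance : Add Expr := ⟨.arith .add⟩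
instance : Sub Expr := ⟨.arith .sub⟩
instance : Mul Expr := ⟨.arith .mul⟩
instance : Div Expr := ⟨.arith .div⟩
instance (k : ℕ) : OfNat Expr k := ⟨.lit k⟩

/-- The content of a memory cell. -/
def Expr.var (a : ℕ) : Expr := .load (.lit a)

/-- Comparison. -/
def Expr.less (a b : Expr) : Expr := .arith .lt a b

/-- The remainder of a division. -/
def Expr.mod (a b : Expr) : Expr := a - b * (a / b)

section

variable {mem : ℕ → ℤ} (a b : Expr)

@[simp] theorem Expr.eval_add : (a + b).eval mem = a.eval mem + b.eval mem := rfl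
@[simp] theorem Expr.eval_sub : (a - b).eval mem = a.eval mem - b.eval mem := rfl
@[simp] theorem Expr.eval_mul : (a * b).eval mem = a.eval mem * b.eval mem := rfl
@[simp] theorem Expr.eval_div : (a / b).eval mem = a.eval mem / b.eval mem := rfl
@[simp] theorem Expr.eval_ofNat (k : ℕ) :
    (no_index (OfNat.ofNat k) : Expr).eval mem = ((OfNat.ofNat k : ℕ) : ℤ) := rfl
@[simp] theorem Expr.eval_lit (z : ℤ) : (Expr.lit z).eval mem = z := rfl
@[simp] theorem Expr.eval_less :
    (a.less b).eval mem = if a.eval mem < b.eval mem then 1 else 0 := rfl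
@[simp] theorem Expr.eval_mod : (a.mod b).eval mem = a.eval mem % b.eval mem := by
  simp [Expr.mod, Int.emod_def]
@[simp] theorem Expr.eval_var (i : ℕ) : (Expr.var i).eval mem = mem i := rfl

end

/-! ### Memory layout

The cells below `100` hold scalars; the other ones hold two interleaved arrays. -/

/-- The array of Pauli labels. -/
def Expr.label (e : Expr) : Expr := .load (100 + 2 * e)

/-- The array of signs. -/
def Expr.sign (e : Expr) : Expr := .load (101 + 2 * e)

/-- A structured description of a state of the machine. -/
structure Config (n : ℕ) where
  sc : ℕ → ℤ
  label : PStr n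
  sign : Fin n → ℤ
  coins : ℕ → Bool

namespace Config

/-- The memory. -/
def mem (x : Config n) (a : ℕ) : ℤ :=
  if a < 100 then x.sc a
  else if h : (a - 100) / 2 < n then
    if a % 2 = 0 then ((x.label ⟨_, h⟩ : Fin 4) : ℕ) else x.sign ⟨_, h⟩
  else 0

/-- The state of the machine. -/
def st (x : Config n) : State := ⟨x.mem, x.coins⟩

/-- Setting a scalar. -/
def set (x : Config n) (a : ℕ) (z : ℤ) : Config n := { x with sc := Function.update x.sc a z }

/-- Setting a Pauli label. -/
def setLabel (x : Config n) (j : Fin n) (P : Fin 4) : Config n :=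
  { x with label := Function.update x.label j P }

/-- Setting a sign. -/
def setSign (x : Config n) (j : Fin n) (z : ℤ) : Config n :=
  { x with sign := Function.update x.sign j z }

variable (x : Config n)

@[simp] theorem set_sc (a : ℕ) (z : ℤ) (b : ℕ) :
    (x.set a z).sc b = if b = a then z else x.sc b := by
  simp [set, Function.update_apply]
@[simp] theorem set_label (a : ℕ) (z : ℤ) : (x.set a z).label = x.label := rfl
@[simp] theorem set_sign (a : ℕ) (z : ℤ) : (x.set a z).sign = x.sign := rfl
@[simp] theorem set_coins (a : ℕ) (z : ℤ) : (x.set a z).coins = x.coins := rfl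
@[simp] theorem setLabel_sc (j : Fin n) (P : Fin 4) : (x.setLabel j P).sc = x.sc := rfl
@[simp] theorem setLabel_label (j : Fin n) (P : Fin 4) :
    (x.setLabel j P).label = Function.update x.label j P := rfl
@[simp] theorem setLabel_sign (j : Fin n) (P : Fin 4) : (x.setLabel j P).sign = x.sign := rfl
@[simp] theorem setLabel_coins (j : Fin n) (P : Fin 4) : (x.setLabel j P).coins = x.coins := rfl
@[simp] theorem setSign_sc (j : Fin n) (z : ℤ) : (x.setSign j z).sc = x.sc := rfl
@[simp] theorem setSign_label (j : Fin n) (z : ℤ) : (x.setSign j z).label = x.label := rfl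
@[simp] theorem setSign_sign (j : Fin n) (z : ℤ) :
    (x.setSign j z).sign = Function.update x.sign j z := rfl
@[simp] theorem setSign_coins (j : Fin n) (z : ℤ) : (x.setSign j z).coins = x.coins := rfl

@[simp] theorem mem_of_lt {a : ℕ} (ha : a < 100) : x.st.mem a = x.sc a := by simp [st, mem, ha]

theorem mem_label (j : Fin n) : x.st.mem (100 + 2 * j) = ((x.label j : Fin 4) : ℕ) := by
  have h1 : (100 + 2 * (j : ℕ) - 100) / 2 = j := by omega
  have h2 : (100 + 2 * (j : ℕ)) % 2 = 0 := by omega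
  simp only [st, mem, h1, h2, j.2, dif_pos, if_pos]
  rw [if_neg (by omega)]

theorem mem_sign (j : Fin n) : x.st.mem (101 + 2 * j) = x.sign j := by
  have h1 : (101 + 2 * (j : ℕ) - 100) / 2 = j := by omega
  have h2 : (101 + 2 * (j : ℕ)) % 2 = 1 := by omega
  simp only [st, mem, h1, h2, j.2, dif_pos]
  rw [if_neg (by omega), if_neg (by omega)]

theorem write_of_lt {a : ℕ} (ha : a < 100) (z : ℤ) : x.st.write a z = (x.set a z).st := by
  simp only [st, State.write, set, State.mk.injEq, and_true, Int.toNat_natCast]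
  funext b
  by_cases h : b = a
  · subst h; simp [mem, ha]
  · simp [mem, h]

theorem write_label (j : Fin n) (P : Fin 4) :
    x.st.write (100 + 2 * (j : ℕ) : ℕ) (P : ℕ) = (x.setLabel j P).st := by
  simp only [st, State.write, setLabel, State.mk.injEq, and_true, Int.toNat_natCast]
  funext b
  by_cases h : b = 100 + 2 * j
  · subst h
    have := (x.setLabel j P).mem_label j
    simp only [st, setLabel] at this
    simp [this]
  · rw [Function.update_of_ne h]
    simp only [mem]
    split_ifs with h1 h2 h3
    · rfl
    · rw [Function.update_of_ne]
      intro h'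
      have := congrArg Fin.val h'
      simp only at this
      omega
    · rfl
    · rfl

theorem write_sign (j : Fin n) (z : ℤ) :
    x.st.write (101 + 2 * (j : ℕ) : ℕ) z = (x.setSign j z).st := by
  simp only [st, State.write, setSign, State.mk.injEq, and_true, Int.toNat_natCast]
  funext b
  by_cases h : b = 101 + 2 * j
  · subst h
    have := (x.setSign j z).mem_sign j
    simp only [st, setSign] at this
    simp [this]
  · rw [Function.update_of_ne h]
    simp only [mem]
    split_ifs with h1 h2 h3
    · rfl
    · rfl
    · rw [Function.update_of_ne]
      intro h'
      have := congrArg Fin.val h'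
      simp only at this
      omega
    · rfl

theorem eval_var {a : ℕ} (ha : a < 100) : (Expr.var a).eval x.st.mem = x.sc a :=
  x.mem_of_lt ha

theorem eval_label {e : Expr} (j : Fin n) (h : e.eval x.st.mem = (j : ℕ)) :
    e.label.eval x.st.mem = ((x.label j : Fin 4) : ℕ) := by
  rw [← x.mem_label j]
  show x.st.mem ((100 + 2 * e).eval x.st.mem).toNat = _
  congr 1
  simp [h]
  omega

theorem eval_sign {e : Expr} (j : Fin n) (h : e.eval x.st.mem = (j : ℕ)) :
    e.sign.eval x.st.mem = x.sign j := by
  rw [← x.mem_sign j]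
  show x.st.mem ((101 + 2 * e).eval x.st.mem).toNat = _
  congr 1
  simp [h]
  omega

/-- Two descriptions agree on the arrays, the coins, and the scalars in the cells below `lo`. -/
structure Agree (lo : ℕ) (x y : Config n) : Prop where
  sc : ∀ a < lo, x.sc a = y.sc a
  label : x.label = y.label
  sign : x.sign = y.sign
  coins : x.coins = y.coins

/-- The states that agree with a given one. -/
def Near (lo : ℕ) (y : Config n) (σ : State) : Prop := ∃ x : Config n, x.Agree lo y ∧ σ = x.st

theorem Near.of {lo : ℕ} {x y : Config n} (sc : ∀ a < lo, x.sc a = y.sc a)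
    (label : x.label = y.label) (sign : x.sign = y.sign) (coins : x.coins = y.coins) :
    Near lo y x.st := ⟨x, ⟨sc, label, sign, coins⟩, rfl⟩

end Config

/-! ### Rules for structured memory states -/

section

variable {I : Input} {B G : ℕ} {x : Config n} {Q : State → Prop}

theorem Runs.set {a : ℕ} (ha : a < 100) {e : Expr} {z : ℤ} (he : e.eval x.st.mem = z)
    (hz : |z| < 2 ^ B) (h : Q (x.set a z).st) : Runs I B G (.store (.lit a) e) x.st Q := by
  refine .store (by rwa [State.val, he]) ?_
  rw [State.val, State.val, he, Expr.eval_lit, x.write_of_lt ha]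
  exact h

theorem Runs.setLabel {dst e : Expr} (j : Fin n) (P : Fin 4) (hd : dst.eval x.st.mem = (j : ℕ))
    (he : e.eval x.st.mem = (P : ℕ)) (hB : 2 ≤ B) (h : Q (x.setLabel j P).st) :
    Runs I B G (.store (100 + 2 * dst) e) x.st Q := by
  refine .store ?_ ?_
  · have : (2 : ℤ) ^ 2 ≤ 2 ^ B := pow_le_pow_right₀ (by norm_num) hB
    have := P.2
    rw [State.val, he, abs_of_nonneg (by positivity)]
    omega
  · have : x.st.val (100 + 2 * dst) = (100 + 2 * (j : ℕ) : ℕ) := by simp [State.val, hd]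
    rw [this, State.val, he, x.write_label]
    exact h

theorem Runs.setSign {dst e : Expr} (j : Fin n) {z : ℤ} (hd : dst.eval x.st.mem = (j : ℕ))
    (he : e.eval x.st.mem = z) (hz : |z| < 2 ^ B) (h : Q (x.setSign j z).st) :
    Runs I B G (.store (101 + 2 * dst) e) x.st Q := by
  refine .store (by rwa [State.val, he]) ?_
  have : x.st.val (101 + 2 * dst) = (101 + 2 * (j : ℕ) : ℕ) := by simp [State.val, hd]
  rw [this, State.val, he, x.write_sign]
  exact h

theorem Bdd.abs_sc_lt (h : Bdd B x.st.mem) {a : ℕ} (ha : a < 100) : |x.sc a| < 2 ^ B := by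
  rw [← x.mem_of_lt ha]; exact h a

theorem Runs.wireSet {a : ℕ} (ha : a < 100) {b : Fin 2} {t g : Expr} {t' g' z : ℕ}
    (ht : t.eval x.st.mem = t') (hg : g.eval x.st.mem = g') (hI : I.wire t' g' b = z)
    (hz : z < 2 ^ B) (h : Q (x.set a z).st) : Runs I B G (.wire b (.lit a) t g) x.st Q := by
  refine .wire ?_ ?_ <;> simp only [State.val, ht, hg, Int.toNat_natCast, hI]
  · rw [abs_of_nonneg (by positivity)]; exact_mod_cast hz
  · rw [Expr.eval_lit, x.write_of_lt ha]; exact h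

theorem Runs.entrySet {a : ℕ} (ha : a < 100) {r s : TwoBits} {im : Bool} {t g prec : Expr}
    {t' g' k : ℕ} {z : ℤ} (ht : t.eval x.st.mem = t') (hg : g.eval x.st.mem = g')
    (hk : prec.eval x.st.mem = k) (hI : I.entry t' g' r s im k = z) (hkB : k ≤ B)
    (hz : |z| < 2 ^ B) (h : Q (x.set a z).st) :
    Runs I B G (.entry r s im (.lit a) t g prec) x.st Q := by
  refine .entry ?_ ?_ ?_ <;> simp only [State.val, ht, hg, hk, Int.toNat_natCast, hI]
  · exact hkB
  · exact hz
  · rw [Expr.eval_lit, x.write_of_lt ha]; exact h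

theorem Runs.paramSet {a : ℕ} (ha : a < 100) {i : Fin 3} {prec : Expr} {k : ℕ} {z : ℤ}
    (hk : prec.eval x.st.mem = k) (hI : I.param i k = z) (hkB : k ≤ B)
    (hz : |z| < 2 ^ B) (h : Q (x.set a z).st) : Runs I B G (.param i (.lit a) prec) x.st Q := by
  refine .param ?_ ?_ ?_ <;> simp only [State.val, hk, Int.toNat_natCast, hI]
  · exact hkB
  · exact hz
  · rw [Expr.eval_lit, x.write_of_lt ha]; exact h

/-- Counting in cell `v` up to the content of cell `h`. -/
def Program.for (v h : ℕ) (P : Program) : Program :=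
  .block [.store (.lit v) 0,
    .loop (.less (.var v) (.var h)) (.block [P, .store (.lit v) (.var v + 1)])]

/-- The body may spoil every scalar above the counter, so states are tracked only up to agreement
below `v + 1`. Nested loops and subroutines use higher cells as scratch space; `h < v` protects the
loop bound. -/
theorem Runs.for {v h : ℕ} {P : Program} (hv : v < 100) (hh : h < v) (S : ℕ → Config n) {k : ℕ}
    (hk : k ≤ G) (hS : ∀ j ≤ k, (S j).sc h = k) (hx : x.Agree v (S 0))
    (hP : ∀ j < k, ∀ y : Config n, y.Agree (v + 1) ((S j).set v j) →
      Runs I B G P y.st (Config.Near (v + 1) ((S (j + 1)).set v j))) :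
    Runs I B G (.for v h P) x.st (Config.Near v (S k)) := by
  refine .block_cons (.set hv (z := 0) (by rfl) (by simp) (.block_cons ?_))
  have hlt : ∀ a < v, a ≠ v := fun a h => h.ne
  refine Runs.mono (Runs.loop (fun j σ => Config.Near (v + 1) ((S j).set v j) σ) hk
    (fun j hj σ hσ => ?_) (fun σ hσ => ?_) ?_) (fun σ _ hσ => .block_nil ?_)
  · obtain ⟨y, hy, rfl⟩ := hσ
    have hv' : y.sc v = j := by rw [hy.sc v (by omega)]; simp
    have hh' : y.sc h = k := by
      rw [hy.sc h (by omega)]; simp [hh.ne, hS j hj.le]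
    refine ⟨?_, .of_bdd fun hB => .block_cons ((hP j hj y hy).mono fun σ hσB hσ => ?_)⟩
    · simp only [State.val, Expr.eval_less, y.eval_var hv, y.eval_var (hh.trans hv), hv', hh']
      rw [if_pos (by exact_mod_cast hj)]
      norm_num
    · obtain ⟨w, hw, rfl⟩ := hσ
      have hwv : w.sc v = j := by rw [hw.sc v (by omega)]; simp
      refine .block_cons (.set hv (z := ((j + 1 : ℕ) : ℤ)) ?_ ?_ (.block_nil ⟨_, ?_, rfl⟩))
      · simp [w.eval_var hv, hwv]
      -- The incremented counter is at most the loop bound, which is stored in a cell and hence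
      -- fits.
      · have := hB.abs_sc_lt (hh.trans hv)
        rw [hh'] at this
        rw [abs_of_nonneg (by positivity)] at this ⊢
        refine lt_of_le_of_lt ?_ this
        exact_mod_cast hj
      · refine ⟨fun a ha => ?_, hw.label, hw.sign, hw.coins⟩
        have := hw.sc a ha
        simp only [Config.set_sc] at this ⊢
        split_ifs at this ⊢ <;> simp_all
  · obtain ⟨y, hy, rfl⟩ := hσ
    have hv' : y.sc v = k := by rw [hy.sc v (by omega)]; simp
    have hh' : y.sc h = k := by
      rw [hy.sc h (by omega)]; simp [hh.ne, hS k le_rfl]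
    simp only [State.val, Expr.eval_less, y.eval_var hv, y.eval_var (hh.trans hv), hv', hh']
    simp
  · refine ⟨x.set v 0, ⟨fun a ha => ?_, hx.label, hx.sign, hx.coins⟩, rfl⟩
    simp only [Config.set_sc]
    split_ifs with h1
    · simp
    · exact hx.sc a (by omega)
  · obtain ⟨y, hy, rfl⟩ := hσ
    refine ⟨y, ⟨fun a ha => ?_, hy.label, hy.sign, hy.coins⟩, rfl⟩
    rw [hy.sc a (by omega)]
    simp [ha.ne]

end

theorem Runs.forThen {I : Input} {B G : ℕ} {x : Config n} {Q : State → Prop} {v h : ℕ}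
    {P : Program} (S : ℕ → Config n) {k : ℕ} (hv : v < 100) (hh : h < v)
    (hk : k ≤ G) (hS : ∀ j ≤ k, (S j).sc h = k) (h₁ : ∀ a < v, x.sc a = (S 0).sc a)
    (h₂ : x.label = (S 0).label) (h₃ : x.sign = (S 0).sign) (h₄ : x.coins = (S 0).coins)
    (hP : ∀ j < k, ∀ y : Config n, y.Agree (v + 1) ((S j).set v j) →
      Runs I B G P y.st (Config.Near (v + 1) ((S (j + 1)).set v j)))
    (hQ : ∀ y : Config n, y.Agree v (S k) → Q y.st) :
    Runs I B G (.for v h P) x.st Q :=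
  (Runs.for hv hh S hk hS ⟨h₁, h₂, h₃, h₄⟩ hP).mono fun _ _ ⟨y, hy, e⟩ => e ▸ hQ y hy

attribute [irreducible] Runs

/-! ### Expressions for transfer coefficients -/

/-- Expressions with values in the Gaussian integers. -/
structure GaussExpr where
  re : Expr
  im : Expr

namespace GaussExpr

/-- The value. -/
def eval (mem : ℕ → ℤ) (a : GaussExpr) : GaussianInt := ⟨a.re.eval mem, a.im.eval mem⟩

/-- The product. -/
def mul (a b : GaussExpr) : GaussExpr := ⟨a.re * b.re - a.im * b.im, a.re * b.im + a.im * b.re⟩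

/-- The complex conjugate. -/
def conj (a : GaussExpr) : GaussExpr := ⟨a.re, 0 - a.im⟩

theorem eval_mul (mem : ℕ → ℤ) (a b : GaussExpr) :
    (a.mul b).eval mem = a.eval mem * b.eval mem := by
  refine Zsqrtd.ext ?_ ?_ <;> simp [eval, mul] <;> ring

theorem eval_conj (mem : ℕ → ℤ) (a : GaussExpr) : a.conj.eval mem = star (a.eval mem) := by
  refine Zsqrtd.ext ?_ ?_ <;> simp [eval, conj]

/-- An entry of the Pauli matrix whose number is the value of an expression. -/
def pauli (e : Expr) (i j : Fin 2) : GaussExpr :=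
  if i = j then
    if i = 0 then ⟨Expr.less e 1 + Expr.less 2 e, 0⟩ else ⟨Expr.less e 1 - Expr.less 2 e, 0⟩
  else
    if i = 0 then ⟨Expr.less e 2 - Expr.less e 1, 0 - (Expr.less e 3 - Expr.less e 2)⟩
    else ⟨Expr.less e 2 - Expr.less e 1, Expr.less e 3 - Expr.less e 2⟩

/-- Comparisons build the indicators of labels: `e < 1` detects `I`, `2 < e` detects `Z`, and
differences of consecutive comparisons detect `X` and `Y`. -/
theorem eval_pauli {mem : ℕ → ℤ} {e : Expr} {a : Fin 4} (h : e.eval mem = (a : ℕ)) (i j : Fin 2) :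
    (pauli e i j).eval mem = pauliGauss a i j := by
  fin_cases a <;> fin_cases i <;> fin_cases j <;> refine Zsqrtd.ext ?_ ?_ <;>
    simp_all [eval, pauli, pauliGauss]

end GaussExpr

/-- The sum of a family of expressions. -/
def Expr.sum {ι : Type*} [Fintype ι] (f : ι → Expr) : Expr :=
  (Finset.univ.toList.map f).foldr (fun a b => a + b) 0

theorem Expr.eval_sum {ι : Type*} [Fintype ι] (mem : ℕ → ℤ) (f : ι → Expr) :
    (Expr.sum f).eval mem = ∑ i, (f i).eval mem := by
  rw [← Finset.sum_map_toList, Expr.sum]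
  induction (Finset.univ : Finset ι).toList with
  | nil => simp
  | cons i l ih => simp [ih]

/-- The cell for the real or imaginary part of an entry of a gate. -/
def entryCell (q : TwoBits × TwoBits × Bool) : ℕ :=
  60 + 16 * q.1.1 + 8 * q.1.2 + 4 * q.2.1.1 + 2 * q.2.1.2 + q.2.2.toNat

theorem entryCell_lt (q : TwoBits × TwoBits × Bool) : entryCell q < 100 := by
  obtain ⟨⟨a, b⟩, ⟨c, e⟩, f⟩ := q
  have := Bool.toNat_le f
  simp only [entryCell]; omega

theorem le_entryCell (q : TwoBits × TwoBits × Bool) : 60 ≤ entryCell q := by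
  simp only [entryCell]; omega

theorem entryCell_injective : Function.Injective entryCell := by
  rintro ⟨⟨a, b⟩, ⟨c, e⟩, f⟩ ⟨⟨a', b'⟩, ⟨c', e'⟩, f'⟩ h
  have h1 := Bool.toNat_le f
  have h2 := Bool.toNat_le f'
  simp only [entryCell] at h
  have hf : f.toNat = f'.toNat := by omega
  have hf' : f = f' := by revert hf; cases f <;> cases f' <;> simp
  simp only [Prod.mk.injEq, Fin.ext_iff, hf', and_true]
  omega

/-- An expression for `gateNum`, with the labels in the cells `54`-`57`. -/
def gateNumExpr (P₁ P₂ Q₁ Q₂ : Expr) : Expr :=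
  Expr.sum fun a : TwoBits => Expr.sum fun b : TwoBits => Expr.sum fun c : TwoBits =>
    Expr.sum fun e : TwoBits =>
      let V (r s : TwoBits) : GaussExpr :=
        ⟨.var (entryCell (r, s, false)), .var (entryCell (r, s, true))⟩
      (((GaussExpr.pauli Q₁ a.1 b.1).mul (.pauli Q₂ a.2 b.2)).mul
        (((V b c).mul ((GaussExpr.pauli P₁ c.1 e.1).mul (.pauli P₂ c.2 e.2))).mul
          (V a e).conj)).re

theorem eval_gateNumExpr {mem : ℕ → ℤ} {P₁ P₂ Q₁ Q₂ : Expr} {P Q : Pauli2}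
    (hP₁ : P₁.eval mem = (P.1 : ℕ)) (hP₂ : P₂.eval mem = (P.2 : ℕ)) (hQ₁ : Q₁.eval mem = (Q.1 : ℕ))
    (hQ₂ : Q₂.eval mem = (Q.2 : ℕ)) : (gateNumExpr P₁ P₂ Q₁ Q₂).eval mem =
      gateNum (fun r s => ⟨mem (entryCell (r, s, false)), mem (entryCell (r, s, true))⟩) P Q := by
  have hre : ∀ f : TwoBits → GaussianInt, (∑ a, f a).re = ∑ a, (f a).re := by
    intro f
    induction (Finset.univ : Finset TwoBits) using Finset.induction_on with
    | empty => rfl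
    | insert a s ha ih => rw [Finset.sum_insert ha, Finset.sum_insert ha, Zsqrtd.re_add, ih]
  simp only [gateNumExpr, gateNum, Expr.eval_sum, hre]
  refine Finset.sum_congr rfl fun a _ => Finset.sum_congr rfl fun b _ => Finset.sum_congr rfl
    fun c _ => Finset.sum_congr rfl fun e _ => ?_
  rw [gateTerm, ← GaussExpr.eval_pauli hP₁, ← GaussExpr.eval_pauli hP₂, ← GaussExpr.eval_pauli hQ₁,
    ← GaussExpr.eval_pauli hQ₂]
  have hre' : ∀ c : GaussExpr, c.re.eval mem = (c.eval mem).re := fun _ => rfl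
  rw [hre', GaussExpr.eval_mul, GaussExpr.eval_mul, GaussExpr.eval_mul, GaussExpr.eval_mul,
    GaussExpr.eval_mul, GaussExpr.eval_conj]
  rfl

/-! ### The setting of the sweeps -/

/-- The data that determine the sweeps of the algorithm, and a priori bounds. -/
structure Setting (m : ℕ) where
  I : Input
  W : ℕ → (Fin m × Fin 2 ≃ Fin (2 * m))
  (K L D w B G : ℕ)
  lam : ℤ
  m_pos : 0 < m
  D_pos : 0 < D
  K_ge : 9 ≤ K
  wire : ∀ t < D, ∀ (g : Fin m) (b : Fin 2), I.wire t g b = (W t (g, b) : ℕ) + 1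
  entry : ∀ t < D, ∀ (g : Fin m) r s im, |I.entry t g r s im K| ≤ 2 ^ K + 1
  gateNum_le : ∀ t < D, ∀ (g : Fin m) P Q,
    |gateNum (fun r s => ⟨I.entry t g r s false K, I.entry t g r s true K⟩) P Q| ≤ 2 * (4 * 2 ^ K * 2 ^ K)
  lam_le : |lam| ≤ 2 * 2 ^ K
  m_lt : 4 * (2 * m) < 2 ^ B
  value_lt : D * (4 * (2 * m)) ^ w * (16 ^ L * (2 ^ sweepLen m D * (2 ^ K + 1))) ^ 2 < 2 ^ B
  m_le : 2 * m ≤ G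
  K_le : K ≤ G
  D_le : D ≤ G
  w_le : w ≤ G
  prefixes_le : (4 * (2 * m)) ^ w ≤ G
  codes_le : 16 ^ L ≤ G

namespace Setting

variable (p : Setting m)

/-- Fixed-point updates. -/
def ops (fwd : Bool) : SweepOps m ℤ where
  gate t g P Q v :=
    v * gateNum (fun r s => ⟨p.I.entry t g r s false p.K, p.I.entry t g r s true p.K⟩)
      (if fwd then P else Q) (if fwd then Q else P) / (4 * 2 ^ p.K * 2 ^ p.K)
  damp v := v * p.lam / 2 ^ p.K

/-- The constants in the memory. -/
structure Consts (x : Config (2 * m)) : Prop where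
  cell_n : x.sc 0 = (2 * m : ℕ)
  cell_m : x.sc 1 = m
  cell_L : x.sc 4 = p.L
  cell_K : x.sc 5 = p.K
  cell_PK : x.sc 6 = 2 ^ p.K
  cell_D : x.sc 7 = p.D
  cell_w : x.sc 8 = p.w
  cell_lam : x.sc 9 = p.lam
  prefixes : x.sc 10 = ((4 * (2 * m)) ^ p.w : ℕ)
  codes : x.sc 11 = (16 ^ p.L : ℕ)

theorem Consts.agree {p : Setting m} {x y : Config (2 * m)} (hx : p.Consts x)
    (h : ∀ a < 12, y.sc a = x.sc a) : p.Consts y := by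
  obtain ⟨h1, h2, h3, h4, h5, h6, h7, h8, h9, h10⟩ := hx
  constructor <;> rw [h _ (by norm_num)] <;> assumption

/-- A priori growth: no operation more than doubles a value. This holds for every described circuit
and is independent of the quality of the approximation, as the time bound requires. -/
theorem abs_mul_ediv_le {v a b : ℤ} (hb : 0 < b) (ha : |a| ≤ 2 * b) :
    |v * a / b| + 1 ≤ 2 * (|v| + 1) := by
  have h1 : |v * a| ≤ 2 * |v| * b := by
    rw [abs_mul]; nlinarith [mul_le_mul_of_nonneg_left ha (abs_nonneg v)]
  obtain ⟨h2, h3⟩ := abs_le.1 h1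
  have h4 : v * a / b ≤ 2 * |v| := Int.ediv_le_of_le_mul hb h3
  have h5 : -(2 * |v|) ≤ v * a / b := Int.le_ediv_of_mul_le hb (by linarith)
  have : |v * a / b| ≤ 2 * |v| := abs_le.2 ⟨h5, h4⟩
  linarith

theorem abs_gate_le (fwd : Bool) {t : ℕ} (ht : t < p.D) (g : Fin m) (P Q : Pauli2) (v : ℤ) :
    |(p.ops fwd).gate t g P Q v| + 1 ≤ 2 * (|v| + 1) :=
  abs_mul_ediv_le (by positivity) (p.gateNum_le t ht g _ _)

theorem abs_damp_le (fwd : Bool) (v : ℤ) : |(p.ops fwd).damp v| + 1 ≤ 2 * (|v| + 1) :=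
  abs_mul_ediv_le (by positivity) p.lam_le

/-- The bound for the values in a sweep. -/
def bound : ℤ := 2 ^ sweepLen m p.D * (2 ^ p.K + 1)

theorem sq_bound_lt : (16 ^ p.L * p.bound) ^ 2 * (p.D * (4 * (2 * m)) ^ p.w) < 2 ^ p.B := by
  have := p.value_lt
  have h : ((p.D * (4 * (2 * m)) ^ p.w * (16 ^ p.L * (2 ^ sweepLen m p.D * (2 ^ p.K + 1))) ^ 2 : ℕ)
    : ℤ) < (2 ^ p.B : ℕ) := by exact_mod_cast this
  push_cast at h
  rw [bound]
  linarith

theorem one_le_bound : 1 ≤ p.bound := by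
  have h1 : (1 : ℤ) ≤ 2 ^ sweepLen m p.D := one_le_pow₀ (by norm_num)
  have h2 : (0 : ℤ) < 2 ^ p.K := by positivity
  rw [bound]; nlinarith

theorem one_le_mul : (1 : ℤ) ≤ p.D * (4 * (2 * m)) ^ p.w := by
  have := p.D_pos; have := p.m_pos
  have : 1 ≤ p.D * (4 * (2 * m)) ^ p.w := Nat.one_le_iff_ne_zero.2 (by positivity)
  exact_mod_cast this

theorem sum_sq_lt : (16 ^ p.L * p.bound) ^ 2 < 2 ^ p.B :=
  lt_of_le_of_lt (le_mul_of_one_le_right (by positivity) p.one_le_mul) p.sq_bound_lt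

theorem sum_lt : 16 ^ p.L * p.bound < 2 ^ p.B := by
  have h := p.one_le_bound
  have h1 : (1 : ℤ) ≤ 16 ^ p.L := one_le_pow₀ (by norm_num)
  exact lt_of_le_of_lt (by nlinarith [mul_le_mul h1 h (by norm_num) (by positivity)]) p.sum_sq_lt

theorem bound_lt : p.bound < 2 ^ p.B := by
  have h := p.one_le_bound
  have h1 : (1 : ℤ) ≤ 16 ^ p.L := one_le_pow₀ (by norm_num)
  exact lt_of_le_of_lt (by nlinarith) p.sum_lt

theorem PK_lt_bound : 2 ^ p.K + 1 ≤ p.bound := by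
  have h1 : (1 : ℤ) ≤ 2 ^ sweepLen m p.D := one_le_pow₀ (by norm_num)
  have h2 : (0 : ℤ) < 2 ^ p.K := by positivity
  rw [bound]; nlinarith

theorem K_lt : p.K < p.B := by
  have h : (2 : ℤ) ^ p.K < 2 ^ p.B := by linarith [p.PK_lt_bound, p.bound_lt]
  exact (pow_lt_pow_iff_right₀ (by norm_num)).1 h

theorem B_ge : 10 ≤ p.B := by
  have := p.K_ge; have := p.K_lt; omega

theorem lit_lt {z : ℤ} (h : |z| < 1024) : |z| < 2 ^ p.B := by
  have : (2 : ℤ) ^ 10 ≤ 2 ^ p.B := pow_le_pow_right₀ (by norm_num) p.B_ge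
  linarith

/-- Querying a gate. -/
def queryProg : Program := .block (Finset.univ.toList.map fun q : TwoBits × TwoBits × Bool =>
  .entry q.1 q.2.1 q.2.2 (.lit (entryCell q)) (.var 44) (.var 51) (.var 5))

theorem runs_query {x : Config (2 * m)} (hx : p.Consts x) {t : ℕ} (ht : t < p.D) (g : Fin m)
    (hxt : x.sc 44 = t) (hxg : x.sc 51 = (g : ℕ)) :
    Runs p.I p.B p.G queryProg x.st fun σ => ∃ y : Config (2 * m), y.Agree 60 x ∧
      (∀ r s im, y.sc (entryCell (r, s, im)) = p.I.entry t g r s im p.K) ∧ σ = y.st := by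
  -- The set `S` collects the entries that are already loaded; distinct entries have distinct cells,
  -- so later queries keep them.
  have key : ∀ (l : List (TwoBits × TwoBits × Bool)) (S : Set (TwoBits × TwoBits × Bool))
      (y : Config (2 * m)), y.Agree 60 x →
      (∀ q ∈ S, y.sc (entryCell q) = p.I.entry t g q.1 q.2.1 q.2.2 p.K) →
      Runs p.I p.B p.G (.block (l.map fun q : TwoBits × TwoBits × Bool =>
        .entry q.1 q.2.1 q.2.2 (.lit (entryCell q)) (.var 44) (.var 51) (.var 5))) y.st fun σ =>
        ∃ y : Config (2 * m), y.Agree 60 x ∧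
        (∀ q, q ∈ l ∨ q ∈ S → y.sc (entryCell q) = p.I.entry t g q.1 q.2.1 q.2.2 p.K) ∧
          σ = y.st := by
    intro l
    induction l with
    | nil => exact fun S y hy hS => .block_nil ⟨y, hy, fun q hq => hS q (by simpa using hq), rfl⟩
    | cons q l ih =>
      intro S y hy hS
      refine .block_cons (.entrySet (entryCell_lt q) (t' := t) (g' := g) (k := p.K) ?_ ?_ ?_ rfl
        p.K_lt.le ?_ ?_)
      · simp [hy.sc 44, hxt]
      · simp [hy.sc 51, hxg]
      · simp [hy.sc 5, hx.cell_K]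
      · have := p.entry t ht g q.1 q.2.1 q.2.2
        linarith [p.PK_lt_bound, p.bound_lt]
      · refine (ih (insert q S) (y.set (entryCell q) _) ⟨fun a ha => ?_, hy.label, hy.sign, hy.coins⟩ ?_).mono ?_
        · have := le_entryCell q
          rw [Config.set_sc, if_neg (by omega), hy.sc a ha]
        · intro q' hq'
          by_cases h : q' = q
          · subst h; simp
          · rw [Config.set_sc, if_neg (fun h' => h (entryCell_injective h'))]
            exact hS q' (by simpa [h] using hq')
        · rintro σ - ⟨y, h1, h2, h3⟩
          refine ⟨y, h1, fun q' hq' => h2 q' ?_, h3⟩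
          simp only [List.mem_cons, Set.mem_insert_iff] at hq' ⊢
          tauto
  refine (key _ ∅ x ⟨fun _ _ => rfl, rfl, rfl, rfl⟩ (by simp)).mono ?_
  rintro σ - ⟨y, h1, h2, h3⟩
  exact ⟨y, h1, fun r s im => h2 (r, s, im) (by simp), h3⟩

/-- Setting the Pauli string, the code and the value of a sweep. -/
def _root_.NoisyRCS.Config.setSweep (x : Config (2 * m)) (s : SweepState m ℤ) : Config (2 * m) :=
  { (x.set 41 (s.2.1 : ℕ)).set 40 s.2.2 with label := s.1 }

/-- Passing a gate. -/
def gateProg (fwd : Bool) : Program := .block [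
  .wire 0 (.lit 52) (.var 44) (.var 51),
  .wire 1 (.lit 53) (.var 44) (.var 51),
  .store (.lit 54) (.label (.var 52 - 1)),
  .store (.lit 55) (.label (.var 53 - 1)),
  .cond (.var 54 + .var 55) (.block [
    .store (.lit 56) ((.var 41 / 4 : Expr).mod 4),
    .store (.lit 57) ((Expr.var 41).mod 4),
    .store (.lit 41) (.var 41 / 16),
    queryProg,
    .store (.lit 40) (.var 40 *
      (if fwd then gateNumExpr (.var 54) (.var 55) (.var 56) (.var 57)
        else gateNumExpr (.var 56) (.var 57) (.var 54) (.var 55)) / (4 * .var 6 * .var 6)),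
    .store (100 + 2 * (.var 52 - 1)) (.var 56),
    .store (100 + 2 * (.var 53 - 1)) (.var 57)]) .skip]

theorem nat_lt {k : ℕ} (h : k < 1024) : |(k : ℤ)| < 2 ^ p.B :=
  p.lit_lt (by rw [abs_of_nonneg (by positivity)]; exact_mod_cast h)

/-- In a backward sweep the label that is read is the output of the gate and the digit chooses its
input. The same program serves both directions, with the two pairs of labels exchanged in the
coefficient. -/
theorem runs_gate (fwd : Bool) {x : Config (2 * m)} (hx : p.Consts x) {t : ℕ} (ht : t < p.D)
    (g : Fin m) (hxt : x.sc 44 = t) (hxg : x.sc 51 = (g : ℕ)) {z : ℕ} (hz : x.sc 41 = z)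
    (hv : 2 * (|x.sc 40| + 1) ≤ 2 ^ p.B) :
    Runs p.I p.B p.G (gateProg fwd) x.st
      (Config.Near 52 (x.setSweep (gateStep p.W (p.ops fwd) t (x.label, z, x.sc 40) g))) := by
  refine .of_bdd fun hB => ?_
  have hmB : ∀ q : Fin (2 * m), (q : ℕ) + 1 < 2 ^ p.B := fun q => by
    have := p.m_lt; have := q.2; omega
  set q₀ := p.W t (g, 0) with hq₀
  set q₁ := p.W t (g, 1) with hq₁
  have hP : pairEquiv (p.W t) (Fin 4) x.label g = (x.label q₀, x.label q₁) := rfl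
  have hlab : ∀ P : Fin 4, |(((P : ℕ) : ℤ))| < 2 ^ p.B := fun P => p.nat_lt (by omega)
  refine .block_cons (.wireSet (by norm_num) (t' := t) (g' := g) (by simp [hxt]) (by simp [hxg])
    (p.wire t ht g 0) (hmB q₀) ?_)
  refine .block_cons (.wireSet (by norm_num) (t' := t) (g' := g) (by simp [hxt]) (by simp [hxg])
    (p.wire t ht g 1) (hmB q₁) ?_)
  -- Qubits are numbered from one in answers to queries, hence the shift by one in the address.
  refine .block_cons (.set (by norm_num) (z := (x.label q₀ : ℕ))
    (by rw [Config.eval_label _ q₀ (by simp [hq₀])]; simp) (hlab _) ?_)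
  refine .block_cons (.set (by norm_num) (z := (x.label q₁ : ℕ))
    (by rw [Config.eval_label _ q₁ (by simp [hq₁])]; simp) (hlab _) ?_)
  have h0 : pairEquiv (p.W t) (Fin 4) x.label g = 0 ↔
      ((x.label q₀ : ℕ) : ℤ) + ((x.label q₁ : ℕ) : ℤ) = 0 := by
    rw [hP, Prod.ext_iff, Fin.ext_iff, Fin.ext_iff]
    simp only [Prod.fst_zero, Prod.snd_zero, Fin.val_zero]
    omega
  refine .block_cons (.cond (fun hc => ?_) fun hc => .skip (.block_nil ?_))
  · have hne : ¬ pairEquiv (p.W t) (Fin 4) x.label g = 0 := by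
      rw [h0]; simpa [State.val] using hc
    rw [gateStep, if_neg hne, hP]
    have hz41 := hB.abs_sc_lt (x := x) (show 41 < 100 by norm_num)
    have hzB : |((z / 16 : ℕ) : ℤ)| < 2 ^ p.B := by
      rw [hz, abs_of_nonneg (by positivity)] at hz41
      rw [abs_of_nonneg (by positivity)]
      have := Nat.div_le_self z 16
      omega
    refine .block_cons (.set (by norm_num) (z := ((pauliDigit z).1 : ℕ)) ?_ (hlab _) ?_)
    · simp [hz, pauliDigit]
    refine .block_cons (.set (by norm_num) (z := ((pauliDigit z).2 : ℕ)) ?_ (hlab _) ?_)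
    · simp [hz, pauliDigit]
    refine .block_cons (.set (by norm_num) (z := ((z / 16 : ℕ) : ℤ)) ?_ hzB ?_)
    · simp [hz]
    refine .block_cons ((p.runs_query (t := t) (hx.agree fun a ha => ?_) ht g (by simp [hxt])
      (by simp [hxg])).mono ?_)
    · simp only [Config.set_sc]
      split_ifs <;> first | rfl | omega
    rintro σ - ⟨y, hy, hE, rfl⟩
    have hsc : ∀ a < 60, y.sc a = _ := hy.sc
    have hl : y.label = x.label := hy.label
    set v' := (p.ops fwd).gate t g (x.label q₀, x.label q₁) (pauliDigit z) (x.sc 40) with hv'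
    have hnum : ∀ P₁ P₂ Q₁ Q₂ : Expr, ∀ P Q : Pauli2, P₁.eval y.st.mem = (P.1 : ℕ) →
        P₂.eval y.st.mem = (P.2 : ℕ) → Q₁.eval y.st.mem = (Q.1 : ℕ) →
        Q₂.eval y.st.mem = (Q.2 : ℕ) → (gateNumExpr P₁ P₂ Q₁ Q₂).eval y.st.mem =
        gateNum (fun r s => ⟨p.I.entry t g r s false p.K, p.I.entry t g r s true p.K⟩) P Q := by
      intro P₁ P₂ Q₁ Q₂ P Q h1 h2 h3 h4
      rw [eval_gateNumExpr h1 h2 h3 h4]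
      simp only [y.mem_of_lt (entryCell_lt _), hE]
    refine .block_cons (.set (by norm_num) (z := v') ?_ ?_ ?_)
    · have e54 : y.sc 54 = (x.label q₀ : ℕ) := by simp [hsc]
      have e55 : y.sc 55 = (x.label q₁ : ℕ) := by simp [hsc]
      have e56 : y.sc 56 = ((pauliDigit z).1 : ℕ) := by simp [hsc]
      have e57 : y.sc 57 = ((pauliDigit z).2 : ℕ) := by simp [hsc]
      have e6 : y.sc 6 = 2 ^ p.K := by simp [hsc, hx.cell_PK]
      have e40 : y.sc 40 = x.sc 40 := by simp [hsc]
      rw [hv']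
      cases fwd
      · simp only [ops, Bool.false_eq_true, if_false]
        rw [Expr.eval_div, Expr.eval_mul, hnum _ _ _ _ (pauliDigit z) (x.label q₀, x.label q₁)
          (by simp [e56]) (by simp [e57]) (by simp [e54]) (by simp [e55])]
        simp [e6, e40]
      · simp only [ops, if_true]
        rw [Expr.eval_div, Expr.eval_mul, hnum _ _ _ _ (x.label q₀, x.label q₁) (pauliDigit z)
          (by simp [e54]) (by simp [e55]) (by simp [e56]) (by simp [e57])]
        simp [e6, e40]
    · have := p.abs_gate_le fwd ht g (x.label q₀, x.label q₁) (pauliDigit z) (x.sc 40)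
      rw [hv']; linarith
    refine .block_cons (.setLabel q₀ (pauliDigit z).1 (by simp [hsc, hq₀]) (by simp [hsc])
      (by have := p.B_ge; omega) ?_)
    refine .block_cons (.setLabel q₁ (pauliDigit z).2 (by simp [hsc, hq₁]) (by simp [hsc])
      (by have := p.B_ge; omega) ?_)
    refine .block_nil (.block_nil (.of (fun a ha => ?_) ?_ ?_ ?_))
    · simp only [Config.setLabel_sc, Config.set_sc, Config.setSweep, hsc a (by omega)]
      split_ifs <;> first | rfl | omega
    · simp [Config.setSweep, setPair, hl, ← hq₀, ← hq₁]
    · simp [Config.setSweep, hy.sign]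
    · simp [Config.setSweep, hy.coins]
  · have he : pairEquiv (p.W t) (Fin 4) x.label g = 0 := by
      rw [h0]; simpa [State.val] using hc
    rw [gateStep, if_pos he]
    refine .of (fun a ha => ?_) rfl rfl rfl
    simp only [Config.set_sc, Config.setSweep]
    split_ifs <;> first | rfl | omega | simp_all

end Setting

namespace Setting

variable (p : Setting m)

/-! ### Programs for sweeps -/

/-- Applying the noise, and counting the non-trivial Pauli labels in cell `45`. -/
def noiseProg : Program := .block [
  .store (.lit 45) 0,
  .for 46 0 (.cond (.label (.var 46)) (.block [
    .store (.lit 45) (.var 45 + 1),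
    .store (.lit 40) (.var 40 * .var 9 / .var 6)]) .skip)]

theorem abs_foldl_le {α : Type*} {f : ℤ → α → ℤ} (hf : ∀ v a, |f v a| + 1 ≤ 2 * (|v| + 1))
    (l : List α) (v : ℤ) : |l.foldl f v| + 1 ≤ 2 ^ l.length * (|v| + 1) := by
  induction l generalizing v with
  | nil => simp
  | cons a l ih =>
    refine (ih _).trans ?_
    rw [List.length_cons, pow_succ, mul_assoc]
    exact mul_le_mul_of_nonneg_left (hf v a) (by positivity)

theorem wtPrefix_le (A : PStr n) (J : ℕ) : wtPrefix A J ≤ n :=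
  (Finset.card_le_univ _).trans (by simp)

theorem n_lt : 2 * m + 1 < 2 ^ p.B := by
  have := p.m_lt; have := p.m_pos; omega

theorem small_lt {k : ℕ} (hk : k ≤ 2 * m + 1) : |(k : ℤ)| < 2 ^ p.B := by
  rw [abs_of_nonneg (by positivity)]
  exact_mod_cast hk.trans_lt p.n_lt

/-- The weight is counted along with the damping, because a backward sweep compares it with `w`
afterwards. -/
theorem runs_noise (fwd : Bool) {x : Config (2 * m)} (hx : p.Consts x)
    (hv : 2 ^ (2 * m) * (|x.sc 40| + 1) ≤ 2 ^ p.B) :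
    Runs p.I p.B p.G noiseProg x.st (Config.Near 46
      ((x.set 45 (wt x.label)).set 40 (dampAll x.label (p.ops fwd).damp (x.sc 40)))) := by
  set f : ℤ → Fin (2 * m) → ℤ := fun v j => if x.label j = 0 then v else (p.ops fwd).damp v with hf
  have hgrow : ∀ v j, |f v j| + 1 ≤ 2 * (|v| + 1) := by
    intro v j
    simp only [hf]
    split_ifs
    · linarith [abs_nonneg v]
    · exact p.abs_damp_le fwd v
  set v : ℕ → ℤ := fun j => ((List.finRange (2 * m)).take j).foldl f (x.sc 40) with hvdef
  have hvB : ∀ j, |v j| < 2 ^ p.B := by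
    intro j
    have h1 := abs_foldl_le hgrow ((List.finRange (2 * m)).take j) (x.sc 40)
    have h2 : (2 : ℤ) ^ ((List.finRange (2 * m)).take j).length ≤ 2 ^ (2 * m) :=
      pow_le_pow_right₀ (by norm_num) ((List.length_take_le' _ _).trans (by simp))
    have h3 := mul_le_mul_of_nonneg_right h2 (show 0 ≤ |x.sc 40| + 1 by positivity)
    simp only [hvdef]
    linarith
  refine .block_cons (.set (by norm_num) (z := 0) (by rfl) (by simp) (.block_cons ?_))
  refine .forThen (fun j => (x.set 45 (wtPrefix x.label j)).set 40 (v j)) (by norm_num)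
    (by norm_num) p.m_le ?_ (fun a ha => ?_) rfl rfl rfl (fun j hj y hy => ?_)
    fun y hy => .block_nil ?_
  · intro j _; simp [hx.cell_n]
  · have : wtPrefix x.label 0 = 0 := by simp [wtPrefix]
    simp only [Config.set_sc, hvdef, this]
    split_ifs <;> simp_all
  · have hy' : ∀ a < 47, y.sc a = _ := hy.sc
    have hl : y.label = x.label := hy.label
    have hval : y.st.val (.label (.var 46)) = ((x.label ⟨j, hj⟩ : Fin 4) : ℕ) := by
      rw [State.val, Config.eval_label _ ⟨j, hj⟩ (by simp [hy']), hl]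
    have hw := wtPrefix_succ x.label hj
    have hv1 : v (j + 1) = f (v j) ⟨j, hj⟩ := foldl_take_finRange_succ _ _ hj
    refine .cond (fun hc => ?_) fun hc => .skip ?_
    · rw [hval] at hc
      have h0 : x.label ⟨j, hj⟩ ≠ 0 := by
        intro h; simp [h] at hc
      rw [if_neg h0] at hw
      simp only [hf, if_neg h0] at hv1
      refine .block_cons (.set (by norm_num) (z := wtPrefix x.label (j + 1)) ?_ ?_ ?_)
      · simp [hy', hw]
      · exact p.small_lt ((wtPrefix_le _ _).trans (by omega))
      refine .block_cons (.set (by norm_num) (z := v (j + 1)) ?_ (hvB _) ?_)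
      · rw [hv1]; simp [hy', hx.cell_lam, hx.cell_PK, ops]
      refine .block_nil (.of (fun a ha => ?_) hl hy.sign hy.coins)
      simp only [Config.set_sc, hy' a ha]
      split_ifs <;> first | rfl | omega
    · rw [hval] at hc
      have h0 : x.label ⟨j, hj⟩ = 0 := by
        apply Fin.ext; simpa using hc
      rw [if_pos h0, add_zero] at hw
      simp only [hf, if_pos h0] at hv1
      refine .of (fun a ha => ?_) hl hy.sign hy.coins
      rw [hy' a ha, hw, hv1]
  · have e : v (2 * m) = dampAll x.label (p.ops fwd).damp (x.sc 40) := foldl_take_finRange _ _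
    rw [wtPrefix_self, e] at hy
    exact .of hy.sc hy.label hy.sign hy.coins

/-- Passing the noise after a layer. -/
def nodeProg (fwd : Bool) : Program :=
  if fwd then noiseProg
  else .block [noiseProg, .cond (.less (.var 8) (.var 45)) .skip (.store (.lit 40) 0)]

theorem runs_node (fwd : Bool) {x : Config (2 * m)} (hx : p.Consts x) {z : ℕ} (hz : x.sc 41 = z)
    (hv : 2 ^ (2 * m) * (|x.sc 40| + 1) ≤ 2 ^ p.B) :
    Runs p.I p.B p.G (nodeProg fwd) x.st (Config.Near 45
      (x.setSweep (nodeStep (p.ops fwd) fwd p.w (x.label, z, x.sc 40)))) := by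
  have h := p.runs_noise fwd hx hv
  cases fwd
  · simp only [nodeProg, Bool.false_eq_true, if_false]
    refine .block_cons (h.mono ?_)
    rintro σ - ⟨y, hy, rfl⟩
    have hy' : ∀ a < 46, y.sc a = _ := hy.sc
    refine .block_cons (.cond (fun hc => .skip ?_) fun hc => .set (by norm_num) (z := 0) (by rfl)
      (by simp) ?_)
    · have hw : ¬ wt x.label ≤ p.w := by
        simpa [State.val, hy', hx.cell_w] using hc
      refine .block_nil (.of (fun a ha => ?_) hy.label hy.sign hy.coins)
      simp only [hy' a (by omega), Config.setSweep, nodeStep, hw, Config.set_sc, and_false, if_false]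
      split_ifs <;> first | rfl | omega | simp_all
    · have hw : wt x.label ≤ p.w := by
        simpa [State.val, hy', hx.cell_w] using hc
      refine .block_nil (.of (fun a ha => ?_) hy.label hy.sign hy.coins)
      simp only [hy' a (by omega), Config.setSweep, nodeStep, hw, Config.set_sc, and_true, if_true]
      split_ifs <;> first | rfl | omega | simp_all
  · simp only [nodeProg, if_true]
    refine h.mono ?_
    rintro σ - ⟨y, hy, rfl⟩
    refine .of (fun a ha => ?_) hy.label hy.sign hy.coins
    simp only [hy.sc a (by omega), Config.setSweep, nodeStep, Config.set_sc]
    split_ifs <;> first | rfl | omega | simp_all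

/-- Passing a layer. -/
def layerProg (fwd : Bool) : Program := .for 51 1 (gateProg fwd)

theorem abs_gateStep_le (fwd : Bool) {t : ℕ} (ht : t < p.D) (s : SweepState m ℤ) (g : Fin m) :
    |(gateStep p.W (p.ops fwd) t s g).2.2| + 1 ≤ 2 * (|s.2.2| + 1) := by
  rw [gateStep]
  split_ifs
  · linarith [abs_nonneg s.2.2]
  · exact p.abs_gate_le fwd ht g _ _ _

theorem abs_gates_le (fwd : Bool) {t : ℕ} (ht : t < p.D) (l : List (Fin m)) (s : SweepState m ℤ) :
    |(l.foldl (gateStep p.W (p.ops fwd) t) s).2.2| + 1 ≤ 2 ^ l.length * (|s.2.2| + 1) := by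
  induction l generalizing s with
  | nil => simp
  | cons a l ih =>
    refine (ih _).trans ?_
    rw [List.length_cons, pow_succ, mul_assoc]
    exact mul_le_mul_of_nonneg_left (p.abs_gateStep_le fwd ht s a) (by positivity)

theorem abs_layerStep_le (fwd : Bool) {t : ℕ} (ht : t < p.D) (s : SweepState m ℤ) :
    |(layerStep p.W (p.ops fwd) t s).2.2| + 1 ≤ 2 ^ m * (|s.2.2| + 1) := by
  have := p.abs_gates_le fwd ht (List.finRange m) s
  rwa [List.length_finRange] at this

theorem abs_nodeStep_le (fwd fwd' : Bool) (s : SweepState m ℤ) :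
    |(nodeStep (p.ops fwd) fwd' p.w s).2.2| + 1 ≤ 2 ^ (2 * m) * (|s.2.2| + 1) := by
  simp only [nodeStep]
  split_ifs
  · have h1 : (1 : ℤ) ≤ 2 ^ (2 * m) := one_le_pow₀ (by norm_num)
    simp only [abs_zero, zero_add]
    nlinarith [abs_nonneg s.2.2]
  · have := abs_foldl_le (f := fun v (j : Fin (2 * m)) => if s.1 j = 0 then v else (p.ops fwd).damp v)
      (fun v j => by
        split_ifs
        · linarith [abs_nonneg v]
        · exact p.abs_damp_le fwd v) (List.finRange (2 * m)) s.2.2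
    rwa [List.length_finRange] at this

theorem runs_layer (fwd : Bool) {x : Config (2 * m)} (hx : p.Consts x) {t : ℕ} (ht : t < p.D)
    (hxt : x.sc 44 = t) {z : ℕ} (hz : x.sc 41 = z) (hv : 2 ^ m * (|x.sc 40| + 1) ≤ 2 ^ p.B) :
    Runs p.I p.B p.G (layerProg fwd) x.st (Config.Near 51
      (x.setSweep (layerStep p.W (p.ops fwd) t (x.label, z, x.sc 40)))) := by
  set s : ℕ → SweepState m ℤ := fun j =>
    ((List.finRange m).take j).foldl (gateStep p.W (p.ops fwd) t) (x.label, z, x.sc 40) with hs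
  have hm : s m = layerStep p.W (p.ops fwd) t (x.label, z, x.sc 40) := foldl_take_finRange _ _
  rw [← hm]
  refine Runs.for (by norm_num) (by norm_num) (fun j => x.setSweep (s j))
    ((by omega : m ≤ 2 * m).trans p.m_le) (fun j _ => ?_) ⟨fun a ha => ?_, rfl, rfl, rfl⟩
    fun j hj y hy => ?_
  · simp [Config.setSweep, hx.cell_m]
  · simp only [Config.setSweep, Config.set_sc, hs, List.take_zero, List.foldl_nil]
    split_ifs <;> simp_all
  · have hy' : ∀ a < 52, y.sc a = _ := hy.sc
    have hl : y.label = (s j).1 := hy.label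
    have h40 : y.sc 40 = (s j).2.2 := by simp [hy', Config.setSweep]
    have hs1 : s (j + 1) = gateStep p.W (p.ops fwd) t (s j) ⟨j, hj⟩ :=
      foldl_take_finRange_succ _ _ hj
    refine (p.runs_gate fwd (hx.agree fun a ha => ?_) ht ⟨j, hj⟩ (z := (s j).2.1) ?_ ?_ ?_ ?_).mono ?_
    · rw [hy' a (by omega)]
      simp only [Config.setSweep, Config.set_sc]
      split_ifs <;> first | rfl | omega
    · simp [hy', Config.setSweep, hxt]
    · simp [hy']
    · simp [hy', Config.setSweep]
    · rw [h40]
      have h1 := p.abs_gates_le fwd ht ((List.finRange m).take j) (x.label, z, x.sc 40)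
      rw [List.length_take, List.length_finRange, min_eq_left hj.le] at h1
      have h2 : (2 : ℤ) * 2 ^ j ≤ 2 ^ m := by
        rw [← pow_succ']; exact pow_le_pow_right₀ (by norm_num) hj
      have h3 := mul_le_mul_of_nonneg_right h2 (show 0 ≤ |x.sc 40| + 1 by positivity)
      simp only [hs]
      linarith
    · rintro σ - ⟨w, hw, rfl⟩
      rw [hl, h40] at hw
      refine .of (fun a ha => ?_) ?_ ?_ ?_
      · rw [hw.sc a ha, hs1]
        simp only [Config.setSweep, Config.set_sc, hy' a ha]
        split_ifs <;> first | rfl | omega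
      · rw [hw.label, hs1]; rfl
      · exact hw.sign.trans hy.sign
      · exact hw.coins.trans hy.coins

/-- The layers of a sweep that starts at node `i`. -/
def sweepLayers (D : ℕ) (fwd : Bool) (i : ℕ) : List ℕ :=
  if fwd then List.range' i (D - i) else (List.range i).reverse

/-- Passing the layers of a sweep that starts at the node whose number is in cell `26`. -/
def sweepProg (fwd : Bool) : Program := .block [
  .store (.lit 42) (if fwd then .var 7 - .var 26 else .var 26),
  .for 43 42 (.block [
    .store (.lit 44) (if fwd then .var 26 + .var 43 else .var 26 - 1 - .var 43),
    layerProg fwd,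
    nodeProg fwd])]

theorem abs_sweep_le (fwd fwd' : Bool) (ts : List ℕ) (hts : ∀ t ∈ ts, t < p.D)
    (s : SweepState m ℤ) : |(sweep p.W (p.ops fwd) fwd' p.w ts s).2.2| + 1 ≤
      2 ^ (3 * m * ts.length) * (|s.2.2| + 1) := by
  induction ts generalizing s with
  | nil => simp [sweep]
  | cons t ts ih =>
    refine (ih (fun t ht => hts t (by simp [ht])) _).trans ?_
    have h1 := p.abs_nodeStep_le fwd fwd' (layerStep p.W (p.ops fwd) t s)
    have h2 := p.abs_layerStep_le fwd (hts t (by simp)) s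
    have h3 := mul_le_mul_of_nonneg_left h2 (show (0 : ℤ) ≤ 2 ^ (2 * m) by positivity)
    rw [List.length_cons, show 3 * m * (ts.length + 1) = 3 * m * ts.length + (2 * m + m) by ring,
      pow_add, pow_add, mul_assoc ((2 : ℤ) ^ (3 * m * ts.length)), mul_assoc ((2 : ℤ) ^ (2 * m))]
    exact mul_le_mul_of_nonneg_left (h1.trans h3) (by positivity)

theorem length_sweepLayers {D i : ℕ} (hi : i ≤ D) (fwd : Bool) :
    (sweepLayers D fwd i).length = (if fwd then D - i else i) ∧
      (sweepLayers D fwd i).length ≤ D ∧ ∀ t ∈ sweepLayers D fwd i, t < D := by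
  cases fwd
  · refine ⟨by simp [sweepLayers], by simpa [sweepLayers] using hi, fun t ht => ?_⟩
    simp [sweepLayers] at ht
    omega
  · refine ⟨by simp [sweepLayers], by simp [sweepLayers], fun t ht => ?_⟩
    simp [sweepLayers, List.mem_range'_1] at ht
    omega

theorem getElem_sweepLayers {D i : ℕ} (fwd : Bool) (j : ℕ)
    (hj : j < (sweepLayers D fwd i).length) :
    ((sweepLayers D fwd i)[j] : ℤ) = if fwd then (i : ℤ) + j else i - 1 - j := by
  cases fwd
  · simp [sweepLayers] at hj ⊢
    omega
  · simp [sweepLayers]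

theorem sweep_take_succ {α : Type*} [Zero α] (W : ℕ → (Fin m × Fin 2 ≃ Fin (2 * m)))
    (o : SweepOps m α) (fwd : Bool) (w : ℕ) (ts : List ℕ) (x : SweepState m α) {j : ℕ}
    (hj : j < ts.length) : sweep W o fwd w (ts.take (j + 1)) x =
      nodeStep o fwd w (layerStep W o ts[j] (sweep W o fwd w (ts.take j) x)) := by
  rw [sweep, List.take_add_one, List.getElem?_eq_getElem hj, Option.toList_some, List.foldl_append]
  rfl

theorem runs_sweep (fwd : Bool) {x : Config (2 * m)} (hx : p.Consts x) {i : ℕ} (hi : i ≤ p.D)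
    (hxi : x.sc 26 = i) {z : ℕ} (hz : x.sc 41 = z)
    (hv : 2 ^ (3 * m * p.D) * (|x.sc 40| + 1) ≤ 2 ^ p.B) :
    Runs p.I p.B p.G (sweepProg fwd) x.st (Config.Near 42 (x.setSweep
      (sweep p.W (p.ops fwd) fwd p.w (sweepLayers p.D fwd i) (x.label, z, x.sc 40)))) := by
  obtain ⟨hlen, hlen', hlt⟩ := length_sweepLayers hi fwd
  set ts := sweepLayers p.D fwd i with hts
  set s : ℕ → SweepState m ℤ := fun j =>
    sweep p.W (p.ops fwd) fwd p.w (ts.take j) (x.label, z, x.sc 40) with hs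
  have hsl : s ts.length = sweep p.W (p.ops fwd) fwd p.w ts (x.label, z, x.sc 40) := by
    simp only [hs, List.take_length]
  rw [← hsl]
  refine .of_bdd fun hB => ?_
  have h7 := hB.abs_sc_lt (x := x) (show 7 < 100 by norm_num)
  rw [hx.cell_D, abs_of_nonneg (by positivity)] at h7
  have hD : ∀ k : ℕ, k ≤ p.D → |(k : ℤ)| < 2 ^ p.B := fun k hk => by
    rw [abs_of_nonneg (by positivity)]; omega
  refine .block_cons (.set (by norm_num) (z := (ts.length : ℤ)) ?_ (hD _ hlen') (.block_cons ?_))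
  · rw [hlen]
    cases fwd
    · simp [hxi]
    · simp [hxi, hx.cell_D, Nat.cast_sub hi]
  refine .forThen (fun j => (x.setSweep (s j)).set 42 ts.length) (by norm_num) (by norm_num)
    (hlen'.trans p.D_le) (fun j _ => by simp) (fun a ha => ?_) rfl rfl rfl (fun j hj y hy => ?_)
    fun y hy => .block_nil ?_
  · simp only [Config.setSweep, Config.set_sc, hs, List.take_zero, sweep, List.foldl_nil]
    split_ifs <;> simp_all
  · have hy' : ∀ a < 44, y.sc a = _ := hy.sc
    have hl : y.label = (s j).1 := hy.label
    have h40 : y.sc 40 = (s j).2.2 := by simp [hy', Config.setSweep]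
    have h41 : y.sc 41 = ((s j).2.1 : ℕ) := by simp [hy', Config.setSweep]
    have hcy : p.Consts y := hx.agree fun a ha => by
      rw [hy' a (by omega)]
      simp only [Config.setSweep, Config.set_sc]
      split_ifs <;> first | rfl | omega
    have htj := hlt _ (ts.getElem_mem hj)
    -- The bound for a whole sweep leaves room for the factor `2 ^ (3 * m)` by which the next layer
    -- can increase the value.
    have hbd : 2 ^ (3 * m) * (|(s j).2.2| + 1) ≤ 2 ^ p.B := by
      have h1 := p.abs_sweep_le fwd fwd (ts.take j) (fun t ht => hlt t (List.mem_of_mem_take ht))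
        (x.label, z, x.sc 40)
      rw [List.length_take, min_eq_left hj.le] at h1
      have h2 : (2 : ℤ) ^ (3 * m) * 2 ^ (3 * m * j) ≤ 2 ^ (3 * m * p.D) := by
        rw [← pow_add]
        refine pow_le_pow_right₀ (by norm_num) ?_
        calc 3 * m + 3 * m * j = 3 * m * (j + 1) := by ring
          _ ≤ _ := Nat.mul_le_mul_left _ (by omega)
      have h3 := mul_le_mul_of_nonneg_left h1 (show (0 : ℤ) ≤ 2 ^ (3 * m) by positivity)
      have h4 := mul_le_mul_of_nonneg_right h2 (show 0 ≤ |x.sc 40| + 1 by positivity)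
      simp only [hs]
      linarith
    refine .block_cons (.set (by norm_num) (z := (ts[j] : ℕ)) ?_ (hD _ htj.le) ?_)
    · simp only [hts]
      rw [getElem_sweepLayers]
      cases fwd <;> simp [hy', Config.setSweep, hxi]
    refine .block_cons ((p.runs_layer fwd (hcy.agree fun a ha => ?_) htj (z := (s j).2.1) ?_ ?_
      ?_).mono ?_)
    · have : a ≠ 44 := by omega
      simp [this]
    · simp
    · simp [h41]
    · simp only [Config.set_sc]
      norm_num
      rw [h40]
      refine le_trans (mul_le_mul_of_nonneg_right ?_ (by positivity)) hbd
      exact pow_le_pow_right₀ (by norm_num) (by omega)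
    rintro σ - ⟨w, hw, rfl⟩
    have hw' : ∀ a < 51, w.sc a = _ := hw.sc
    set s' := layerStep p.W (p.ops fwd) ts[j] (s j) with hs'
    have hsj : ((y.set 44 (ts[j] : ℕ)).label, (s j).2.1, (y.set 44 (ts[j] : ℕ)).sc 40) = s j := by
      simp [hl, h40]
    rw [hsj, ← hs'] at hw hw'
    have hwl : w.label = s'.1 := hw.label
    have hw40 : w.sc 40 = s'.2.2 := by simp [hw', Config.setSweep]
    refine .block_cons ((p.runs_node fwd (hcy.agree fun a ha => ?_) (z := s'.2.1) ?_ ?_).mono ?_)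
    · rw [hw' a (by omega)]
      simp only [Config.setSweep, Config.set_sc]
      split_ifs <;> first | rfl | omega
    · simp [hw', Config.setSweep]
    · rw [hw40]
      have h1 := p.abs_layerStep_le fwd htj (s j)
      have h2 := mul_le_mul_of_nonneg_left h1 (show (0 : ℤ) ≤ 2 ^ (2 * m) by positivity)
      rw [← mul_assoc, ← pow_add, show 2 * m + m = 3 * m by ring] at h2
      exact h2.trans hbd
    rintro σ - ⟨u, hu, rfl⟩
    have hs1 : s (j + 1) = nodeStep (p.ops fwd) fwd p.w s' := sweep_take_succ _ _ _ _ _ _ hj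
    rw [hwl, hw40, show ((s'.1, s'.2.1, s'.2.2) : SweepState m ℤ) = s' from rfl, ← hs1] at hu
    refine .block_nil (.of (fun a ha => ?_) hu.label ?_ ?_)
    · rw [hu.sc a (by omega)]
      simp only [Config.setSweep, Config.set_sc, hw' a (by omega), hy' a ha]
      split_ifs <;> first | rfl | omega
    · exact hu.sign.trans (hw.sign.trans hy.sign)
    · exact hu.coins.trans (hw.coins.trans hy.coins)
  · refine .of (fun a ha => ?_) hy.label hy.sign hy.coins
    rw [hy.sc a (by omega), Config.set_sc, if_neg (by omega)]

end Setting

/-! ### Contraction at the end of a sweep, and codes of strings in memory -/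

namespace Setting

variable (p : Setting m)

/-- Contracting the Pauli string at the end of a sweep. -/
def finishProg (fwd : Bool) : Program := .block [
  .for 42 0 (.cond (.label (.var 42))
    (.cond (.label (.var 42) - 3) (.store (.lit 40) 0)
      (.store (.lit 40) (if fwd then .sign (.var 42) * .var 40 else .var 40))) .skip),
  .cond (.var 41) (.store (.lit 40) 0) .skip]

theorem abs_finish_aux {z : Fin n → ℤ} (hz : ∀ i, |z i| ≤ 1) (A : PStr n) (l : List (Fin n))
    (v : ℤ) : |l.foldl (fun v j => if A j = 0 then v else if A j = 3 then z j • v else 0) v| ≤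
      |v| := by
  induction l generalizing v with
  | nil => simp
  | cons j l ih =>
    refine (ih _).trans ?_
    dsimp only
    split_ifs
    · rfl
    · rw [smul_eq_mul, abs_mul]; exact mul_le_of_le_one_left (abs_nonneg _) (hz j)
    · simp

theorem abs_finish_le {z : Fin (2 * m) → ℤ} (hz : ∀ i, |z i| ≤ 1) (s : SweepState m ℤ) :
    |finish z s| ≤ |s.2.2| := by
  rw [finish]
  split_ifs
  · exact abs_finish_aux hz _ _ _
  · simp

theorem label_ne_zero_iff (P : Fin 4) : ((P : ℕ) : ℤ) ≠ 0 ↔ P ≠ 0 := by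
  rw [Ne, Ne, Fin.ext_iff]; simp

/-- A forward sweep ends at the measurement and uses the stored signs. A backward sweep ends at the
all-zero initial state, where every sign is one. Unread digits annul the result. -/
theorem runs_finish (fwd : Bool) {x : Config (2 * m)} (hx : p.Consts x) {s : SweepState m ℤ}
    (hxs : x.label = s.1) (hx41 : x.sc 41 = (s.2.1 : ℕ)) (hx40 : x.sc 40 = s.2.2)
    (hz : ∀ i, |x.sign i| ≤ 1) (hv : |s.2.2| < 2 ^ p.B) :
    Runs p.I p.B p.G (finishProg fwd) x.st
      (Config.Near 41 (x.set 40 (finish (if fwd then x.sign else 1) s))) := by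
  set ζ : Fin (2 * m) → ℤ := if fwd then x.sign else 1 with hζ
  have hζ1 : ∀ i, |ζ i| ≤ 1 := by
    intro i; rw [hζ]; cases fwd <;> simp [hz i]
  set f : ℤ → Fin (2 * m) → ℤ := fun v j =>
    if s.1 j = 0 then v else if s.1 j = 3 then ζ j • v else 0 with hf
  set v : ℕ → ℤ := fun j => ((List.finRange (2 * m)).take j).foldl f s.2.2 with hvdef
  have hvB : ∀ j, |v j| < 2 ^ p.B := fun j => (abs_finish_aux hζ1 _ _ _).trans_lt hv
  refine .block_cons (.forThen (fun j => x.set 40 (v j)) (by norm_num) (by norm_num) p.m_le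
    (fun j _ => by simp [hx.cell_n]) (fun a _ => ?_) rfl rfl rfl (fun j hj y hy => ?_)
    fun y hy => ?_)
  · simp only [Config.set_sc, hvdef, List.take_zero, List.foldl_nil]
    split_ifs <;> simp_all
  · have hy' : ∀ a < 43, y.sc a = _ := hy.sc
    have hl : y.label = s.1 := hy.label.trans hxs
    have hval : (Expr.label (.var 42)).eval y.st.mem = ((s.1 ⟨j, hj⟩ : Fin 4) : ℕ) := by
      rw [Config.eval_label _ ⟨j, hj⟩ (by simp [hy']), hl]
    have hv1 : v (j + 1) = f (v j) ⟨j, hj⟩ := foldl_take_finRange_succ _ _ hj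
    have hdone : ∀ u : ℤ, u = v (j + 1) →
        Config.Near (42 + 1) ((x.set 40 (v (j + 1))).set 42 j) (y.set 40 u).st := by
      intro u hu
      refine .of (fun a ha => ?_) hy.label hy.sign hy.coins
      simp only [Config.set_sc, hy' a ha, hu]
      split_ifs <;> first | rfl | omega
    refine .cond (fun hc => ?_) fun hc => .skip ?_
    · rw [State.val, hval, label_ne_zero_iff] at hc
      simp only [hf, if_neg hc] at hv1
      refine .cond (fun hc' => ?_) fun hc' => ?_
      · have h3 : s.1 ⟨j, hj⟩ ≠ 3 := by
          intro h; simp [State.val, hval, h] at hc'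
        rw [if_neg h3] at hv1
        exact .set (by norm_num) (z := 0) (by rfl) (by simp) (hdone _ hv1.symm)
      · have h3 : s.1 ⟨j, hj⟩ = 3 := by
          have : ((s.1 ⟨j, hj⟩ : ℕ) : ℤ) - 3 = 0 := by simpa [State.val, hval] using hc'
          apply Fin.ext; simp; omega
        rw [if_pos h3, smul_eq_mul] at hv1
        refine .set (by norm_num) (z := v (j + 1)) ?_ (hvB _) (hdone _ rfl)
        rw [hv1, hζ]
        cases fwd
        · simp [hy']
        · have := Config.eval_sign y (e := .var 42) ⟨j, hj⟩ (by simp [hy'])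
          simp [hy', this, hy.sign]
    · rw [State.val, hval] at hc
      have h0 : s.1 ⟨j, hj⟩ = 0 := by apply Fin.ext; simpa using hc
      simp only [hf, if_pos h0] at hv1
      refine .of (fun a ha => ?_) hy.label hy.sign hy.coins
      rw [hy' a ha, hv1]
  · have hy' : ∀ a < 42, y.sc a = _ := hy.sc
    have e : v (2 * m) = (List.finRange (2 * m)).foldl f s.2.2 := foldl_take_finRange _ _
    refine .block_cons (.cond (fun hc => ?_) fun hc => .skip ?_)
    · have h0 : s.2.1 ≠ 0 := by simpa [State.val, hy', hx41] using hc
      refine .set (by norm_num) (z := 0) (by rfl) (by simp) (.block_nil ?_)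
      refine .of (fun a ha => ?_) hy.label hy.sign hy.coins
      simp only [Config.set_sc, hy' a (by omega), finish, if_neg h0]
      split_ifs <;> rfl
    · have h0 : s.2.1 = 0 := by simpa [State.val, hy', hx41] using hc
      refine .block_nil (.of (fun a ha => ?_) hy.label hy.sign hy.coins)
      rw [hy' a (by omega), finish, if_pos h0, e]

/-! ### Programs for codes of Pauli strings -/

/-- Setting all Pauli labels to zero. -/
def resetProg : Program := .for 41 0 (.store (100 + 2 * .var 41) 0)

theorem runs_reset {x : Config (2 * m)} (hx : p.Consts x) {Q : State → Prop}
    (hQ : ∀ y : Config (2 * m), y.Agree 41 { x with label := 0 } → Q y.st) :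
    Runs p.I p.B p.G resetProg x.st Q := by
  refine .forThen (fun j => { x with label := fun i => if (i : ℕ) < j then 0 else x.label i })
    (by norm_num) (by norm_num) p.m_le (fun j _ => by simp [hx.cell_n]) (fun a _ => rfl)
    (by simp) rfl rfl (fun j hj y hy => ?_) fun y hy => hQ y ⟨hy.sc, ?_, hy.sign, hy.coins⟩
  · have hy' : ∀ a < 42, y.sc a = _ := hy.sc
    refine .setLabel ⟨j, hj⟩ 0 (by simp [hy']) (by simp) (by have := p.B_ge; omega) ?_
    refine .of (fun a ha => hy' a ha) ?_ hy.sign hy.coins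
    funext i
    by_cases h : i = ⟨j, hj⟩
    · subst h; simp [Config.set]
    · have : (i : ℕ) ≠ j := fun h' => h (Fin.ext h')
      have h2 : (i : ℕ) ≤ j ↔ (i : ℕ) < j := by omega
      rw [Config.setLabel_label, Function.update_of_ne h, hy.label]
      simp [h2]
  · rw [hy.label]; funext i; simp

/-- Decoding the Pauli string whose code is in cell `27`. -/
def decodeProg : Program := .block [
  resetProg,
  .store (.lit 39) (.var 27),
  .for 41 8 (.block [
    .store (.lit 42) ((Expr.var 39).mod (4 * .var 0)),
    .store (.lit 39) (.var 39 / (4 * .var 0)),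
    .cond ((Expr.var 42).mod 4)
      (.store (100 + 2 * (.var 42 / 4)) ((Expr.var 42).mod 4)) .skip])]

theorem runs_decode {x : Config (2 * m)} (hx : p.Consts x) {z : ℕ} (hz : x.sc 27 = z)
    {Q : State → Prop}
    (hQ : ∀ y : Config (2 * m), y.Agree 39 { x with label := decode (2 * m) p.w z } → Q y.st) :
    Runs p.I p.B p.G decodeProg x.st Q := by
  refine .of_bdd fun hB => ?_
  have hz' := hB.abs_sc_lt (x := x) (show 27 < 100 by norm_num)
  rw [hz, abs_of_nonneg (by positivity)] at hz'
  have hpos : 0 < 4 * (2 * m) := by have := p.m_pos; omega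
  refine .block_cons (p.runs_reset hx fun y hy => ?_)
  have hy' : ∀ a < 41, y.sc a = x.sc a := hy.sc
  refine .block_cons (.set (by norm_num) (z := z) (by simp [hy', hz])
    (by rwa [abs_of_nonneg (by positivity)]) (.block_cons ?_))
  set s : ℕ → PStr (2 * m) × ℕ := fun j => (decodeStep (2 * m))^[j] (0, z) with hs
  have hsz : ∀ j, (s j).2 ≤ z := by
    intro j
    induction j with
    | zero => simp [hs]
    | succ j ih =>
      have : (s (j + 1)).2 = (s j).2 / (4 * (2 * m)) := by
        simp only [hs]; rw [Function.iterate_succ_apply']; rfl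
      rw [this]; exact (Nat.div_le_self _ _).trans ih
  have hsB : ∀ j, |((s j).2 : ℤ)| < 2 ^ p.B := fun j => by
    rw [abs_of_nonneg (by positivity)]
    have := hsz j
    omega
  refine .forThen (fun j => { x.set 39 (s j).2 with label := (s j).1 }) (by norm_num)
    (by norm_num) p.w_le (fun j _ => by simp [hx.cell_w]) (fun a ha => ?_) hy.label hy.sign
    hy.coins (fun j hj u hu => ?_) fun u hu => .block_nil (hQ u ⟨fun a ha => ?_, hu.label, hu.sign,
      hu.coins⟩)
  · simp only [Config.set_sc, hy' a ha]
    split_ifs <;> simp [hs]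
  · have hu' : ∀ a < 42, u.sc a = _ := hu.sc
    have hl : u.label = (s j).1 := hu.label
    have hs1 : s (j + 1) = decodeStep (2 * m) (s j) := Function.iterate_succ_apply' _ _ _
    set e := (s j).2 % (4 * (2 * m)) with he
    have hediv : e / 4 < 2 * m := by have := Nat.mod_lt (s j).2 hpos; omega
    have heB : |(e : ℤ)| < 2 ^ p.B := by
      rw [abs_of_nonneg (by positivity)]
      have h1 := Nat.mod_lt (s j).2 hpos
      have h2 := p.m_lt
      exact_mod_cast h1.trans h2
    have h39 : u.sc 39 = ((s j).2 : ℕ) := by simp [hu']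
    have h0 : u.sc 0 = (2 * m : ℕ) := by simp [hu', hx.cell_n]
    refine .block_cons (.set (by norm_num) (z := (e : ℕ)) ?_ heB ?_)
    · simp [h39, h0, he]
    refine .block_cons (.set (by norm_num) (z := ((s (j + 1)).2 : ℕ)) ?_ (hsB _) ?_)
    · simp [h39, h0, hs1, decodeStep]
    refine .block_cons (.cond (fun hc => ?_) fun hc => .skip (.block_nil ?_))
    · have hne : e % 4 ≠ 0 := by
        intro h
        apply hc
        simp only [State.val, Expr.eval_mod, Expr.eval_var, Expr.eval_ofNat]
        simp
        omega
      refine .setLabel ⟨e / 4, hediv⟩ ⟨e % 4, Nat.mod_lt _ (by norm_num)⟩ (by simp) (by simp)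
        (by have := p.B_ge; omega) (.block_nil (.of (fun a ha => ?_) ?_ hu.sign hu.coins))
      · simp only [Config.set_sc, Config.setLabel_sc, hu' a (by omega)]
        split_ifs <;> first | rfl | omega
      · simp only [Config.setLabel_label, Config.set_label, hl, hs1, decodeStep]
        rw [dif_pos ⟨hediv, hne⟩]
    · have hne : e % 4 = 0 := by
        simp [State.val] at hc
        omega
      refine .of (fun a ha => ?_) ?_ hu.sign hu.coins
      · simp only [Config.set_sc, hu' a (by omega)]
        split_ifs <;> first | rfl | omega
      · simp only [Config.set_label, hl, hs1, decodeStep]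
        rw [dif_neg (fun h => h.2 hne)]
  · rw [hu.sc a (by omega)]
    simp only [Config.set_sc]
    rw [if_neg (by omega)]

/-- Encoding the Pauli string. -/
def encodeProg : Program := .block [
  .store (.lit 28) 0,
  .for 29 0 (.cond (.label (.var 29))
    (.store (.lit 28) (.var 28 * (4 * .var 0) + 4 * .var 29 + .label (.var 29))) .skip)]

theorem runs_encode {x : Config (2 * m)} (hx : p.Consts x) (hw : wt x.label ≤ p.w)
    {Q : State → Prop}
    (hQ : ∀ y : Config (2 * m), y.Agree 29 (x.set 28 (encode x.label)) → Q y.st) :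
    Runs p.I p.B p.G encodeProg x.st Q := by
  refine .of_bdd fun hB => ?_
  -- The number `(4 * n) ^ w` sits in cell `10` and therefore fits; all partial codes of a string of
  -- weight at most `w` are smaller.
  have hpre := hB.abs_sc_lt (x := x) (show 10 < 100 by norm_num)
  rw [hx.prefixes, abs_of_nonneg (by positivity)] at hpre
  have hcB : ∀ j ≤ 2 * m, |(encodePrefix x.label j : ℤ)| < 2 ^ p.B := by
    intro j hj
    rw [abs_of_nonneg (by positivity)]
    refine lt_trans ?_ hpre
    have hmono : wtPrefix x.label j ≤ p.w := by
      refine le_trans ?_ hw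
      rw [← wtPrefix_self]
      refine Finset.card_le_card fun i hi => ?_
      simp only [Finset.mem_filter] at hi ⊢
      exact ⟨hi.1, i.2, hi.2.2⟩
    have := (encodePrefix_lt x.label hj).trans_le
      (Nat.pow_le_pow_right (by have := p.m_pos; omega) hmono)
    exact_mod_cast this
  refine .block_cons (.set (by norm_num) (z := 0) (by rfl) (by simp) (.block_cons ?_))
  refine .forThen (fun j => x.set 28 (encodePrefix x.label j)) (by norm_num) (by norm_num) p.m_le
    (fun j _ => by simp [hx.cell_n]) (fun a ha => ?_) rfl rfl rfl (fun j hj y hy => ?_)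
    fun y hy => .block_nil (hQ y ?_)
  · simp [encodePrefix]
  · have hy' : ∀ a < 30, y.sc a = _ := hy.sc
    have hl : y.label = x.label := hy.label
    have hval : (Expr.label (.var 29)).eval y.st.mem = ((x.label ⟨j, hj⟩ : Fin 4) : ℕ) := by
      rw [Config.eval_label _ ⟨j, hj⟩ (by simp [hy']), hl]
    have hc1 := encodePrefix_succ x.label hj
    refine .cond (fun hc => ?_) fun hc => .skip ?_
    · rw [State.val, hval, label_ne_zero_iff] at hc
      rw [if_neg hc] at hc1
      refine .set (by norm_num) (z := encodePrefix x.label (j + 1)) ?_ (hcB _ hj)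
        (.of (fun a ha => ?_) hl hy.sign hy.coins)
      · rw [hc1]; simp [hval, hy', hx.cell_n]
      · simp only [Config.set_sc, hy' a ha]
        split_ifs <;> first | rfl | omega
    · rw [State.val, hval] at hc
      have h0 : x.label ⟨j, hj⟩ = 0 := by apply Fin.ext; simpa using hc
      rw [if_pos h0] at hc1
      refine .of (fun a ha => ?_) hl hy.sign hy.coins
      rw [hy' a ha, hc1]
  · rwa [encodePrefix_self] at hy

end Setting

namespace Setting

variable (p : Setting m)

/-! ### Programs for marginals -/

/-- The contribution of one code to a sum over sweeps. -/
def term (fwd : Bool) (z : Fin (2 * m) → ℤ) (i : ℕ) (A : PStr (2 * m)) (c : ℕ) : ℤ :=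
  finish (if fwd then z else 1) (sweep p.W (p.ops fwd) fwd p.w (sweepLayers p.D fwd i)
    (A, c, if fwd then dampAll A (p.ops fwd).damp (2 ^ p.K) else 2 ^ p.K))

/-- The sum over all sweeps with a given initial Pauli string. -/
def total (fwd : Bool) (z : Fin (2 * m) → ℤ) (i : ℕ) (A : PStr (2 * m)) : ℤ :=
  ∑ c ∈ Finset.range (16 ^ p.L), p.term fwd z i A c

theorem abs_start_le (fwd : Bool) (A : PStr (2 * m)) :
    |if fwd then dampAll A (p.ops fwd).damp (2 ^ p.K) else 2 ^ p.K| + 1 ≤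
      2 ^ (2 * m) * (2 ^ p.K + 1) := by
  have h0 : (0 : ℤ) < 2 ^ p.K := by positivity
  cases fwd
  · have h1 : (1 : ℤ) ≤ 2 ^ (2 * m) := one_le_pow₀ (by norm_num)
    simp only [Bool.false_eq_true, if_false, abs_of_pos h0]
    nlinarith
  · have := abs_foldl_le (f := fun v (j : Fin (2 * m)) => if A j = 0 then v else (p.ops true).damp v)
      (fun v j => by
        split_ifs
        · linarith [abs_nonneg v]
        · exact p.abs_damp_le true v) (List.finRange (2 * m)) (2 ^ p.K)
    rw [List.length_finRange, abs_of_pos h0] at this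
    exact this

/-- At most `2 * m` doublings at the pivot and `3 * m` per layer, which `sweepLen` dominates. -/
theorem abs_end_le (fwd : Bool) {i : ℕ} (hi : i ≤ p.D) (A : PStr (2 * m)) (c : ℕ) :
    |(sweep p.W (p.ops fwd) fwd p.w (sweepLayers p.D fwd i)
      (A, c, if fwd then dampAll A (p.ops fwd).damp (2 ^ p.K) else 2 ^ p.K)).2.2| + 1 ≤
      p.bound := by
  obtain ⟨-, h1, h2⟩ := length_sweepLayers hi fwd
  refine (p.abs_sweep_le fwd fwd _ h2 _).trans ?_
  have h3 := p.abs_start_le fwd A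
  have h4 : (2 : ℤ) ^ (3 * m * (sweepLayers p.D fwd i).length) ≤ 2 ^ (3 * m * p.D) :=
    pow_le_pow_right₀ (by norm_num) (Nat.mul_le_mul_left _ h1)
  have h5 : (2 : ℤ) ^ (3 * m * p.D) * 2 ^ (2 * m) ≤ 2 ^ sweepLen m p.D := by
    rw [← pow_add]
    refine pow_le_pow_right₀ (by norm_num) ?_
    rw [sweepLen]; ring_nf; omega
  calc _ ≤ 2 ^ (3 * m * p.D) * (2 ^ (2 * m) * (2 ^ p.K + 1)) :=
        mul_le_mul h4 h3 (by positivity) (by positivity)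
    _ = 2 ^ (3 * m * p.D) * 2 ^ (2 * m) * (2 ^ p.K + 1) := by ring
    _ ≤ _ := mul_le_mul_of_nonneg_right h5 (by positivity)

theorem abs_term_le (fwd : Bool) {z : Fin (2 * m) → ℤ} (hz : ∀ j, |z j| ≤ 1) {i : ℕ}
    (hi : i ≤ p.D) (A : PStr (2 * m)) (c : ℕ) : |p.term fwd z i A c| ≤ p.bound := by
  have h := p.abs_end_le fwd hi A c
  refine (abs_finish_le (fun j => ?_) _).trans (by linarith)
  cases fwd <;> simp [hz j]

theorem abs_partial_total_le (fwd : Bool) {z : Fin (2 * m) → ℤ} (hz : ∀ j, |z j| ≤ 1) {i : ℕ}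
    (hi : i ≤ p.D) (A : PStr (2 * m)) {k : ℕ} (hk : k ≤ 16 ^ p.L) :
    |∑ c ∈ Finset.range k, p.term fwd z i A c| ≤ 16 ^ p.L * p.bound := by
  refine (Finset.abs_sum_le_sum_abs _ _).trans
    ((Finset.sum_le_card_nsmul _ _ _ fun c _ => p.abs_term_le fwd hz hi A c).trans ?_)
  rw [Finset.card_range, nsmul_eq_mul]
  have := p.one_le_bound
  exact mul_le_mul_of_nonneg_right (by exact_mod_cast hk) (by linarith)

/-- Adding up the results of all sweeps in cell `36`. -/
def sumProg (fwd : Bool) : Program := .block [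
  .store (.lit 36) 0,
  .for 37 11 (.block [
    .store (.lit 41) (.var 37),
    .store (.lit 40) (.var 6),
    if fwd then noiseProg else .skip,
    sweepProg fwd,
    finishProg fwd,
    .store (.lit 36) (.var 36 + .var 40),
    decodeProg])]

/-- A sweep overwrites the Pauli string, so the pivot is decoded afresh from its code after each
sweep. Only forward sweeps damp the pivot, which is how its noise is counted once. -/
theorem runs_sum (fwd : Bool) {x : Config (2 * m)} (hx : p.Consts x) {i : ℕ} (hi : i ≤ p.D)
    (hxi : x.sc 26 = i) {z₁ : ℕ} (hz₁ : x.sc 27 = z₁) (hl : x.label = decode (2 * m) p.w z₁)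
    (hz : ∀ j, |x.sign j| ≤ 1) {Q : State → Prop}
    (hQ : ∀ y : Config (2 * m), y.Agree 37 (x.set 36 (p.total fwd x.sign i x.label)) → Q y.st) :
    Runs p.I p.B p.G (sumProg fwd) x.st Q := by
  set T : ℕ → ℤ := fun k => ∑ c ∈ Finset.range k, p.term fwd x.sign i x.label c with hT
  refine .of_bdd fun hB => ?_
  have hcodes := hB.abs_sc_lt (x := x) (show 11 < 100 by norm_num)
  rw [hx.codes, abs_of_nonneg (by positivity)] at hcodes
  refine .block_cons (.set (by norm_num) (z := 0) (by rfl) (by simp) (.block_cons ?_))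
  refine .forThen (fun j => x.set 36 (T j)) (by norm_num) (by norm_num) p.codes_le
    (fun j _ => by simp [hx.codes]) (fun a ha => by simp [hT]) rfl rfl rfl (fun c hc y hy => ?_)
    fun y hy => .block_nil (hQ y hy)
  have hy' : ∀ a < 38, y.sc a = _ := hy.sc
  have hyl : y.label = x.label := hy.label
  have hys : y.sign = x.sign := hy.sign
  have hcB : |(c : ℤ)| < 2 ^ p.B := by
    rw [abs_of_nonneg (by positivity)]
    refine lt_of_le_of_lt ?_ hcodes
    exact_mod_cast hc.le
  have hPK : |(2 : ℤ) ^ p.K| < 2 ^ p.B := by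
    rw [abs_of_pos (by positivity)]
    linarith [p.PK_lt_bound, p.bound_lt]
  set v₀ : ℤ := if fwd then dampAll x.label (p.ops fwd).damp (2 ^ p.K) else 2 ^ p.K with hv₀
  set s := sweep p.W (p.ops fwd) fwd p.w (sweepLayers p.D fwd i) (x.label, c, v₀) with hs
  have hbound : |s.2.2| + 1 ≤ p.bound := p.abs_end_le fwd hi x.label c
  have hstart : |v₀| + 1 ≤ 2 ^ (2 * m) * (2 ^ p.K + 1) := p.abs_start_le fwd x.label
  have hterm : finish (if fwd then x.sign else 1) s = p.term fwd x.sign i x.label c := rfl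
  have hconst : ∀ u : Config (2 * m), (∀ a < 36, u.sc a = x.sc a) → p.Consts u :=
    fun u hu => hx.agree fun a ha => hu a (by omega)
  refine .block_cons (.set (by norm_num) (z := c) (by simp [hy']) hcB ?_)
  refine .block_cons (.set (by norm_num) (z := 2 ^ p.K) (by simp [hy', hx.cell_PK]) hPK ?_)
  set y₁ := (y.set 41 c).set 40 (2 ^ p.K) with hy₁
  have hnoise : Runs p.I p.B p.G (if fwd then noiseProg else .skip) y₁.st fun σ =>
      ∃ u : Config (2 * m), u.Agree 45 (y₁.set 40 v₀) ∧ σ = u.st := by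
    cases fwd
    · refine .skip ⟨y₁, ⟨fun a ha => ?_, rfl, rfl, rfl⟩, rfl⟩
      simp only [hv₀, Bool.false_eq_true, if_false, Config.set_sc]
      split_ifs with h
      · subst h; simp [hy₁]
      · rfl
    · simp only [if_true]
      refine (p.runs_noise true (hconst _ fun a ha => ?_) ?_).mono ?_
      · have h1 : a ≠ 40 := by omega
        have h2 : a ≠ 41 := by omega
        have h3 : a ≠ 36 := by omega
        have h4 : a ≠ 37 := by omega
        simp [hy₁, h1, h2, h3, h4, hy' a (by omega)]
      · simp only [hy₁, Config.set_sc, if_true]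
        rw [abs_of_pos (by positivity : (0 : ℤ) < 2 ^ p.K)]
        have h5 : (2 : ℤ) ^ (2 * m) ≤ 2 ^ sweepLen m p.D :=
          pow_le_pow_right₀ (by norm_num) (by rw [sweepLen]; nlinarith [p.D_pos])
        have h6 := p.bound_lt
        rw [bound] at h6
        have h7 : (0 : ℤ) ≤ 2 ^ p.K + 1 := by positivity
        nlinarith [mul_le_mul_of_nonneg_right h5 h7]
      · rintro σ - ⟨u, hu, rfl⟩
        refine ⟨u, ⟨fun a ha => ?_, hu.label, hu.sign, hu.coins⟩, rfl⟩
        rw [hu.sc a (by omega)]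
        have h1 : a ≠ 45 := by omega
        simp [h1, hy₁, hyl, hv₀]
  refine .block_cons (hnoise.mono ?_)
  rintro σ - ⟨u, hu, rfl⟩
  have hu' : ∀ a < 45, u.sc a = _ := hu.sc
  have hul : u.label = x.label := hu.label.trans hyl
  have hlow : ∀ a < 36, y₁.sc a = x.sc a := fun a ha => by
    have h1 : a ≠ 40 := by omega
    have h2 : a ≠ 41 := by omega
    have h3 : a ≠ 36 := by omega
    have h4 : a ≠ 37 := by omega
    simp [hy₁, h1, h2, h3, h4, hy' a (by omega)]
  have hulow : ∀ a < 36, u.sc a = x.sc a := fun a ha => by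
    have h1 : a ≠ 40 := by omega
    rw [hu' a (by omega), Config.set_sc, if_neg h1, hlow a ha]
  have hu40 : u.sc 40 = v₀ := by simp [hu']
  refine .block_cons ((p.runs_sweep fwd (hconst _ hulow) hi (by rw [hulow 26 (by norm_num), hxi])
    (z := c) (by simp [hu', hy₁]) ?_).mono ?_)
  · rw [hu40]
    have h1 := mul_le_mul_of_nonneg_left hstart (show (0 : ℤ) ≤ 2 ^ (3 * m * p.D) by positivity)
    have h5 : (2 : ℤ) ^ (3 * m * p.D) * 2 ^ (2 * m) ≤ 2 ^ sweepLen m p.D := by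
      rw [← pow_add]
      refine pow_le_pow_right₀ (by norm_num) ?_
      rw [sweepLen]; ring_nf; omega
    have h6 := p.bound_lt
    rw [bound] at h6
    have h7 := mul_le_mul_of_nonneg_right h5 (show (0 : ℤ) ≤ 2 ^ p.K + 1 by positivity)
    linarith
  rintro σ - ⟨w, hw, rfl⟩
  rw [hul, hu40, ← hs] at hw
  have hw' : ∀ a < 42, w.sc a = _ := hw.sc
  have hws : w.sign = x.sign := hw.sign.trans (hu.sign.trans hys)
  have hwlow : ∀ a < 36, w.sc a = x.sc a := fun a ha => by
    have h1 : a ≠ 40 := by omega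
    have h2 : a ≠ 41 := by omega
    rw [hw' a (by omega)]
    simp [Config.setSweep, h1, h2, hulow a ha]
  refine .block_cons ((p.runs_finish fwd (hconst _ hwlow) (s := s) hw.label
    (by simp [hw', Config.setSweep]) (by simp [hw', Config.setSweep]) (by rwa [hws])
    (by linarith [p.bound_lt])).mono ?_)
  rintro σ - ⟨q, hq, rfl⟩
  rw [hws, hterm] at hq
  have hq' : ∀ a < 41, q.sc a = _ := hq.sc
  have hT1 : T (c + 1) = T c + p.term fwd x.sign i x.label c := Finset.sum_range_succ _ _
  have hqlow : ∀ a < 36, q.sc a = x.sc a := fun a ha => by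
    have h1 : a ≠ 40 := by omega
    rw [hq' a (by omega), Config.set_sc, if_neg h1, hwlow a ha]
  refine .block_cons (.set (by norm_num) (z := T (c + 1)) ?_ ?_ ?_)
  · simp [hq', hw', hu', hy₁, hy', Config.setSweep, hT1]
  · exact (p.abs_partial_total_le fwd hz hi x.label hc).trans_lt p.sum_lt
  refine .block_cons (p.runs_decode (z := z₁) (hconst _ fun a ha => ?_) ?_ fun r hr =>
    .block_nil (.of (fun a ha => ?_) (hr.label.trans hl.symm) ?_ ?_))
  · have h1 : a ≠ 36 := by omega
    simp [h1, hqlow a ha]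
  · simp [hqlow 27, hz₁]
  · rw [hr.sc a (by omega)]
    have h1 : a ≠ 40 := by omega
    have h2 : a ≠ 41 := by omega
    simp only [Config.set_sc, hq' a (by omega), hw' a (by omega), hu' a (by omega), hy₁,
      hy' a (by omega), Config.setSweep, h1, h2, if_false]
    split_ifs <;> first | rfl | omega
  · exact hr.sign.trans (hq.sign.trans hws)
  · exact hr.coins.trans (hq.coins.trans (hw.coins.trans (hu.coins.trans hy.coins)))

/-- Computing the marginal for the partial assignment of signs in the second array. -/
def marginalProg : Program := .cond (.less (.var 4) (.var 7))
  (.store (.lit 25) (.var 6 * .var 6))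
  (.block [
    .store (.lit 25) 0,
    .for 26 7 (.for 27 10 (.block [
      decodeProg,
      encodeProg,
      .cond (.var 28 - .var 27) .skip (.block [
        sumProg true,
        .store (.lit 30) (.var 36),
        sumProg false,
        .store (.lit 25) (.var 25 + .var 30 * .var 36)]),
      resetProg]))])

/-- The result of the computation of a marginal. -/
def marginal (z : Fin (2 * m) → ℤ) : ℤ :=
  if p.L < p.D then 2 ^ p.K * 2 ^ p.K
  else marginalInt p.W (p.ops true) (p.ops false) (2 ^ p.K) p.L p.w p.D z

/-- Every number below `(4 * n) ^ w` is tried as the code of a pivot and skipped unless it is the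
canonical one. The labels are reset in between, so that each pass starts from the same state. -/
theorem runs_marginal {x : Config (2 * m)} (hx : p.Consts x) (hl : x.label = 0)
    (hz : ∀ j, |x.sign j| ≤ 1) {Q : State → Prop}
    (hQ : ∀ y : Config (2 * m), y.Agree 26 (x.set 25 (p.marginal x.sign)) → Q y.st) :
    Runs p.I p.B p.G marginalProg x.st Q := by
  set M := (4 * (2 * m)) ^ p.w with hM
  set X := 16 ^ p.L * p.bound with hX
  have hX0 : 0 ≤ X := by have := p.one_le_bound; positivity
  set τ : ℕ → ℕ → ℤ := fun i z₁ => if encode (decode (2 * m) p.w z₁) = z₁ then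
    p.total true x.sign i (decode (2 * m) p.w z₁) * p.total false x.sign i (decode (2 * m) p.w z₁)
    else 0 with hτ
  have hτb : ∀ i ≤ p.D, ∀ z₁, |τ i z₁| ≤ X ^ 2 := by
    intro i hi z₁
    simp only [hτ]
    split_ifs
    · rw [abs_mul, pow_two]
      exact mul_le_mul (p.abs_partial_total_le true hz hi _ le_rfl)
        (p.abs_partial_total_le false hz hi _ le_rfl) (abs_nonneg _) hX0
    · simp; positivity
  set R : ℕ → ℤ := fun i => ∑ i' ∈ Finset.range i, ∑ z₁ ∈ Finset.range M, τ i' z₁ with hR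
  have hpart : ∀ i < p.D, ∀ k ≤ M, |∑ z₁ ∈ Finset.range k, τ i z₁| ≤ k * X ^ 2 := by
    intro i hi k _
    refine (Finset.abs_sum_le_sum_abs _ _).trans
      ((Finset.sum_le_card_nsmul _ _ _ fun c _ => hτb i hi.le c).trans ?_)
    rw [Finset.card_range, nsmul_eq_mul]
  have hRb : ∀ i ≤ p.D, |R i| ≤ i * (M * X ^ 2) := by
    intro i hi
    refine (Finset.abs_sum_le_sum_abs _ _).trans
      ((Finset.sum_le_card_nsmul _ _ (M * X ^ 2) fun i' hi' => ?_).trans ?_)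
    · exact hpart i' (by have := Finset.mem_range.1 hi'; omega) M le_rfl
    · rw [Finset.card_range, nsmul_eq_mul]
  -- Every partial result must fit into a cell, so the a priori bound is needed inside both nested
  -- sums.
  have hsmall : ∀ i < p.D, ∀ k ≤ M, |R i + ∑ z₁ ∈ Finset.range k, τ i z₁| < 2 ^ p.B := by
    intro i hi k hk
    have h1 := hRb i hi.le
    have h2 := hpart i hi k hk
    have h3 : (k : ℤ) * X ^ 2 ≤ M * X ^ 2 :=
      mul_le_mul_of_nonneg_right (by exact_mod_cast hk) (by positivity)
    have h4 : ((i : ℤ) + 1) * (M * X ^ 2) ≤ p.D * (M * X ^ 2) :=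
      mul_le_mul_of_nonneg_right (by exact_mod_cast hi) (by positivity)
    have h5 := p.sq_bound_lt
    rw [← hX] at h5
    have h6 : (p.D : ℤ) * (M * X ^ 2) < 2 ^ p.B := by
      refine lt_of_eq_of_lt ?_ h5
      rw [hM]; push_cast; ring
    have := abs_add_le (R i) (∑ z₁ ∈ Finset.range k, τ i z₁)
    linarith
  have hmono : ∀ y : Config (2 * m), (∀ a < 25, y.sc a = x.sc a) → p.Consts y :=
    fun y hy => hx.agree fun a ha => hy a (by omega)
  -- If `L < D` the result is that of the trivial path alone, namely `1` at the scale `2 ^ K * 2 ^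
  -- K`.
  refine .cond (fun hc => ?_) fun hc => ?_
  · have hLD : p.L < p.D := by
      simpa [State.val, hx.cell_L, hx.cell_D] using hc
    refine .set (by norm_num) (z := 2 ^ p.K * 2 ^ p.K) (by simp [hx.cell_PK]) ?_ (hQ _ ?_)
    · rw [abs_of_pos (by positivity)]
      have h1 := p.PK_lt_bound
      have h2 := p.sum_sq_lt
      have h3 : (1 : ℤ) ≤ 16 ^ p.L := one_le_pow₀ (by norm_num)
      have h4 : (2 : ℤ) ^ p.K ≤ X := by nlinarith [p.one_le_bound]
      have h5 : (2 : ℤ) ^ p.K * 2 ^ p.K ≤ X * X := mul_le_mul h4 h4 (by positivity) hX0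
      linarith [pow_two X]
    · rw [marginal, if_pos hLD]
      exact ⟨fun _ _ => rfl, rfl, rfl, rfl⟩
  have hLD : ¬ p.L < p.D := by
    simpa [State.val, hx.cell_L, hx.cell_D] using hc
  have hfin : p.marginal x.sign = R p.D := by
    rw [marginal, if_neg hLD]; rfl
  rw [hfin] at hQ
  refine .block_cons (.set (by norm_num) (z := 0) (by rfl) (by simp) (.block_cons ?_))
  refine .forThen (fun i => x.set 25 (R i)) (by norm_num) (by norm_num) p.D_le
    (fun j _ => by simp [hx.cell_D]) (fun a ha => by simp [hR]) rfl rfl rfl (fun i hi y hy => ?_)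
    fun y hy => .block_nil (hQ y hy)
  have hy' : ∀ a < 27, y.sc a = _ := hy.sc
  refine .forThen (fun k => (x.set 25 (R i + ∑ z₁ ∈ Finset.range k, τ i z₁)).set 26 i)
    (by norm_num) (by norm_num) p.prefixes_le (fun j _ => by simp [hx.prefixes])
    (fun a ha => by simp [hy' a ha]) hy.label hy.sign hy.coins (fun k hk u hu => ?_) fun u hu => ?_
  · have hu' : ∀ a < 28, u.sc a = _ := hu.sc
    have hus : u.sign = x.sign := hu.sign
    set A := decode (2 * m) p.w k with hA
    have hucl : ∀ a < 25, u.sc a = x.sc a := fun a ha => by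
      have h1 : a ≠ 25 := by omega
      have h2 : a ≠ 26 := by omega
      have h3 : a ≠ 27 := by omega
      simp [hu' a (by omega), h1, h2, h3]
    refine .block_cons (p.runs_decode (hmono _ hucl) (z := k) (by simp [hu']) fun w hw => ?_)
    have hw' : ∀ a < 39, w.sc a = u.sc a := hw.sc
    have hwl : w.label = A := hw.label
    have hwcl : ∀ a < 25, w.sc a = x.sc a := fun a ha => by
      rw [hw' a (by omega), hucl a ha]
    refine .block_cons (p.runs_encode (hmono _ hwcl) (by rw [hwl]; exact wt_decode_le _ _)
      fun q hq => ?_)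
    rw [hwl] at hq
    have hq' : ∀ a < 29, q.sc a = _ := hq.sc
    have hql : q.label = A := hq.label.trans hwl
    have hqs : q.sign = x.sign := hq.sign.trans (hw.sign.trans hus)
    have hqc : q.coins = x.coins := hq.coins.trans (hw.coins.trans hu.coins)
    have hq28 : q.sc 28 = encode A := by simp [hq']
    have hqu : ∀ a < 28, q.sc a = u.sc a := fun a ha => by
      rw [hq' a (by omega), Config.set_sc, if_neg (by omega), hw' a (by omega)]
    have hqcl : ∀ a < 25, q.sc a = x.sc a := fun a ha => by
      rw [hqu a (by omega), hucl a ha]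
    have hq27 : q.sc 27 = k := by simp [hqu, hu']
    have hq26 : q.sc 26 = i := by simp [hqu, hu']
    have hq25 : q.sc 25 = R i + ∑ z₁ ∈ Finset.range k, τ i z₁ := by simp [hqu, hu']
    have hsum : R i + ∑ z₁ ∈ Finset.range (k + 1), τ i z₁ =
        R i + ∑ z₁ ∈ Finset.range k, τ i z₁ + τ i k := by
      rw [Finset.sum_range_succ, add_assoc]
    have hlast : ∀ r : Config (2 * m), (∀ a < 28, r.sc a =
        (q.set 25 (R i + ∑ z₁ ∈ Finset.range (k + 1), τ i z₁)).sc a) → r.sign = x.sign →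
        r.coins = x.coins → Runs p.I p.B p.G (.block [resetProg]) r.st (Config.Near (27 + 1)
          (((x.set 25 (R i + ∑ z₁ ∈ Finset.range (k + 1), τ i z₁)).set 26 i).set 27 k)) := by
      intro r hr hrs hrc
      refine .block_cons (p.runs_reset (hmono _ fun a ha => ?_) fun e he => .block_nil
        (.of (fun a ha => ?_) (he.label.trans hl.symm) (he.sign.trans hrs) (he.coins.trans hrc)))
      · rw [hr a (by omega), Config.set_sc, if_neg (by omega), hqcl a ha]
      · have h1 : e.sc a = r.sc a := he.sc a (by omega)
        rw [h1, hr a (by omega)]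
        simp only [Config.set_sc, hqu a (by omega), hu' a (by omega)]
        split_ifs <;> first | rfl | omega
    refine .block_cons (.cond (fun hc => .skip (hlast q (fun a ha => ?_) hqs hqc)) fun hc => ?_)
    · have hne : encode A ≠ k := by
        intro h
        apply hc
        simp [State.val, hq28, hq27, h]
      have h0 : τ i k = 0 := if_neg hne
      rw [hsum, h0, add_zero, Config.set_sc]
      split_ifs with h
      · rw [h, hq25]
      · rfl
    · have heq : encode A = k := by
        have : (encode A : ℤ) - k = 0 := by simpa [State.val, hq28, hq27] using hc
        omega
      have hτk : τ i k = p.total true x.sign i A * p.total false x.sign i A := if_pos heq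
      refine .block_cons (p.runs_sum true (hmono _ hqcl) hi.le hq26 hq27 hql (by rwa [hqs])
        fun e he => ?_)
      rw [hqs, hql] at he
      have he' : ∀ a < 37, e.sc a = _ := he.sc
      refine .block_cons (.set (by norm_num) (z := p.total true x.sign i A) (by simp [he'])
        ((p.abs_partial_total_le true hz hi.le _ le_rfl).trans_lt p.sum_lt) ?_)
      have hel : ∀ a < 30, (e.set 30 (p.total true x.sign i A)).sc a = q.sc a := fun a ha => by
        have h1 : a ≠ 30 := by omega
        have h2 : a ≠ 36 := by omega
        simp [h1, h2, he' a (by omega)]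
      refine .block_cons (p.runs_sum false (x := e.set 30 (p.total true x.sign i A))
        (hmono _ fun a ha => by rw [hel a (by omega), hqcl a ha]) hi.le
        (by rw [hel 26 (by norm_num), hq26]) (by rw [hel 27 (by norm_num), hq27])
        (he.label.trans hql) (by rw [Config.set_sign, he.sign, Config.set_sign, hqs]; exact hz)
        fun f hf => ?_)
      have hes : e.sign = x.sign := he.sign.trans hqs
      have hela : e.label = A := he.label.trans hql
      rw [Config.set_sign, Config.set_label, hes, hela] at hf
      have hf' : ∀ a < 37, f.sc a = _ := hf.sc
      refine .block_cons (.set (by norm_num)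
        (z := R i + ∑ z₁ ∈ Finset.range (k + 1), τ i z₁) ?_ (hsmall i hi _ hk) (.block_nil
          (hlast _ (fun a ha => ?_) (hf.sign.trans hes)
            (hf.coins.trans (he.coins.trans hqc)))))
      · rw [hsum, hτk]
        simp [hf', he', hq25]
      · have h1 : a ≠ 30 := by omega
        have h2 : a ≠ 36 := by omega
        simp [hf' a (by omega), h1, h2, he' a (by omega)]
  · refine .of (fun a ha => ?_) hu.label hu.sign hu.coins
    have h1 : R (i + 1) = R i + ∑ z₁ ∈ Finset.range M, τ i z₁ := Finset.sum_range_succ _ _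
    rw [hu.sc a ha, h1]

end Setting

/-! ### Sampling bit by bit -/

/-- The integer whose binary digits are the first `j` coins. -/
def coinInt (ω : ℕ → Bool) : ℕ → ℕ
  | 0 => 0
  | j + 1 => 2 * coinInt ω j + (ω j).toNat

theorem coinInt_lt (ω : ℕ → Bool) (j : ℕ) : coinInt ω j < 2 ^ j := by
  induction j with
  | zero => simp [coinInt]
  | succ j ih =>
    have := Bool.toNat_le (ω j)
    rw [coinInt, pow_succ]; omega

/-- The sampling of one more bit: the signs of the bits that have been chosen, and the coins. -/
def sampleStep (K : ℕ) (M : (Fin n → ℤ) → ℤ) (s : (Fin n → ℤ) × (ℕ → Bool)) (j : Fin n) :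
    (Fin n → ℤ) × (ℕ → Bool) :=
  (Function.update s.1 j
    (if coinInt s.2 K * (M (Function.update s.1 j 1) + M (Function.update s.1 j (-1))) <
      2 ^ K * M (Function.update s.1 j 1) then 1 else -1), fun i => s.2 (i + K))

/-- The state of the sampling after `j` bits. -/
def sampleState (K : ℕ) (M : (Fin n → ℤ) → ℤ) (ω : ℕ → Bool) (j : ℕ) :
    (Fin n → ℤ) × (ℕ → Bool) :=
  ((List.finRange n).take j).foldl (sampleStep K M) (0, ω)

theorem sampleState_succ (K : ℕ) (M : (Fin n → ℤ) → ℤ) (ω : ℕ → Bool) {j : ℕ} (hj : j < n) :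
    sampleState K M ω (j + 1) = sampleStep K M (sampleState K M ω j) ⟨j, hj⟩ :=
  foldl_take_finRange_succ _ _ hj

theorem abs_sampleState_le (K : ℕ) (M : (Fin n → ℤ) → ℤ) (ω : ℕ → Bool) {j : ℕ} (hj : j ≤ n)
    (i : Fin n) : |(sampleState K M ω j).1 i| ≤ 1 := by
  induction j with
  | zero => simp [sampleState]
  | succ j ih =>
    rw [sampleState_succ K M ω hj, sampleStep]
    by_cases h : i = ⟨j, hj⟩
    · subst h
      simp only [Function.update_self]
      split_ifs <;> simp
    · simp only [Function.update_of_ne h]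
      exact ih (by omega)

/-- The bits encoded by signs. -/
def signBits (z : Fin n → ℤ) : Bits n := fun i => if z i = -1 then 1 else 0

/-- The number with the given first `j` binary digits. -/
def packBits (x : Bits n) (j : ℕ) : ℕ := ∑ i : Fin n, if (i : ℕ) < j then (x i : ℕ) * 2 ^ (i : ℕ) else 0

theorem packBits_succ (x : Bits n) {j : ℕ} (hj : j < n) :
    packBits x (j + 1) = packBits x j + (x ⟨j, hj⟩ : ℕ) * 2 ^ j := by
  have h : ∀ i : Fin n, (if (i : ℕ) < j + 1 then (x i : ℕ) * 2 ^ (i : ℕ) else 0) =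
      (if (i : ℕ) < j then (x i : ℕ) * 2 ^ (i : ℕ) else 0) +
        if i = ⟨j, hj⟩ then (x i : ℕ) * 2 ^ (i : ℕ) else 0 := by
    intro i
    by_cases h : i = ⟨j, hj⟩
    · subst h; simp
    · have : (i : ℕ) ≠ j := fun h' => h (Fin.ext h')
      have h2 : (i : ℕ) ≤ j ↔ (i : ℕ) < j := by omega
      simp [h, h2, Order.lt_add_one_iff]
  rw [packBits, Finset.sum_congr rfl fun i _ => h i, Finset.sum_add_distrib]
  simp [packBits]

theorem packBits_lt (x : Bits n) {j : ℕ} (hj : j ≤ n) : packBits x j < 2 ^ j := by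
  induction j with
  | zero => simp [packBits]
  | succ j ih =>
    have h1 := ih (by omega)
    have h2 := (x ⟨j, hj⟩).2
    have h3 : (x ⟨j, hj⟩ : ℕ) * 2 ^ j ≤ 1 * 2 ^ j := Nat.mul_le_mul_right _ (by omega)
    rw [packBits_succ x hj, pow_succ]; omega

theorem packBits_congr {x y : Bits n} {j : ℕ} (h : ∀ i : Fin n, (i : ℕ) < j → x i = y i) :
    packBits x j = packBits y j :=
  Finset.sum_congr rfl fun i _ => by
    split_ifs with hi
    · rw [h i hi]
    · rfl

/-- The output belongs into the first cells, which hold constants and scratch values until the end.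
Meanwhile the sampled bits are packed into one integer, and this recovers them. -/
theorem packBits_digit (x : Bits n) {j : ℕ} (hj : j ≤ n) (i : Fin n) (hi : (i : ℕ) < j) :
    packBits x j / 2 ^ (i : ℕ) % 2 = x i := by
  induction j with
  | zero => omega
  | succ j ih =>
    have hlt := packBits_lt x (show j ≤ n by omega)
    rw [packBits_succ x hj]
    have h2 := (x ⟨j, hj⟩).2
    by_cases h : (i : ℕ) = j
    · have hi' : i = ⟨j, hj⟩ := Fin.ext h
      subst hi'
      rw [Nat.add_mul_div_right _ _ (by positivity), Nat.div_eq_of_lt hlt, zero_add]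
      exact Nat.mod_eq_of_lt (x ⟨j, hj⟩).2
    · have hlt' : (i : ℕ) < j := by omega
      rw [← ih (by omega) hlt']
      obtain ⟨e, he⟩ := Nat.exists_eq_add_of_lt hlt'
      have hpow : 2 ^ j = 2 ^ (i : ℕ) * (2 * 2 ^ e) := by subst he; ring
      have : (x ⟨j, hj⟩ : ℕ) * 2 ^ j = 2 ^ (i : ℕ) * (2 * ((x ⟨j, hj⟩ : ℕ) * 2 ^ e)) := by
        rw [hpow]; ring
      rw [this, Nat.add_mul_div_left _ _ (by positivity), Nat.add_mul_mod_self_left]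

theorem Runs.flipSet {I : Input} {B G : ℕ} {x : Config n} {Q : State → Prop} {a : ℕ}
    (ha : a < 100) (hB : 1 ≤ B)
    (h : Q ({ x.set a ((x.coins 0).toNat : ℕ) with coins := fun i => x.coins (i + 1) } :
      Config n).st) :
    Runs I B G (.flip (.lit a)) x.st Q := by
  refine .flip ?_ hB
  have h1 := x.write_of_lt ha ((x.coins 0).toNat : ℕ)
  have h2 : x.st.coin = ((x.coins 0).toNat : ℕ) := by
    simp only [State.coin, Config.st]
    by_cases h : x.coins 0 = true
    · simp [h]
    · simp [Bool.not_eq_true _ ▸ h]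
  have h3 : (x.st.write a ((x.coins 0).toNat : ℕ)).mem = (x.set a ((x.coins 0).toNat : ℕ)).mem := by
    rw [h1]; rfl
  rw [h2]
  simp only [State.write] at h3
  rw [State.val, Expr.eval_lit, h3]
  exact h

/-! ### The sampling program -/

namespace Setting

variable (p : Setting m)

/-- Sampling all bits. -/
def sampleProg : Program := .block [
  .store (.lit 14) 0,
  .store (.lit 15) 1,
  .for 20 0 (.block [
    .store (101 + 2 * .var 20) 1,
    marginalProg,
    .store (.lit 21) (.var 25),
    .store (101 + 2 * .var 20) (0 - 1),
    marginalProg,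
    .store (.lit 22) (.var 25),
    .store (.lit 23) 0,
    .for 24 5 (.block [
      .flip (.lit 25),
      .store (.lit 23) (2 * .var 23 + .var 25)]),
    .cond (.less (.var 23 * (.var 21 + .var 22)) (.var 6 * .var 21))
      (.store (101 + 2 * .var 20) 1)
      (.store (.lit 14) (.var 14 + .var 15)),
    .store (.lit 15) (.var 15 + .var 15)])]

theorem runs_coins {x : Config (2 * m)} (hx : p.Consts x) {Q : State → Prop}
    (hQ : ∀ y : Config (2 * m), y.Agree 24 { x.set 23 (coinInt x.coins p.K) with
      coins := fun i => x.coins (i + p.K) } → Q y.st) (h23 : x.sc 23 = 0) :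
    Runs p.I p.B p.G (.for 24 5 (.block [
      .flip (.lit 25),
      .store (.lit 23) (2 * .var 23 + .var 25)])) x.st Q := by
  refine .forThen (fun j => { x.set 23 (coinInt x.coins j) with coins := fun i => x.coins (i + j) })
    (by norm_num) (by norm_num) p.K_le (fun j _ => by simp [hx.cell_K]) (fun a ha => ?_) rfl rfl
    rfl (fun j hj y hy => ?_) hQ
  · simp only [Config.set_sc, coinInt]
    split_ifs with h
    · rw [h, h23]; rfl
    · rfl
  · have hy' : ∀ a < 25, y.sc a = _ := hy.sc
    have hc : y.coins = fun i => x.coins (i + j) := hy.coins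
    refine .block_cons (.flipSet (by norm_num) (by have := p.B_ge; omega) ?_)
    refine .block_cons (.set (by norm_num) (z := coinInt x.coins (j + 1)) ?_ ?_
      (.block_nil (.of (fun a ha => ?_) hy.label hy.sign ?_)))
    · simp [hy', hc, coinInt]
    · rw [abs_of_nonneg (by positivity)]
      have h1 := coinInt_lt x.coins (j + 1)
      have h2 : 2 ^ (j + 1) ≤ 2 ^ p.B := Nat.pow_le_pow_right (by norm_num) (by have := p.K_lt; omega)
      exact_mod_cast h1.trans_le h2
    · have h1 : a ≠ 25 := by omega
      simp only [Config.set_sc, h1, if_false, hy' a ha]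
      split_ifs <;> first | rfl | omega
    · simp only [Config.set_coins, hc]
      funext i; congr 1; omega

theorem two_mul_lt_B : 2 * m < p.B := by
  have h1 : 2 * m ≤ sweepLen m p.D := by rw [sweepLen]; nlinarith [p.D_pos]
  have h2 : (2 : ℤ) ^ (2 * m) ≤ 2 ^ sweepLen m p.D := pow_le_pow_right₀ (by norm_num) h1
  have h3 : (2 : ℤ) ^ (2 * m) < 2 ^ p.B := by
    have h4 := p.bound_lt
    rw [bound] at h4
    have h5 : (0 : ℤ) < 2 ^ p.K := by positivity
    have h6 : (0 : ℤ) < 2 ^ sweepLen m p.D := by positivity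
    nlinarith
  exact (pow_lt_pow_iff_right₀ (by norm_num)).1 h3

/-- Signs of later bits are still zero, so these bits are summed out in the two marginals `a` and
`b` for the next bit. That bit is zero with probability about `a / (a + b)`, decided by comparing
`K` coins without a division. -/
theorem runs_sample {x : Config (2 * m)} (hx : p.Consts x) (hl : x.label = 0) (hz : x.sign = 0)
    {Q : State → Prop}
    (hQ : ∀ y : Config (2 * m), y.sc 0 = x.sc 0 → y.sc 14 = packBits (signBits
      (sampleState p.K p.marginal x.coins (2 * m)).1) (2 * m) → Q y.st) :
    Runs p.I p.B p.G sampleProg x.st Q := by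
  set s := sampleState p.K p.marginal x.coins with hs
  set Y : ℕ → ℕ := fun j => packBits (signBits (s j).1) j with hY
  have hYlt : ∀ j ≤ 2 * m, |((Y j : ℕ) : ℤ)| < 2 ^ p.B := fun j hj => by
    rw [abs_of_nonneg (by positivity)]
    have h1 := packBits_lt (signBits (s j).1) hj
    have h2 : 2 ^ j ≤ 2 ^ p.B :=
      Nat.pow_le_pow_right (by norm_num) (by have := p.two_mul_lt_B; omega)
    exact_mod_cast h1.trans_le h2
  have h1B : |(1 : ℤ)| < 2 ^ p.B := p.lit_lt (by norm_num)
  refine .block_cons (.set (by norm_num) (z := 0) (by rfl) (by simp) (.block_cons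
    (.set (by norm_num) (z := 1) (by rfl) h1B (.block_cons ?_))))
  refine .forThen (fun j => { (x.set 14 (Y j)).set 15 (2 ^ j) with
    sign := (s j).1, coins := (s j).2 }) (by norm_num) (by norm_num) p.m_le
    (fun j _ => by simp [hx.cell_n]) (fun a ha => ?_) rfl hz rfl (fun j hj y hy => ?_)
    fun y hy => .block_nil (hQ y ?_ ?_)
  · simp only [Config.set_sc, hY, packBits]
    simp
  · have hy' : ∀ a < 21, y.sc a = _ := hy.sc
    have hys : y.sign = (s j).1 := hy.sign
    have hyc : y.coins = (s j).2 := hy.coins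
    have hyl : y.label = 0 := hy.label.trans hl
    set J : Fin (2 * m) := ⟨j, hj⟩ with hJ
    set z := (s j).1 with hz
    have hz1 : ∀ i, |z i| ≤ 1 := abs_sampleState_le _ _ _ hj.le
    have hup : ∀ e : ℤ, |e| ≤ 1 → ∀ i, |Function.update z J e i| ≤ 1 := by
      intro e he i
      by_cases h : i = J
      · subst h; simpa using he
      · rw [Function.update_of_ne h]; exact hz1 i
    have hlow : ∀ a < 14, y.sc a = x.sc a := fun a ha => by
      have h1 : a ≠ 14 := by omega
      have h2 : a ≠ 15 := by omega
      have h3 : a ≠ 20 := by omega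
      simp [hy' a (by omega), h1, h2, h3]
    have hconst : ∀ u : Config (2 * m), (∀ a < 14, u.sc a = x.sc a) → p.Consts u :=
      fun u hu => hx.agree fun a ha => hu a (by omega)
    have hj20 : y.sc 20 = (J : ℕ) := by simp [hy', hJ]
    set a := p.marginal (Function.update z J 1) with ha
    set b := p.marginal (Function.update z J (-1)) with hb
    refine .block_cons (.setSign J (z := 1) (by simp [hj20]) (by rfl) h1B ?_)
    refine .block_cons (p.runs_marginal (x := y.setSign J 1) (hconst _ hlow) hyl
      (by rw [Config.setSign_sign, hys]; exact hup 1 (by simp)) fun u hu => Runs.of_bdd fun huB => ?_)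
    rw [Config.setSign_sign, hys, ← ha] at hu
    have hu' : ∀ a < 26, u.sc a = _ := hu.sc
    have hus : u.sign = Function.update z J 1 := by rw [hu.sign]; simp [hys]
    have haB : |a| < 2 ^ p.B := by
      have h1 := huB.abs_sc_lt (x := u) (show 25 < 100 by norm_num)
      simpa [hu'] using h1
    refine .block_cons (.set (by norm_num) (z := a) (by simp [hu']) haB ?_)
    refine .block_cons (.setSign J (z := -1) (by simp [hu', hj20]) (by simp) (by simpa using h1B) ?_)
    refine .block_cons (p.runs_marginal (x := (u.set 21 a).setSign J (-1)) (hconst _ fun c hc => ?_) (hu.label.trans hyl)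
      (by
        rw [Config.setSign_sign, Config.set_sign, hus, Function.update_idem]
        exact hup (-1) (by simp))
      fun v hv => Runs.of_bdd fun hvB => ?_)
    · have h1 : c ≠ 21 := by omega
      have h2 : c ≠ 25 := by omega
      simp [h1, h2, hu' c (by omega), hlow c hc]
    rw [Config.setSign_sign, Config.set_sign, hus, Function.update_idem, ← hb] at hv
    have hv' : ∀ a < 26, v.sc a = _ := hv.sc
    have hvs : v.sign = Function.update z J (-1) := by
      rw [hv.sign]; simp [hus]
    have hbB : |b| < 2 ^ p.B := by
      have h1 := hvB.abs_sc_lt (x := v) (show 25 < 100 by norm_num)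
      simpa [hv'] using h1
    refine .block_cons (.set (by norm_num) (z := b) (by simp [hv']) hbB ?_)
    refine .block_cons (.set (by norm_num) (z := 0) (by rfl) (by simp) ?_)
    have hvlow : ∀ c < 21, v.sc c = y.sc c := fun c hc => by
      have h1 : c ≠ 21 := by omega
      have h2 : c ≠ 25 := by omega
      simp [hv' c (by omega), h1, h2, hu' c (by omega)]
    have hvc : v.coins = (s j).2 := hv.coins.trans (hu.coins.trans hyc)
    refine .block_cons (p.runs_coins (x := (v.set 22 b).set 23 0) (hconst _ fun c hc => ?_) (fun w hw => ?_) (by simp))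
    · have h1 : c ≠ 22 := by omega
      have h2 : c ≠ 23 := by omega
      simp [h1, h2, hvlow c (by omega), hlow c hc]
    simp only [Config.set_coins, hvc] at hw
    have hw' : ∀ c < 24, w.sc c = _ := hw.sc
    have hwc : w.coins = (s (j + 1)).2 := by
      rw [hw.coins, hs, sampleState_succ _ _ _ hj]; rfl
    have hwlow : ∀ c < 21, w.sc c = y.sc c := fun c hc => by
      have h1 : c ≠ 22 := by omega
      have h2 : c ≠ 23 := by omega
      simp [hw' c (by omega), h1, h2, hvlow c hc]
    have hws : w.sign = Function.update z J (-1) := hw.sign.trans hvs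
    have hwl : w.label = x.label := by
      rw [hl]; exact hw.label.trans (hv.label.trans (hu.label.trans hyl))
    have w21 : w.sc 21 = a := by simp [hw', hv']
    have w22 : w.sc 22 = b := by simp [hw']
    have w23 : w.sc 23 = coinInt (s j).2 p.K := by simp [hw']
    have w6 : w.sc 6 = 2 ^ p.K := by rw [hwlow 6 (by norm_num), hlow 6 (by norm_num), hx.cell_PK]
    have w14 : w.sc 14 = Y j := by rw [hwlow 14 (by norm_num), hy' 14 (by norm_num)]; simp
    have w15 : w.sc 15 = 2 ^ j := by rw [hwlow 15 (by norm_num), hy' 15 (by norm_num)]; simp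
    have w20 : w.sc 20 = (J : ℕ) := by rw [hwlow 20 (by norm_num), hj20]
    have hs1 : (s (j + 1)).1 = Function.update z J
        (if coinInt (s j).2 p.K * (a + b) < 2 ^ p.K * a then 1 else -1) := by
      rw [hs, sampleState_succ _ _ _ hj]; rfl
    have hYs : Y (j + 1) = packBits (signBits z) j +
        (signBits (s (j + 1)).1 J : ℕ) * 2 ^ j := by
      simp only [hY]
      rw [packBits_succ _ hj]
      congr 1
      refine packBits_congr fun i hi => ?_
      have : i ≠ J := fun h => by rw [h] at hi; simp [hJ] at hi
      simp only [signBits, hs1, Function.update_of_ne this]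
    have hYj : Y j = packBits (signBits z) j := rfl
    have hpw : |(2 : ℤ) ^ (j + 1)| < 2 ^ p.B := by
      rw [abs_of_pos (by positivity)]
      exact pow_lt_pow_right₀ (by norm_num) (by have := p.two_mul_lt_B; omega)
    have hend : ∀ r : Config (2 * m), (∀ c < 21, r.sc c = (w.set 14 (Y (j + 1))).sc c) →
        r.label = x.label → r.sign = (s (j + 1)).1 → r.coins = (s (j + 1)).2 →
        Runs p.I p.B p.G (.block [.store (.lit 15) (.var 15 + .var 15)]) r.st
          (Config.Near (20 + 1) (({ (x.set 14 (Y (j + 1))).set 15 (2 ^ (j + 1)) with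
            sign := (s (j + 1)).1, coins := (s (j + 1)).2 } : Config (2 * m)).set 20 j)) := by
      intro r hr hrl hrs hrc
      refine .block_cons (.set (by norm_num) (z := 2 ^ (j + 1)) ?_ hpw (.block_nil
        (.of (fun c hc => ?_) hrl hrs hrc)))
      · have : r.sc 15 = 2 ^ j := by rw [hr 15 (by norm_num)]; simp [w15]
        simp [this, pow_succ]; ring
      · simp only [Config.set_sc, hr c hc, hwlow c hc, hy' c hc]
        split_ifs <;> first | rfl | omega
    have hcond : w.st.val (.less (.var 23 * (.var 21 + .var 22)) (.var 6 * .var 21)) =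
        if coinInt (s j).2 p.K * (a + b) < 2 ^ p.K * a then 1 else 0 := by
      simp [State.val, w21, w22, w23, w6]
    refine .block_cons (.cond (fun hc => ?_) fun hc => ?_)
    · have hlt : coinInt (s j).2 p.K * (a + b) < 2 ^ p.K * a := by
        by_contra h
        rw [hcond, if_neg h] at hc
        exact hc rfl
      rw [if_pos hlt] at hs1
      have hbit : signBits (s (j + 1)).1 J = 0 := by simp [signBits, hs1]
      rw [hbit] at hYs
      refine .setSign J (z := 1) (by simp [w20]) (by rfl) h1B (hend _ (fun c _ => ?_) hwl ?_ hwc)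
      · simp only [Config.setSign_sc, Config.set_sc]
        split_ifs with h
        · rw [h, w14, hYs, hYj]; simp
        · rfl
      · rw [Config.setSign_sign, hws, Function.update_idem, hs1]
    · have hlt : ¬ coinInt (s j).2 p.K * (a + b) < 2 ^ p.K * a := by
        intro h
        rw [hcond, if_pos h] at hc
        norm_num at hc
      rw [if_neg hlt] at hs1
      have hbit : signBits (s (j + 1)).1 J = 1 := by simp [signBits, hs1]
      rw [hbit] at hYs
      refine .set (by norm_num) (z := Y (j + 1)) ?_ (hYlt _ hj) (hend _ (fun c _ => rfl) hwl
        (by rw [Config.set_sign, hws, hs1]) hwc)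
      rw [hYs]; simp [w14, w15, hYj]
  · rw [hy.sc 0 (by norm_num)]; simp
  · rw [hy.sc 14 (by norm_num)]; simp [hY]

end Setting

/-! ### The output -/

/-- Writing the binary digits of the number in cell `14` to the first cells. -/
def outputProg : Program := .block [
  .store (.lit 2) (.var 14),
  .store (.lit 3) (.var 14),
  .store (.lit 1) 0,
  .loop (.less (.var 1) (.var 0)) (.block [
    .cond (.less 3 (.var 1)) (.store (.var 1) ((Expr.var 2).mod 2)) .skip,
    .store (.lit 2) (.var 2 / 2),
    .store (.lit 1) (.var 1 + 1)]),
  .store (.lit 0) ((Expr.var 3).mod 2),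
  .store (.lit 1) ((.var 3 / 2 : Expr).mod 2),
  .store (.lit 2) ((.var 3 / 4 : Expr).mod 2),
  .store (.lit 3) ((.var 3 / 8 : Expr).mod 2)]

theorem abs_mod_two_lt {B : ℕ} (hB : 1 ≤ B) (a : ℤ) : |a % 2| < 2 ^ B := by
  have : (2 : ℤ) ^ 1 ≤ 2 ^ B := pow_le_pow_right₀ (by norm_num) hB
  rw [abs_of_nonneg (by omega)]; omega

/-- Cells `0` to `3` hold the loop bound, the counter, the remaining digits and a copy of the
number. The loop writes only to cells from `4` on; the first four digits are extracted from the copy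
afterwards, its own cell coming last. -/
theorem runs_output {I : Input} {B G : ℕ} (hB : 1 ≤ B) (hG : n ≤ G) {σ : State}
    (h0 : σ.mem 0 = n) {Y : ℕ} (h14 : σ.mem 14 = Y) (hY : Y < 2 ^ B) (hn : n < 2 ^ B) :
    Runs I B G outputProg σ fun σ' => ∀ a < n, σ'.mem a = ((Y / 2 ^ a % 2 : ℕ) : ℤ) := by
  have hYB : |(Y : ℤ)| < 2 ^ B := by rw [abs_of_nonneg (by positivity)]; exact_mod_cast hY
  have hdiv : ∀ j, |((Y / 2 ^ j : ℕ) : ℤ)| < 2 ^ B := fun j => by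
    rw [abs_of_nonneg (by positivity)]
    exact_mod_cast (Nat.div_le_self _ _).trans_lt hY
  refine .block_cons (.store (by simpa [State.val, h14] using hYB) (.block_cons
    (.store (by simpa [State.val, State.write, h14] using hYB) (.block_cons
      (.store (by simp [State.val]) (.block_cons ?_))))))
  refine (Runs.loop (fun j σ => σ.mem 0 = n ∧ σ.mem 1 = (j : ℕ) ∧ σ.mem 2 = ((Y / 2 ^ j : ℕ) : ℤ) ∧
    σ.mem 3 = Y ∧ ∀ a, 4 ≤ a → a < j → σ.mem a = ((Y / 2 ^ a % 2 : ℕ) : ℤ)) hG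
    (fun j hj σ => ?_) (fun σ => ?_) ?_).mono fun σ _ => ?_
  · rintro ⟨i0, i1, i2, i3, i4⟩
    refine ⟨by simp [State.val, i0, i1, hj], ?_⟩
    have key : ∀ σ' : State, σ'.mem 0 = n → σ'.mem 1 = (j : ℕ) →
        σ'.mem 2 = ((Y / 2 ^ j : ℕ) : ℤ) → σ'.mem 3 = Y →
        (∀ a, 4 ≤ a → a < j + 1 → σ'.mem a = ((Y / 2 ^ a % 2 : ℕ) : ℤ)) →
        Runs I B G (.block [.store (.lit 2) (.var 2 / 2), .store (.lit 1) (.var 1 + 1)]) σ'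
          fun σ => σ.mem 0 = n ∧ σ.mem 1 = (j + 1 : ℕ) ∧ σ.mem 2 = ((Y / 2 ^ (j + 1) : ℕ) : ℤ) ∧
          σ.mem 3 = Y ∧ ∀ a, 4 ≤ a → a < j + 1 → σ.mem a = ((Y / 2 ^ a % 2 : ℕ) : ℤ) := by
      intro σ' k0 k1 k2 k3 k4
      have e2 : ((Y / 2 ^ j : ℕ) : ℤ) / 2 = ((Y / 2 ^ (j + 1) : ℕ) : ℤ) := by
        rw [pow_succ, ← Nat.div_div_eq_div_mul]; simp
      refine .block_cons (.store ?_ (.block_cons (.store ?_ (.block_nil ⟨?_, ?_, ?_, ?_, ?_⟩))))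
      · simp only [State.val, Expr.eval_div, Expr.eval_var, k2, Expr.eval_ofNat]
        have := hdiv (j + 1)
        rw [← e2] at this
        exact this
      · have : ((j + 1 : ℕ) : ℤ) < (2 : ℤ) ^ B := by exact_mod_cast (show j + 1 < 2 ^ B by omega)
        simp [State.val, State.write, k1]
        rw [abs_of_nonneg (by positivity)]
        exact_mod_cast this
      · simp [State.val, State.write, k0]
      · simp [State.val, State.write, k1]
      · simp only [State.val, State.write, Expr.eval_lit, Expr.eval_div, Expr.eval_var, k2]
        rw [← e2]
        simp
      · simp [State.val, State.write, k3]
      · intro a ha ha'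
        have h1 : a ≠ 1 := by omega
        have h2 : a ≠ 2 := by omega
        simp [State.val, State.write, h1, h2]
        exact_mod_cast k4 a ha ha'
    refine .block_cons (.cond (fun hc => ?_) fun hc => .skip ?_)
    · have h3 : 3 < j := by
        simp [State.val, i1] at hc
        exact_mod_cast hc
      refine .store (by simpa [State.val] using abs_mod_two_lt hB _) ?_
      refine key _ ?_ ?_ ?_ ?_ fun a ha ha' => ?_
      · simp [State.val, State.write, i1, i0, show (0 : ℕ) ≠ j by omega]
      · simp [State.val, State.write, i1, show (1 : ℕ) ≠ j by omega]
      · simp [State.val, State.write, i1, i2, show (2 : ℕ) ≠ j by omega]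
      · simp [State.val, State.write, i1, i3, show (3 : ℕ) ≠ j by omega]
      · by_cases h : a = j
        · subst h; simp [State.val, State.write, i1, i2]
        · simp only [State.val, State.write, Expr.eval_var, i1, Int.toNat_natCast]
          rw [Function.update_of_ne h]
          exact i4 a ha (by omega)
    · have h3 : ¬ 3 < j := by
        simp [State.val, i1] at hc
        omega
      exact key σ i0 i1 i2 i3 fun a ha ha' => by omega
  · rintro ⟨i0, i1, -⟩
    simp [State.val, i0, i1]
  · refine ⟨by simp [State.val, State.write, h0], by simp [State.val, State.write],
      by simp [State.val, State.write, h14], by simp [State.val, State.write, h14],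
      fun a ha ha' => by omega⟩
  · rintro ⟨-, -, -, i3, i4⟩
    have hmod : ∀ a : ℤ, |a % 2| < 2 ^ B := abs_mod_two_lt hB
    refine .block_cons (.store (by simpa [State.val] using hmod _) (.block_cons
      (.store (by simpa [State.val, State.write] using hmod _) (.block_cons
      (.store (by simpa [State.val, State.write] using hmod _) (.block_cons
      (.store (by simpa [State.val, State.write] using hmod _) (.block_nil fun a ha => ?_))))))))
    by_cases h : 4 ≤ a
    · have e := i4 a h ha
      simp only [State.val, State.write, Expr.eval_lit, Expr.eval_mod, Expr.eval_div, Expr.eval_var]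
      rw [Function.update_of_ne (by simp; omega), Function.update_of_ne (by simp; omega),
        Function.update_of_ne (by simp; omega), Function.update_of_ne (by simp; omega), e]
    · have : a = 0 ∨ a = 1 ∨ a = 2 ∨ a = 3 := by omega
      rcases this with rfl | rfl | rfl | rfl <;> simp [State.val, State.write, i3]

/-! ### The constants -/

/-- Computing the power of an expression in cell `a`, with the exponent in cell `h`. -/
def powProg (a h : ℕ) (e : Expr) : Program := .block [
  .store (.lit a) 1,
  .for 16 h (.store (.lit a) (.var a * e))]

theorem runs_pow {I : Input} {B G : ℕ} {x : Config n} {a h : ℕ} (ha : a < 16) (hh : h < 16)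
    (hah : a ≠ h) {e : Expr} {b k : ℕ} (hk : x.sc h = k) (hkG : k ≤ G) (hB : b ^ k < 2 ^ B)
    (hb : 0 < b) (he : ∀ y : Config n, (∀ c < 16, c ≠ a → y.sc c = x.sc c) → e.eval y.st.mem = b)
    {Q : State → Prop} (hQ : ∀ y : Config n, y.Agree 16 (x.set a (b ^ k)) → Q y.st) :
    Runs I B G (powProg a h e) x.st Q := by
  have hle : ∀ j ≤ k, |((b : ℤ) ^ j)| < 2 ^ B := fun j hj => by
    rw [abs_of_nonneg (by positivity)]
    exact_mod_cast (Nat.pow_le_pow_right hb hj).trans_lt hB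
  refine .block_cons (.set (by omega) (z := 1) (by rfl) (by simpa using hle 0 (by omega))
    (.block_cons ?_))
  refine .forThen (fun j => x.set a (b ^ j)) (by norm_num) hh hkG
    (fun j _ => by simp [hah.symm, hk]) (fun c hc => by simp) rfl rfl rfl
    (fun j hj y hy => ?_) fun y hy => .block_nil (hQ y hy)
  have h16 : a ≠ 16 := by omega
  have hya : y.sc a = b ^ j := by rw [hy.sc a (by omega)]; simp [h16]
  refine .set (by omega) (z := b ^ (j + 1)) ?_ (hle _ hj)
    (.of (fun c hc => ?_) hy.label hy.sign hy.coins)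
  · rw [Expr.eval_mul, he y fun c hc hca => ?_, Expr.eval_var, y.mem_of_lt (by omega), hya, pow_succ]
    rw [hy.sc c (by omega)]
    have : c ≠ 16 := by omega
    simp [this, hca]
  · simp only [Config.set_sc, hy.sc c hc]
    split_ifs <;> first | rfl | omega

/-- The accuracy `2⁻ᵏ` suffices. -/
def Input.Good (I : Input) (n k : ℕ) : Prop := 2 ≤ I.param 1 k ∧ 2 ≤ I.param 2 k ∧ n < 2 ^ k

/-- The program that finds the accuracy. -/
def accuracyProg : Program := .block [
  .store (.lit 3) 1,
  .store (.lit 13) 1,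
  .loop (.var 13) (.block [
    .store (.lit 2) (.var 2 + 1),
    .store (.lit 3) (.var 3 + .var 3),
    .param 1 (.lit 16) (.var 2),
    .param 2 (.lit 17) (.var 2),
    .store (.lit 13)
      (1 - .less 1 (.var 16) * .less 1 (.var 17) * .less (.var 0) (.var 3))])]

theorem runs_accuracy {I : Input} {B G : ℕ} {x : Config n} {k : ℕ} (hk : 0 < k) (hgood : I.Good n k)
    (hleast : ∀ j, 0 < j → j < k → ¬ I.Good n j) (hkG : k ≤ G) (hkB : 2 ^ k + 1 < 2 ^ B)
    (hparam : ∀ i j, |I.param i j| ≤ 2 ^ j + 1) (h0 : x.sc 0 = n) (h2 : x.sc 2 = 0)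
    {Q : State → Prop}
    (hQ : ∀ y : Config n, y.Agree 16 (((x.set 2 k).set 3 (2 ^ k)).set 13 0) → Q y.st) :
    Runs I B G accuracyProg x.st Q := by
  classical
  have hkB' : k ≤ B := by
    have : 2 ^ k < 2 ^ B := by omega
    exact ((Nat.pow_lt_pow_iff_right (by norm_num)).1 this).le
  have hpow : ∀ j ≤ k, (2 : ℤ) ^ j + 1 < 2 ^ B := fun j hj => by
    have h1 : 2 ^ j ≤ 2 ^ k := Nat.pow_le_pow_right (by norm_num) hj
    exact_mod_cast (show 2 ^ j + 1 < 2 ^ B by omega)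
  have h1B : |(1 : ℤ)| < 2 ^ B := by
    have := hpow 0 (by omega)
    simp at this ⊢
    linarith
  -- The flag that keeps the loop running; it is set before the first pass, so the accuracy found is
  -- at least one.
  set fl : ℕ → ℤ := fun j => if j = 0 then 1 else if I.Good n j then 0 else 1 with hfl
  refine .block_cons (.set (by norm_num) (z := 1) (by rfl) h1B (.block_cons
    (.set (by norm_num) (z := 1) (by rfl) h1B (.block_cons ?_))))
  refine (Runs.loop (fun j σ => Config.Near 16 (((x.set 2 j).set 3 (2 ^ j)).set 13 (fl j)) σ) hkG
    (fun j hj σ => ?_) (fun σ => ?_) ?_).mono ?_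
  · rintro ⟨y, hy, rfl⟩
    have hy' : ∀ a < 16, y.sc a = _ := hy.sc
    have hfj : fl j = 1 := by
      simp only [hfl]
      split_ifs with h1 h2
      · rfl
      · exact absurd h2 (hleast j (by omega) hj)
      · rfl
    refine ⟨by simp [State.val, hy', hfj], ?_⟩
    have hj1 : |((j + 1 : ℕ) : ℤ)| < 2 ^ B := by
      rw [abs_of_nonneg (by positivity)]
      have h1 : j + 1 < 2 ^ B := (Nat.lt_two_pow_self (n := j + 1)).trans_le
        (Nat.pow_le_pow_right (by norm_num) (by omega))
      exact_mod_cast h1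
    refine .block_cons (.set (by norm_num) (z := (j + 1 : ℕ)) (by simp [hy']) hj1 ?_)
    refine .block_cons (.set (by norm_num) (z := 2 ^ (j + 1)) ?_ ?_ ?_)
    · simp [hy', pow_succ]; ring
    · rw [abs_of_pos (by positivity)]; linarith [hpow (j + 1) hj]
    refine .block_cons (.paramSet (by norm_num) (k := j + 1) (by simp) rfl (by omega)
      ((hparam _ _).trans_lt (hpow _ hj)) ?_)
    refine .block_cons (.paramSet (by norm_num) (k := j + 1) (by simp) rfl (by omega)
      ((hparam _ _).trans_lt (hpow _ hj)) ?_)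
    refine .block_cons (.set (by norm_num) (z := fl (j + 1)) ?_ ?_
      (.block_nil (.of (fun a ha => ?_) hy.label hy.sign hy.coins)))
    · have e1 : (1 < I.param 1 (j + 1)) = (2 ≤ I.param 1 (j + 1)) := by simp [Int.lt_iff_add_one_le]
      have e2 : (1 < I.param 2 (j + 1)) = (2 ≤ I.param 2 (j + 1)) := by simp [Int.lt_iff_add_one_le]
      have e3 : ((n : ℤ) < 2 ^ (j + 1)) = (n < 2 ^ (j + 1)) := by
        rw [eq_iff_iff]; exact_mod_cast Iff.rfl
      simp only [hfl, Input.Good, Nat.succ_ne_zero, if_false]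
      by_cases a1 : 2 ≤ I.param 1 (j + 1) <;> by_cases a2 : 2 ≤ I.param 2 (j + 1) <;>
        by_cases a3 : n < 2 ^ (j + 1) <;> simp [hy', h0, e1, e2, e3, a1, a2, a3]
    · simp only [hfl]
      split_ifs <;> first | exact h1B | simp
    · have h1 : a ≠ 16 := by omega
      have h2 : a ≠ 17 := by omega
      simp only [Config.set_sc, h1, h2, if_false, hy' a ha]
      split_ifs <;> rfl
  · rintro ⟨y, hy, rfl⟩
    have : fl k = 0 := by simp only [hfl]; rw [if_neg (by omega), if_pos hgood]
    simp [State.val, hy.sc 13, this]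
  · refine .of (fun a ha => ?_) rfl rfl rfl
    simp only [Config.set_sc, hfl, if_true, pow_zero]
    split_ifs <;> first | rfl | simp_all
  · rintro σ - ⟨y, hy, rfl⟩
    have : fl k = 0 := by simp only [hfl]; rw [if_neg (by omega), if_pos hgood]
    rw [this] at hy
    exact .block_nil (hQ y hy)

/-- The program that computes the constants. -/
def setupProg (c₁ c₂ : ℕ) : Program := .block [
  accuracyProg,
  .store (.lit 1) (.var 0 / 2),
  .store (.lit 4) (.lit c₁ * .var 2),
  .store (.lit 5) (.lit c₂ * (.var 2 + 1) * (.var 0 + 1)),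
  .store (.lit 13) (.var 4 + 1),
  .store (.lit 7) 0,
  .for 16 13 (.block [
    .wire 0 (.lit 17) (.var 16) 0,
    .cond (.var 17) (.store (.lit 7) (.var 7 + 1)) .skip]),
  .store (.lit 8) (.var 4 / .var 7),
  powProg 6 5 2,
  .param 0 (.lit 9) (.var 5),
  .store (.lit 9) (.var 6 - .var 9),
  powProg 10 8 (4 * .var 0),
  powProg 11 4 16]

namespace Setting

variable (p : Setting m)

/-- The depth is neither given nor polynomially bounded, so only the first `L + 1` layers are
probed. The count `min d (L + 1)` reveals whether `L < d`, and otherwise it is the depth. -/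
theorem runs_setup {c₁ c₂ k : ℕ} (hk : 0 < k) (hgood : p.I.Good (2 * m) k)
    (hleast : ∀ j, 0 < j → j < k → ¬ p.I.Good (2 * m) j)
    (hparam : ∀ i j, |p.I.param i j| ≤ 2 ^ j + 1) (hc₂ : 1 ≤ c₂) (hL : p.L = c₁ * k)
    (hK : p.K = c₂ * (k + 1) * (2 * m + 1)) (hD : p.D = min d (p.L + 1)) (hw : p.w = p.L / p.D)
    (hlam : p.lam = 2 ^ p.K - p.I.param 0 p.K) (hwire : ∀ t, p.I.wire t 0 0 = 0 ↔ d ≤ t)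
    (hwire' : ∀ t, p.I.wire t 0 0 ≤ 2 * m) {x : Config (2 * m)} (h0 : x.sc 0 = (2 * m : ℕ))
    (h2 : x.sc 2 = 0) {Q : State → Prop}
    (hQ : ∀ y : Config (2 * m), p.Consts y → y.label = x.label → y.sign = x.sign →
      y.coins = x.coins → Q y.st) :
    Runs p.I p.B p.G (setupProg c₁ c₂) x.st Q := by
  have hkK : k ≤ p.K := by
    rw [hK]; nlinarith [Nat.zero_le (c₂ * (k + 1) * (2 * m)), Nat.mul_le_mul_right (k + 1) hc₂]
  have hKB : 2 ^ p.K + 1 < 2 ^ p.B := by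
    have := p.PK_lt_bound.trans_lt p.bound_lt
    exact_mod_cast this
  have hkB : 2 ^ k + 1 < 2 ^ p.B := by
    have : 2 ^ k ≤ 2 ^ p.K := Nat.pow_le_pow_right (by norm_num) hkK
    omega
  have hM2 : 16 ^ p.L < 2 ^ p.B := by
    have h1 := p.sum_lt
    have h2 := p.one_le_bound
    have h3 : (16 : ℤ) ^ p.L < 2 ^ p.B := by
      have : (0 : ℤ) < 16 ^ p.L := by positivity
      nlinarith
    exact_mod_cast h3
  have hM1 : (4 * (2 * m)) ^ p.w < 2 ^ p.B := by
    have h1 := p.sq_bound_lt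
    have h2 : (1 : ℤ) ≤ (16 ^ p.L * p.bound) ^ 2 := by
      have h3 : (1 : ℤ) ≤ 16 ^ p.L := one_le_pow₀ (by norm_num)
      have := p.one_le_bound
      exact one_le_pow₀ (one_le_mul_of_one_le_of_one_le h3 this)
    have h4 : (1 : ℤ) ≤ p.D := by exact_mod_cast p.D_pos
    have h5 : ((4 * (2 * m)) ^ p.w : ℤ) < 2 ^ p.B := by
      have h6 : (0 : ℤ) ≤ (4 * (2 * m)) ^ p.w := by positivity
      calc ((4 * (2 * m)) ^ p.w : ℤ) ≤ p.D * (4 * (2 * m)) ^ p.w := le_mul_of_one_le_left h6 h4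
        _ ≤ (16 ^ p.L * p.bound) ^ 2 * (p.D * (4 * (2 * m)) ^ p.w) :=
          le_mul_of_one_le_left (by positivity) h2
        _ < _ := h1
    exact_mod_cast h5
  have hL16 : p.L + 1 ≤ 16 ^ p.L := (Nat.lt_two_pow_self (n := p.L)).trans_le
    (Nat.pow_le_pow_left (by norm_num) _)
  have hnat : ∀ a : ℕ, a < 2 ^ p.B → |(a : ℤ)| < 2 ^ p.B := fun a ha => by
    rw [abs_of_nonneg (by positivity)]; exact_mod_cast ha
  have hKlt : p.K < 2 ^ p.B := Nat.lt_two_pow_self.trans (by omega)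
  refine .block_cons (runs_accuracy hk hgood hleast (hkK.trans p.K_le) hkB hparam h0 h2
    fun y hy => ?_)
  have hy' : ∀ a < 16, y.sc a = _ := hy.sc
  refine .block_cons (.set (by norm_num) (z := m) (by simp [hy', h0])
    (p.small_lt (by omega)) ?_)
  refine .block_cons (.set (by norm_num) (z := p.L) (by simp [hy', hL]) (hnat _ (by omega)) ?_)
  refine .block_cons (.set (by norm_num) (z := p.K) (by simp [hy', hK, h0]) (hnat _ hKlt) ?_)
  refine .block_cons (.set (by norm_num) (z := ((p.L + 1 : ℕ) : ℤ)) (by simp)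
    (hnat _ (by omega)) ?_)
  refine .block_cons (.set (by norm_num) (z := 0) (by rfl) (by simp) ?_)
  set y₁ := ((((y.set 1 m).set 4 p.L).set 5 p.K).set 13 ((p.L + 1 : ℕ) : ℤ)) with hy₁
  refine .block_cons (.forThen (fun j => y₁.set 7 ((min d j : ℕ) : ℤ)) (by norm_num) (by norm_num)
    (hL16.trans p.codes_le) (fun j _ => by simp [hy₁]) (fun a ha => by simp) rfl rfl rfl
    (fun j hj u hu => ?_) fun u hu => ?_)
  · have hu' : ∀ a < 17, u.sc a = _ := hu.sc
    refine .block_cons (.wireSet (by norm_num) (t' := j) (g' := 0) (by simp [hu']) (by simp) rfl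
      ((hwire' j).trans_lt (by have := p.n_lt; omega)) ?_)
    refine .block_cons (.cond (fun hc => ?_) fun hc => .skip (.block_nil ?_))
    · have hjd : j < d := by
        by_contra h
        apply hc
        simp [State.val, (hwire j).2 (by omega)]
      refine .set (by norm_num) (z := ((min d (j + 1) : ℕ) : ℤ)) ?_ (hnat _ ?_)
        (.block_nil (.of (fun a ha => ?_) hu.label hu.sign hu.coins))
      · have e1 : min d j = j := by omega
        have e2 : min d (j + 1) = j + 1 := by omega
        simp only [e2]
        simp [hu', hy₁]
        omega
      · have := min_le_right d (j + 1)
        omega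
      · have h1 : a ≠ 17 := by omega
        simp only [Config.set_sc, h1, if_false, hu' a ha]
        split_ifs <;> first | rfl | omega
    · have hjd : d ≤ j := by
        have : p.I.wire j 0 0 = 0 := by simpa [State.val] using hc
        exact (hwire j).1 this
      refine .of (fun a ha => ?_) hu.label hu.sign hu.coins
      have h1 : a ≠ 17 := by omega
      have e1 : min d (j + 1) = min d j := by omega
      simp only [Config.set_sc, h1, if_false, hu' a ha, e1]
  rw [← hD] at hu
  have hu' : ∀ a < 16, u.sc a = _ := hu.sc
  have hwL : p.w ≤ p.L := hw ▸ Nat.div_le_self _ _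
  refine .block_cons (.set (by norm_num) (z := p.w) (by simp [hu', hy₁, hw]) (hnat _ (by omega)) ?_)
  refine .block_cons (runs_pow (by norm_num) (by norm_num) (by norm_num) (b := 2) (k := p.K)
    (by simp [hu', hy₁]) p.K_le (by omega) (by norm_num) (fun v _ => by simp) fun v hv => ?_)
  have hv' : ∀ a < 16, v.sc a = _ := hv.sc
  refine .block_cons (.paramSet (by norm_num) (k := p.K) (by simp [hv', hu', hy₁]) rfl p.K_lt.le
    ((hparam _ _).trans_lt (by exact_mod_cast hKB)) ?_)
  refine .block_cons (.set (by norm_num) (z := p.lam) (by simp [hv', hlam]) ?_ ?_)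
  · rw [hlam]
    have h1 := p.I
    have h2 := (abs_le.1 (hparam 0 p.K))
    have h3 := p.lam_le
    rw [hlam] at h3
    have h4 := p.bound_lt
    rw [bound] at h4
    have h5 : (2 : ℤ) ^ 1 ≤ 2 ^ sweepLen m p.D := by
      refine pow_le_pow_right₀ (by norm_num) ?_
      rw [sweepLen]; nlinarith [p.m_pos]
    have h6 : (0 : ℤ) < 2 ^ p.K := by positivity
    nlinarith
  refine .block_cons (runs_pow (by norm_num) (by norm_num) (by norm_num) (b := 4 * (2 * m))
    (k := p.w) (by simp [hv']) p.w_le hM1 (by have := p.m_pos; omega)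
    (fun w hw => ?_) fun w hw => ?_)
  · simp [hw 0, hv', hu', hy₁, hy', h0]
  have hw' : ∀ a < 16, w.sc a = _ := hw.sc
  refine .block_cons (runs_pow (by norm_num) (by norm_num) (by norm_num) (b := 16)
    (k := p.L) (by simp [hw', hv', hu', hy₁]) ((by omega : p.L ≤ 16 ^ p.L).trans p.codes_le) hM2
    (by norm_num) (fun v _ => by simp) fun q hq => .block_nil (hQ q ?_ ?_ ?_ ?_))
  · have hq' : ∀ a < 16, q.sc a = _ := hq.sc
    constructor <;> simp [hq', hw', hv', hu', hy₁, hy', h0]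
  · exact hq.label.trans (hw.label.trans (hv.label.trans (hu.label.trans hy.label)))
  · exact hq.sign.trans (hw.sign.trans (hv.sign.trans (hu.sign.trans hy.sign)))
  · exact hq.coins.trans (hw.coins.trans (hv.coins.trans (hu.coins.trans hy.coins)))

end Setting

/-- The whole algorithm. -/
def mainProg (c₁ c₂ : ℕ) : Program :=
  .cond (.var 0) (.block [setupProg c₁ c₂, Setting.sampleProg, outputProg]) .skip

/-- The initial state. -/
def initialConfig (n : ℕ) (ω : ℕ → Bool) : Config n := ⟨Function.update 0 0 (n : ℤ), 0, 0, ω⟩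

theorem st_initialConfig (n : ℕ) (ω : ℕ → Bool) : (initialConfig n ω).st = initial n ω := by
  simp only [Config.st, initial, State.mk.injEq]
  refine ⟨funext fun a => ?_, rfl⟩
  simp only [Config.mem, initialConfig]
  split_ifs with h1
  · rfl
  all_goals rw [Function.update_of_ne (by omega)]; simp

namespace Setting

variable (p : Setting m)

theorem runs_main {c₁ c₂ k : ℕ} (hk : 0 < k) (hgood : p.I.Good (2 * m) k)
    (hleast : ∀ j, 0 < j → j < k → ¬ p.I.Good (2 * m) j)
    (hparam : ∀ i j, |p.I.param i j| ≤ 2 ^ j + 1) (hc₂ : 1 ≤ c₂) (hL : p.L = c₁ * k)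
    (hK : p.K = c₂ * (k + 1) * (2 * m + 1)) (hD : p.D = min d (p.L + 1)) (hw : p.w = p.L / p.D)
    (hlam : p.lam = 2 ^ p.K - p.I.param 0 p.K) (hwire : ∀ t, p.I.wire t 0 0 = 0 ↔ d ≤ t)
    (hwire' : ∀ t, p.I.wire t 0 0 ≤ 2 * m) (ω : ℕ → Bool) :
    Runs p.I p.B p.G (mainProg c₁ c₂) (initial (2 * m) ω) fun σ =>
      σ.output (2 * m) = signBits (sampleState p.K p.marginal ω (2 * m)).1 := by
  have hm := p.m_pos
  rw [← st_initialConfig]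
  refine .cond (fun _ => ?_) fun hc => absurd hc ?_
  · refine .block_cons (p.runs_setup (d := d) hk hgood hleast hparam hc₂ hL hK hD hw hlam hwire hwire'
      (by simp [initialConfig]) (by simp [initialConfig]) fun y hy h1 h2 h3 => ?_)
    refine .block_cons (p.runs_sample hy h1 h2 fun u hu0 hu14 => ?_)
    rw [h3] at hu14
    set x : Bits (2 * m) := signBits (sampleState p.K p.marginal ω (2 * m)).1 with hx
    refine .block_cons ((runs_output (n := 2 * m) (Y := packBits x (2 * m))
      (by have := p.B_ge; omega) p.m_le ?_ ?_ ?_ ?_).mono fun σ _ hσ => .block_nil ?_)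
    · rw [u.mem_of_lt (by norm_num), hu0, hy.cell_n]
    · rw [u.mem_of_lt (by norm_num), hu14]; rfl
    · exact (packBits_lt x le_rfl).trans_le
        (Nat.pow_le_pow_right (by norm_num) p.two_mul_lt_B.le)
    · have := p.n_lt; omega
    · funext i
      have h := hσ i i.2
      rw [packBits_digit x le_rfl i i.2] at h
      simp only [State.output, h]
      have := (x i).2
      by_cases h0 : x i = 0
      · simp [h0]
      · have h1 : x i = 1 := by
          apply Fin.ext
          have : (x i : ℕ) ≠ 0 := fun h => h0 (Fin.ext h)
          simp; omega
        simp [h1]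
  · rw [State.val, Expr.eval_var, Config.mem_of_lt _ (by norm_num)]
    simp [initialConfig]
    omega

end Setting

/-! ### The law of the sampled bits -/

/-- The sign of a bit. -/
def bitInt (b : Fin 2) : ℤ := if b = 0 then 1 else -1

/-- The signs of the first `j` bits, and zeros. -/
def partialSign (x : Bits n) (j : ℕ) : Fin n → ℤ := fun i => if (i : ℕ) < j then bitInt (x i) else 0

theorem partialSign_zero (x : Bits n) : partialSign x 0 = 0 := by
  funext i; simp [partialSign]

theorem partialSign_succ (x : Bits n) (j : Fin n) :
    partialSign x (j + 1) = Function.update (partialSign x j) j (bitInt (x j)) := by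
  funext i
  by_cases h : i = j
  · subst h; simp [partialSign]
  · have h1 : (i : ℕ) ≠ j := fun h' => h (Fin.ext h')
    have h2 : (i : ℕ) < j + 1 ↔ (i : ℕ) < j := by omega
    simp [partialSign, h, h2]

theorem update_partialSign_zero (x : Bits n) (j : Fin n) :
    Function.update (partialSign x j) j 0 = partialSign x j := by
  rw [Function.update_eq_self_iff]; simp [partialSign]

/-- Flipping a bit. -/
def flipBit (j : Fin n) (x : Bits n) : Bits n := Function.update x j (1 - x j)

theorem flipBit_involutive (j : Fin n) : Function.Involutive (flipBit j) := fun x => by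
  simp [flipBit]

theorem sum_flipBit (j : Fin n) (f : Bits n → ℝ) : ∑ x, f (flipBit j x) = ∑ x, f x :=
  Equiv.sum_comp (flipBit_involutive j).toPerm f

theorem partialSign_flipBit (x : Bits n) (j : Fin n) :
    partialSign (flipBit j x) j = partialSign x j := by
  funext i
  by_cases h : (i : ℕ) < j
  · have : i ≠ j := fun h' => by subst h'; omega
    simp [partialSign, h, flipBit, this]
  · simp [partialSign, h]

theorem bitInt_cases (x : Bits n) (j : Fin n) :
    (bitInt (x j) = 1 ∧ bitInt (flipBit j x j) = -1) ∨
      (bitInt (x j) = -1 ∧ bitInt (flipBit j x j) = 1) := by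
  simp only [flipBit, Function.update_self]
  generalize x j = b
  fin_cases b <;> simp [bitInt]

/-- The number of values of `K` coins for which the next sign is `1`. -/
def plusCount (K : ℕ) (a b : ℤ) : ℕ :=
  ((Finset.range (2 ^ K)).filter fun R : ℕ => (R : ℤ) * (a + b) < 2 ^ K * a).card

/-- The probability that the next bit is that of `x`, given that the previous ones are. -/
def bitProb (K : ℕ) (M : (Fin n → ℤ) → ℤ) (x : Bits n) (j : Fin n) : ℝ :=
  let α : ℝ := plusCount K (M (Function.update (partialSign x j) j 1))
    (M (Function.update (partialSign x j) j (-1))) / 2 ^ K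
  if x j = 0 then α else 1 - α

theorem plusCount_le (K : ℕ) (a b : ℤ) : (plusCount K a b : ℝ) / 2 ^ K ≤ 1 := by
  rw [div_le_one (by positivity)]
  have : plusCount K a b ≤ 2 ^ K := (Finset.card_filter_le _ _).trans (by simp)
  exact_mod_cast this

theorem bitProb_nonneg (K : ℕ) (M : (Fin n → ℤ) → ℤ) (x : Bits n) (j : Fin n) :
    0 ≤ bitProb K M x j := by
  simp only [bitProb]
  split_ifs
  · positivity
  · exact sub_nonneg.2 (plusCount_le _ _ _)

theorem bitProb_add_flipBit (K : ℕ) (M : (Fin n → ℤ) → ℤ) (x : Bits n) (j : Fin n) :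
    bitProb K M x j + bitProb K M (flipBit j x) j = 1 := by
  simp only [bitProb, partialSign_flipBit]
  have : flipBit j x j = 1 - x j := by simp [flipBit]
  rw [this]
  generalize x j = b
  fin_cases b <;> simp

/-! ### The error of the sampling -/

/-- Functions of signs that are affine in each sign. -/
def MultiAffine (F : (Fin n → ℤ) → ℝ) : Prop := ∀ z j,
  F (Function.update z j 1) + F (Function.update z j (-1)) = 2 * F (Function.update z j 0)

section hybrid

variable {F : (Fin n → ℤ) → ℝ}

/-- A zero sign stands for the average over that bit, so partial assignments of signs give
marginals. -/
theorem MultiAffine.two_mul_partialSign (hF : MultiAffine F) (x : Bits n) (j : Fin n) :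
    2 * F (partialSign x j) = F (partialSign x (j + 1)) + F (partialSign (flipBit j x) (j + 1)) := by
  have h := hF (partialSign x j) j
  rw [update_partialSign_zero] at h
  rw [partialSign_succ, partialSign_succ, partialSign_flipBit, ← h]
  rcases bitInt_cases x j with ⟨h1, h2⟩ | ⟨h1, h2⟩ <;> rw [h1, h2]
  ring

theorem MultiAffine.nonneg (hF : MultiAffine F) (h : ∀ x, 0 ≤ F (partialSign x n)) {j : ℕ}
    (hj : j ≤ n) (x : Bits n) : 0 ≤ F (partialSign x j) := by
  induction hj using Nat.decreasingInduction generalizing x with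
  | of_succ k hk ih =>
    have h1 := hF.two_mul_partialSign x ⟨k, hk⟩
    have h2 := ih x
    have h3 := ih (flipBit ⟨k, hk⟩ x)
    simp only at h1
    linarith
  | self => exact h x

/-- Averaging contracts the sum of absolute values. Thus the truncation error, controlled for full
bit strings only, controls all marginals as well. -/
theorem MultiAffine.sum_abs_le (hF : MultiAffine F) {j : ℕ} (hj : j ≤ n) :
    ∑ x, |F (partialSign x j)| ≤ ∑ x, |F (partialSign x n)| := by
  induction hj using Nat.decreasingInduction with
  | of_succ k hk ih =>
    refine le_trans ?_ ih
    have h1 : ∀ x, 2 * |F (partialSign x k)| ≤ |F (partialSign x (k + 1))| +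
        |F (partialSign (flipBit ⟨k, hk⟩ x) (k + 1))| := fun x => by
      have h1 := hF.two_mul_partialSign x ⟨k, hk⟩
      simp only at h1
      rw [← abs_two (α := ℝ), ← abs_mul, h1]
      exact abs_add_le _ _
    have h2 := Finset.sum_le_sum fun x (_ : x ∈ Finset.univ) => h1 x
    rw [← Finset.mul_sum, Finset.sum_add_distrib,
      sum_flipBit ⟨k, hk⟩ fun x => |F (partialSign x (k + 1))|] at h2
    linarith
  | self => exact le_rfl

theorem MultiAffine.sum_eq (hF : MultiAffine F) {j : ℕ} (hj : j ≤ n) :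
    ∑ x, F (partialSign x j) = 2 ^ n * F 0 := by
  induction j with
  | zero => simp [partialSign_zero]
  | succ j ih =>
    have h2 := Finset.sum_congr rfl fun x (_ : x ∈ Finset.univ) => hF.two_mul_partialSign x ⟨j, hj⟩
    simp only at h2
    rw [← Finset.mul_sum, Finset.sum_add_distrib,
      sum_flipBit ⟨j, hj⟩ fun x => F (partialSign x (j + 1)), ih (by omega)] at h2
    linarith

/-- The bound contains no quotient by a small marginal, since the conditional probability is
weighted with the true one. Signs of the approximations are arbitrary, but wherever they are wrong
the true values are as small as the errors. -/
theorem abs_plusCount_sub {K : ℕ} {a b : ℤ} {S u v e₁ e₀ : ℝ} (hS : 0 < S) (hu : 0 ≤ u) (hv : 0 ≤ v)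
    (ha : |a / S - u| ≤ e₁) (hb : |b / S - v| ≤ e₀) :
    |(plusCount K a b : ℝ) / 2 ^ K * ((u + v) / 2) - u / 2| ≤ e₁ + e₀ + (u + v) / 2 / 2 ^ K := by
  set α : ℝ := (plusCount K a b : ℝ) / 2 ^ K with hα
  have hα0 : 0 ≤ α := by positivity
  have hα1 : α ≤ 1 := plusCount_le _ _ _
  have hN : (0 : ℝ) < 2 ^ K := by positivity
  have ha' := abs_le.1 ha
  have hb' := abs_le.1 hb
  have he₁ : 0 ≤ e₁ := (abs_nonneg _).trans ha
  have he₀ : 0 ≤ e₀ := (abs_nonneg _).trans hb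
  have hq : 0 ≤ (u + v) / 2 / 2 ^ K := by positivity
  set A : ℝ := a / S with hA
  set B : ℝ := b / S with hB
  -- Here `u + v ≤ e₁ + e₀`, and any probability will do.
  by_cases hs : a + b ≤ 0
  · have h1 : A + B ≤ 0 := by
      rw [hA, hB, ← add_div]
      exact div_nonpos_of_nonpos_of_nonneg (by exact_mod_cast hs) hS.le
    have h2 : α * ((u + v) / 2) ≤ (u + v) / 2 := mul_le_of_le_one_left (by positivity) hα1
    have h3 : 0 ≤ α * ((u + v) / 2) := by positivity
    rw [abs_le]
    constructor <;> linarith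
  push Not at hs
  have hsS : 0 < A + B := by rw [hA, hB, ← add_div]; exact div_pos (by exact_mod_cast hs) hS
  -- The sign `1` never occurs, and `u ≤ e₁`.
  by_cases ha0 : a < 0
  · have h0 : plusCount K a b = 0 := by
      rw [plusCount, Finset.card_eq_zero, Finset.filter_eq_empty_iff]
      intro R _ h
      have h1 : 0 ≤ (R : ℤ) * (a + b) := by positivity
      have h2 : (2 : ℤ) ^ K * a < 0 := mul_neg_of_pos_of_neg (by positivity) ha0
      omega
    have hA0 : A < 0 := div_neg_of_neg_of_pos (by exact_mod_cast ha0) hS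
    rw [hα, h0]
    simp only [Nat.cast_zero, zero_div, zero_mul, zero_sub, abs_neg]
    rw [abs_of_nonneg (by positivity)]
    linarith
  -- The sign `1` always occurs, and `v ≤ e₀`.
  by_cases hb0 : b < 0
  · have h1 : plusCount K a b = 2 ^ K := by
      rw [plusCount, Finset.filter_true_of_mem, Finset.card_range]
      intro R hR
      have h1 : (R : ℤ) < 2 ^ K := by exact_mod_cast Finset.mem_range.1 hR
      nlinarith
    have hB0 : B < 0 := div_neg_of_neg_of_pos (by exact_mod_cast hb0) hS
    rw [hα, h1]
    push_cast
    rw [div_self hN.ne', one_mul, abs_of_nonneg (by linarith)]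
    linarith
  push Not at ha0 hb0
  have hs' : (0 : ℝ) < a + b := by exact_mod_cast hs
  set t : ℝ := a / (a + b) with ht
  have ht0 : 0 ≤ t := div_nonneg (by exact_mod_cast ha0) hs'.le
  have ht1 : t ≤ 1 := by
    rw [ht, div_le_one hs']
    have : (0 : ℝ) ≤ b := by exact_mod_cast hb0
    linarith
  have htA : t * (A + B) = A := by
    rw [hA, hB, ht]; field_simp
  -- In the regular case the coins realise `t = a / (a + b)` up to `1 / 2 ^ K`.
  have hcount : plusCount K a b = ⌈2 ^ K * t⌉₊ := by
    rw [plusCount, ← Finset.card_range ⌈2 ^ K * t⌉₊]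
    congr 1
    ext R
    have h1 : ((R : ℤ) * (a + b) < 2 ^ K * a) ↔ (R : ℝ) < 2 ^ K * t := by
      rw [ht, mul_div_assoc', lt_div_iff₀ hs']
      exact_mod_cast Iff.rfl
    simp only [Finset.mem_filter, Finset.mem_range, h1, Nat.lt_ceil]
    refine ⟨fun h => h.2, fun h => ⟨?_, h⟩⟩
    have : (R : ℝ) < 2 ^ K := h.trans_le (mul_le_of_le_one_right hN.le ht1)
    exact_mod_cast this
  have hαt : |α - t| ≤ 1 / 2 ^ K := by
    have h1 := Nat.le_ceil (2 ^ K * t)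
    have h2 := Nat.ceil_lt_add_one (show 0 ≤ 2 ^ K * t by positivity)
    have e : α - t = (⌈2 ^ K * t⌉₊ - 2 ^ K * t) / 2 ^ K := by
      rw [hα, hcount]; field_simp
    rw [e, abs_of_nonneg (div_nonneg (by linarith) hN.le)]
    gcongr
    linarith
  have e : α * ((u + v) / 2) - u / 2 =
      (α - t) * ((u + v) / 2) + (t * ((u - A) + (v - B)) / 2 + (A - u) / 2) := by
    linear_combination (1 / 2) * htA
  rw [e]
  refine (abs_add_le _ _).trans ?_
  have h1 : |(α - t) * ((u + v) / 2)| ≤ (u + v) / 2 / 2 ^ K := by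
    rw [abs_mul, abs_of_nonneg (show 0 ≤ (u + v) / 2 by positivity)]
    calc _ ≤ 1 / 2 ^ K * ((u + v) / 2) := mul_le_mul_of_nonneg_right hαt (by positivity)
      _ = _ := by ring
  have h2 : |t * ((u - A) + (v - B)) / 2 + (A - u) / 2| ≤ e₁ + e₀ := by
    have h3 : |t * ((u - A) + (v - B))| ≤ e₁ + e₀ := by
      rw [abs_mul, abs_of_nonneg ht0]
      refine (mul_le_of_le_one_left (abs_nonneg _) ht1).trans ?_
      rw [abs_le]; constructor <;> linarith
    have h4 := abs_le.1 h3
    rw [abs_le]; constructor <;> linarith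
  linarith

/-- The total variation distance of the sampled bits to a distribution with given marginals. -/
theorem MultiAffine.sum_abs_prod_bitProb_sub_le (hF : MultiAffine F)
    (h0 : ∀ x, 0 ≤ F (partialSign x n)) (h1 : F 0 = 1) {K : ℕ} {M : (Fin n → ℤ) → ℤ} {S : ℝ}
    (hS : 0 < S) {E : ℝ}
    (hE : ∀ j ≤ n, ∑ x, |M (partialSign x j) / S - F (partialSign x j)| ≤ 2 ^ n * E) :
    ∑ x, |∏ j, bitProb K M x j - F (partialSign x n) / 2 ^ n| ≤ n * (4 * E + 2 / 2 ^ K) := by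
  -- The probability of the first `ℓ` bits of `x`; the quantity `2 ^ ℓ * P ℓ x` is compared with the
  -- exact marginal `F (partialSign x ℓ)`.
  set P : ℕ → Bits n → ℝ := fun ℓ x => ∏ j : Fin n, if (j : ℕ) < ℓ then bitProb K M x j else 1 with hP
  have hPs : ∀ (ℓ : Fin n) x, P (ℓ + 1) x = P ℓ x * bitProb K M x ℓ := fun ℓ x => by
    have e : bitProb K M x ℓ = ∏ j : Fin n, if j = ℓ then bitProb K M x j else 1 := by simp
    rw [e, hP, ← Finset.prod_mul_distrib]
    refine Finset.prod_congr rfl fun j _ => ?_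
    by_cases h : j = ℓ
    · subst h; simp
    · have h1 : (j : ℕ) ≠ ℓ := fun h' => h (Fin.ext h')
      have h2 : (j : ℕ) < ℓ + 1 ↔ (j : ℕ) < ℓ := by omega
      simp [h, h2]
  have hPf : ∀ (ℓ : Fin n) x, P ℓ (flipBit ℓ x) = P ℓ x := fun ℓ x => by
    refine Finset.prod_congr rfl fun j _ => ?_
    by_cases h : (j : ℕ) < ℓ
    · have hne : j ≠ ℓ := fun h' => by subst h'; omega
      have e1 : partialSign (flipBit ℓ x) j = partialSign x j := by
        funext i
        by_cases hi : (i : ℕ) < j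
        · have : i ≠ ℓ := fun h' => by subst h'; omega
          simp [partialSign, hi, flipBit, this]
        · simp [partialSign, hi]
      have e2 : flipBit ℓ x j = x j := by simp [flipBit, hne]
      simp [h, bitProb, e1, e2]
    · simp [h]
  -- Hybrid step: the old error is carried on by the sampled conditional probability, and the new
  -- error is weighted with the exact marginal.
  have hstep : ∀ (ℓ : Fin n) x, |2 ^ ((ℓ : ℕ) + 1) * P (ℓ + 1) x - F (partialSign x (ℓ + 1))| ≤
      2 * (bitProb K M x ℓ * |2 ^ (ℓ : ℕ) * P ℓ x - F (partialSign x ℓ)|) +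
      2 * (|M (partialSign x (ℓ + 1)) / S - F (partialSign x (ℓ + 1))| +
        |M (partialSign (flipBit ℓ x) (ℓ + 1)) / S - F (partialSign (flipBit ℓ x) (ℓ + 1))| +
        F (partialSign x ℓ) / 2 ^ K) := fun ℓ x => by
    have hb : |bitProb K M x ℓ * F (partialSign x ℓ) - F (partialSign x (ℓ + 1)) / 2| ≤
        |M (partialSign x (ℓ + 1)) / S - F (partialSign x (ℓ + 1))| +
        |M (partialSign (flipBit ℓ x) (ℓ + 1)) / S - F (partialSign (flipBit ℓ x) (ℓ + 1))| +
        F (partialSign x ℓ) / 2 ^ K := by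
      have e1 := hF.two_mul_partialSign x ℓ
      have hn1 := hF.nonneg h0 ℓ.2 x
      have hn2 := hF.nonneg h0 ℓ.2 (flipBit ℓ x)
      have e2 := partialSign_succ x ℓ
      have e3 := partialSign_succ (flipBit ℓ x) ℓ
      rw [partialSign_flipBit] at e3
      have e0 : F (partialSign x ℓ) =
        (F (partialSign x (ℓ + 1)) + F (partialSign (flipBit ℓ x) (ℓ + 1))) / 2 := by linarith
      rw [e0]
      by_cases hx : x ℓ = 0
      · have e4 : bitInt (x ℓ) = 1 := by simp [bitInt, hx]
        have e5 : bitInt (flipBit ℓ x ℓ) = -1 := by simp [bitInt, flipBit, hx]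
        rw [e4] at e2
        rw [e5] at e3
        rw [bitProb]
        simp only [hx, if_true, ← e2, ← e3]
        exact abs_plusCount_sub hS hn1 hn2 le_rfl le_rfl
      · have hx1 : x ℓ = 1 := by
          have := (x ℓ).2
          have h' : (x ℓ : ℕ) ≠ 0 := fun h => hx (Fin.ext h)
          apply Fin.ext; simp; omega
        have e4 : bitInt (x ℓ) = -1 := by simp [bitInt, hx]
        have e5 : bitInt (flipBit ℓ x ℓ) = 1 := by simp [bitInt, flipBit, hx1]
        rw [e4] at e2
        rw [e5] at e3
        rw [bitProb]
        simp only [hx, if_false, ← e2, ← e3]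
        have h := abs_plusCount_sub (K := K) hS hn2 hn1
          (le_refl |(M (partialSign (flipBit ℓ x) (ℓ + 1)) : ℝ) / S - F (partialSign (flipBit ℓ x) (ℓ + 1))|)
          (le_refl |(M (partialSign x (ℓ + 1)) : ℝ) / S - F (partialSign x (ℓ + 1))|)
        rw [← abs_neg]
        convert h using 1
        · congr 1; ring
        · ring
    have e : 2 ^ ((ℓ : ℕ) + 1) * P (ℓ + 1) x - F (partialSign x (ℓ + 1)) =
        2 * (bitProb K M x ℓ * (2 ^ (ℓ : ℕ) * P ℓ x - F (partialSign x ℓ))) +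
        2 * (bitProb K M x ℓ * F (partialSign x ℓ) - F (partialSign x (ℓ + 1)) / 2) := by
      rw [hPs]; ring
    rw [e]
    refine (abs_add_le _ _).trans ?_
    rw [abs_mul, abs_mul, abs_mul (2 : ℝ), abs_two, abs_of_nonneg (bitProb_nonneg _ _ _ _)]
    gcongr
  have hD : ∀ ℓ ≤ n, ∑ x, |2 ^ ℓ * P ℓ x - F (partialSign x ℓ)| ≤
      2 ^ n * (ℓ * (4 * E + 2 / 2 ^ K)) := by
    intro ℓ hℓ
    induction ℓ with
    | zero => simp [hP, partialSign_zero, h1]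
    | succ ℓ ih =>
      have hs := Finset.sum_le_sum fun x (_ : x ∈ Finset.univ) => hstep ⟨ℓ, hℓ⟩ x
      simp only at hs
      refine hs.trans ?_
      set g : Bits n → ℝ := fun x => |2 ^ ℓ * P ℓ x - F (partialSign x ℓ)| with hg
      have hgf : ∀ x, g (flipBit ⟨ℓ, hℓ⟩ x) = g x := fun x => by
        have a1 := hPf ⟨ℓ, hℓ⟩ x
        have a2 := partialSign_flipBit x ⟨ℓ, hℓ⟩
        simp only at a1 a2
        simp only [hg, a1, a2]
      -- The old error does not depend on bit `ℓ`, and the probabilities of its two values add up to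
      -- one. Hence errors accumulate additively instead of doubling with each bit.
      have hmain : 2 * ∑ x, bitProb K M x ⟨ℓ, hℓ⟩ * g x = ∑ x, g x := by
        have a1 := sum_flipBit ⟨ℓ, hℓ⟩ fun x => bitProb K M x ⟨ℓ, hℓ⟩ * g x
        rw [two_mul]
        nth_rw 2 [← a1]
        rw [← Finset.sum_add_distrib]
        refine Finset.sum_congr rfl fun x _ => ?_
        rw [hgf, ← add_mul, bitProb_add_flipBit, one_mul]
      rw [Finset.sum_add_distrib, ← Finset.mul_sum, hmain, ← Finset.mul_sum, Finset.sum_add_distrib,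
        Finset.sum_add_distrib, ← Finset.sum_div, hF.sum_eq (by omega), h1,
        sum_flipBit ⟨ℓ, hℓ⟩ fun x => |(M (partialSign x (ℓ + 1)) : ℝ) / S - F (partialSign x (ℓ + 1))|]
      have h2 := hE (ℓ + 1) hℓ
      have h3 := ih (by omega)
      push_cast
      calc _ ≤ 2 ^ n * (ℓ * (4 * E + 2 / 2 ^ K)) + 2 * (2 ^ n * E + 2 ^ n * E + 2 ^ n * 1 / 2 ^ K) := by
            gcongr
        _ = _ := by ring
  have h := hD n le_rfl
  have e : ∀ x, |2 ^ n * P n x - F (partialSign x n)| =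
      2 ^ n * |∏ j, bitProb K M x j - F (partialSign x n) / 2 ^ n| := fun x => by
    have : P n x = ∏ j, bitProb K M x j := Finset.prod_congr rfl fun j _ => by simp
    rw [this, ← abs_of_pos (show (0 : ℝ) < 2 ^ n by positivity), ← abs_mul,
      abs_of_pos (show (0 : ℝ) < 2 ^ n by positivity)]
    congr 1
    field_simp
  rw [Finset.sum_congr rfl fun x _ => e x, ← Finset.mul_sum] at h
  exact le_of_mul_le_mul_left h (by positivity)

end hybrid

/-! ### Fair coins -/

instance : IsProbabilityMeasure coinLaw := by unfold coinLaw; infer_instance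

/-- Putting a coin in front of a sequence of coins. -/
def consCoin (x : Bool × (ℕ → Bool)) : ℕ → Bool
  | 0 => x.1
  | i + 1 => x.2 i

theorem measurable_consCoin : Measurable consCoin := by
  refine measurable_pi_iff.2 fun i => ?_
  cases i with
  | zero => exact measurable_fst
  | succ i => exact (measurable_pi_apply i).comp measurable_snd

/-- Prepending an independent fair coin does not change the law of the sequence; it suffices to
compare finite boxes, after splitting off coordinate zero. -/
theorem map_consCoin :
    ((PMF.uniformOfFintype Bool).toMeasure.prod coinLaw).map consCoin = coinLaw := by
  classical
  conv_rhs => rw [coinLaw]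
  refine Measure.eq_infinitePi _ fun s t ht => ?_
  have e : consCoin ⁻¹' Set.pi (s : Set ℕ) t =
      (if 0 ∈ s then t 0 else Set.univ) ×ˢ
        Set.pi ((s.preimage (· + 1) ((add_left_injective 1).injOn) : Finset ℕ) : Set ℕ)
          fun i => t (i + 1) := by
    ext x
    simp only [Set.mem_preimage, Set.mem_pi, Set.mem_prod, Finset.coe_preimage]
    constructor
    · intro h
      refine ⟨?_, fun i hi => h (i + 1) hi⟩
      split_ifs with h0
      · exact h 0 h0
      · trivial
    · rintro ⟨h1, h2⟩ i hi
      cases i with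
      | zero => rw [if_pos (by exact hi)] at h1; exact h1
      | succ i => exact h2 i hi
  rw [Measure.map_apply measurable_consCoin (MeasurableSet.pi s.countable_toSet fun i _ => ht i), e,
    Measure.prod_prod, coinLaw, Measure.infinitePi_pi _ fun i _ => ht (i + 1)]
  rw [Finset.prod_preimage' (· + 1) s _ fun i => (PMF.uniformOfFintype Bool).toMeasure (t i),
    ← Finset.prod_filter_mul_prod_filter_not s (· = 0)]
  congr 1
  · by_cases h0 : 0 ∈ s
    · simp [h0, Finset.filter_eq']
    · simp only [h0, if_false, measure_univ, Finset.filter_eq', Finset.prod_empty]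
  · refine Finset.prod_congr (Finset.filter_congr fun i _ => ?_) fun _ _ => rfl
    cases i <;> simp

theorem measurable_shift (k : ℕ) : Measurable fun (ω : ℕ → Bool) i => ω (i + k) :=
  measurable_pi_iff.2 fun i => measurable_pi_apply (i + k)

theorem measurableSet_first (b : Bool) {T : Set (ℕ → Bool)} (hT : MeasurableSet T) :
    MeasurableSet {ω : ℕ → Bool | ω 0 = b ∧ (fun i => ω (i + 1)) ∈ T} :=
  ((measurableSet_singleton b).preimage (measurable_pi_apply (X := fun _ : ℕ => Bool) 0)).inter
    (hT.preimage (measurable_shift 1))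

theorem coinLaw_first (b : Bool) {T : Set (ℕ → Bool)} (hT : MeasurableSet T) :
    coinLaw {ω | ω 0 = b ∧ (fun i => ω (i + 1)) ∈ T} = coinLaw T / 2 := by
  have e : consCoin ⁻¹' {ω : ℕ → Bool | ω 0 = b ∧ (fun i => ω (i + 1)) ∈ T} = {b} ×ˢ T := by
    ext x; simp [consCoin]
  conv_lhs => rw [← map_consCoin]
  rw [Measure.map_apply measurable_consCoin (measurableSet_first b hT), e, Measure.prod_prod,
    PMF.toMeasure_apply_singleton _ _ (measurableSet_singleton b)]
  simp [div_eq_mul_inv, mul_comm]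

theorem measurable_coinInt (K : ℕ) : Measurable fun ω => coinInt ω K := by
  induction K with
  | zero => exact measurable_const
  | succ K ih =>
    have h : Measurable fun b : Bool => b.toNat := measurable_from_top
    exact (ih.const_mul 2).add (h.comp (measurable_pi_apply K))

/-- The last of the `K + 1` digits is the first coin of the sequence that remains after `K` coins,
so it can be absorbed into the event `T`. -/
theorem coinLaw_coinInt_eq (K : ℕ) {R : ℕ} (hR : R < 2 ^ K) {T : Set (ℕ → Bool)}
    (hT : MeasurableSet T) :
    coinLaw {ω | coinInt ω K = R ∧ (fun i => ω (i + K)) ∈ T} = coinLaw T / 2 ^ K := by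
  induction K generalizing R T with
  | zero =>
    have : R = 0 := by simpa using hR
    subst this
    simp [coinInt]
    rfl
  | succ K ih =>
    have hR' : R / 2 < 2 ^ K := by rw [pow_succ] at hR; omega
    obtain ⟨b, hb⟩ : ∃ b : Bool, b.toNat = R % 2 := by
      rcases Nat.mod_two_eq_zero_or_one R with h | h
      · exact ⟨false, by simp [h]⟩
      · exact ⟨true, by simp [h]⟩
    have hT' : MeasurableSet {ω : ℕ → Bool | ω 0 = b ∧ (fun i => ω (i + 1)) ∈ T} :=
      measurableSet_first b hT
    have e : {ω : ℕ → Bool | coinInt ω (K + 1) = R ∧ (fun i => ω (i + (K + 1))) ∈ T} =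
        {ω | coinInt ω K = R / 2 ∧
          (fun i => ω (i + K)) ∈ {ω : ℕ → Bool | ω 0 = b ∧ (fun i => ω (i + 1)) ∈ T}} := by
      ext ω
      simp only [coinInt, Set.mem_ofPred_eq, zero_add]
      rw [← and_assoc]
      have h1 : (fun i => ω (i + 1 + K)) = fun i => ω (i + (K + 1)) := by
        funext i; congr 1; ring
      rw [h1]
      refine and_congr_left fun _ => ?_
      have h2 := Bool.toNat_le (ω K)
      have h3 : ω K = b ↔ (ω K).toNat = b.toNat := by
        cases ω K <;> cases b <;> simp
      rw [h3, hb]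
      omega
    rw [e, ih hR' hT', coinLaw_first b hT, ENNReal.div_eq_inv_mul, ENNReal.div_eq_inv_mul,
      ENNReal.div_eq_inv_mul, ← mul_assoc, pow_succ, ENNReal.mul_inv (by simp) (by simp)]

theorem coinLaw_coinInt_mem (K : ℕ) (S : ℕ → Prop) [DecidablePred S] {T : Set (ℕ → Bool)}
    (hT : MeasurableSet T) :
    coinLaw {ω | S (coinInt ω K) ∧ (fun i => ω (i + K)) ∈ T} =
      ((Finset.range (2 ^ K)).filter S).card / 2 ^ K * coinLaw T := by
  have e : {ω | S (coinInt ω K) ∧ (fun i => ω (i + K)) ∈ T} =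
      ⋃ R ∈ (Finset.range (2 ^ K)).filter S, {ω | coinInt ω K = R ∧ (fun i => ω (i + K)) ∈ T} := by
    ext ω
    simp only [Set.mem_ofPred_eq, Set.mem_iUnion, Finset.mem_filter, Finset.mem_range, exists_prop]
    constructor
    · rintro ⟨h1, h2⟩
      exact ⟨_, ⟨coinInt_lt ω K, h1⟩, rfl, h2⟩
    · rintro ⟨R, ⟨-, h1⟩, rfl, h2⟩
      exact ⟨h1, h2⟩
  rw [e, measure_biUnion_finset]
  · rw [Finset.sum_congr rfl fun R hR =>
      coinLaw_coinInt_eq K (Finset.mem_range.1 (Finset.mem_filter.1 hR).1) hT]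
    rw [Finset.sum_const, nsmul_eq_mul, ENNReal.div_eq_inv_mul, ENNReal.div_eq_inv_mul]
    ring
  · intro R _ R' _ h
    refine Set.disjoint_left.2 fun ω h1 h2 => h (h1.1.symm.trans h2.1)
  · exact fun R _ => (measurable_coinInt K (measurableSet_singleton R)).inter (measurable_shift K hT)

/-- Different bits use disjoint blocks of coins. Carrying an arbitrary event `T` for the unused
coins along makes this independence available to the induction. -/
theorem coinLaw_sampleState (K : ℕ) (M : (Fin n → ℤ) → ℤ) (x : Bits n) {j : ℕ} (hj : j ≤ n)
    {T : Set (ℕ → Bool)} (hT : MeasurableSet T) :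
    coinLaw {ω | (sampleState K M ω j).1 = partialSign x j ∧ (sampleState K M ω j).2 ∈ T} =
      ENNReal.ofReal (∏ i : Fin n, if (i : ℕ) < j then bitProb K M x i else 1) * coinLaw T := by
  classical
  induction j generalizing T with
  | zero => simp [sampleState, partialSign_zero]
  | succ j ih =>
    set i : Fin n := ⟨j, hj⟩ with hi
    set a := M (Function.update (partialSign x j) i 1)
    set b := M (Function.update (partialSign x j) i (-1))
    set S : ℕ → Prop := fun R => (if (R : ℤ) * (a + b) < 2 ^ K * a then (1 : ℤ) else -1) = bitInt (x i)
    set T' : Set (ℕ → Bool) := {ω | S (coinInt ω K) ∧ (fun i => ω (i + K)) ∈ T} with hT'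
    have hmT' : MeasurableSet T' :=
      ((measurable_coinInt K) (MeasurableSet.of_discrete (s := {R | S R}))).inter (measurable_shift K hT)
    have e : {ω | (sampleState K M ω (j + 1)).1 = partialSign x (j + 1) ∧
        (sampleState K M ω (j + 1)).2 ∈ T} =
        {ω | (sampleState K M ω j).1 = partialSign x j ∧ (sampleState K M ω j).2 ∈ T'} := by
      ext ω
      rw [Set.mem_ofPred_eq, Set.mem_ofPred_eq, sampleState_succ K M ω hj, sampleStep, hT',
        Set.mem_ofPred_eq, ← and_assoc]
      refine and_congr_left fun _ => ?_
      dsimp only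
      have hps := partialSign_succ x i
      simp only [hi] at hps
      rw [hps]
      -- The sign to be set is still zero, so the previous state can be recovered from the updated
      -- one.
      have hz : (sampleState K M ω j).1 i = 0 := by
        have : ∀ k ≤ j, (sampleState K M ω k).1 i = 0 := by
          intro k hk
          induction k with
          | zero => simp [sampleState]
          | succ k ihk =>
            rw [sampleState_succ K M ω (by omega), sampleStep]
            have : i ≠ ⟨k, by omega⟩ := fun h => by
              have := congrArg Fin.val h; simp [hi] at this; omega
            simp only [Function.update_of_ne this]
            exact ihk (by omega)
        exact this j le_rfl
      constructor
      · intro h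
        have h1 : (sampleState K M ω j).1 = partialSign x j := by
          funext k
          by_cases hk : k = i
          · subst hk
            rw [hz]; simp [partialSign, hi]
          · have := congrFun h k
            rwa [Function.update_of_ne hk, Function.update_of_ne hk] at this
        have h2 := congrFun h i
        rw [Function.update_self, Function.update_self, h1] at h2
        exact ⟨h1, h2⟩
      · rintro ⟨h1, h2⟩
        rw [h1]
        exact congrArg _ h2
    rw [e, ih (by omega) hmT', coinLaw_coinInt_mem K S hT, ← mul_assoc]
    congr 1
    have hprod : (∏ k : Fin n, if (k : ℕ) < j + 1 then bitProb K M x k else 1) =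
        (∏ k : Fin n, if (k : ℕ) < j then bitProb K M x k else 1) * bitProb K M x i := by
      have e : bitProb K M x i = ∏ k : Fin n, if k = i then bitProb K M x k else 1 := by simp
      rw [e, ← Finset.prod_mul_distrib]
      refine Finset.prod_congr rfl fun k _ => ?_
      by_cases h : k = i
      · subst h; simp [hi]
      · have h1 : (k : ℕ) ≠ j := fun h' => h (Fin.ext h')
        have h2 : (k : ℕ) < j + 1 ↔ (k : ℕ) < j := by omega
        simp [h, h2]
    rw [hprod, ENNReal.ofReal_mul (Finset.prod_nonneg fun k _ => by
      split_ifs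
      · exact bitProb_nonneg _ _ _ _
      · exact zero_le_one)]
    congr 1
    have hc : bitProb K M x i = ((Finset.range (2 ^ K)).filter S).card / 2 ^ K := by
      have hps : plusCount K a b + ((Finset.range (2 ^ K)).filter
          fun R : ℕ => ¬ (R : ℤ) * (a + b) < 2 ^ K * a).card = 2 ^ K := by
        rw [plusCount, Finset.card_filter_add_card_filter_not, Finset.card_range]
      have hps' : (plusCount K a b : ℝ) + ((Finset.range (2 ^ K)).filter
          fun R : ℕ => ¬ (R : ℤ) * (a + b) < 2 ^ K * a).card = 2 ^ K := by exact_mod_cast hps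
      rw [bitProb]
      by_cases hx : x i = 0
      · have hS : (Finset.range (2 ^ K)).filter S =
            (Finset.range (2 ^ K)).filter fun R : ℕ => (R : ℤ) * (a + b) < 2 ^ K * a := by
          refine Finset.filter_congr fun R _ => ?_
          simp only [S, bitInt, hx, if_true]
          split_ifs with h <;> simp [h]
        rw [hS]
        simp only [hx, if_true]
        rfl
      · have hS : (Finset.range (2 ^ K)).filter S =
            (Finset.range (2 ^ K)).filter fun R : ℕ => ¬ (R : ℤ) * (a + b) < 2 ^ K * a := by
          refine Finset.filter_congr fun R _ => ?_
          simp only [S, bitInt, hx, if_false]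
          split_ifs with h <;> simp [h]
        rw [hS]
        simp only [hx, if_false]
        rw [eq_div_iff (by positivity), sub_mul, div_mul_cancel₀ _ (by positivity)]
        simp only [hi] at hps' ⊢
        linarith
    rw [hc, ENNReal.ofReal_div_of_pos (by positivity), ENNReal.ofReal_natCast,
      ENNReal.ofReal_pow (by norm_num), ENNReal.ofReal_ofNat]

theorem sampleState_sign (K : ℕ) (M : (Fin n → ℤ) → ℤ) (ω : ℕ → Bool) {j : ℕ} (hj : j ≤ n)
    (i : Fin n) (hi : (i : ℕ) < j) :
    (sampleState K M ω j).1 i = 1 ∨ (sampleState K M ω j).1 i = -1 := by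
  induction j with
  | zero => omega
  | succ j ih =>
    rw [sampleState_succ K M ω hj, sampleStep]
    by_cases h : i = ⟨j, hj⟩
    · subst h
      simp only [Function.update_self]
      split_ifs <;> simp
    · simp only [Function.update_of_ne h]
      have : (i : ℕ) ≠ j := fun h' => h (Fin.ext h')
      exact ih (by omega) (by omega)

/-- The law of the sampled bits. -/
theorem coinLaw_real_signBits (K : ℕ) (M : (Fin n → ℤ) → ℤ) (x : Bits n) :
    coinLaw.real {ω | signBits (sampleState K M ω n).1 = x} = ∏ i, bitProb K M x i := by
  have h := coinLaw_sampleState K M x le_rfl MeasurableSet.univ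
  have e : {ω | signBits (sampleState K M ω n).1 = x} =
      {ω | (sampleState K M ω n).1 = partialSign x n ∧ (sampleState K M ω n).2 ∈ Set.univ} := by
    ext ω
    simp only [Set.mem_ofPred_eq, Set.mem_univ, and_true]
    constructor
    · rintro rfl
      funext i
      rcases sampleState_sign K M ω le_rfl i i.2 with h | h <;>
        simp [partialSign, signBits, bitInt, h]
    · intro h
      funext i
      have hx : x i = 0 ∨ x i = 1 := by
        generalize x i = b; fin_cases b <;> simp
      rcases hx with hx | hx <;> simp [h, partialSign, signBits, bitInt, hx]
  rw [Measure.real, e, h]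
  have hnn : 0 ≤ ∏ i, bitProb K M x i := Finset.prod_nonneg fun i _ => bitProb_nonneg _ _ _ _
  simp [ENNReal.toReal_ofReal hnn]

/-! ### Combinations of paths as functions of signs -/

/-- A linear combination of Pauli paths, as a function of the signs of the qubits. -/
def pathFun (arch : Architecture m d) (c : Path m d → ℝ) (C : Circuit m d) (z : Fin (2 * m) → ℤ) :
    ℝ := ∑ s, c s * pathAmp arch C s * zprod (s (Fin.last d)) fun j => (z j : ℝ)

/-- Each qubit contributes `1`, its sign, or `0`, all of them affine in the sign. -/
theorem multiAffine_zprod (s : PStr n) :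
    MultiAffine fun z : Fin n → ℤ => zprod s fun j => (z j : ℝ) := by
  intro z j
  have h : ∀ a : ℤ, zprod s (fun i => (Function.update z j a i : ℝ)) =
      zfac (s j) (a : ℝ) * ∏ i ∈ Finset.univ.erase j, zfac (s i) (z i : ℝ) := by
    intro a
    rw [zprod, ← Finset.mul_prod_erase _ _ (Finset.mem_univ j), Function.update_self]
    refine congrArg _ (Finset.prod_congr rfl fun i hi => ?_)
    rw [Function.update_of_ne (Finset.ne_of_mem_erase hi)]
  simp only [h]
  rw [← add_mul, ← mul_assoc]
  congr 1
  unfold zfac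
  push_cast
  split_ifs <;> ring

theorem multiAffine_pathFun (arch : Architecture m d) (c : Path m d → ℝ) (C : Circuit m d) :
    MultiAffine (pathFun arch c C) := by
  intro z j
  simp only [pathFun]
  rw [← Finset.sum_add_distrib, Finset.mul_sum]
  refine Finset.sum_congr rfl fun s _ => ?_
  have := multiAffine_zprod (s (Fin.last d)) z j
  simp only at this
  rw [← mul_add, this]
  ring

theorem pathFun_partialSign (arch : Architecture m d) (c : Path m d → ℝ) (C : Circuit m d)
    (x : Bits (2 * m)) :
    pathFun arch c C (partialSign x (2 * m)) = 2 ^ (2 * m) * pathSum arch c C x := by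
  have h : (fun j => (partialSign x (2 * m) j : ℝ)) = bitSign x := by
    funext j
    simp only [partialSign, j.2, if_true, bitInt, bitSign]
    split_ifs <;> simp
  rw [pathFun, pathSum, h, ← mul_assoc, mul_inv_cancel₀ (by positivity), one_mul]

theorem pathFun_sub (arch : Architecture m d) (c c' : Path m d → ℝ) (C : Circuit m d)
    (z : Fin (2 * m) → ℤ) :
    pathFun arch (fun s => c s - c' s) C z = pathFun arch c C z - pathFun arch c' C z := by
  simp only [pathFun, ← Finset.sum_sub_distrib, sub_mul]

theorem zprod_zero_left (z : Fin n → ℝ) : zprod 0 z = 1 := by simp [zprod, zfac]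

theorem pathAmp_zero (arch : Architecture m d) (C : Circuit m d) : pathAmp arch C 0 = 1 := by
  have h : ∀ t, trans arch C t 0 0 = 1 := fun t => by
    have hz : ∀ g, pairEquiv (arch t) (Fin 4) 0 g = 0 := fun g => rfl
    simp [trans, hz, rc_zero_left]
  simp [pathAmp, h, zprod_zero_left]

theorem wt_zero : wt (0 : PStr n) = 0 := by simp [wt]

theorem pathAmp_eq_zero_of_last {arch : Architecture m d} {s : Path m d} (hs : s ≠ 0)
    (h : s (Fin.last d) = 0) (C : Circuit m d) : pathAmp arch C s = 0 := by
  by_contra hC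
  have hstep : ∀ t : Fin d, s t.castSucc = 0 ↔ s t.succ = 0 := fun t => by
    by_contra ht
    exact hC (by rw [pathAmp, Finset.prod_eq_zero (Finset.mem_univ t) (trans_eq_zero ht C), mul_zero])
  refine hs (funext fun t => ?_)
  induction t using Fin.reverseInduction with
  | last => exact h
  | cast t ih => exact (hstep t).2 ih

/-- Normalisation: with all signs zero, a path contributes only if it ends in the trivial string,
and then it is trivial throughout or has amplitude zero. -/
theorem pathFun_zero (arch : Architecture m d) {c : Path m d → ℝ} (hc : c 0 = 1)
    (C : Circuit m d) : pathFun arch c C 0 = 1 := by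
  rw [pathFun, Finset.sum_eq_single 0]
  · simp [hc, pathAmp_zero, zprod_zero_left]
  · intro s _ hs
    by_cases h : s (Fin.last d) = 0
    · rw [pathAmp_eq_zero_of_last hs h]; simp
    · obtain ⟨j, hj⟩ := Function.ne_iff.1 h
      have : zprod (s (Fin.last d)) (fun j => (((0 : Fin (2 * m) → ℤ) j : ℤ) : ℝ)) = 0 := by
        refine Finset.prod_eq_zero (Finset.mem_univ j) ?_
        have hj' : s (Fin.last d) j ≠ 0 := hj
        simp [zfac, hj']
      rw [this, mul_zero]
  · simp

/-- The coefficients of the noisy circuit. -/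
def noiseCoeff (γ : ℝ) (s : Path m d) : ℝ := (1 - γ) ^ pathWt s

theorem noiseCoeff_zero (γ : ℝ) : noiseCoeff γ (0 : Path m d) = 1 := by
  simp [noiseCoeff, pathWt, wt_zero]

theorem pathSum_noiseCoeff (γ : ℝ) (arch : Architecture m d) (C : Circuit m d) (x : Bits (2 * m)) :
    pathSum arch (noiseCoeff γ) C x = noisyProb γ arch C x := (noisyProb_eq γ arch C x).symm

/-- The wires of an architecture, continued beyond the last layer. -/
def extendedWires (hd : 0 < d) (arch : Architecture m d) (t : ℕ) : Fin m × Fin 2 ≃ Fin (2 * m) :=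
  arch ⟨min t (d - 1), by omega⟩

/-- The transfer coefficients of a circuit, continued beyond the last layer. -/
def extendedCoeff (hd : 0 < d) (C : Circuit m d) (t : ℕ) (g : Fin m) : Pauli2 → Pauli2 → ℝ :=
  rc (C ⟨min t (d - 1), by omega⟩ g)

theorem extend_fin (hd : 0 < d) (t : Fin d) :
    (⟨min (t : ℕ) (d - 1), by omega⟩ : Fin d) = t := by
  ext
  have := t.2
  simp only
  omega

open Classical in
/-- The indicator of the paths that the algorithm takes into account. -/
def keepIndicator (hd : 0 < d) (arch : Architecture m d) (L : ℕ) (s : Path m d) : ℝ :=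
  if L < d then if s = 0 then 1 else 0 else retainedIndicator (extendedWires hd arch) L (L / d) s

/-- The coefficients of the paths that the algorithm ignores. -/
def tailCoeff (hd : 0 < d) (arch : Architecture m d) (γ : ℝ) (L : ℕ) (s : Path m d) : ℝ :=
  noiseCoeff γ s - noiseCoeff γ s * keepIndicator hd arch L s

/-- If `L < d`, a non-trivial path of non-zero amplitude has weight above `d`, so noise suppresses
it. Otherwise all paths of weight at most `L` are kept, and the others are suppressed by noise
whether or not they are kept. -/
theorem abs_tailCoeff_le (hd : 0 < d) (arch : Architecture m d) {γ : ℝ} (h0 : 0 ≤ γ) (h1 : γ ≤ 1)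
    (L : ℕ) (s : Path m d) :
    |tailCoeff hd arch γ L s| ≤ (1 - γ) ^ L ∨ ∀ C, pathAmp arch C s = 0 := by
  have hlam0 : 0 ≤ 1 - γ := by linarith
  have hlam1 : 1 - γ ≤ 1 := by linarith
  rw [tailCoeff, ← mul_one_sub]
  by_cases hL : L < d
  · rw [keepIndicator, if_pos hL]
    by_cases hs : s = 0
    · left
      simp only [hs, if_true, sub_self, mul_zero, abs_zero]
      positivity
    · rcases lt_pathWt_or_pathAmp_eq_zero arch hs with h | h
      · left
        simp only [hs, if_false, sub_zero, mul_one, noiseCoeff]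
        rw [abs_of_nonneg (by positivity)]
        exact pow_le_pow_of_le_one hlam0 hlam1 (by omega)
      · exact Or.inr h
  · left
    rw [keepIndicator, if_neg hL]
    by_cases hs : pathWt s ≤ L
    · rw [retainedIndicator_eq_one _ hd hs]
      simp only [sub_self, mul_zero, abs_zero]
      positivity
    · obtain ⟨r0, r1⟩ := retainedIndicator_mem (extendedWires hd arch) L (L / d) s
      rw [noiseCoeff, abs_mul, abs_of_nonneg (show (0 : ℝ) ≤ (1 - γ) ^ pathWt s by positivity),
        abs_of_nonneg (show 0 ≤ 1 - retainedIndicator (extendedWires hd arch) L (L / d) s by linarith)]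
      refine (mul_le_of_le_one_right (by positivity) (by linarith)).trans ?_
      exact pow_le_pow_of_le_one hlam0 hlam1 (by omega)

theorem pathFun_keepIndicator_of_lt (hd : 0 < d) (arch : Architecture m d) (γ : ℝ) {L : ℕ}
    (hL : L < d) (C : Circuit m d) (z : Fin (2 * m) → ℤ) :
    pathFun arch (fun s => noiseCoeff γ s * keepIndicator hd arch L s) C z = 1 := by
  rw [pathFun, Finset.sum_eq_single 0]
  · simp [keepIndicator, hL, noiseCoeff_zero, pathAmp_zero, zprod_zero_left]
  · intro s _ hs
    simp [keepIndicator, hL, hs]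
  · simp

theorem pathFun_keepIndicator (hd : 0 < d) (arch : Architecture m d) (γ : ℝ) {L : ℕ}
    (hL : ¬ L < d) (C : Circuit m d) (z : Fin (2 * m) → ℤ) :
    pathFun arch (fun s => noiseCoeff γ s * keepIndicator hd arch L s) C z =
      marginalReal (extendedWires hd arch) (extendedCoeff hd C) (1 - γ) L (L / d) d z := by
  rw [marginalReal_eq arch C _ (extendedCoeff hd C) (fun t => by rw [extendedWires, extend_fin hd])
    (fun t g => by rw [extendedCoeff, extend_fin hd]) (fun t g Q => rc_zero_left _ _)
    (fun t g P => rc_zero_right _ _)]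
  refine Finset.sum_congr rfl fun s _ => ?_
  simp only [keepIndicator, if_neg hL, noiseCoeff]

/-! ### The error of the numerical computation -/

section describes

variable {I : Input} {arch : Architecture m d} {C : Circuit m d} {γ ε δ : ℝ}

theorem Approximates.abs_le {a : ℕ → ℤ} {x : ℝ} (h : Approximates a x) (hx : |x| ≤ 1) (k : ℕ) :
    |a k| ≤ 2 ^ k + 1 := by
  have h1 := abs_add_le ((a k : ℝ) - 2 ^ k * x) (2 ^ k * x)
  rw [sub_add_cancel, abs_mul, abs_of_pos (show (0 : ℝ) < 2 ^ k by positivity)] at h1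
  have h2 := mul_le_mul_of_nonneg_left hx (show (0 : ℝ) ≤ 2 ^ k by positivity)
  have h3 := h k
  have : |(a k : ℝ)| ≤ 2 ^ k + 1 := by linarith
  exact_mod_cast this

theorem abs_re_entry_le (U : Gate) (r s : TwoBits) :
    |((U : Matrix TwoBits TwoBits ℂ) r s).re| ≤ 1 :=
  (Complex.abs_re_le_norm _).trans (entry_norm_bound_of_unitary U.2 r s)

theorem abs_im_entry_le (U : Gate) (r s : TwoBits) :
    |((U : Matrix TwoBits TwoBits ℂ) r s).im| ≤ 1 :=
  (Complex.abs_im_le_norm _).trans (entry_norm_bound_of_unitary U.2 r s)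

theorem Input.Describes.gateNum_sub (hI : I.Describes arch C γ ε δ) (hd : 0 < d) (K : ℕ) {t : ℕ}
    (ht : t < d) (g : Fin m) (P Q : Pauli2) :
    |(gateNum (fun r s => ⟨I.entry t g r s false K, I.entry t g r s true K⟩) P Q : ℝ) -
      4 * (2 ^ K) ^ 2 * extendedCoeff hd C t g P Q| ≤ 2048 * 2 ^ K := by
  have e : extendedCoeff hd C t g = rc (C ⟨t, ht⟩ g) := by
    rw [extendedCoeff]
    have := extend_fin hd ⟨t, ht⟩
    simp only at this
    rw [this]
  rw [e]
  exact gateNum_approx _ _ (one_le_pow₀ (by norm_num)) (fun r s => hI.re ⟨t, ht⟩ g r s K)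
    (fun r s => hI.im ⟨t, ht⟩ g r s K) P Q

theorem abs_extendedCoeff_le (hd : 0 < d) (C : Circuit m d) (t : ℕ) (g : Fin m) (P Q : Pauli2) :
    |extendedCoeff hd C t g P Q| ≤ 1 := abs_rc_le_one _ _ _

theorem five_hundred_twelve_le {K : ℕ} (hK : 9 ≤ K) : (512 : ℝ) ≤ 2 ^ K := by
  calc (512 : ℝ) = 2 ^ 9 := by norm_num
    _ ≤ 2 ^ K := pow_le_pow_right₀ (by norm_num) hK

theorem Input.Describes.abs_gateNum_le (hI : I.Describes arch C γ ε δ) (hd : 0 < d) {K : ℕ}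
    (hK : 9 ≤ K) {t : ℕ} (ht : t < d) (g : Fin m) (P Q : Pauli2) :
    |gateNum (fun r s => ⟨I.entry t g r s false K, I.entry t g r s true K⟩) P Q| ≤
      2 * (4 * 2 ^ K * 2 ^ K) := by
  have h1 := hI.gateNum_sub hd K ht g P Q
  have h2 := abs_extendedCoeff_le hd C t g P Q
  have h3 := five_hundred_twelve_le hK
  set a := gateNum (fun r s => ⟨I.entry t g r s false K, I.entry t g r s true K⟩) P Q
  set b := extendedCoeff hd C t g P Q
  have h4 := abs_add_le ((a : ℝ) - 4 * (2 ^ K) ^ 2 * b) (4 * (2 ^ K) ^ 2 * b)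
  rw [sub_add_cancel, abs_mul, abs_of_pos (show (0 : ℝ) < 4 * (2 ^ K) ^ 2 by positivity)] at h4
  have h5 := mul_le_mul_of_nonneg_left h2 (show (0 : ℝ) ≤ 4 * (2 ^ K) ^ 2 by positivity)
  have : |(a : ℝ)| ≤ 2 * (4 * 2 ^ K * 2 ^ K) := by nlinarith
  exact_mod_cast this

/-- The error `2048 * 2 ^ K` of a gate numerator, divided by `4 * 4 ^ K`, is the tolerance `512 / 2
^ K` of `Close.mul_div`. The noise parameter is off by only `1 / 2 ^ K`. -/
theorem opsClose {p : Setting m} (hI : p.I.Describes arch C γ ε δ) (hd : 0 < d) (h0 : 0 ≤ γ)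
    (h1 : γ ≤ 1) (hD : p.D ≤ d) (hlam : p.lam = 2 ^ p.K - p.I.param 0 p.K) (fwd : Bool) :
    OpsClose ((2 ^ p.K : ℤ) : ℝ) (p.ops fwd)
      (realOps (fun t g P Q => extendedCoeff hd C t g (if fwd then P else Q) (if fwd then Q else P))
        (1 - γ)) p.D := by
  have hp := five_hundred_twelve_le p.K_ge
  have hp0 : (0 : ℝ) < 2 ^ p.K := by positivity
  push_cast
  constructor
  · intro t ht g P Q j v V hv
    refine hv.mul_div hp (by positivity) (abs_extendedCoeff_le hd C t g _ _) ?_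
    have h := hI.gateNum_sub hd p.K (ht.trans_le hD) g (if fwd then P else Q) (if fwd then Q else P)
    set a := gateNum _ _ _
    set b := extendedCoeff hd C t g (if fwd then P else Q) (if fwd then Q else P)
    have e : (a : ℝ) / ((4 * 2 ^ p.K * 2 ^ p.K : ℤ) : ℝ) - b =
        (a - 4 * (2 ^ p.K) ^ 2 * b) / (4 * (2 ^ p.K) ^ 2) := by
      push_cast
      field_simp
    rw [e, abs_div, abs_of_pos (show (0 : ℝ) < 4 * (2 ^ p.K) ^ 2 by positivity),
      div_le_div_iff₀ (by positivity) hp0]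
    nlinarith
  · intro j v V hv
    refine hv.mul_div hp (by positivity) (abs_le.2 ⟨by linarith, by linarith⟩) ?_
    have h := hI.gamma p.K
    have e : (p.lam : ℝ) / ((2 ^ p.K : ℤ) : ℝ) - (1 - γ) =
        -(p.I.param 0 p.K - 2 ^ p.K * γ) / 2 ^ p.K := by
      rw [hlam]; push_cast; field_simp; ring
    rw [e, abs_div, abs_neg, abs_of_pos hp0]
    gcongr
    linarith

end describes

/-! ### The choice of the precision -/

/-- The factor in the precision of the algorithm. -/
def precision (c₁ c₃ : ℕ) : ℕ := 13 * c₁ + c₃ + 68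

/-- The number of bits of the fixed-point numbers. -/
def precisionBits (m c₁ c₃ k : ℕ) : ℕ := precision c₁ c₃ * (k + 1) * (2 * m + 1)

/-- The exponent of the bound for the loops of the algorithm. -/
def loopExponent (c₁ c₃ : ℕ) : ℕ := precision c₁ c₃ + 4 * c₁ + c₃ + 2

section bounds

variable {c₁ c₃ k D : ℕ}

/-- One inequality collects every exponent that the precision must dominate. Sweep lengths are of
order `m * c₁ * k`, and `(k + 1) * (2 * m + 1)` dominates `k * m`, `k` and `m`; the constants are
`13 = 9 + 4` and `68 = 8 + 40 + 20`. -/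
theorem le_precisionBits (hD : D ≤ c₁ * k + 1) :
    9 * (c₁ * k) + c₃ * k + 2 * sweepLen m D + 40 * (k + 1) + 20 * (2 * m + 1) ≤ precisionBits m c₁ c₃ k := by
  set X := (k + 1) * (2 * m + 1) with hX
  have e : precisionBits m c₁ c₃ k = 13 * (c₁ * X) + c₃ * X + 68 * X := by
    rw [precisionBits, precision, hX]; ring
  have hkX : k ≤ X := by rw [hX]; nlinarith [Nat.zero_le (k * m)]
  have hkX' : k + 1 ≤ X := by rw [hX]; nlinarith [Nat.zero_le (k * m)]
  have hmX : 2 * m + 1 ≤ X := by rw [hX]; nlinarith [Nat.zero_le (k * m)]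
  have h1 := Nat.mul_le_mul_left c₁ hkX
  have h2 := Nat.mul_le_mul_left c₃ hkX
  have h3 : 2 * sweepLen m D ≤ 4 * (c₁ * X) + 8 * X := by
    have e1 : 2 * sweepLen m D = 6 * (m * (D + 1)) := by rw [sweepLen]; ring
    have e2 := Nat.mul_le_mul_left m (show D + 1 ≤ c₁ * k + 2 by omega)
    have e3 : 6 * (m * (c₁ * k + 2)) = 6 * (c₁ * (k * m)) + 12 * m := by ring
    have e4 : 4 * (c₁ * X) = 8 * (c₁ * (k * m)) + 4 * (c₁ * k) + 8 * (c₁ * m) + 4 * c₁ := by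
      rw [hX]; ring
    omega
  omega

theorem le_two_pow_self (a : ℕ) : a ≤ 2 ^ a := Nat.lt_two_pow_self.le

theorem succ_le_two_pow (a : ℕ) : a + 1 ≤ 2 ^ a := Nat.lt_two_pow_self

theorem sixteen_pow (a : ℕ) : 16 ^ a = 2 ^ (4 * a) := by rw [pow_mul]; norm_num

theorem precisionBits_le (hn : 2 * m < 2 ^ k) (hk : 0 < k) :
    precisionBits m c₁ c₃ k ≤ 2 ^ ((precision c₁ c₃ + 2) * k) := by
  have h1 : precision c₁ c₃ ≤ 2 ^ (precision c₁ c₃ * k) :=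
    (le_two_pow_self _).trans (Nat.pow_le_pow_right (by norm_num) (Nat.le_mul_of_pos_right _ hk))
  calc precisionBits m c₁ c₃ k ≤ 2 ^ (precision c₁ c₃ * k) * 2 ^ k * 2 ^ k :=
        Nat.mul_le_mul (Nat.mul_le_mul h1 (succ_le_two_pow k)) hn
    _ = _ := by rw [← pow_add, ← pow_add]; congr 1; ring

end bounds

/-- The setting of the algorithm. -/
theorem Input.Describes.exists_setting {I : Input} {arch : Architecture m d} {C : Circuit m d}
    {γ ε δ : ℝ} (hI : I.Describes arch C γ ε δ) (hm : 0 < m) (hd : 0 < d) (h0 : 0 ≤ γ) (h1 : γ ≤ 1)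
    {c₁ c₃ k : ℕ} (hk : 0 < k) (hn : 2 * m < 2 ^ k)
    (hw : (4 * (2 * m)) ^ (c₁ * k / min d (c₁ * k + 1)) ≤ 2 ^ (c₃ * k)) :
    ∃ p : Setting m, p.I = I ∧ p.L = c₁ * k ∧ p.K = precisionBits m c₁ c₃ k ∧
      p.B = 4 * precisionBits m c₁ c₃ k ∧ p.G = 2 ^ (loopExponent c₁ c₃ * k) ∧
      p.D = min d (p.L + 1) ∧ p.w = p.L / p.D ∧
      p.lam = 2 ^ p.K - p.I.param 0 p.K ∧ p.W = extendedWires hd arch := by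
  set K := precisionBits m c₁ c₃ k with hK
  set L := c₁ * k with hL
  set D := min d (L + 1) with hD
  have hDL : D ≤ L + 1 := min_le_right _ _
  have hDd : D ≤ d := min_le_left _ _
  have hD0 : 0 < D := by omega
  have hbig := le_precisionBits (m := m) (c₃ := c₃) (show D ≤ c₁ * k + 1 from hDL)
  rw [← hK, ← hL] at hbig
  have hD2 : D ≤ 2 ^ L := hDL.trans (succ_le_two_pow L)
  have h2 : 0 < 2 := by norm_num
  have hentry : ∀ t < D, ∀ (g : Fin m) r s im, |I.entry t g r s im K| ≤ 2 ^ K + 1 := by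
    intro t ht g r s im
    cases im
    · exact (hI.re ⟨t, by omega⟩ g r s).abs_le (abs_re_entry_le _ _ _) K
    · exact (hI.im ⟨t, by omega⟩ g r s).abs_le (abs_im_entry_le _ _ _) K
  have hlamle : |2 ^ K - I.param 0 K| ≤ 2 * 2 ^ K := by
    have h := abs_le.1 (hI.gamma K)
    have hp : (1 : ℝ) ≤ 2 ^ K := one_le_pow₀ (by norm_num)
    have h' : |(2 ^ K - I.param 0 K : ℝ)| ≤ 2 * 2 ^ K := by
      rw [abs_le]; constructor <;> nlinarith
    exact_mod_cast h'
  have hG2 : ∀ {a b : ℕ}, b ≤ loopExponent c₁ c₃ * k → a ≤ 2 ^ b → a ≤ 2 ^ (loopExponent c₁ c₃ * k) :=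
    fun hb ha => ha.trans (Nat.pow_le_pow_right h2 hb)
  have hexp : loopExponent c₁ c₃ * k = (precision c₁ c₃ + 2) * k + 4 * L + c₃ * k := by
    rw [loopExponent, hL]; ring
  have hprec : k ≤ (precision c₁ c₃ + 2) * k := Nat.le_mul_of_pos_left _ (by omega)
  let p : Setting m :=
    { I := I
      W := extendedWires hd arch
      K := K
      L := L
      D := D
      w := L / D
      B := 4 * K
      G := 2 ^ (loopExponent c₁ c₃ * k)
      lam := 2 ^ K - I.param 0 K
      m_pos := hm
      D_pos := hD0
      K_ge := by omega
      wire := fun t ht g b => by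
        have h := extend_fin hd ⟨t, ht.trans_le hDd⟩
        simp only at h
        rw [hI.wire, dif_pos ⟨by omega, g.2⟩, extendedWires, h]
      entry := hentry
      gateNum_le := fun t ht g P Q => hI.abs_gateNum_le hd (by omega) (ht.trans_le hDd) g P Q
      lam_le := hlamle
      m_lt := by
        have e1 := succ_le_two_pow (2 * m + 2)
        have e2 : 2 ^ (2 * m + 2) = 4 * 2 ^ (2 * m) := by rw [pow_add]; ring
        have e3 := succ_le_two_pow (2 * m)
        exact (show 4 * (2 * m) < 2 ^ (2 * m + 2) by omega).trans_le
          (Nat.pow_le_pow_right h2 (by omega))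
      -- Products of two sums at scale `2 ^ K` have about `2 * K` bits; the number of terms and the
      -- growth within sweeps fit into the remaining `2 * K`.
      value_lt := by
        have e1 : 2 ^ K + 1 ≤ 2 ^ (K + 1) := by
          rw [pow_succ]; have := Nat.one_le_two_pow (n := K); omega
        calc D * (4 * (2 * m)) ^ (L / D) * (16 ^ L * (2 ^ sweepLen m D * (2 ^ K + 1))) ^ 2
            ≤ 2 ^ L * 2 ^ (c₃ * k) * (2 ^ (4 * L) * (2 ^ sweepLen m D * 2 ^ (K + 1))) ^ 2 := by
              rw [sixteen_pow]
              gcongr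
          _ = 2 ^ (L + c₃ * k + 2 * (4 * L + (sweepLen m D + (K + 1)))) := by
              ring
          _ < 2 ^ (4 * K) := Nat.pow_lt_pow_right (by norm_num) (by omega)
      m_le := hG2 (b := k) (by omega) hn.le
      K_le := hG2 (b := (precision c₁ c₃ + 2) * k) (by omega) (precisionBits_le hn hk)
      D_le := hG2 (b := L) (by omega) hD2
      w_le := hG2 (b := L) (by omega) ((Nat.div_le_self _ _).trans (le_two_pow_self L))
      prefixes_le := hG2 (b := c₃ * k) (by omega) hw
      codes_le := hG2 (b := 4 * L) (by omega) (sixteen_pow L).le }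
  exact ⟨p, rfl, rfl, rfl, rfl, rfl, rfl, rfl, rfl, rfl⟩

/-- The quality of the approximations of the algorithm. -/
theorem Setting.abs_marginal_div_sub_le (p : Setting m) {arch : Architecture m d} {C : Circuit m d}
    {γ ε δ : ℝ} (hI : p.I.Describes arch C γ ε δ) (hd : 0 < d) (h0 : 0 ≤ γ) (h1 : γ ≤ 1)
    {c₁ c₃ k : ℕ} (hL : p.L = c₁ * k) (hK : p.K = precisionBits m c₁ c₃ k)
    (hD : p.D = min d (p.L + 1)) (hpw : p.w = p.L / p.D)
    (hlam : p.lam = 2 ^ p.K - p.I.param 0 p.K) (hW : p.W = extendedWires hd arch)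
    (hw : (4 * (2 * m)) ^ p.w ≤ 2 ^ (c₃ * k)) {z : Fin (2 * m) → ℤ} (hz : ∀ i, |z i| ≤ 1) :
    |(p.marginal z : ℝ) / (2 ^ p.K) ^ 2 -
      pathFun arch (fun s => noiseCoeff γ s * keepIndicator hd arch p.L s) C z| ≤
        1 / 2 ^ (2 * k + 3) := by
  have hDL : p.D ≤ p.L + 1 := hD ▸ min_le_right _ _
  have hDd : p.D ≤ d := hD ▸ min_le_left _ _
  have hbig := le_precisionBits (m := m) (c₃ := c₃) (hL ▸ hDL)
  rw [← hK, ← hL] at hbig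
  have hD2 : p.D ≤ 2 ^ p.L := hDL.trans (succ_le_two_pow p.L)
  have hPK : (0 : ℝ) < 2 ^ p.K := by positivity
  by_cases hLd : p.L < d
  · have e : p.marginal z = 2 ^ p.K * 2 ^ p.K := by
      rw [Setting.marginal, if_pos (by omega)]
    rw [pathFun_keepIndicator_of_lt hd arch γ hLd, e]
    push_cast
    rw [← sq, div_self (by positivity), sub_self, abs_zero]
    positivity
  · have hDd' : p.D = d := by omega
    have hsw : sweepErr (sweepLen m p.D) ≤ 2 ^ (10 + sweepLen m p.D) := by
      have : (0 : ℝ) < 2 ^ sweepLen m p.D := by positivity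
      rw [sweepErr, pow_add]
      linarith
    have hsw' : sweepErr (sweepLen m p.D) ≤ ((2 ^ p.K : ℤ) : ℝ) := by
      push_cast
      exact hsw.trans (pow_le_pow_right₀ (by norm_num) (by omega))
    have h := abs_marginalInt_sub (W := p.W) (opsClose hI hd h0 h1 hDd hlam true)
      (opsClose hI hd h0 h1 hDd hlam false) p.m_pos p.L p.w hz hsw'
    have hmr : marginalReal p.W (fun t g P Q => extendedCoeff hd C t g
        (if true then P else Q) (if true then Q else P)) (1 - γ) p.L p.w p.D z =
        pathFun arch (fun s => noiseCoeff γ s * keepIndicator hd arch p.L s) C z := by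
      rw [pathFun_keepIndicator hd arch γ hLd, hpw, hDd', hW]
      rfl
    have hM : p.marginal z = marginalInt p.W (p.ops true) (p.ops false) (2 ^ p.K) p.L p.w p.D z := by
      rw [Setting.marginal, if_neg (by omega)]
    rw [← hM, hmr] at h
    set F := pathFun arch (fun s => noiseCoeff γ s * keepIndicator hd arch p.L s) C z
    push_cast at h
    have e1 : (p.marginal z : ℝ) / (2 ^ p.K) ^ 2 - F =
        (p.marginal z - (2 ^ p.K) ^ 2 * F) / (2 ^ p.K) ^ 2 := by
      field_simp
    rw [e1, abs_div, abs_of_pos (show (0 : ℝ) < (2 ^ p.K) ^ 2 by positivity),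
      div_le_div_iff₀ (by positivity) (by positivity), one_mul]
    have hDr : (p.D : ℝ) ≤ 2 ^ p.L := by exact_mod_cast hD2
    have hwr : ((4 * (2 * m) : ℝ)) ^ p.w ≤ 2 ^ (c₃ * k) := by exact_mod_cast hw
    have h16 : (16 : ℝ) ^ p.L = 2 ^ (4 * p.L) := by rw [pow_mul]; norm_num
    have hnn := sweepErr_nonneg (sweepLen m p.D)
    -- All factors become powers of two, with `3 ≤ 2 ^ 2` and `1000 ≤ 2 ^ 10`, and the exponents sum
    -- to at most `K` besides the explicit factor `2 ^ K`.
    calc _ ≤ (p.D * (4 * (2 * m)) ^ p.w *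
          (3 * (16 ^ p.L) ^ 2 * sweepErr (sweepLen m p.D) * 2 ^ p.K)) * 2 ^ (2 * k + 3) :=
            mul_le_mul_of_nonneg_right h (by positivity)
      _ ≤ (2 ^ p.L * 2 ^ (c₃ * k) *
          (2 ^ 2 * (2 ^ (4 * p.L)) ^ 2 * 2 ^ (10 + sweepLen m p.D) * 2 ^ p.K)) * 2 ^ (2 * k + 3) := by
            rw [h16]
            gcongr
            norm_num
      _ = 2 ^ (p.L + c₃ * k + (2 + 4 * p.L * 2 + (10 + sweepLen m p.D)) + (2 * k + 3)) * 2 ^ p.K := by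
            ring
      _ ≤ 2 ^ p.K * 2 ^ p.K := by
            gcongr
            · norm_num
            · omega
      _ = (2 ^ p.K) ^ 2 := by ring

/-! ### The accuracy -/

theorem Approximates.one_le_mul {a : ℕ → ℤ} {x : ℝ} (h : Approximates a x) {k : ℕ} (hk : 2 ≤ a k) :
    1 ≤ 2 ^ k * x := by
  have h1 := (_root_.abs_le.1 (h k)).2
  have h2 : (2 : ℝ) ≤ a k := by exact_mod_cast hk
  linarith

theorem Approximates.mul_le_two {a : ℕ → ℤ} {x : ℝ} (h : Approximates a x) {k : ℕ} (hk : ¬ 2 ≤ a k) :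
    2 ^ k * x ≤ 2 := by
  have h1 := (_root_.abs_le.1 (h k)).1
  have h2 : (a k : ℝ) ≤ 1 := by exact_mod_cast (show a k ≤ 1 by omega)
  linarith

theorem Approximates.exists_two_le {a : ℕ → ℤ} {x : ℝ} (h : Approximates a x) (hx : 0 < x) :
    ∃ k₀, ∀ k, k₀ ≤ k → 2 ≤ a k := by
  obtain ⟨k₀, hk₀⟩ := pow_unbounded_of_one_lt (3 / x) (one_lt_two (α := ℝ))
  refine ⟨k₀, fun k hk => ?_⟩
  by_contra h2
  have h3 := h.mul_le_two h2
  have h4 := hk₀.trans_le (pow_le_pow_right₀ (one_le_two (α := ℝ)) hk)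
  rw [div_lt_iff₀ hx] at h4
  linarith

section describes

variable {I : Input} {arch : Architecture m d} {C : Circuit m d} {γ ε δ : ℝ}

/-- Approximations to positive numbers exceed one once the precision is high enough. The least such
`k` may depend on which correct answers are given. -/
theorem Input.Describes.exists_least_good (hI : I.Describes arch C γ ε δ) (hε : 0 < ε) (hδ : 0 < δ) :
    ∃ k, 0 < k ∧ I.Good (2 * m) k ∧ ∀ j, 0 < j → j < k → ¬ I.Good (2 * m) j := by
  classical
  obtain ⟨k₁, h₁⟩ := hI.eps.exists_two_le hε
  obtain ⟨k₂, h₂⟩ := hI.delta.exists_two_le hδ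
  have hex : ∃ k, 0 < k ∧ I.Good (2 * m) k := by
    refine ⟨k₁ + k₂ + 2 * m + 1, by omega, h₁ _ (by omega), h₂ _ (by omega), ?_⟩
    exact (show 2 * m < k₁ + k₂ + 2 * m + 1 by omega).trans Nat.lt_two_pow_self
  exact ⟨Nat.find hex, (Nat.find_spec hex).1, (Nat.find_spec hex).2,
    fun j hj hjk hg => Nat.find_min hex hjk ⟨hj, hg⟩⟩

/-- By minimality one of the three tests fails at `k - 1` unless `k = 1`, so `2 ^ k` is linear in
the parameter of the time bound. -/
theorem Input.Describes.two_pow_le (hI : I.Describes arch C γ ε δ) (hε : 0 < ε) (hε' : ε ≤ 1)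
    (hδ : 0 < δ) {k : ℕ} (hk : 0 < k) (hleast : ∀ j, 0 < j → j < k → ¬ I.Good (2 * m) j) :
    (2 : ℝ) ^ k ≤ 4 * (((2 * m : ℕ) : ℝ) + 1 / ε + 1 / δ) := by
  have e1 : 0 < 1 / ε := by positivity
  have e2 : 0 < 1 / δ := by positivity
  have e3 : (0 : ℝ) ≤ (2 * m : ℕ) := Nat.cast_nonneg _
  obtain ⟨j, rfl⟩ : ∃ j, k = j + 1 := ⟨k - 1, by omega⟩
  rw [pow_succ]
  rcases Nat.eq_zero_or_pos j with rfl | hj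
  · have : 1 ≤ 1 / ε := (one_le_div hε).2 hε'
    linarith
  · have hng := hleast j hj (by omega)
    simp only [Input.Good, not_and_or] at hng
    rcases hng with h | h | h
    · have := hI.eps.mul_le_two h
      have : (2 : ℝ) ^ j ≤ 2 * (1 / ε) := by
        rw [mul_one_div, le_div_iff₀ hε]; exact this
      linarith
    · have := hI.delta.mul_le_two h
      have : (2 : ℝ) ^ j ≤ 2 * (1 / δ) := by
        rw [mul_one_div, le_div_iff₀ hδ]; exact this
      linarith
    · have : (2 : ℝ) ^ j ≤ (2 * m : ℕ) := by exact_mod_cast not_lt.1 h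
      linarith

theorem Input.Describes.abs_param_le (hI : I.Describes arch C γ ε δ) (hγ : |γ| ≤ 1) (hε : |ε| ≤ 1)
    (hδ : |δ| ≤ 1) (i : Fin 3) (j : ℕ) : |I.param i j| ≤ 2 ^ j + 1 := by
  fin_cases i
  · exact hI.gamma.abs_le hγ j
  · exact hI.eps.abs_le hε j
  · exact hI.delta.abs_le hδ j

theorem bdd_initial {B : ℕ} (h : n < 2 ^ B) (ω : ℕ → Bool) : Bdd B (initial n ω).mem := by
  intro a
  simp only [initial]
  by_cases ha : a = 0
  · subst ha
    rw [Function.update_self, abs_of_nonneg (by positivity)]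
    exact_mod_cast h
  · rw [Function.update_of_ne ha]
    simp

/-- What the algorithm does on a description of a circuit. -/
theorem Input.Describes.runs_main (hI : I.Describes arch C γ ε δ) (hm : 0 < m) (hd : 0 < d)
    (hγ0 : 0 ≤ γ) (hγ1 : γ ≤ 1) (hε0 : 0 ≤ ε) (hε1 : ε ≤ 1) (hδ0 : 0 ≤ δ) (hδ1 : δ ≤ 1)
    {c₁ c₃ k : ℕ} (hk : 0 < k) (hgood : I.Good (2 * m) k)
    (hleast : ∀ j, 0 < j → j < k → ¬ I.Good (2 * m) j)
    (hw : (4 * (2 * m)) ^ (c₁ * k / min d (c₁ * k + 1)) ≤ 2 ^ (c₃ * k)) :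
    ∃ M : (Fin (2 * m) → ℤ) → ℤ,
      (∀ ω, Runs I (4 * precisionBits m c₁ c₃ k) (2 ^ (loopExponent c₁ c₃ * k))
        (mainProg c₁ (precision c₁ c₃)) (initial (2 * m) ω) fun σ => σ.output (2 * m) =
          signBits (sampleState (precisionBits m c₁ c₃ k) M ω (2 * m)).1) ∧
      (∀ ω, Bdd (4 * precisionBits m c₁ c₃ k) (initial (2 * m) ω).mem) ∧
      ∀ z : Fin (2 * m) → ℤ, (∀ i, |z i| ≤ 1) →
        |(M z : ℝ) / (2 ^ precisionBits m c₁ c₃ k) ^ 2 -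
          pathFun arch (fun s => noiseCoeff γ s * keepIndicator hd arch (c₁ * k) s) C z| ≤
            1 / 2 ^ (2 * k + 3) := by
  obtain ⟨p, hpI, hL, hK, hB, hG, hD, hpw, hlam, hW⟩ :=
    hI.exists_setting hm hd hγ0 hγ1 hk hgood.2.2 hw
  subst hpI
  have hwire : ∀ t, p.I.wire t 0 0 = 0 ↔ d ≤ t := fun t => by
    rw [hI.wire]
    by_cases ht : t < d
    · simp [ht, hm]
    · simp [ht, not_lt.1 ht]
  have hwire' : ∀ t, p.I.wire t 0 0 ≤ 2 * m := fun t => by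
    rw [hI.wire]
    split_ifs
    · exact (arch _ _).2
    · exact Nat.zero_le _
  have hpar := hI.abs_param_le (abs_le.2 ⟨by linarith, hγ1⟩) (abs_le.2 ⟨by linarith, hε1⟩)
    (abs_le.2 ⟨by linarith, hδ1⟩)
  refine ⟨p.marginal, fun ω => ?_, fun ω => bdd_initial ?_ ω, fun z hz => ?_⟩
  · rw [← hB, ← hG, ← hK]
    exact p.runs_main hk hgood hleast hpar (by unfold precision; omega) hL hK hD hpw hlam hwire hwire' ω
  · rw [← hB]
    have := p.m_lt
    omega
  · rw [← hK, ← hL]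
    refine p.abs_marginal_div_sub_le hI hd hγ0 hγ1 hL hK hD hpw hlam hW ?_ hz
    rw [hpw, hD, hL]
    exact hw

/-- By determinism the run that has been verified is the only one, so the output is a function of
the coins. -/
theorem outputProb_eq_of_runs {P : Program} {B G : ℕ} {f : (ℕ → Bool) → Bits n}
    (h : ∀ ω, Runs I B G P (initial n ω) fun σ => σ.output n = f ω)
    (hB : ∀ ω, Bdd B (initial n ω).mem) (x : Bits n) :
    outputProb P I n x = coinLaw.real {ω | f ω = x} := by
  rw [outputProb]
  congr 1
  ext ω
  rw [Set.mem_ofPred_eq, Set.mem_ofPred_eq]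
  have h' := h ω
  unfold Runs at h'
  obtain ⟨σ, T, h1, -, -, h2⟩ := h' (hB ω)
  constructor
  · rintro ⟨σ', T', h3, rfl⟩
    rw [← h1.det h3, h2]
  · rintro rfl
    exact ⟨σ, T, h1, h2⟩

theorem runsWithin_of_runs {P : Program} {B G : ℕ} {Q : (ℕ → Bool) → State → Prop} {b : ℝ}
    (h : ∀ ω, Runs I B G P (initial n ω) (Q ω)) (hB : ∀ ω, Bdd B (initial n ω).mem)
    (hb : ((P.weight * (G + 1) ^ P.depth * (B + 1) ^ 2 : ℕ) : ℝ) ≤ b) : RunsWithin P I n b := by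
  intro ω
  have h' := h ω
  unfold Runs at h'
  obtain ⟨σ, T, h1, h2, -, -⟩ := h' (hB ω)
  exact ⟨σ, T, h1, le_trans (by exact_mod_cast h2) hb⟩

/-- Numerical and truncation error are both at most `η = 4 ^ (-k) / 8` per marginal on average. Over
`n ≤ 2 ^ k` bits they add up to at most `2 * 2 ^ (-k) ≤ 2 * ε`, and the total variation distance
halves this. -/
theorem tvDist_le_of_marginals {K k : ℕ} (hd : 0 < d) (hγ0 : 0 ≤ γ) (hγ1 : γ ≤ 1)
    {M : (Fin (2 * m) → ℤ) → ℤ} {L : ℕ} (hK : 2 * k + 1 ≤ K) (hn : 2 * m < 2 ^ k)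
    (hkε : 1 ≤ 2 ^ k * ε)
    (hM : ∀ z : Fin (2 * m) → ℤ, (∀ i, |z i| ≤ 1) → |(M z : ℝ) / (2 ^ K) ^ 2 -
      pathFun arch (fun s => noiseCoeff γ s * keepIndicator hd arch L s) C z| ≤ 1 / 2 ^ (2 * k + 3))
    (hC : ∑ x, |pathSum arch (tailCoeff hd arch γ L) C x| ≤ 1 / 2 ^ (2 * k + 3)) :
    tvDist (fun x => ∏ j, bitProb K M x j) (noisyProb γ arch C) ≤ ε := by
  set η : ℝ := 1 / 2 ^ (2 * k + 3) with hη
  set F := pathFun arch (noiseCoeff γ) C with hF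
  have hFM : MultiAffine F := multiAffine_pathFun _ _ _
  have hprob : ∀ x, F (partialSign x (2 * m)) = 2 ^ (2 * m) * noisyProb γ arch C x := fun x => by
    rw [hF, pathFun_partialSign, pathSum_noiseCoeff]
  have hsum := hFM.sum_abs_prod_bitProb_sub_le (K := K) (M := M) (S := (2 ^ K) ^ 2) (E := η + η)
    (fun x => by
      rw [hprob]
      exact mul_nonneg (by positivity) (noisyProb_nonneg hγ0 hγ1 arch C x))
    (pathFun_zero arch (noiseCoeff_zero γ) C) (by positivity) fun j hj => by
      have h1 : ∀ x : Bits (2 * m), |(M (partialSign x j) : ℝ) / (2 ^ K) ^ 2 - F (partialSign x j)| ≤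
          η + |pathFun arch (tailCoeff hd arch γ L) C (partialSign x j)| := fun x => by
        have h2 := hM (partialSign x j) fun i => by
          simp only [partialSign, bitInt]
          split_ifs <;> simp
        have h3 : pathFun arch (tailCoeff hd arch γ L) C (partialSign x j) = F (partialSign x j) -
            pathFun arch (fun s => noiseCoeff γ s * keepIndicator hd arch L s) C (partialSign x j) :=
          pathFun_sub arch _ _ C _
        rw [h3]
        refine (abs_sub_le _ (pathFun arch (fun s => noiseCoeff γ s * keepIndicator hd arch L s) C
          (partialSign x j)) _).trans (add_le_add h2 (abs_sub_comm _ _).le)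
      refine (Finset.sum_le_sum fun x _ => h1 x).trans ?_
      rw [Finset.sum_add_distrib, mul_add]
      refine add_le_add (by simp) (((multiAffine_pathFun _ _ _).sum_abs_le hj).trans ?_)
      have h4 : ∀ x, |pathFun arch (tailCoeff hd arch γ L) C (partialSign x (2 * m))| =
          2 ^ (2 * m) * |pathSum arch (tailCoeff hd arch γ L) C x| := fun x => by
        rw [pathFun_partialSign, abs_mul, abs_of_pos (show (0 : ℝ) < 2 ^ (2 * m) by positivity)]
      rw [Finset.sum_congr rfl fun x _ => h4 x, ← Finset.mul_sum]
      exact mul_le_mul_of_nonneg_left hC (by positivity)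
  have e : ∀ x, F (partialSign x (2 * m)) / 2 ^ (2 * m) = noisyProb γ arch C x := fun x => by
    rw [hprob, mul_div_cancel_left₀ _ (by positivity)]
  simp only [e] at hsum
  rw [tvDist, div_le_iff₀ two_pos]
  refine hsum.trans ?_
  have hK2 : (2 : ℝ) / 2 ^ K ≤ 1 / 2 ^ (2 * k) := by
    rw [div_le_div_iff₀ (by positivity) (by positivity), one_mul, ← pow_succ']
    exact pow_le_pow_right₀ one_le_two hK
  have hη' : η = 1 / 2 ^ (2 * k) / 8 := by
    rw [hη, pow_add]; norm_num; ring
  have hn' : ((2 * m : ℕ) : ℝ) ≤ 2 ^ k := by exact_mod_cast hn.le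
  have h2k : (0 : ℝ) < 2 ^ k := by positivity
  have h0 : (0 : ℝ) < 1 / 2 ^ (2 * k) := by positivity
  calc ((2 * m : ℕ) : ℝ) * (4 * (η + η) + 2 / 2 ^ K) ≤ 2 ^ k * (2 * (1 / 2 ^ (2 * k))) := by
        refine mul_le_mul hn' (by rw [hη']; linarith) ?_ h2k.le
        rw [hη']; positivity
    _ = 2 * (1 / 2 ^ k) := by rw [two_mul k, pow_add]; field_simp
    _ ≤ 2 * ε := by
        refine mul_le_mul_of_nonneg_left ?_ two_pos.le
        rw [div_le_iff₀ h2k]; linarith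
    _ = ε * 2 := mul_comm _ _

end describes

/-! ### The choice of the constants -/

/-- Every other factor is exponential in `k`, so a cutoff linear in `k` makes the failure
probability in Markov's inequality at most `4 ^ (-k)`. -/
theorem exists_truncation {lam : ℝ} (h0 : 0 ≤ lam) (h1 : lam < 1) (A : ℝ) :
    ∃ c₁ : ℕ, ∀ k, 0 < k →
      (lam ^ (c₁ * k)) ^ 2 * A / (1 / 2 ^ (2 * k + 3)) ^ 2 ≤ 1 / 2 ^ (2 * k) := by
  set A' := max A 1 with hA'
  have hA1 : 1 ≤ A' := le_max_right _ _
  -- The powers of two amount to `2 ^ (6 * k + 6)`, at most `2 ^ (12 * k)` for `k ≥ 1`; hence the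
  -- constant `2 ^ 12`.
  obtain ⟨c, hc⟩ := exists_pow_lt_of_lt_one (show (0 : ℝ) < 1 / (A' * 2 ^ 12) by positivity) h1
  refine ⟨c, fun k hk => ?_⟩
  have hc' : lam ^ c * (A' * 2 ^ 12) ≤ 1 := by
    rw [lt_div_iff₀ (by positivity)] at hc; exact hc.le
  have hl : (lam ^ (c * k)) ^ 2 ≤ (lam ^ c) ^ k := by
    rw [← pow_mul, ← pow_mul]
    exact pow_le_pow_of_le_one h0 h1.le (by omega)
  have hAk : A ≤ A' ^ k := (le_max_left A 1).trans (le_self_pow₀ hA1 (by omega))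
  rw [le_div_iff₀ (by positivity), one_div, inv_pow, div_inv_eq_mul]
  calc (lam ^ (c * k)) ^ 2 * A * (2 ^ (2 * k + 3)) ^ 2 * 2 ^ (2 * k)
      ≤ (lam ^ (c * k)) ^ 2 * A' ^ k * (2 ^ (2 * k + 3)) ^ 2 * 2 ^ (2 * k) := by gcongr
    _ ≤ (lam ^ c) ^ k * A' ^ k * (2 ^ (2 * k + 3)) ^ 2 * 2 ^ (2 * k) := by gcongr
    _ = (lam ^ c) ^ k * A' ^ k * 2 ^ (6 * k + 6) := by ring
    _ ≤ (lam ^ c) ^ k * A' ^ k * 2 ^ (12 * k) := by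
        gcongr
        · norm_num
        · omega
    _ = (lam ^ c * (A' * 2 ^ 12)) ^ k := by
        rw [mul_pow, mul_pow, pow_mul (2 : ℝ) 12 k, mul_assoc]
    _ ≤ 1 := pow_le_one₀ (by positivity) hc'

/-- This is where logarithmic depth enters: the pivot weight is at most `L / d` and `log n ≤ d / c`,
so their product is at most `L / c`, and the number of pivots is exponential in `k` only. For `L <
d` the pivot weight is zero. -/
theorem prefixes_le_two_pow {c : ℝ} (hc : 0 < c) (c₁ : ℕ) {k : ℕ} (hm : 0 < m)
    (h : c * Real.log ((2 * m : ℕ) : ℝ) ≤ d) :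
    (4 * (2 * m)) ^ (c₁ * k / min d (c₁ * k + 1)) ≤ 2 ^ (⌈c₁ * (2 + 2 / c)⌉₊ * k) := by
  set L := c₁ * k with hL
  by_cases hLd : L < d
  · rw [min_eq_right (by omega), Nat.div_eq_of_lt (by omega), pow_zero]
    exact Nat.one_le_two_pow
  rw [min_eq_left (by omega)]
  set w := L / d with hw
  have hwL : (w : ℝ) ≤ L := by exact_mod_cast Nat.div_le_self _ _
  have hwd : (w : ℝ) * d ≤ L := by exact_mod_cast Nat.div_mul_le_self _ _
  have hn : (1 : ℝ) ≤ (2 * m : ℕ) := by exact_mod_cast (show 1 ≤ 2 * m by omega)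
  have hln : 0 ≤ Real.log ((2 * m : ℕ) : ℝ) := Real.log_nonneg hn
  have hl2 : (1 : ℝ) / 2 ≤ Real.log 2 := by linarith [Real.log_two_gt_d9]
  have h4 : Real.log 4 = 2 * Real.log 2 := by
    rw [show (4 : ℝ) = 2 ^ 2 by norm_num, Real.log_pow]; norm_num
  have hlog : (w : ℝ) * Real.log (4 * (2 * m : ℕ)) ≤ (⌈c₁ * (2 + 2 / c)⌉₊ * k : ℕ) * Real.log 2 := by
    rw [Real.log_mul (by norm_num) (by positivity), h4]
    have e1 : (w : ℝ) * Real.log ((2 * m : ℕ) : ℝ) ≤ L / c := by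
      rw [le_div_iff₀ hc]
      calc (w : ℝ) * Real.log ((2 * m : ℕ) : ℝ) * c = w * (c * Real.log ((2 * m : ℕ) : ℝ)) := by ring
        _ ≤ w * d := by gcongr
        _ ≤ L := hwd
    have e2 : (w : ℝ) * (2 * Real.log 2) ≤ L * (2 * Real.log 2) := by gcongr
    have e3 : (L : ℝ) * (2 + 2 / c) ≤ (⌈c₁ * (2 + 2 / c)⌉₊ * k : ℕ) := by
      rw [hL]
      push_cast
      calc (c₁ * k : ℝ) * (2 + 2 / c) = c₁ * (2 + 2 / c) * k := by ring
        _ ≤ _ := by gcongr; exact Nat.le_ceil _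
    have e4 : (L : ℝ) / c ≤ L * (2 / c) * Real.log 2 := by
      have : 0 ≤ (L : ℝ) / c := by positivity
      calc (L : ℝ) / c = 2 * (L / c) * (1 / 2) := by ring
        _ ≤ 2 * (L / c) * Real.log 2 := by gcongr
        _ = _ := by ring
    have e5 := mul_le_mul_of_nonneg_right e3 (show 0 ≤ Real.log 2 by linarith)
    nlinarith
  have hlt : Real.log ((4 * (2 * m : ℕ) : ℝ) ^ w) ≤ Real.log ((2 : ℝ) ^ (⌈c₁ * (2 + 2 / c)⌉₊ * k)) := by
    rw [Real.log_pow, Real.log_pow]; exact hlog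
  have := (Real.log_le_log_iff (by positivity) (by positivity)).1 hlt
  exact_mod_cast this

/-! ### The main theorem -/

/-- The exponent of the time bound. -/
def timeExponent (c₁ c₃ : ℕ) : ℕ :=
  (loopExponent c₁ c₃ + 1) * (mainProg c₁ (precision c₁ c₃)).depth + 2 * (precision c₁ c₃ + 5)

/-- The time bound of the algorithm is `X ↦ K * X ^ K` with this `K`. -/
def timeBound (c₁ c₃ : ℕ) : ℕ :=
  4 * (mainProg c₁ (precision c₁ c₃)).weight + 3 * timeExponent c₁ c₃

theorem cost_le_two_pow {c₁ c₃ k : ℕ} (hk : 0 < k) (hn : 2 * m < 2 ^ k) :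
    (mainProg c₁ (precision c₁ c₃)).weight *
      (2 ^ (loopExponent c₁ c₃ * k) + 1) ^ (mainProg c₁ (precision c₁ c₃)).depth *
        (4 * precisionBits m c₁ c₃ k + 1) ^ 2 ≤
      (mainProg c₁ (precision c₁ c₃)).weight * (2 ^ k) ^ timeExponent c₁ c₃ := by
  have h1 : 2 ^ (loopExponent c₁ c₃ * k) + 1 ≤ (2 ^ k) ^ (loopExponent c₁ c₃ + 1) := by
    rw [← pow_mul, mul_add, mul_one, pow_add, mul_comm k]
    have := Nat.one_le_two_pow (n := loopExponent c₁ c₃ * k)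
    have h2 : 2 ^ 1 ≤ 2 ^ k := Nat.pow_le_pow_right two_pos hk
    nlinarith
  have h2 : 4 * precisionBits m c₁ c₃ k + 1 ≤ (2 ^ k) ^ (precision c₁ c₃ + 5) := by
    have h3 := precisionBits_le (m := m) (c₁ := c₁) (c₃ := c₃) hn hk
    have h4 := Nat.one_le_two_pow (n := (precision c₁ c₃ + 2) * k)
    have e : (2 ^ k) ^ (precision c₁ c₃ + 5) = 2 ^ ((precision c₁ c₃ + 2) * k) * 2 ^ (3 * k) := by
      rw [← pow_mul, ← pow_add]; congr 1; ring
    have h5 : 2 ^ 3 ≤ 2 ^ (3 * k) := Nat.pow_le_pow_right two_pos (by omega)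
    rw [e]
    nlinarith
  calc _ ≤ (mainProg c₁ (precision c₁ c₃)).weight *
        ((2 ^ k) ^ (loopExponent c₁ c₃ + 1)) ^ (mainProg c₁ (precision c₁ c₃)).depth *
          ((2 ^ k) ^ (precision c₁ c₃ + 5)) ^ 2 := by gcongr
    _ = _ := by
      generalize 2 ^ k = b
      rw [timeExponent, pow_add b (_ * _), pow_mul b (_ + 1), mul_comm 2, pow_mul b _ 2, mul_assoc]

theorem cost_le_timeBound {c₁ c₃ k : ℕ} {X : ℝ} (hX : 2 ≤ X) (h : (2 : ℝ) ^ k ≤ 4 * X) :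
    (((mainProg c₁ (precision c₁ c₃)).weight * (2 ^ k) ^ timeExponent c₁ c₃ : ℕ) : ℝ) ≤
      timeBound c₁ c₃ * X ^ timeBound c₁ c₃ := by
  have h1 : (2 : ℝ) ^ k ≤ X ^ 3 := by nlinarith [mul_self_nonneg (X - 2)]
  push_cast
  calc ((mainProg c₁ (precision c₁ c₃)).weight : ℝ) * (2 ^ k) ^ timeExponent c₁ c₃
      ≤ (timeBound c₁ c₃ : ℕ) * (X ^ 3) ^ timeExponent c₁ c₃ := by
        gcongr
        unfold timeBound; omega
    _ ≤ _ := by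
        rw [← pow_mul]
        gcongr
        · linarith
        · unfold timeBound; omega

theorem runs_mainProg_zero (I : Input) (c₁ c₂ : ℕ) (ω : ℕ → Bool) :
    Runs I 1 0 (mainProg c₁ c₂) (initial 0 ω) fun _ => True :=
  .cond (fun h => absurd (by simp [State.val, initial, Expr.var, Expr.eval]) h) fun _ => .skip trivial

theorem runsWithin_mainProg_zero (I : Input) (c₁ c₃ : ℕ) {X : ℝ} (hX : 2 ≤ X) :
    RunsWithin (mainProg c₁ (precision c₁ c₃)) I 0 (timeBound c₁ c₃ * X ^ timeBound c₁ c₃) := by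
  refine runsWithin_of_runs (runs_mainProg_zero I _ _) (fun ω => bdd_initial (by norm_num) ω) ?_
  have h1 : 1 ≤ X ^ timeBound c₁ c₃ := one_le_pow₀ (by linarith)
  calc _ ≤ ((timeBound c₁ c₃ : ℕ) : ℝ) := by
        simp only [zero_add, one_pow, mul_one]
        exact_mod_cast (by unfold timeBound; omega)
    _ ≤ _ := le_mul_of_one_le_right (Nat.cast_nonneg _) h1

theorem tvDist_mainProg_zero {d : ℕ} (I : Input) (c₁ c₂ : ℕ) (γ : ℝ) (arch : Architecture 0 d)
    (C : Circuit 0 d) :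
    tvDist (outputProb (mainProg c₁ c₂) I (2 * 0)) (noisyProb γ arch C) = 0 := by
  have : Subsingleton (Bits (2 * 0)) := inferInstanceAs (Subsingleton (Fin 0 → Fin 2))
  have h1 : ∀ x, outputProb (mainProg c₁ c₂) I (2 * 0) x = 1 := fun x => by
    rw [outputProb_eq_of_runs (f := fun _ => x)
      (fun ω => (runs_mainProg_zero I c₁ c₂ ω).mono fun σ _ _ => Subsingleton.elim _ _)
      (fun ω => bdd_initial (by norm_num) ω)]
    simp
  have h2 : ∀ x, noisyProb γ arch C x = 1 := fun x => by
    have := pathFun_partialSign arch (noiseCoeff γ) C x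
    rw [pathSum_noiseCoeff, show partialSign x (2 * 0) = 0 from partialSign_zero x,
      pathFun_zero arch (noiseCoeff_zero γ)] at this
    simpa using this.symm
  simp [tvDist, h1, h2]

/-- The accuracy `k` depends on the answers to queries, so circuits that are bad for any admissible
`k` are excluded at once. The union bound converges to `δ` because only values with `2 ^ k * δ ≥ 1`
occur. -/
theorem measure_iUnion_tail_le {μ : Fin d → Fin m → Measure Gate}
    (hμ : IsPauliInvariantEnsemble μ) {arch : Architecture m d} {A : ℝ}
    (hA : AntiConcentrated arch μ A) (hd : 0 < d) {γ δ : ℝ} (hγ0 : 0 ≤ γ) (hγ1 : γ ≤ 1)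
    (hδ : 0 < δ) {c₁ : ℕ} (hc₁ : ∀ k, 0 < k →
      ((1 - γ) ^ (c₁ * k)) ^ 2 * A / (1 / 2 ^ (2 * k + 3)) ^ 2 ≤ 1 / 2 ^ (2 * k)) :
    circuitLaw μ {C | ∃ k, 0 < k ∧ 1 ≤ 2 ^ k * δ ∧
      1 / 2 ^ (2 * k + 3) ≤ ∑ x, |pathSum arch (tailCoeff hd arch γ (c₁ * k)) C x|} ≤
        ENNReal.ofReal δ := by
  set E : ℕ → Set (Circuit m d) := fun j => {C | 1 ≤ 2 ^ (j + 1) * δ ∧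
    1 / 2 ^ (2 * (j + 1) + 3) ≤ ∑ x, |pathSum arch (tailCoeff hd arch γ (c₁ * (j + 1))) C x|} with hE
  have hsub : {C | ∃ k, 0 < k ∧ 1 ≤ 2 ^ k * δ ∧
      1 / 2 ^ (2 * k + 3) ≤ ∑ x, |pathSum arch (tailCoeff hd arch γ (c₁ * k)) C x|} ⊆ ⋃ j, E j := by
    rintro C ⟨k, hk, h1, h2⟩
    refine Set.mem_iUnion.2 ⟨k - 1, ?_⟩
    have : k - 1 + 1 = k := by omega
    simp only [hE, Set.mem_ofPred_eq, this]
    exact ⟨h1, h2⟩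
  have hmeas : ∀ j, circuitLaw μ (E j) ≤ ENNReal.ofReal (δ / 2 / 2 ^ j) := by
    intro j
    by_cases hj : 1 ≤ 2 ^ (j + 1) * δ
    · have e : E j = {C | 1 / 2 ^ (2 * (j + 1) + 3) ≤
          ∑ x, |pathSum arch (tailCoeff hd arch γ (c₁ * (j + 1))) C x|} := by
        simp only [hE, hj, true_and]
      rw [e]
      refine (measure_le_sum_abs_pathSum hμ hA _ (abs_tailCoeff_le hd arch hγ0 hγ1 _)
        (by positivity)).trans (ENNReal.ofReal_le_ofReal ?_)
      refine (hc₁ (j + 1) (by omega)).trans ?_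
      -- One factor `2 ^ (-k)` of the bound `4 ^ (-k)` is at most `δ`; the other one is summable.
      rw [div_div, ← pow_succ', div_le_div_iff₀ (by positivity) (by positivity), two_mul (j + 1),
        pow_add _ (j + 1), one_mul, ← mul_assoc]
      refine le_mul_of_one_le_left (by positivity) ?_
      linarith
    · have e : E j = ∅ := by simp only [hE, hj, false_and]; rfl
      rw [e]; simp
  refine (measure_mono hsub).trans ((measure_iUnion_le _).trans ((ENNReal.tsum_le_tsum hmeas).trans ?_))
  have hs : HasSum (fun j : ℕ => δ / 2 / 2 ^ j) δ := hasSum_geometric_two' δ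
  rw [← ENNReal.ofReal_tsum_of_nonneg (fun j => by positivity) hs.summable, hs.tsum_eq]

end NoisyRCS

end

open NoisyRCS in
theorem theorem1 (γ : ℝ) (hγ : 0 < γ) (hγ' : γ ≤ 1) (A c : ℝ) (hc : 0 < c) :
    ∃ (P : Program) (K : ℕ),
      ∀ (m d : ℕ) (_ : 0 < d) (arch : Architecture m d) (μ : Fin d → Fin m → Measure Gate),
        IsPauliInvariantEnsemble μ →
        AntiConcentrated arch μ A →
        (c * Real.log ((2 * m : ℕ) : ℝ) ≤ d ∨ IsHaarEnsemble μ) →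
        ∀ ε δ : ℝ, 0 < ε → ε ≤ 1 → 0 < δ → δ ≤ 1 →
          (∀ (C : Circuit m d) (I : Input), I.Describes arch C γ ε δ →
            RunsWithin P I (2 * m) (K * (((2 * m : ℕ) : ℝ) + 1 / ε + 1 / δ) ^ K)) ∧
          circuitLaw μ {C | ¬ ∀ I : Input, I.Describes arch C γ ε δ →
            tvDist (outputProb P I (2 * m)) (noisyProb γ arch C) ≤ ε} ≤ ENNReal.ofReal δ := by
  obtain ⟨cH, hcH, hHaar⟩ := exists_log_le_depth A
  obtain ⟨c₁, hc₁⟩ := exists_truncation (lam := 1 - γ) (by linarith) (by linarith) A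
  -- The minimum of the two constants makes a single program work for both alternatives on the
  -- depth.
  set c₃ := ⌈c₁ * (2 + 2 / min c cH)⌉₊
  refine ⟨mainProg c₁ (precision c₁ c₃), timeBound c₁ c₃, fun m d hd arch μ hμ hA hdepth ε δ hε hε' hδ
    hδ' => ?_⟩
  have hX : 2 ≤ ((2 * m : ℕ) : ℝ) + 1 / ε + 1 / δ := by
    have e1 : 1 ≤ 1 / ε := (one_le_div hε).2 hε'
    have e2 : 1 ≤ 1 / δ := (one_le_div hδ).2 hδ'
    have e3 : (0 : ℝ) ≤ (2 * m : ℕ) := Nat.cast_nonneg _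
    linarith
  -- Without qubits there is just one output string, and the program stops immediately.
  rcases Nat.eq_zero_or_pos m with rfl | hm
  · refine ⟨fun C I _ => runsWithin_mainProg_zero I c₁ c₃ hX, ?_⟩
    have : {C : Circuit 0 d | ¬ ∀ I : Input, I.Describes arch C γ ε δ →
        tvDist (outputProb (mainProg c₁ (precision c₁ c₃)) I (2 * 0)) (noisyProb γ arch C) ≤ ε} = ∅ :=
      Set.eq_empty_of_forall_notMem fun C hC => hC fun I _ => by
        rw [tvDist_mainProg_zero]; exact hε.le
    rw [this]
    simp
  have hlog : 0 ≤ Real.log ((2 * m : ℕ) : ℝ) := Real.log_natCast_nonneg _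
  have hdepth' : min c cH * Real.log ((2 * m : ℕ) : ℝ) ≤ d := by
    rcases hdepth with h | h
    · exact (mul_le_mul_of_nonneg_right (min_le_left _ _) hlog).trans h
    · exact (mul_le_mul_of_nonneg_right (min_le_right _ _) hlog).trans (hHaar m d hd arch μ hμ hA h)
  have hw : ∀ k, (4 * (2 * m)) ^ (c₁ * k / min d (c₁ * k + 1)) ≤ 2 ^ (c₃ * k) := fun k =>
    prefixes_le_two_pow (lt_min hc hcH) c₁ hm hdepth'
  constructor
  · intro C I hI
    obtain ⟨k, hk, hgood, hleast⟩ := hI.exists_least_good hε hδ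
    obtain ⟨M, hruns, hbdd, -⟩ := hI.runs_main hm hd hγ.le hγ' hε.le hε' hδ.le hδ' hk hgood hleast (hw k)
    refine runsWithin_of_runs hruns hbdd (le_trans ?_
      (cost_le_timeBound hX (hI.two_pow_le hε hε' hδ hk hleast)))
    exact_mod_cast cost_le_two_pow hk hgood.2.2
  · refine (measure_mono ?_).trans (measure_iUnion_tail_le hμ hA hd hγ.le hγ' hδ hc₁)
    intro C hC
    by_contra hC'
    refine hC fun I hI => ?_
    obtain ⟨k, hk, hgood, hleast⟩ := hI.exists_least_good hε hδ
    obtain ⟨M, hruns, hbdd, hM⟩ := hI.runs_main hm hd hγ.le hγ' hε.le hε' hδ.le hδ' hk hgood hleast (hw k)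
    have hout : outputProb (mainProg c₁ (precision c₁ c₃)) I (2 * m) =
        fun x => ∏ j, bitProb (precisionBits m c₁ c₃ k) M x j := by
      funext x
      rw [outputProb_eq_of_runs hruns hbdd, coinLaw_real_signBits]
    rw [hout]
    refine tvDist_le_of_marginals hd hγ.le hγ' ?_ hgood.2.2 (hI.eps.one_le_mul hgood.1) hM ?_
    · have := le_precisionBits (m := m) (c₁ := c₁) (c₃ := c₃) (k := k) (D := 0) (by omega)
      omega
    · by_contra hlt
      exact hC' ⟨k, hk, hI.delta.one_le_mul hgood.2.1, (not_le.1 hlt).le⟩
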